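/- **Setting.** Let $d\ge 0$ and $m_0\ge m_1\ge\dots\ge m_d$ be integers with $m_0\ge1$ and $m_d\ge 0$, $N=m_0+\dots+m_d$, $Q=m_0+3m_1+\dots+(2d+1)m_d$, and let $B=(b_{ij})$ be a constant real $N\times N$ matrix, written in blocks of sizes $m_0,\dots,m_d$, whose $(k-1,k)$ blocks $B_k$ (of size $m_{k-1}\times m_k$) have rank $m_k$ for $1\le k\le d$, whose $(k,l)$ blocks with $l\ge k+2$ vanish, and whose other blocks are arbitrary. Put $Y=\sum_{i,j=1}^N b_{ij}x_i\partial_{x_j}-\partial_t$ on $\mathbb R^{N+1}\ni(x,t)$ and $D_{m_0}=(\partial_{x_1},\dots,\partial_{x_{m_0}})$. Let $\lambda>0$ and let $a_{ij}=a_{ji}\in L^\infty(\mathbb R^{N+1})$, $1\le i,j\le m_0$, satisfy $\lambda^{-1}|\xi|^2\le\sum a_{ij}\xi_i\xi_j\le\lambda|\xi|^2$ for all $\xi\in\mathbb R^{m_0}$. Let $\Omega\subset\mathbb R^{N+1}$ be open, $q>\frac{Q+2}{2}$ real, $c,f\in L^q(\Omega)$ and $b'\in L^{Q+2}(\Omega;\mathbb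 R^{m_0})$. A *weak sub-solution* in $\Omega$ of $$\sum_{i,j=1}^{m_0}\partial_i(a_{ij}\partial_ju)+Yu=b'\cdot D_{m_0}u+cu+f$$ is a function $u$ such that $u$, the distributional derivatives $D_{m_0}u$ and $Yu$, and $b',c,f$ are in $L^2_{\rm loc}(\Omega)$, and $$\int_\Omega \Big(\phi\,Yu-\sum_{i,j=1}^{m_0}a_{ij}\,\partial_iu\,\partial_j\phi\Big)\ \ge\ \int_\Omega\phi\,(b'\cdot D_{m_0}u+cu+f)\qquad\text{for all }0\le\phi\in C_0^\infty(\Omega).$$ With $E(\tau)=\exp(-\tau B^T)$ put $(x,t)\circ(\xi,\tau)=(\xi+E(\tau)x,\,t+\tau)$ and $(x,t)^{-1}=(-E(-t)x,-t)$. Let $\alpha_i=2k+1$ if $x_i$ is a coordinate of block $k$; put $\|(0,0)\|=0$ and, for $(x,t)\ne 0$, let $\|(x,t)\|$ be the unique $s>0$ with $\sum_i x_i^2s^{-2\alpha_i}+t^2s^{-4}=1$. Let $\mathcal B^-_r(x_0,t_0)=\{(x,t):\ \|(x_0,t_0)^{-1}\circ(x,t)\|\le r,\ t<t_0\}$. **Lemma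 (Sobolev estimate).** Let $k=1+\frac2Q$. For all $K_b,K_c\ge 0$ there is a constant $C>0$, depending only on $B$ (with its block structure, hence on $N,Q$), $\lambda$, $q$, $K_b$, $K_c$, such that the following holds for all coefficients as above, every non-negative weak sub-solution $u$ in $\Omega$, all $\frac12\le\rho<r\le1$, every $(x_0,t_0)\in\Omega$ with $\overline{\mathcal B^-_r(x_0,t_0)}\subset\Omega$, $\|b'\|_{L^{Q+2}(\mathcal B^-_r(x_0,t_0))}\le K_b$ and $\|c\|_{L^q(\mathcal B^-_r(x_0,t_0))}\le K_c$, and every cut-off function $\varphi$ with $\varphi=1$ on $\mathcal B^-_\rho(x_0,t_0)$. All balls below are centred at $(x_0,t_0)$. (i) $$\|\varphi u\|_{L^{2k}(\mathcal B^-_\rho)}\le\frac{C}{r-\rho}\Big(\|u\|_{L^2(\mathcal B^-_r)}+\|D_{m_0}u\|_{L^2(\mathcal B^-_r)}\Big)+C\,\|f\|_{L^{\frac{2Q+4}{Q+4}}(\mathcal B^-_r)}.$$ (ii) Suppose moreover that $q<Q+2$, so that $\beta:=\frac{Q+2}{q}-1\in(0,1)$. Let $p>1$ be an integer and let $w=u^p$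 have a weak gradient $D_{m_0}w$ in the interior of $\mathcal B^-_r$ (with $w$ and $D_{m_0}w$ locally integrable there). Then, with the same $C$ (in particular independent of $p$ and $f$), $$\|\varphi w\|_{L^{2k}(\mathcal B^-_\rho)}\le\frac{C}{r-\rho}\Big(p^{\frac1{1-\beta}}\|w\|_{L^2(\mathcal B^-_r)}+\|D_{m_0}w\|_{L^2(\mathcal B^-_r)}\Big)+r^{\,p\left(2-\frac{Q+2}{q}\right)+\frac Q2}\,\|f\|_{L^q(\mathcal B^-_r)}^p,$$ where the right-hand side may be $+\infty$. -/

import Mathlib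

open MeasureTheory
open scoped ENNReal NNReal ContDiff

noncomputable section

namespace Ultraparabolic

/-- Indices of the coordinates of `ℝ^N`, where `N = m₀ + m₁ + ⋯ + m_d`: the pair `⟨k, i⟩` is the
`i`-th coordinate of the `k`-th block. The first `m₀` coordinates are the `⟨0, i⟩`. -/
abbrev Idx {d : ℕ} (m : Fin (d + 1) → ℕ) : Type := Σ k : Fin (d + 1), Fin (m k)

/-- The space `ℝ^{N+1}` of points `z = (x, t)`; `volume` on it is Lebesgue measure. -/
abbrev Pt {d : ℕ} (m : Fin (d + 1) → ℕ) : Type := (Idx m → ℝ) × ℝ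

/-- Values of the gradient `D_{m₀}` and of the drift `b'`, with the Euclidean norm. -/
abbrev Grad {d : ℕ} (m : Fin (d + 1) → ℕ) : Type := EuclideanSpace ℝ (Fin (m 0))

variable {d : ℕ} {m : Fin (d + 1) → ℕ}

/-- The weight `α_i = 2k + 1` of a coordinate of the `k`-th block. -/
def weight (i : Idx m) : ℕ := 2 * (i.1 : ℕ) + 1

variable (m) in
/-- `Q = m₀ + 3 m₁ + ⋯ + (2d+1) m_d`. -/
def homDim : ℕ := ∑ k : Fin (d + 1), (2 * (k : ℕ) + 1) * m k

/-- The structure of the drift matrix: the blocks on the first superdiagonal,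
`B_k ∈ ℝ^{m_{k-1} × m_k}`, have rank `m_k`, the blocks above them vanish, and all
other blocks are arbitrary; moreover `m₀ ≥ m₁ ≥ ⋯ ≥ m_d` and `m₀ ≥ 1`. -/
structure DriftStructure (B : Matrix (Idx m) (Idx m) ℝ) : Prop where
  antitone : Antitone m
  one_le : 1 ≤ m 0
  rank_block : ∀ k : Fin d,
    (B.submatrix (fun i : Fin (m k.castSucc) => (⟨k.castSucc, i⟩ : Idx m))
      (fun j : Fin (m k.succ) => (⟨k.succ, j⟩ : Idx m))).rank = m k.succ
  eq_zero : ∀ i j : Idx m, (i.1 : ℕ) + 1 < (j.1 : ℕ) → B i j = 0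

/-! ### The group law, the homogeneous norm and the balls -/

/-- `E(τ) = exp(-τ Bᵀ)`. -/
def expE (B : Matrix (Idx m) (Idx m) ℝ) (τ : ℝ) : Matrix (Idx m) (Idx m) ℝ :=
  NormedSpace.exp ((-τ) • B.transpose)

/-- `(x, t) ∘ (ξ, τ) = (ξ + E(τ) x, t + τ)`. -/
def groupMul (B : Matrix (Idx m) (Idx m) ℝ) (z w : Pt m) : Pt m :=
  (w.1 + (expE B w.2).mulVec z.1, z.2 + w.2)

/-- `(x, t)⁻¹ = (-E(-t) x, -t)`. -/
def groupInv (B : Matrix (Idx m) (Idx m) ℝ) (z : Pt m) : Pt m :=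
  (-(expE B (-z.2)).mulVec z.1, -z.2)

/-- `∑ x_i² / r^{2 α_i} + t² / r⁴`. -/
def normSum (z : Pt m) (r : ℝ) : ℝ :=
  ∑ i, z.1 i ^ 2 / r ^ (2 * weight i) + z.2 ^ 2 / r ^ 4

theorem normSum_strictAntiOn {z : Pt m} (hz : z ≠ 0) :
    StrictAntiOn (normSum z) (Set.Ioi 0) := by
  intro r hr s hs hrs
  have hr' : (0 : ℝ) < r := hr
  have key : ∀ (a : ℝ) (n : ℕ), a ^ 2 / s ^ n ≤ a ^ 2 / r ^ n := fun a n => by gcongr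
  have key' : ∀ (a : ℝ) (n : ℕ), a ≠ 0 → n ≠ 0 → a ^ 2 / s ^ n < a ^ 2 / r ^ n :=
    fun a n ha hn => by
      have : 0 < a ^ 2 := by positivity
      gcongr
  unfold normSum
  by_cases ht : z.2 = 0
  · have hx : z.1 ≠ 0 := fun h => hz (Prod.ext h ht)
    obtain ⟨i, hi⟩ := Function.ne_iff.1 hx
    refine add_lt_add_of_lt_of_le (Finset.sum_lt_sum (fun i _ => key _ _)
      ⟨i, Finset.mem_univ i, key' _ _ hi (by simp [weight])⟩) (key _ _)
  · exact add_lt_add_of_le_of_lt (Finset.sum_le_sum fun i _ => key _ _)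
      (key' _ _ ht (by norm_num))

/-- For `z ≠ 0` the equation defining the homogeneous norm has a unique positive solution. -/
theorem existsUnique_normSum {z : Pt m} (hz : z ≠ 0) : ∃! r : ℝ, 0 < r ∧ normSum z r = 1 := by
  obtain ⟨S, hS⟩ : ∃ S : ℝ, S = ∑ i, z.1 i ^ 2 + z.2 ^ 2 := ⟨_, rfl⟩
  have hSg : ∀ r : ℝ, S / r ^ 2 = ∑ i, z.1 i ^ 2 / r ^ 2 + z.2 ^ 2 / r ^ 2 := fun r => by
    rw [hS, add_div, Finset.sum_div]
  have hSpos : 0 < S := by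
    have h1 := normSum_strictAntiOn hz (show (1 : ℝ) ∈ Set.Ioi 0 by norm_num)
      (show (2 : ℝ) ∈ Set.Ioi 0 by norm_num) (by norm_num)
    have h2 : 0 ≤ normSum z 2 := by unfold normSum; positivity
    have h3 : normSum z 1 = S := by simp [normSum, hS]
    linarith
  have hsq : 0 < Real.sqrt S := Real.sqrt_pos.2 hSpos
  have hup : 1 ≤ normSum z (min 1 (Real.sqrt S)) := by
    obtain ⟨r, hr⟩ : ∃ r, r = min 1 (Real.sqrt S) := ⟨_, rfl⟩
    rw [← hr]
    have h0 : 0 < r := by rw [hr]; exact lt_min one_pos hsq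
    have h1 : r ≤ 1 := by rw [hr]; exact min_le_left _ _
    have h2 : r ^ 2 ≤ S := by
      have : r ≤ Real.sqrt S := by rw [hr]; exact min_le_right _ _
      calc r ^ 2 ≤ Real.sqrt S ^ 2 := by gcongr
        _ = S := Real.sq_sqrt hSpos.le
    have key : ∀ (a : ℝ) (n : ℕ), 2 ≤ n → a ^ 2 / r ^ 2 ≤ a ^ 2 / r ^ n := fun a n hn => by
      have := pow_le_pow_of_le_one h0.le h1 hn
      gcongr
    calc (1 : ℝ) ≤ S / r ^ 2 := by rw [le_div_iff₀ (by positivity)]; linarith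
      _ ≤ normSum z r := by
        rw [hSg]
        exact add_le_add (Finset.sum_le_sum fun i _ => key _ _ (by simp [weight]))
          (key _ _ (by norm_num))
  have hdown : normSum z (max 1 (Real.sqrt S)) ≤ 1 := by
    obtain ⟨r, hr⟩ : ∃ r, r = max 1 (Real.sqrt S) := ⟨_, rfl⟩
    rw [← hr]
    have h1 : 1 ≤ r := by rw [hr]; exact le_max_left _ _
    have h0 : 0 < r := by linarith
    have h2 : S ≤ r ^ 2 := by
      have : Real.sqrt S ≤ r := by rw [hr]; exact le_max_right _ _
      calc S = Real.sqrt S ^ 2 := (Real.sq_sqrt hSpos.le).symm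
        _ ≤ r ^ 2 := by gcongr
    have key : ∀ (a : ℝ) (n : ℕ), 2 ≤ n → a ^ 2 / r ^ n ≤ a ^ 2 / r ^ 2 := fun a n hn => by
      have := pow_le_pow_right₀ h1 hn
      gcongr
    calc normSum z r ≤ S / r ^ 2 := by
          rw [hSg]
          exact add_le_add (Finset.sum_le_sum fun i _ => key _ _ (by simp [weight]))
            (key _ _ (by norm_num))
      _ ≤ 1 := by rw [div_le_one (by positivity)]; exact h2
  have hmin : 0 < min 1 (Real.sqrt S) := lt_min one_pos hsq
  have hle : min 1 (Real.sqrt S) ≤ max 1 (Real.sqrt S) :=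
    (min_le_left _ _).trans (le_max_left _ _)
  have hcont : ContinuousOn (normSum z) (Set.Icc (min 1 (Real.sqrt S)) (max 1 (Real.sqrt S))) := by
    unfold normSum
    refine ContinuousOn.add (continuousOn_finsetSum _ fun i _ => ?_) ?_
    · exact continuousOn_const.div (continuousOn_id.pow _)
        fun r hr => pow_ne_zero _ (hmin.trans_le hr.1).ne'
    · exact continuousOn_const.div (continuousOn_id.pow _)
        fun r hr => pow_ne_zero _ (hmin.trans_le hr.1).ne'
  obtain ⟨r, hr, hr1⟩ := intermediate_value_Icc' hle hcont ⟨hdown, hup⟩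
  refine ⟨r, ⟨hmin.trans_le hr.1, hr1⟩, fun s hs => ?_⟩
  exact (normSum_strictAntiOn hz).injOn hs.1 (hmin.trans_le hr.1) (hs.2.trans hr1.symm)

open Classical in
/-- The homogeneous norm: `‖0‖ = 0`, and for `z ≠ 0`, `‖z‖ = r` is the unique positive solution of
`∑ x_i² / r^{2 α_i} + t² / r⁴ = 1`. -/
def homNorm (z : Pt m) : ℝ :=
  if hz : z = 0 then 0 else (existsUnique_normSum hz).choose

/-- `𝓑_r(z₀) = {z : ‖z₀⁻¹ ∘ z‖ ≤ r}`. -/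
def ballB (B : Matrix (Idx m) (Idx m) ℝ) (r : ℝ) (z₀ : Pt m) : Set (Pt m) :=
  {z | homNorm (groupMul B (groupInv B z₀) z) ≤ r}

/-- `𝓑⁻_r(z₀) = 𝓑_r(z₀) ∩ {t < t₀}`. -/
def ballMinus (B : Matrix (Idx m) (Idx m) ℝ) (r : ℝ) (z₀ : Pt m) : Set (Pt m) :=
  ballB B r z₀ ∩ {z | z.2 < z₀.2}

/-! ### Weak derivatives and weak sub-solutions -/

/-- `φ ∈ C₀^∞(Ω)`. -/
structure IsTest (Ω : Set (Pt m)) (φ : Pt m → ℝ) : Prop where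
  smooth : ContDiff ℝ ∞ φ
  compact : HasCompactSupport φ
  subset : tsupport φ ⊆ Ω

/-- `g ∈ L^p_loc(Ω)`. -/
def MemLpLoc {F : Type*} [NormedAddCommGroup F] (g : Pt m → F) (p : ℝ≥0∞) (Ω : Set (Pt m)) :
    Prop :=
  ∀ K : Set (Pt m), IsCompact K → K ⊆ Ω → MemLp g p (volume.restrict K)

/-- The classical gradient `D_{m₀} φ = (∂_1 φ, …, ∂_{m₀} φ)`. -/
def gradD (φ : Pt m → ℝ) (z : Pt m) : Grad m :=
  WithLp.toLp 2 fun i : Fin (m 0) => fderiv ℝ φ z (Pi.single (⟨0, i⟩ : Idx m) 1, 0)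

/-- The classical `Y φ = ∑_{i,j} b_ij x_i ∂_{x_j} φ - ∂_t φ`. -/
def fieldY (B : Matrix (Idx m) (Idx m) ℝ) (φ : Pt m → ℝ) (z : Pt m) : ℝ :=
  ∑ i, ∑ j, B i j * z.1 i * fderiv ℝ φ z (Pi.single j 1, 0) - fderiv ℝ φ z (0, 1)

/-- `g = D_{m₀} u` on `Ω` in the sense of distributions, both functions being locally integrable. -/
structure IsWeakGrad (Ω : Set (Pt m)) (u : Pt m → ℝ) (g : Pt m → Grad m) : Prop where
  locInt : LocallyIntegrableOn u Ω
  locInt_grad : LocallyIntegrableOn g Ω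
  eq : ∀ φ : Pt m → ℝ, IsTest Ω φ → ∀ i : Fin (m 0),
    ∫ z in Ω, u z * gradD φ z i = -∫ z in Ω, g z i * φ z

/-- `v = Y u` on `Ω` in the sense of distributions, both functions being locally integrable;
the formal adjoint of `Y` is `Y* φ = -Y φ - tr(B) φ`. -/
structure IsWeakY (B : Matrix (Idx m) (Idx m) ℝ) (Ω : Set (Pt m)) (u v : Pt m → ℝ) : Prop where
  locInt : LocallyIntegrableOn u Ω
  locInt_Y : LocallyIntegrableOn v Ω
  eq : ∀ φ : Pt m → ℝ, IsTest Ω φ →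
    ∫ z in Ω, u z * (-fieldY B φ z - B.trace * φ z) = ∫ z in Ω, v z * φ z

/-- Bounded measurable symmetric coefficients `a_ij`, `1 ≤ i, j ≤ m₀`, on `ℝ^{N+1}` with
`λ⁻¹ |ξ|² ≤ ∑ a_ij ξ_i ξ_j ≤ λ |ξ|²` (almost everywhere). -/
structure Elliptic (lam : ℝ) (a : Pt m → Matrix (Fin (m 0)) (Fin (m 0)) ℝ) : Prop where
  bounded : ∀ i j, MemLp (fun z => a z i j) ∞ volume
  symm : ∀ᵐ z : Pt m, ∀ i j, a z i j = a z j i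
  bounds : ∀ᵐ z : Pt m, ∀ ξ : Fin (m 0) → ℝ,
    (1 / lam) * ∑ i, ξ i ^ 2 ≤ ∑ i, ∑ j, a z i j * ξ i * ξ j ∧
      ∑ i, ∑ j, a z i j * ξ i * ξ j ≤ lam * ∑ i, ξ i ^ 2

/-- `u` is a weak sub-solution on `Ω` of
`∑ ∂_i (a_ij ∂_j u) + ∑ b_ij x_i ∂_j u - ∂_t u = b' · D_{m₀} u + c u + f`,
with weak derivatives `Du = D_{m₀} u` and `Yu = Y u`. -/
structure IsWeakSubsolution (B : Matrix (Idx m) (Idx m) ℝ)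
    (a : Pt m → Matrix (Fin (m 0)) (Fin (m 0)) ℝ) (b : Pt m → Grad m) (c f : Pt m → ℝ)
    (Ω : Set (Pt m)) (u : Pt m → ℝ) (Du : Pt m → Grad m) (Yu : Pt m → ℝ) : Prop where
  u_loc : MemLpLoc u 2 Ω
  Du_loc : MemLpLoc Du 2 Ω
  Yu_loc : MemLpLoc Yu 2 Ω
  b_loc : MemLpLoc b 2 Ω
  c_loc : MemLpLoc c 2 Ω
  f_loc : MemLpLoc f 2 Ω
  weakGrad : IsWeakGrad Ω u Du
  weakY : IsWeakY B Ω u Yu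
  ineq : ∀ φ : Pt m → ℝ, IsTest Ω φ → (∀ z, 0 ≤ φ z) →
    ∫ z in Ω, φ z * ((∑ i, b z i * Du z i) + c z * u z + f z) ≤
      ∫ z in Ω, (φ z * Yu z - ∑ i, ∑ j, Du z i * a z i j * gradD φ z j)

end Ultraparabolic

end

open MeasureTheory
open scoped ENNReal NNReal ContDiff

noncomputable section

namespace Ultraparabolic

/-! The derivatives in `L²` are those in the first block of variables and along `Y`, so the gain of
integrability cannot come from a Euclidean Sobolev embedding. It comes from bounding a sub-solution
pointwise by potentials adapted to the group law and then applying a Hardy–Littlewood–Sobolev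
inequality.

Let `v ≥ 0` satisfy `div (a Dv) + Y v ≥ H`, where `div` and `D` involve the first block only. The
inequality is tested with `χ Ψ(z⁻¹ ∘ ·)`, where `χ` is a cut-off and `Ψ` is a parametrix with `Y Ψ =
div J + k + e` (`exists_parametrix`). Here `Ψ` and `e` are of size `s^(-Q/2)` and `J` and `DΨ` of
size `s^(-(Q+1)/2)`, `s` being the elapsed time, all supported in a self-similar region, and `k` is
an approximate identity at time scale `ε`. The term `div J` is too singular to keep; it is moved
onto `v` by the definition of `Dv` (`lintegral_mul_parametrix_le`). Letting `ε → 0` bounds `χ v` by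
the potential of order one of `v + |Dv|` plus the potential of order two of `χ |H|`
(`pointwise_bound`). No fundamental solution and no regularity of `a` is needed: `a` enters only
through its bound.

The parametrix is a compactly supported profile of a quadratic form, times `s^(-Q/2)`. The form is
the inverse controllability Gramian of the principal part of the drift. The rank condition makes the
Gramian positive definite, and its Lyapunov equation makes the leading terms of `Y Ψ - div J - k`
cancel (`exists_lyapunov_form`, `fderiv_sqForm_yVec`).

Lebesgue measure is left invariant and slices of the region at time `-s` have volume of order
`s^(Q/2)`, so the homogeneous dimension is `Q + 2` and the kernels satisfy `hls_grpKer`. The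
potential of order one maps `L²`, and that of order two maps `L^((2Q+4)/(Q+4))`, into `L^(2k)`.

The right-hand side satisfies `|H| ≤ |b'| |Dv| + W v + S` with `W` in `L^q`. The first term is in
the right space by Hölder. The potential `W` is cut at a level: the high part is small in the
critical space `L^((Q+2)/2)` and is absorbed into the left-hand side, the low part is in `L^(Q+2)`
and meets the `L²` norm of `v` (`lnorm_absorb`). For `W` of norm at most `p K₀` the optimal level
produces the power `p^(q/(2q-Q-2)) = p^(1/(1-β))`.

For (i) take `v = u`. For (ii), `w = u^p` satisfies such an inequality with right-hand side `b'·Dw +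
p c w + p u^(p-1) f`, and Young's inequality at a height `κ` proportional to `‖f‖` splits the last
term into a piece of `W` of controlled norm and a source `κ^(p-1) |f|`. The proportionality factor
is small enough to swallow every constant in front of `‖f‖^p`, which requires the constant of the
source term to be independent of the size of `W`. That powers satisfy the inequality rests on
mollification by left translations, which commutes with the first-block derivatives and with `Y`
simultaneously (`exists_smooth_approx`). -/

theorem lintegral_layer_rpow (t : ℝ≥0∞) {r : ℝ} (hr : 0 < r) :
    ∫⁻ l in Set.Ioi (0 : ℝ), (if ENNReal.ofReal l < t then ENNReal.ofReal (r * l ^ (r - 1)) else 0)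
      = t ^ r := by
  have key : ∀ x : ℝ, 0 ≤ x → ∫⁻ l in Set.Ioi (0 : ℝ),
      (if ENNReal.ofReal l < ENNReal.ofReal x then ENNReal.ofReal (r * l ^ (r - 1)) else 0)
      = ENNReal.ofReal x ^ r := by
    intro x hx
    -- Under a Dirac mass, the layer-cake formula for a constant function is the scalar identity
    -- wanted.
    have h := lintegral_rpow_eq_lintegral_meas_lt_mul (Measure.dirac ()) (f := fun _ => x)
      (Filter.Eventually.of_forall fun _ => hx) aemeasurable_const hr
    rw [lintegral_dirac] at h
    rw [ENNReal.ofReal_rpow_of_nonneg hx hr.le, h,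
      ← lintegral_const_mul' _ _ ENNReal.ofReal_ne_top]
    refine setLIntegral_congr_fun measurableSet_Ioi fun l hl => ?_
    have hl' : (0 : ℝ) < l := hl
    by_cases hlx : l < x
    · have : ENNReal.ofReal l < ENNReal.ofReal x :=
        (ENNReal.ofReal_lt_ofReal_iff (hl'.trans hlx)).2 hlx
      simp [this, hlx, ENNReal.ofReal_mul hr.le]
    · have : ¬ ENNReal.ofReal l < ENNReal.ofReal x := not_lt.2 (ENNReal.ofReal_le_ofReal
        (not_lt.1 hlx))
      simp [this, hlx]
  by_cases ht : t = ⊤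
  -- The infinite value is reached as a supremum of finite ones, the finite case being used at `x ^
  -- (1 / r)`.
  · subst ht
    rw [ENNReal.top_rpow_of_pos hr, eq_top_iff]
    refine ENNReal.le_of_forall_nnreal_lt fun x _ => ?_
    have h1 := key ((x : ℝ) ^ (1 / r)) (by positivity)
    rw [ENNReal.ofReal_rpow_of_nonneg (by positivity) hr.le, ← Real.rpow_mul x.coe_nonneg,
      one_div_mul_cancel hr.ne', Real.rpow_one, ENNReal.ofReal_coe_nnreal] at h1
    rw [← h1]
    refine lintegral_mono fun l => ?_
    split_ifs <;> simp_all
  · have := key t.toReal ENNReal.toReal_nonneg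
    rwa [ENNReal.ofReal_toReal ht] at this

/-- The integral operator with kernel `K`. -/
def kerOp {X Y : Type*} [MeasurableSpace Y] (ν : Measure Y) (K : X → Y → ℝ≥0∞) (f : Y → ℝ≥0∞)
    (x : X) : ℝ≥0∞ := ∫⁻ y, K x y * f y ∂ν

/-! ### Integral operators with non-negative kernels and the Hardy–Littlewood–Sobolev inequality. -/

section HLS

variable {X Y : Type*} [MeasurableSpace Y] {ν : Measure Y}

theorem kerOp_congr {K : X → Y → ℝ≥0∞} {f g : Y → ℝ≥0∞} (h : f =ᵐ[ν] g) :
    kerOp ν K f = kerOp ν K g := by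
  funext x
  exact lintegral_congr_ae (h.mono fun y hy => by simp only [hy])

theorem kerOp_mono {K : X → Y → ℝ≥0∞} {f g : Y → ℝ≥0∞} (h : f ≤ᵐ[ν] g) (x : X) :
    kerOp ν K f x ≤ kerOp ν K g x :=
  lintegral_mono_ae (h.mono fun y hy => by gcongr)

theorem kerOp_add {K : X → Y → ℝ≥0∞} (hK : ∀ x, Measurable (K x))
    {f g : Y → ℝ≥0∞} (hf : AEMeasurable f ν) (x : X) :
    kerOp ν K (fun y => f y + g y) x = kerOp ν K f x + kerOp ν K g x := by
  unfold kerOp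
  simp only [mul_add]
  exact lintegral_add_left' ((hK x).aemeasurable.mul hf) _

theorem kerOp_const_mul {K : X → Y → ℝ≥0∞} {f : Y → ℝ≥0∞} {c : ℝ≥0∞} (hc : c ≠ ⊤) (x : X) :
    kerOp ν K (fun y => c * f y) x = c * kerOp ν K f x := by
  unfold kerOp
  rw [← lintegral_const_mul' _ _ hc]
  simp only [mul_left_comm]

variable [MeasurableSpace X] {μ : Measure X}

theorem measurable_kerOp [SFinite ν] {K : X → Y → ℝ≥0∞} (hK : Measurable (Function.uncurry K))
    {f : Y → ℝ≥0∞} (hf : AEMeasurable f ν) : Measurable (kerOp ν K f) := by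
  rw [kerOp_congr hf.ae_eq_mk]
  exact Measurable.lintegral_prod_right (hK.mul (hf.measurable_mk.comp measurable_snd))

/-- `L¹` bound of an integral operator whose columns are integrable against a weight. -/
theorem lintegral_kerOp_le [SFinite μ] [SFinite ν] {K : X → Y → ℝ≥0∞}
    (hK : Measurable (Function.uncurry K)) {V : X → ℝ≥0∞} (hV : Measurable V) {A : ℝ≥0∞}
    (h : ∀ y, ∫⁻ x, V x * K x y ∂μ ≤ A) {f : Y → ℝ≥0∞} (hf : AEMeasurable f ν) :
    ∫⁻ x, V x * kerOp ν K f x ∂μ ≤ A * ∫⁻ y, f y ∂ν := by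
  rw [kerOp_congr hf.ae_eq_mk, lintegral_congr_ae hf.ae_eq_mk]
  have hg := hf.measurable_mk
  set g := hf.mk
  calc ∫⁻ x, V x * kerOp ν K g x ∂μ
      = ∫⁻ x, ∫⁻ y, V x * (K x y * g y) ∂ν ∂μ := by
        refine lintegral_congr fun x => ?_
        rw [kerOp, lintegral_const_mul]
        exact (hK.comp measurable_prodMk_left).mul hg
    _ = ∫⁻ y, ∫⁻ x, V x * (K x y * g y) ∂μ ∂ν := by
        rw [lintegral_lintegral_swap]
        exact ((hV.comp measurable_fst).mul (hK.mul (hg.comp measurable_snd))).aemeasurable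
    _ = ∫⁻ y, (∫⁻ x, V x * K x y ∂μ) * g y ∂ν := by
        refine lintegral_congr fun y => ?_
        rw [← lintegral_mul_const]
        · simp only [mul_assoc]
        · exact hV.mul (hK.comp measurable_prodMk_right)
    _ ≤ ∫⁻ y, A * g y ∂ν := lintegral_mono fun y => by gcongr; exact h y
    _ = A * ∫⁻ y, g y ∂ν := lintegral_const_mul _ hg

/-- The distribution function of `K f` for a kernel that splits, at every threshold `τ`,
into a part of small `L¹` norm and a part of bounded `L^{p'}` norm. -/
theorem meas_kerOp_gt_le [SFinite μ] [SFinite ν] {K K₁ K₂ : X → Y → ℝ≥0∞} {p p' : ℝ}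
    (hpp : p.HolderConjugate p')
    (hK₁ : Measurable (Function.uncurry K₁)) (hK₂ : Measurable (Function.uncurry K₂))
    (hK : ∀ x y, K x y ≤ K₁ x y + K₂ x y) {s : ℝ} (hs : 0 < s) {l g : ℝ} (hg : 0 < g)
    (hgl : 3 * (s * g) = l)
    (hx : ∀ x, ∫⁻ y, K₁ x y ∂ν ≤ ENNReal.ofReal s) (hy : ∀ y, ∫⁻ x, K₁ x y ∂μ ≤ ENNReal.ofReal s)
    (h2 : ∀ x, (∫⁻ y, K₂ x y ^ p' ∂ν) ^ (1 / p') ≤ ENNReal.ofReal (l / 3))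
    {f : Y → ℝ≥0∞} (hf : Measurable f) (hf1 : ∫⁻ y, f y ^ p ∂ν ≤ 1) :
    μ {x | ENNReal.ofReal l < kerOp ν K f x} ≤
      (ENNReal.ofReal g)⁻¹ * ∫⁻ y, (if ENNReal.ofReal g < f y then f y else 0) ∂ν := by
  have hl : 0 < l := by rw [← hgl]; positivity
  -- Only the part of `f` above the height `g` matters. Hölder bounds `K₂ f` by `l / 3`, and `K₁`
  -- applied to the part below `g` is at most `s g = l / 3`. Hence `K f > l` forces `K₁ F ≥ l / 3`,
  -- a set controlled by Chebyshev's inequality and the column bound of `K₁`.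
  set F : Y → ℝ≥0∞ := fun y => if ENNReal.ofReal g < f y then f y else 0 with hF
  have hFm : Measurable F := Measurable.ite (measurableSet_lt measurable_const hf) hf
    measurable_const
  have hK₁x : ∀ x, Measurable (K₁ x) := fun x => hK₁.comp measurable_prodMk_left
  have hK₂x : ∀ x, Measurable (K₂ x) := fun x => hK₂.comp measurable_prodMk_left
  have hbound : ∀ x, kerOp ν K f x ≤
      kerOp ν K₁ F x + ENNReal.ofReal (l / 3) + ENNReal.ofReal (l / 3) := by
    intro x
    have e1 : ∫⁻ y, K₂ x y * f y ∂ν ≤ ENNReal.ofReal (l / 3) := by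
      calc ∫⁻ y, K₂ x y * f y ∂ν
          ≤ (∫⁻ y, K₂ x y ^ p' ∂ν) ^ (1 / p') * (∫⁻ y, f y ^ p ∂ν) ^ (1 / p) :=
            ENNReal.lintegral_mul_le_Lp_mul_Lq ν hpp.symm (hK₂x x).aemeasurable hf.aemeasurable
        _ ≤ ENNReal.ofReal (l / 3) * 1 := by
            gcongr
            · exact h2 x
            · exact ENNReal.rpow_le_one hf1 (by have := hpp.pos; positivity)
        _ = _ := mul_one _
    have e2 : ∫⁻ y, K₁ x y * ENNReal.ofReal g ∂ν ≤ ENNReal.ofReal (l / 3) := by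
      rw [lintegral_mul_const _ (hK₁x x)]
      calc (∫⁻ y, K₁ x y ∂ν) * ENNReal.ofReal g ≤ ENNReal.ofReal s * ENNReal.ofReal g := by
            gcongr; exact hx x
        _ = ENNReal.ofReal (l / 3) := by
            rw [← ENNReal.ofReal_mul hs.le]; congr 1; linarith
    calc kerOp ν K f x ≤ ∫⁻ y, (K₁ x y * F y + K₁ x y * ENNReal.ofReal g + K₂ x y * f y) ∂ν := by
          refine lintegral_mono fun y => ?_
          have : f y ≤ F y + ENNReal.ofReal g := by
            simp only [hF]
            split_ifs with h
            · exact le_self_add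
            · simpa using h
          calc K x y * f y ≤ (K₁ x y + K₂ x y) * f y := by gcongr; exact hK x y
            _ = K₁ x y * f y + K₂ x y * f y := add_mul _ _ _
            _ ≤ K₁ x y * (F y + ENNReal.ofReal g) + K₂ x y * f y := by gcongr
            _ = _ := by rw [mul_add]
      _ = kerOp ν K₁ F x + (∫⁻ y, K₁ x y * ENNReal.ofReal g ∂ν) + ∫⁻ y, K₂ x y * f y ∂ν := by
          rw [lintegral_add_left, lintegral_add_left]
          · rfl
          · exact (hK₁x x).mul hFm
          · exact ((hK₁x x).mul hFm).add ((hK₁x x).mul_const _)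
      _ ≤ _ := by gcongr
  have hsub : {x | ENNReal.ofReal l < kerOp ν K f x} ⊆
      {x | ENNReal.ofReal (l / 3) ≤ kerOp ν K₁ F x} := by
    intro x hx'
    by_contra hcon
    have hcon' : kerOp ν K₁ F x < ENNReal.ofReal (l / 3) := not_le.1 hcon
    refine (lt_irrefl (ENNReal.ofReal l)) (lt_of_lt_of_le (lt_of_lt_of_le hx' (hbound x)) ?_)
    calc kerOp ν K₁ F x + ENNReal.ofReal (l / 3) + ENNReal.ofReal (l / 3)
        ≤ ENNReal.ofReal (l / 3) + ENNReal.ofReal (l / 3) + ENNReal.ofReal (l / 3) := by gcongr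
      _ = ENNReal.ofReal l := by
          rw [← ENNReal.ofReal_add (by positivity) (by positivity),
            ← ENNReal.ofReal_add (by positivity) (by positivity)]
          congr 1; ring
  have hl3 : ENNReal.ofReal (l / 3) ≠ 0 := by simp; positivity
  have hint : ∫⁻ x, kerOp ν K₁ F x ∂μ ≤ ENNReal.ofReal s * ∫⁻ y, F y ∂ν := by
    have := lintegral_kerOp_le (μ := μ) (ν := ν) hK₁ (V := fun _ => 1) measurable_const
      (A := ENNReal.ofReal s) (by simpa using hy) hFm.aemeasurable
    simpa using this
  calc μ {x | ENNReal.ofReal l < kerOp ν K f x}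
      ≤ μ {x | ENNReal.ofReal (l / 3) ≤ kerOp ν K₁ F x} := measure_mono hsub
    _ ≤ (∫⁻ x, kerOp ν K₁ F x ∂μ) / ENNReal.ofReal (l / 3) :=
        meas_ge_le_lintegral_div (measurable_kerOp hK₁ hFm.aemeasurable).aemeasurable hl3
          ENNReal.ofReal_ne_top
    _ ≤ (ENNReal.ofReal s * ∫⁻ y, F y ∂ν) / ENNReal.ofReal (l / 3) := by gcongr
    _ = _ := by
        have : l / 3 = s * g := by linarith
        rw [this, ENNReal.ofReal_mul hs.le, ENNReal.div_eq_inv_mul, ENNReal.mul_inv, ← mul_assoc,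
          mul_right_comm _ _ (ENNReal.ofReal s), ENNReal.inv_mul_cancel, one_mul]
        · simpa using hs
        · exact ENNReal.ofReal_ne_top
        · left; simpa using hs
        · left; exact ENNReal.ofReal_ne_top

/-- Each level `l` gets its own threshold `τ` and its own truncation height for `f`, so the
distributional bounds can be integrated over `l` and give the strong-type inequality at once,
without an interpolation theorem. -/
theorem hls_normalized [SFinite μ] [SFinite ν] {K : X → Y → ℝ≥0∞} {σ : X → Y → ℝ}
    (hK : Measurable (Function.uncurry K)) (hσ : Measurable (Function.uncurry σ))
    {p p' q a b A : ℝ} (hpp : p.HolderConjugate p') (ha : 0 < a) (hb : 0 < b) (hA : 0 < A)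
    (hq : q * b = p * (a + b))
    (hx : ∀ τ > 0, ∀ x, ∫⁻ y, (if σ x y < τ then K x y else 0) ∂ν ≤ ENNReal.ofReal (A * τ ^ a))
    (hy : ∀ τ > 0, ∀ y, ∫⁻ x, (if σ x y < τ then K x y else 0) ∂μ ≤ ENNReal.ofReal (A * τ ^ a))
    (h2 : ∀ τ > 0, ∀ x, (∫⁻ y, (if σ x y < τ then 0 else K x y) ^ p' ∂ν) ^ (1 / p') ≤
      ENNReal.ofReal (A * τ ^ (-b))) :
    ∃ C : ℝ≥0∞, C ≠ ⊤ ∧ ∀ f : Y → ℝ≥0∞, Measurable f → ∫⁻ y, f y ^ p ∂ν ≤ 1 →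
      ∫⁻ x, kerOp ν K f x ^ q ∂μ ≤ C * ∫⁻ y, f y ^ p ∂ν := by
  have hp1 : 1 < p := hpp.lt
  have hp0 : 0 < p := hpp.pos
  obtain ⟨n, hn⟩ : ∃ n, n = a / b := ⟨_, rfl⟩
  have hn0 : 0 < n := by rw [hn]; positivity
  have hqn : q = p * (1 + n) := by
    rw [hn]; field_simp; linarith
  have hq0 : 0 < q := by rw [hqn]; positivity
  have hqm : 0 < q - (1 + n) := by rw [hqn]; nlinarith
  -- the height is `g l = c * l ^ (1 + n)`
  obtain ⟨c, hc⟩ : ∃ c : ℝ, c = (3 * A * (3 * A) ^ n)⁻¹ := ⟨_, rfl⟩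
  have hc0 : 0 < c := by rw [hc]; positivity
  have hdist : ∀ f : Y → ℝ≥0∞, Measurable f → ∫⁻ y, f y ^ p ∂ν ≤ 1 → ∀ l : ℝ, 0 < l →
      μ {x | ENNReal.ofReal l < kerOp ν K f x} ≤ (ENNReal.ofReal (c * l ^ (1 + n)))⁻¹ *
        ∫⁻ y, (if ENNReal.ofReal (c * l ^ (1 + n)) < f y then f y else 0) ∂ν := by
    intro f hf hf1 l hl
    -- With this threshold the far part is worth exactly `A τ^(-b) = l / 3`.
    obtain ⟨τ, hτ⟩ : ∃ τ : ℝ, τ = (3 * A / l) ^ (1 / b) := ⟨_, rfl⟩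
    have hτ0 : 0 < τ := by rw [hτ]; positivity
    have e1 : τ ^ (-b) = l / (3 * A) := by
      rw [hτ, ← Real.rpow_mul (by positivity)]
      have : 1 / b * -b = -1 := by field_simp
      rw [this, Real.rpow_neg_one, inv_div]
    have e2 : τ ^ a = (3 * A / l) ^ n := by
      rw [hτ, ← Real.rpow_mul (by positivity), hn]
      congr 1; field_simp
    -- The value of `c` is the one for which the near part, applied to the constant `c l^(1+n)`, is
    -- also worth `l / 3`.
    have e3 : 3 * (A * τ ^ a * (c * l ^ (1 + n))) = l := by
      rw [e2, hc, Real.div_rpow (by positivity) hl.le, Real.rpow_add hl, Real.rpow_one]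
      have : 0 < l ^ n := by positivity
      have : 0 < (3 * A) ^ n := by positivity
      field_simp
    have mσ : MeasurableSet {z : X × Y | Function.uncurry σ z < τ} :=
      measurableSet_lt hσ measurable_const
    refine meas_kerOp_gt_le (s := A * τ ^ a) hpp
      (K₁ := fun x y => if σ x y < τ then K x y else 0)
      (K₂ := fun x y => if σ x y < τ then 0 else K x y)
      (Measurable.ite mσ hK measurable_const) (Measurable.ite mσ measurable_const hK)
      (fun x y => ?_) (by positivity) (by positivity) e3 (hx τ hτ0) (hy τ hτ0) (fun x => ?_) hf hf1
    · split_ifs <;> simp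
    · refine (h2 τ hτ0 x).trans (ENNReal.ofReal_le_ofReal (le_of_eq ?_))
      rw [e1]; field_simp
  refine ⟨ENNReal.ofReal (q / (c * (q - (1 + n)))) *
    (ENNReal.ofReal c)⁻¹ ^ ((q - (1 + n)) / (1 + n)), ?_, ?_⟩
  · refine ENNReal.mul_ne_top ENNReal.ofReal_ne_top (ENNReal.rpow_ne_top_of_nonneg (by positivity) ?_)
    simpa using hc0
  intro f hf hf1
  have hTm := measurable_kerOp (ν := ν) hK hf.aemeasurable
  calc ∫⁻ x, kerOp ν K f x ^ q ∂μ
      = ∫⁻ x, (∫⁻ l in Set.Ioi (0 : ℝ), (if ENNReal.ofReal l < kerOp ν K f x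
          then ENNReal.ofReal (q * l ^ (q - 1)) else 0)) ∂μ :=
        lintegral_congr fun x => (lintegral_layer_rpow _ hq0).symm
    _ = ∫⁻ l in Set.Ioi (0 : ℝ), ∫⁻ x, (if ENNReal.ofReal l < kerOp ν K f x
          then ENNReal.ofReal (q * l ^ (q - 1)) else 0) ∂μ := by
        rw [lintegral_lintegral_swap]
        refine Measurable.aemeasurable (Measurable.ite (measurableSet_lt ?_ ?_) ?_ measurable_const)
        · exact ENNReal.measurable_ofReal.comp measurable_snd
        · exact hTm.comp measurable_fst
        · fun_prop
    _ ≤ ∫⁻ l in Set.Ioi (0 : ℝ), ∫⁻ y, (if ENNReal.ofReal (c * l ^ (1 + n)) < f y then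
          ENNReal.ofReal (q / c * l ^ (q - (1 + n) - 1)) * f y else 0) ∂ν := by
        refine setLIntegral_mono' measurableSet_Ioi fun l hl => ?_
        have hl' : (0 : ℝ) < l := hl
        have hms : MeasurableSet {x | ENNReal.ofReal l < kerOp ν K f x} :=
          measurableSet_lt measurable_const hTm
        calc ∫⁻ x, (if ENNReal.ofReal l < kerOp ν K f x
              then ENNReal.ofReal (q * l ^ (q - 1)) else 0) ∂μ
            = ENNReal.ofReal (q * l ^ (q - 1)) * μ {x | ENNReal.ofReal l < kerOp ν K f x} := by
              rw [← lintegral_indicator_const hms]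
              simp only [Set.indicator, Set.mem_ofPred_eq]
          _ ≤ ENNReal.ofReal (q * l ^ (q - 1)) * ((ENNReal.ofReal (c * l ^ (1 + n)))⁻¹ *
              ∫⁻ y, (if ENNReal.ofReal (c * l ^ (1 + n)) < f y then f y else 0) ∂ν) := by
              gcongr; exact hdist f hf hf1 l hl'
          _ = _ := by
              rw [← mul_assoc, ← ENNReal.ofReal_inv_of_pos (by positivity),
                ← ENNReal.ofReal_mul (by positivity), ← lintegral_const_mul' _ _
                ENNReal.ofReal_ne_top]
              refine lintegral_congr fun y => ?_
              rw [mul_ite, mul_zero]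
              congr 3
              rw [show q - (1 + n) - 1 = q - 1 - (1 + n) by ring, Real.rpow_sub hl' (q - 1)]
              field_simp
    _ = ∫⁻ y, (∫⁻ l in Set.Ioi (0 : ℝ), (if ENNReal.ofReal (c * l ^ (1 + n)) < f y then
          ENNReal.ofReal (q / c * l ^ (q - (1 + n) - 1)) * f y else 0)) ∂ν := by
        rw [lintegral_lintegral_swap]
        refine Measurable.aemeasurable (Measurable.ite (measurableSet_lt ?_ ?_) ?_ measurable_const)
        · exact ENNReal.measurable_ofReal.comp (by fun_prop)
        · exact hf.comp measurable_snd
        · exact (ENNReal.measurable_ofReal.comp (by fun_prop)).mul (hf.comp measurable_snd)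
    _ = ∫⁻ y, _ * f y ^ p ∂ν := by
        refine lintegral_congr fun y => ?_
        -- Since `q = p (1 + n)`, the exponent `(q - (1 + n)) / (1 + n)` is `p - 1`: the integral
        -- over the levels below `f y` supplies the missing power.
        have hexp : f y ^ p = f y ^ ((q - (1 + n)) / (1 + n)) * f y := by
          rw [show p = (q - (1 + n)) / (1 + n) + 1 by rw [hqn]; field_simp; ring,
            ENNReal.rpow_add_of_nonneg _ _ (by positivity) zero_le_one, ENNReal.rpow_one]
        have hL := lintegral_layer_rpow (((ENNReal.ofReal c)⁻¹ * f y) ^ (1 / (1 + n))) hqm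
        rw [← ENNReal.rpow_mul, one_div_mul_eq_div,
          ENNReal.mul_rpow_of_nonneg _ _ (z := (q - (1 + n)) / (1 + n)) (by positivity)] at hL
        rw [hexp, mul_assoc, ← mul_assoc _ _ (f y), ← hL, ← mul_assoc,
          ← lintegral_const_mul' _ _ ENNReal.ofReal_ne_top, ← lintegral_mul_const'']
        · refine setLIntegral_congr_fun measurableSet_Ioi fun l hl => ?_
          have hl' : (0 : ℝ) < l := hl
          have hiff : ENNReal.ofReal (c * l ^ (1 + n)) < f y ↔
              ENNReal.ofReal l < ((ENNReal.ofReal c)⁻¹ * f y) ^ (1 / (1 + n)) := by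
            have hc1 : ENNReal.ofReal c ≠ 0 := by simpa using hc0
            rw [← ENNReal.rpow_lt_rpow_iff (z := 1 + n) (by positivity) (x := ENNReal.ofReal l),
              ← ENNReal.rpow_mul, one_div_mul_cancel (by positivity), ENNReal.rpow_one,
              ENNReal.ofReal_rpow_of_pos hl', ENNReal.ofReal_mul hc0.le, ← ENNReal.div_eq_inv_mul,
              ENNReal.lt_div_iff_mul_lt (Or.inl hc1) (Or.inl ENNReal.ofReal_ne_top), mul_comm]
          simp only [hiff]
          split_ifs
          · rw [← ENNReal.ofReal_mul (by positivity)]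
            congr 2
            field_simp
          · simp
        · refine AEMeasurable.const_mul (Measurable.aemeasurable (Measurable.ite
            (measurableSet_lt ?_ measurable_const) (by fun_prop) measurable_const)) _
          exact ENNReal.measurable_ofReal
    _ = _ := lintegral_const_mul _ (hf.pow_const p)

/-- The `L^p` norm of an extended nonnegative function. -/
def lnorm {X : Type*} [MeasurableSpace X] (μ : Measure X) (p : ℝ) (f : X → ℝ≥0∞) : ℝ≥0∞ :=
  (∫⁻ x, f x ^ p ∂μ) ^ (1 / p)

/-- Hardy–Littlewood–Sobolev inequality for kernels with a homogeneous splitting. -/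
theorem hls [SFinite μ] [SFinite ν] {K : X → Y → ℝ≥0∞} {σ : X → Y → ℝ}
    (hK : Measurable (Function.uncurry K)) (hσ : Measurable (Function.uncurry σ))
    {p p' q a b A : ℝ} (hpp : p.HolderConjugate p') (ha : 0 < a) (hb : 0 < b) (hA : 0 < A)
    (hq : q * b = p * (a + b))
    (hx : ∀ τ > 0, ∀ x, ∫⁻ y, (if σ x y < τ then K x y else 0) ∂ν ≤ ENNReal.ofReal (A * τ ^ a))
    (hy : ∀ τ > 0, ∀ y, ∫⁻ x, (if σ x y < τ then K x y else 0) ∂μ ≤ ENNReal.ofReal (A * τ ^ a))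
    (h2 : ∀ τ > 0, ∀ x, (∫⁻ y, (if σ x y < τ then 0 else K x y) ^ p' ∂ν) ^ (1 / p') ≤
      ENNReal.ofReal (A * τ ^ (-b))) :
    ∃ C : ℝ≥0, 0 < C ∧ ∀ f : Y → ℝ≥0∞, AEMeasurable f ν →
      lnorm μ q (kerOp ν K f) ≤ C * lnorm ν p f := by
  obtain ⟨C, hC, h⟩ := hls_normalized hK hσ hpp ha hb hA hq hx hy h2
  have hp0 : 0 < p := hpp.pos
  have hq0 : 0 < q := by
    have : 0 < q * b := by rw [hq]; positivity
    exact pos_of_mul_pos_left this hb.le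
  have hqi : 0 < 1 / q := by positivity
  have hCq : C ^ (1 / q) ≠ ⊤ := ENNReal.rpow_ne_top_of_nonneg (by positivity) hC
  -- The added `1` keeps the constant non-zero, so that the case of an infinite norm of `f` is
  -- trivial.
  refine ⟨(C ^ (1 / q)).toNNReal + 1, by positivity, fun f hf => ?_⟩
  have hcoe : C ^ (1 / q) ≤ (((C ^ (1 / q)).toNNReal + 1 : ℝ≥0) : ℝ≥0∞) := by
    rw [ENNReal.coe_add, ENNReal.coe_toNNReal hCq]; exact le_self_add
  have hcoe0 : (((C ^ (1 / q)).toNNReal + 1 : ℝ≥0) : ℝ≥0∞) ≠ 0 := by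
    simp
  set D := (((C ^ (1 / q)).toNNReal + 1 : ℝ≥0) : ℝ≥0∞)
  have hmk : lnorm ν p f = lnorm ν p (hf.mk f) := by
    unfold lnorm
    congr 1
    exact lintegral_congr_ae (hf.ae_eq_mk.mono fun y hy => by simp only [hy])
  rw [kerOp_congr hf.ae_eq_mk, hmk]
  have hg := hf.measurable_mk
  generalize hf.mk f = g at hg
  clear hmk hf f
  by_cases htop : lnorm ν p g = ⊤
  · rw [htop, ENNReal.mul_top hcoe0]; exact le_top
  by_cases h0 : lnorm ν p g = 0
  · have h1 : ∫⁻ y, g y ^ p ∂ν = 0 := by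
      simpa [lnorm, hp0, hp0.not_gt, ENNReal.rpow_eq_zero_iff] using h0
    have := h g hg (by rw [h1]; exact zero_le_one)
    rw [h1, mul_zero] at this
    rw [lnorm, le_antisymm this bot_le, ENNReal.zero_rpow_of_pos hqi]
    exact bot_le
  set N := lnorm ν p g with hN
  have hNp : N ^ p = ∫⁻ y, g y ^ p ∂ν := by
    rw [hN, lnorm, ← ENNReal.rpow_mul, one_div_mul_cancel hp0.ne', ENNReal.rpow_one]
  have hn1 : ∫⁻ y, (N⁻¹ * g y) ^ p ∂ν = 1 := by
    simp only [ENNReal.mul_rpow_of_nonneg _ _ hp0.le]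
    rw [lintegral_const_mul _ (hg.pow_const p), ← hNp, ← ENNReal.mul_rpow_of_nonneg _ _ hp0.le,
      ENNReal.inv_mul_cancel h0 htop, ENNReal.one_rpow]
  have h3 := h (fun y => N⁻¹ * g y) (hg.const_mul _) hn1.le
  rw [hn1, mul_one] at h3
  have h4 : kerOp ν K g = fun x => N * kerOp ν K (fun y => N⁻¹ * g y) x := by
    funext x
    rw [kerOp_const_mul (by simpa using h0), ← mul_assoc, ENNReal.mul_inv_cancel h0 htop, one_mul]
  rw [h4, lnorm]
  simp only [ENNReal.mul_rpow_of_nonneg _ _ hq0.le]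
  rw [lintegral_const_mul' _ _ (ENNReal.rpow_ne_top_of_nonneg hq0.le htop),
    ENNReal.mul_rpow_of_nonneg _ _ hqi.le, ← ENNReal.rpow_mul, mul_one_div_cancel hq0.ne',
    ENNReal.rpow_one, mul_comm]
  gcongr
  exact (ENNReal.rpow_le_rpow h3 hqi.le).trans hcoe

end HLS

variable {d : ℕ} {m : Fin (d + 1) → ℕ}

/-! ### The group law -/

section Group

variable (B : Matrix (Idx m) (Idx m) ℝ)

theorem expE_zero : expE B 0 = 1 := by
  simp [expE]

theorem expE_add (s t : ℝ) : expE B (s + t) = expE B s * expE B t := by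
  unfold expE
  rw [← Matrix.exp_add_of_commute, neg_add, add_smul]
  exact ((Commute.refl _).smul_left _).smul_right _

theorem expE_mul_neg (s : ℝ) : expE B s * expE B (-s) = 1 := by
  rw [← expE_add, add_neg_cancel, expE_zero]

theorem det_expE_mul (s : ℝ) : (expE B s).det * (expE B (-s)).det = 1 := by
  rw [← Matrix.det_mul, expE_mul_neg, Matrix.det_one]

theorem det_expE_ne_zero (s : ℝ) : (expE B s).det ≠ 0 :=
  left_ne_zero_of_mul (by rw [det_expE_mul]; exact one_ne_zero)

section NormedExp

attribute [local instance] Matrix.linftyOpNormedRing Matrix.linftyOpNormedAlgebra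

theorem hasDerivAt_expE (τ : ℝ) :
    HasDerivAt (expE B) (-(B.transpose * expE B τ)) τ := by
  have h := (hasDerivAt_exp_smul_const' (𝕂 := ℝ) (B.transpose) (-τ)).scomp τ (hasDerivAt_neg τ)
  have e : expE B = fun τ => NormedSpace.exp ((-τ) • B.transpose) := rfl
  rw [e]
  simp only [Function.comp_def, neg_smul, one_smul] at h ⊢
  exact h

theorem contDiff_expE_entry (i j : Idx m) : ContDiff ℝ ∞ fun τ => expE B τ i j := by
  have h1 : ContDiff ℝ ∞ (NormedSpace.exp : Matrix (Idx m) (Idx m) ℝ → Matrix (Idx m) (Idx m) ℝ) :=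
    AnalyticOnNhd.contDiff fun x _ => NormedSpace.exp_analytic (𝕂 := ℝ) x
  have h2 : ContDiff ℝ ∞ (expE B) := by
    unfold expE
    exact h1.comp (contDiff_neg.smul contDiff_const)
  let L : Matrix (Idx m) (Idx m) ℝ →ₗ[ℝ] ℝ :=
    { toFun := fun A => A i j, map_add' := fun _ _ => rfl, map_smul' := fun _ _ => rfl }
  exact (LinearMap.toContinuousLinearMap L).contDiff.comp h2

theorem hasDerivAt_expE_mulVec (x : Idx m → ℝ) (τ : ℝ) :
    HasDerivAt (fun τ => (expE B τ).mulVec x)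
      (-(B.transpose.mulVec ((expE B τ).mulVec x))) τ := by
  let L : Matrix (Idx m) (Idx m) ℝ →ₗ[ℝ] (Idx m → ℝ) :=
    { toFun := fun A => A.mulVec x
      map_add' := fun _ _ => Matrix.add_mulVec _ _ _
      map_smul' := fun _ _ => Matrix.smul_mulVec _ _ _ }
  have h := (LinearMap.toContinuousLinearMap L).hasFDerivAt.comp_hasDerivAt τ
    (hasDerivAt_expE B τ)
  have e : (LinearMap.toContinuousLinearMap L) (-(B.transpose * expE B τ)) =
      -(B.transpose.mulVec ((expE B τ).mulVec x)) := by
    change (-(B.transpose * expE B τ)).mulVec x = _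
    rw [Matrix.neg_mulVec, Matrix.mulVec_mulVec]
  exact h.congr_deriv e

end NormedExp

theorem contDiff_expE_mulVec : ContDiff ℝ ∞ fun z : Pt m => (expE B z.2).mulVec z.1 := by
  refine contDiff_pi.2 fun i => ?_
  simp only [Matrix.mulVec, dotProduct]
  refine ContDiff.sum fun j _ => ?_
  exact ((contDiff_expE_entry B i j).comp contDiff_snd).mul
    ((contDiff_apply ℝ ℝ j).comp contDiff_fst)

theorem contDiff_groupMul : ContDiff ℝ ∞ fun p : Pt m × Pt m => groupMul B p.1 p.2 := by
  unfold groupMul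
  refine ContDiff.prodMk ?_ (by fun_prop)
  exact (contDiff_fst.comp contDiff_snd).add ((contDiff_expE_mulVec B).comp
    ((contDiff_fst.comp contDiff_fst).prodMk (contDiff_snd.comp contDiff_snd)))

theorem contDiff_groupInv : ContDiff ℝ ∞ (groupInv B) := by
  unfold groupInv
  refine ContDiff.prodMk (ContDiff.neg ?_) (by fun_prop)
  exact (contDiff_expE_mulVec B).comp (contDiff_fst.prodMk contDiff_snd.neg)

theorem groupMul_assoc (z w v : Pt m) :
    groupMul B (groupMul B z w) v = groupMul B z (groupMul B w v) := by
  refine Prod.ext ?_ (add_assoc _ _ _)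
  simp only [groupMul, Matrix.mulVec_add, Matrix.mulVec_mulVec, ← expE_add, add_assoc,
    add_comm w.2 v.2]

theorem groupMul_zero (z : Pt m) : groupMul B z 0 = z := by
  simp [groupMul, expE_zero]

theorem zero_groupMul (z : Pt m) : groupMul B 0 z = z := by
  simp [groupMul]

theorem groupInv_groupMul (z : Pt m) : groupMul B (groupInv B z) z = 0 := by
  refine Prod.ext ?_ (neg_add_cancel _)
  simp [groupMul, groupInv, Matrix.mulVec_neg, Matrix.mulVec_mulVec, expE_mul_neg]

theorem groupMul_groupInv (z : Pt m) : groupMul B z (groupInv B z) = 0 := by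
  refine Prod.ext ?_ (add_neg_cancel _)
  simp [groupMul, groupInv]

theorem groupInv_groupMul_cancel (z w : Pt m) :
    groupMul B (groupInv B z) (groupMul B z w) = w := by
  rw [← groupMul_assoc, groupInv_groupMul, zero_groupMul]

theorem groupMul_groupInv_cancel (z w : Pt m) :
    groupMul B z (groupMul B (groupInv B z) w) = w := by
  rw [← groupMul_assoc, groupMul_groupInv, zero_groupMul]

theorem groupInv_groupMul_eq (z ζ : Pt m) : groupMul B (groupInv B z) ζ =
    (ζ.1 - (expE B (ζ.2 - z.2)).mulVec z.1, ζ.2 - z.2) := by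
  refine Prod.ext ?_ (by simp [groupMul, groupInv]; ring)
  simp only [groupMul, groupInv, Matrix.mulVec_neg, Matrix.mulVec_mulVec, ← expE_add,
    sub_eq_add_neg]

theorem continuous_groupMul_left (z : Pt m) : Continuous (groupMul B z) :=
  (contDiff_groupMul B).continuous.comp (Continuous.prodMk_right z)

theorem contDiff_groupMul_left (z : Pt m) : ContDiff ℝ ∞ (groupMul B z) :=
  (contDiff_groupMul B).comp (contDiff_prodMk_right z)

/-! ### Invariance of measure -/

theorem lintegral_affine (A : Matrix (Idx m) (Idx m) ℝ) (hA : A.det ≠ 0) (a : Idx m → ℝ)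
    {F : (Idx m → ℝ) → ℝ≥0∞} (hF : Measurable F) :
    ∫⁻ x, F (a + A.mulVec x) = ENNReal.ofReal |A.det|⁻¹ * ∫⁻ x, F x := by
  have h := Real.map_matrix_volume_pi_eq_smul_volume_pi hA
  have hm : Measurable (Matrix.toLin' A) := (LinearMap.continuous_of_finiteDimensional _).measurable
  calc ∫⁻ x, F (a + A.mulVec x) = ∫⁻ y, F (a + y) ∂(Measure.map (Matrix.toLin' A) volume) := by
        rw [lintegral_map (f := fun y => F (a + y)) (hF.comp (measurable_const_add a)) hm]
        simp
    _ = ENNReal.ofReal |A.det|⁻¹ * ∫⁻ y, F (a + y) := by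
        rw [h, lintegral_smul_measure, abs_inv, smul_eq_mul]
    _ = _ := by rw [lintegral_add_left_eq_self]

/-- A left translation shifts `t` and, for each fixed `t`, shifts `x`. Lebesgue measure is thus a
left Haar measure. -/
theorem lintegral_groupMul_left (w : Pt m) {F : Pt m → ℝ≥0∞} (hF : Measurable F) :
    ∫⁻ z, F (groupMul B w z) = ∫⁻ z, F z := by
  have hm : Measurable fun z => F (groupMul B w z) :=
    hF.comp (continuous_groupMul_left B w).measurable
  rw [Measure.volume_eq_prod, lintegral_prod_symm' _ hm, lintegral_prod_symm' _ hF]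
  simp only [groupMul]
  have h1 : ∀ t : ℝ, ∫⁻ x, F (x + (expE B t).mulVec w.1, w.2 + t) = ∫⁻ x, F (x, w.2 + t) :=
    fun t => lintegral_add_right_eq_self (fun x => F (x, w.2 + t)) _
  simp only [h1]
  exact lintegral_add_left_eq_self (fun t => ∫⁻ x, F (x, t)) w.2

theorem measurePreserving_groupMul_left (w : Pt m) : MeasurePreserving (groupMul B w) := by
  have hm := (continuous_groupMul_left B w).measurable
  refine ⟨hm, Measure.ext fun s hs => ?_⟩
  rw [Measure.map_apply hm hs, ← lintegral_indicator_one (hm hs), ← lintegral_indicator_one hs,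
    ← lintegral_groupMul_left B w (F := s.indicator 1) (measurable_one.indicator hs)]
  rfl

/-- A right translation applies `E` to `x`, whence a Jacobian; the group is unimodular only if the
trace of `B` vanishes. -/
theorem lintegral_groupMul_right (w : Pt m) {F : Pt m → ℝ≥0∞} (hF : Measurable F) :
    ∫⁻ z, F (groupMul B z w) = ENNReal.ofReal |(expE B w.2).det|⁻¹ * ∫⁻ z, F z := by
  have hm : Measurable fun z => F (groupMul B z w) :=
    hF.comp ((contDiff_groupMul B).continuous.comp (Continuous.prodMk_left w)).measurable
  rw [Measure.volume_eq_prod, lintegral_prod_symm' _ hm, lintegral_prod_symm' _ hF]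
  simp only [groupMul]
  have h1 : ∀ t : ℝ, ∫⁻ x, F (w.1 + (expE B w.2).mulVec x, t + w.2) =
      ENNReal.ofReal |(expE B w.2).det|⁻¹ * ∫⁻ x, F (x, t + w.2) := fun t =>
    lintegral_affine _ (det_expE_ne_zero B _) _ (F := fun x => F (x, t + w.2))
      (hF.comp measurable_prodMk_right)
  simp only [h1]
  rw [lintegral_const_mul' _ _ ENNReal.ofReal_ne_top,
    lintegral_add_right_eq_self (fun t => ∫⁻ x, F (x, t)) w.2]

/-- This is the change of variables for the columns of a left-invariant kernel; its Jacobian depends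
only on the time of the new variable. -/
theorem lintegral_groupInv_left (ζ : Pt m) {F : Pt m → ℝ≥0∞} (hF : Measurable F) :
    ∫⁻ z, F (groupMul B (groupInv B z) ζ) =
      ∫⁻ w : Pt m, ENNReal.ofReal |(expE B w.2).det|⁻¹ * F w := by
  have hd : Measurable fun w : Pt m => ENNReal.ofReal |(expE B w.2).det|⁻¹ := by
    have : Continuous fun τ => (expE B τ).det :=
      Continuous.matrix_det (continuous_pi fun i => continuous_pi fun j =>
        (contDiff_expE_entry B i j).continuous)
    exact (((this.measurable.comp measurable_snd).abs).inv).ennreal_ofReal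
  have hm : Measurable fun z => F (groupMul B (groupInv B z) ζ) :=
    hF.comp ((contDiff_groupMul B).continuous.comp
      ((contDiff_groupInv B).continuous.prodMk continuous_const)).measurable
  rw [Measure.volume_eq_prod, lintegral_prod_symm' _ hm,
    lintegral_prod_symm' (fun w : Pt m => ENNReal.ofReal |(expE B w.2).det|⁻¹ * F w) (hd.mul hF)]
  simp only [groupInv_groupMul_eq]
  have h1 : ∀ t : ℝ, ∫⁻ x, F (ζ.1 - (expE B (ζ.2 - t)).mulVec x, ζ.2 - t) =
      ∫⁻ x, ENNReal.ofReal |(expE B (ζ.2 - t)).det|⁻¹ * F (x, ζ.2 - t) := fun t => by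
    have hF' : Measurable fun x => F (x, ζ.2 - t) := hF.comp measurable_prodMk_right
    have h := lintegral_affine (expE B (ζ.2 - t)) (det_expE_ne_zero B _) (-ζ.1)
      (F := fun x => F (-x, ζ.2 - t)) (hF'.comp measurable_neg)
    rw [lintegral_neg_eq_self (fun x => F (x, ζ.2 - t))] at h
    rw [lintegral_const_mul' _ _ ENNReal.ofReal_ne_top, ← h]
    refine lintegral_congr fun x => ?_
    congr 2
    abel
  simp only [h1]
  exact lintegral_sub_left_eq_self
    (fun t => ∫⁻ x, ENNReal.ofReal |(expE B t).det|⁻¹ * F (x, t)) ζ.2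

/-- Jacobians are bounded by compactness for bounded times only; this is why the kernels below are
truncated at elapsed time `1`. -/
theorem exists_det_bound : ∃ D : ℝ, 0 < D ∧ ∀ τ : ℝ, |τ| ≤ 1 → |(expE B τ).det|⁻¹ ≤ D := by
  have hc : Continuous fun τ => |(expE B τ).det|⁻¹ := by
    have : Continuous fun τ => (expE B τ).det :=
      Continuous.matrix_det (continuous_pi fun i => continuous_pi fun j =>
        (contDiff_expE_entry B i j).continuous)
    exact this.abs.inv₀ fun τ => by simpa using det_expE_ne_zero B τ
  obtain ⟨D, hD⟩ := (isCompact_Icc (a := (-1 : ℝ)) (b := 1)).exists_bound_of_continuousOn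
    hc.continuousOn
  refine ⟨max D 1, by positivity, fun τ hτ => ?_⟩
  have := hD τ (abs_le.1 hτ)
  exact (le_abs_self _).trans (this.trans (le_max_left _ _))

/-! ### Left invariance of the vector fields -/

/-- The vector of coefficients of `Y` at `z`. -/
def yVec (z : Pt m) : Pt m := (B.transpose.mulVec z.1, -1)

theorem fieldY_eq (φ : Pt m → ℝ) (z : Pt m) : fieldY B φ z = fderiv ℝ φ z (yVec B z) := by
  have h1 : yVec B z = ∑ i, ∑ j, (B i j * z.1 i) • ((Pi.single j 1, 0) : Pt m) - (0, 1) := by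
    refine Prod.ext ?_ ?_
    · simp only [yVec, Prod.fst_sub, sub_zero, Prod.fst_sum, Prod.smul_fst]
      funext j
      simp [Finset.sum_apply, Pi.single_apply, Matrix.mulVec, dotProduct]
    · simp [yVec, Prod.snd_sum]
  rw [h1, map_sub]
  simp only [map_sum, map_smul, smul_eq_mul, fieldY]

/-- A left translation leaves the directions of `x` alone and corrects the time direction only.
Hence every `∂_{x_i}` is invariant, and the correction is exactly the change of the coefficient `Bᵀ
x` of `Y` under the translation. -/
theorem hasFDerivAt_groupMul_left (w ζ : Pt m) :
    HasFDerivAt (groupMul B w)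
      (ContinuousLinearMap.id ℝ (Pt m) - (ContinuousLinearMap.snd ℝ (Idx m → ℝ) ℝ).smulRight
        ((B.transpose.mulVec ((expE B ζ.2).mulVec w.1), 0) : Pt m)) ζ := by
  have h1 := (hasDerivAt_expE_mulVec B w.1 ζ.2).hasFDerivAt.comp ζ (hasFDerivAt_snd (𝕜 := ℝ)
    (E := Idx m → ℝ) (F := ℝ) (p := ζ))
  have h2 : HasFDerivAt (groupMul B w) _ ζ :=
    ((hasFDerivAt_fst (𝕜 := ℝ) (E := Idx m → ℝ) (F := ℝ) (p := ζ)).add h1).prodMk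
      ((hasFDerivAt_snd (𝕜 := ℝ) (E := Idx m → ℝ) (F := ℝ) (p := ζ)).const_add w.2)
  refine h2.congr_fderiv ?_
  refine ContinuousLinearMap.ext fun v => ?_
  refine Prod.ext ?_ ?_
  · simp [sub_eq_add_neg]
  · simp

theorem fderiv_comp_groupMul {φ : Pt m → ℝ} (hφ : Differentiable ℝ φ) (w ζ v : Pt m) :
    fderiv ℝ (fun z => φ (groupMul B w z)) ζ v =
      fderiv ℝ φ (groupMul B w ζ)
        (v - v.2 • ((B.transpose.mulVec ((expE B ζ.2).mulVec w.1), 0) : Pt m)) := by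
  have h := (hφ (groupMul B w ζ)).hasFDerivAt.comp ζ (hasFDerivAt_groupMul_left B w ζ)
  have h' : fderiv ℝ (fun z => φ (groupMul B w z)) ζ = _ := h.fderiv
  rw [h']
  simp

theorem gradD_comp_groupMul {φ : Pt m → ℝ} (hφ : Differentiable ℝ φ) (w ζ : Pt m) :
    gradD (fun z => φ (groupMul B w z)) ζ = gradD φ (groupMul B w ζ) := by
  unfold gradD
  congr 1
  funext i
  rw [fderiv_comp_groupMul B hφ]
  simp

theorem fieldY_comp_groupMul {φ : Pt m → ℝ} (hφ : Differentiable ℝ φ) (w ζ : Pt m) :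
    fieldY B (fun z => φ (groupMul B w z)) ζ = fieldY B φ (groupMul B w ζ) := by
  rw [fieldY_eq, fieldY_eq, fderiv_comp_groupMul B hφ]
  congr 1
  refine Prod.ext ?_ ?_
  · simp [yVec, groupMul, Matrix.mulVec_add]
  · simp [yVec]

end Group

/-! ### Balls -/

theorem continuous_normSum (r : ℝ) : Continuous fun z : Pt m => normSum z r := by
  unfold normSum
  fun_prop

/-- Monotonicity of `normSum` in the radius replaces the implicitly defined norm by an explicit
inequality, the only form in which balls are used. -/
theorem homNorm_le_iff {r : ℝ} (hr : 0 < r) (z : Pt m) : homNorm z ≤ r ↔ normSum z r ≤ 1 := by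
  by_cases hz : z = 0
  · subst hz
    simp [homNorm, normSum, hr.le]
  · rw [homNorm, dif_neg hz]
    obtain ⟨h1, h2⟩ := (existsUnique_normSum hz).choose_spec.1
    generalize (existsUnique_normSum hz).choose = s at h1 h2
    rw [← (normSum_strictAntiOn hz).le_iff_ge hr h1, h2]

theorem mem_ballMinus_iff {B : Matrix (Idx m) (Idx m) ℝ} {r : ℝ} (hr : 0 < r) {z₀ z : Pt m} :
    z ∈ ballMinus B r z₀ ↔ normSum (groupMul B (groupInv B z₀) z) r ≤ 1 ∧ z.2 < z₀.2 := by
  simp only [ballMinus, ballB, Set.mem_inter_iff, Set.mem_ofPred_eq, homNorm_le_iff hr]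

theorem measurableSet_ballMinus {B : Matrix (Idx m) (Idx m) ℝ} {r : ℝ} (hr : 0 < r) (z₀ : Pt m) :
    MeasurableSet (ballMinus B r z₀) := by
  have : ballMinus B r z₀ =
      {z | normSum (groupMul B (groupInv B z₀) z) r ≤ 1} ∩ {z | z.2 < z₀.2} := by
    ext z; exact mem_ballMinus_iff hr
  rw [this]
  refine MeasurableSet.inter (measurableSet_le ?_ measurable_const)
    (measurableSet_lt measurable_snd measurable_const)
  exact ((continuous_normSum r).comp (continuous_groupMul_left B _)).measurable

theorem abs_le_one_of_normSum_le {z : Pt m} {r : ℝ} (hr : 0 < r) (hr1 : r ≤ 1)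
    (h : normSum z r ≤ 1) : (∀ i, |z.1 i| ≤ 1) ∧ |z.2| ≤ 1 := by
  have hnn : ∀ i, 0 ≤ z.1 i ^ 2 / r ^ (2 * weight i) := fun i => by positivity
  have key : ∀ (a : ℝ) (n : ℕ), a ^ 2 / r ^ n ≤ 1 → |a| ≤ 1 := by
    intro a n han
    rw [div_le_one (by positivity)] at han
    have : a ^ 2 ≤ 1 := han.trans (pow_le_one₀ hr.le hr1)
    exact (sq_le_one_iff_abs_le_one a).1 this
  have ht : 0 ≤ z.2 ^ 2 / r ^ 4 := by positivity
  unfold normSum at h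
  refine ⟨fun i => key _ (2 * weight i) ?_, key _ 4 ?_⟩
  · have : z.1 i ^ 2 / r ^ (2 * weight i) ≤ ∑ i, z.1 i ^ 2 / r ^ (2 * weight i) :=
      Finset.single_le_sum (f := fun i => z.1 i ^ 2 / r ^ (2 * weight i))
        (fun i _ => hnn i) (Finset.mem_univ i)
    linarith
  · have := Finset.sum_nonneg (s := Finset.univ) fun i _ => hnn i
    linarith

/-- The open truncated ball. -/
def openBall (B : Matrix (Idx m) (Idx m) ℝ) (r : ℝ) (z₀ : Pt m) : Set (Pt m) :=
  {z | normSum (groupMul B (groupInv B z₀) z) r < 1 ∧ z.2 < z₀.2}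

theorem isOpen_openBall (B : Matrix (Idx m) (Idx m) ℝ) (r : ℝ) (z₀ : Pt m) :
    IsOpen (openBall B r z₀) :=
  (isOpen_lt ((continuous_normSum r).comp (continuous_groupMul_left B _)) continuous_const).inter
    (isOpen_lt continuous_snd continuous_const)

theorem openBall_subset {B : Matrix (Idx m) (Idx m) ℝ} {r : ℝ} (hr : 0 < r) (z₀ : Pt m) :
    openBall B r z₀ ⊆ ballMinus B r z₀ := fun _ hz => (mem_ballMinus_iff hr).2 ⟨hz.1.le, hz.2⟩

theorem isBounded_of_groupMul {B : Matrix (Idx m) (Idx m) ℝ} {S T : Set (Pt m)} (z₀ : Pt m)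
    (hT : Bornology.IsBounded T) (h : ∀ z ∈ S, groupMul B (groupInv B z₀) z ∈ T) :
    Bornology.IsBounded S := by
  refine ((hT.isCompact_closure).image (continuous_groupMul_left B z₀)).isBounded.subset ?_
  intro z hz
  exact ⟨_, subset_closure (h z hz), groupMul_groupInv_cancel B _ _⟩

theorem isBounded_normSum_le {r : ℝ} (hr : 0 < r) (hr1 : r ≤ 1) :
    Bornology.IsBounded {z : Pt m | normSum z r ≤ 1} := by
  refine (Metric.isBounded_closedBall (x := (0 : Pt m)) (r := 1)).subset fun z hz => ?_
  obtain ⟨h1, h2⟩ := abs_le_one_of_normSum_le hr hr1 hz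
  rw [mem_closedBall_zero_iff, Prod.norm_def, max_le_iff]
  exact ⟨(pi_norm_le_iff_of_nonneg zero_le_one).2 h1, h2⟩

theorem isBounded_ballMinus {B : Matrix (Idx m) (Idx m) ℝ} {r : ℝ} (hr : 0 < r) (hr1 : r ≤ 1)
    (z₀ : Pt m) : Bornology.IsBounded (ballMinus B r z₀) :=
  isBounded_of_groupMul z₀ (isBounded_normSum_le hr hr1) fun _ hz => ((mem_ballMinus_iff hr).1 hz).1

/-! ### The controllability Gramian of the principal part of the drift -/

section Gramian

variable (B : Matrix (Idx m) (Idx m) ℝ)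

/-- The number of the block of a coordinate. -/
def blk (i : Idx m) : ℕ := (i.1 : ℕ)

/-- The `i`-th coordinate of the block `0`. -/
def idx0 (a : Fin (m 0)) : Idx m := ⟨0, a⟩

/-- The principal part of the drift matrix. -/
def principal : Matrix (Idx m) (Idx m) ℝ :=
  Matrix.of fun i j => if blk j = blk i + 1 then B i j else 0

theorem principal_apply (i j : Idx m) :
    principal B i j = if blk j = blk i + 1 then B i j else 0 := rfl

theorem blk_idx0 (a : Fin (m 0)) : blk (idx0 (m := m) a) = 0 := rfl

theorem exists_idx0_of_blk {i : Idx m} (h : blk i = 0) : ∃ a, i = idx0 a := by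
  obtain ⟨k, a⟩ := i
  have hk : k = 0 := Fin.ext h
  subst hk
  exact ⟨a, rfl⟩

/-- The vectors `B_1 ⋯ B_k e_i`, for `i` in the block `k`. -/
def chain (i : Idx m) (a : Fin (m 0)) : ℝ := (principal B ^ blk i) (idx0 a) i

theorem chain_of_blk_eq_zero {i : Idx m} (h : blk i = 0) (a : Fin (m 0)) :
    chain B i a = if idx0 a = i then 1 else 0 := by
  simp [chain, h, Matrix.one_apply]

/-- The transposed principal part carries the chain vectors from one block to the next and nothing
into block `0`, because `P^(n+1) = P^n P`. -/
theorem sum_principal_chain (j : Idx m) (a : Fin (m 0)) :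
    ∑ i, principal B i j * chain B i a = if blk j = 0 then 0 else chain B j a := by
  split_ifs with h
  · refine Finset.sum_eq_zero fun i _ => ?_
    rw [principal_apply, if_neg (by omega), zero_mul]
  · obtain ⟨n, hn⟩ := Nat.exists_eq_succ_of_ne_zero h
    rw [chain, hn, Nat.succ_eq_add_one, pow_succ, Matrix.mul_apply]
    refine Finset.sum_congr rfl fun i _ => ?_
    by_cases hi : blk i = n
    · rw [chain, hi, mul_comm]
    · rw [principal_apply, if_neg (by omega), zero_mul, mul_zero]

/-- The Gramian. -/
def gram : Matrix (Idx m) (Idx m) ℝ := Matrix.of fun i j =>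
  (∑ a, chain B i a * chain B j a) /
    ((blk i).factorial * (blk j).factorial * ((blk i : ℝ) + blk j + 1))

theorem gram_symm (i j : Idx m) : gram B i j = gram B j i := by
  simp only [gram, Matrix.of_apply]
  congr 1
  · exact Finset.sum_congr rfl fun a _ => mul_comm _ _
  · ring

theorem sum_principal_gram (j l : Idx m) : ∑ i, principal B i j * gram B i l =
    if blk j = 0 then 0 else (∑ a, chain B j a * chain B l a) /
      ((blk j - 1).factorial * (blk l).factorial * ((blk j : ℝ) + blk l)) := by
  have h1 : ∀ i, principal B i j * gram B i l = ∑ a, (principal B i j * chain B i a) *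
      (chain B l a / ((blk j - 1).factorial * (blk l).factorial * ((blk j : ℝ) + blk l))) := by
    intro i
    by_cases h : blk j = blk i + 1
    · have e1 : blk j - 1 = blk i := by omega
      have e2 : (blk j : ℝ) + blk l = blk i + blk l + 1 := by rw [h]; push_cast; ring
      rw [e1, e2]
      simp only [gram, Matrix.of_apply, Finset.mul_sum, Finset.sum_div]
      refine Finset.sum_congr rfl fun a _ => ?_
      ring
    · simp [principal_apply, h]
  rw [Finset.sum_congr rfl fun i _ => h1 i, Finset.sum_comm]
  simp only [← Finset.sum_mul, sum_principal_chain]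
  split_ifs with h
  · simp
  · rw [Finset.sum_div]
    exact Finset.sum_congr rfl fun a _ => by ring

/-- Weighting the `(j, l)` entry by `s ^ (blk j + blk l + 1)` gives the Gramian `C(s)` on the time
interval `[0, s]`, which solves `C' = I₀ + Pᵀ C + C P` with `P` the principal part and `I₀` the
projection onto block `0`. The identity is this equation at `s = 1`. -/
theorem lyapunov (j l : Idx m) :
    ∑ i, principal B i j * gram B i l + ∑ i, principal B i l * gram B i j
      - ((blk j : ℝ) + blk l + 1) * gram B j l = -∑ a, if idx0 a = j ∧ idx0 a = l then 1 else 0 := by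
  have hc : ∑ a, chain B l a * chain B j a = ∑ a, chain B j a * chain B l a :=
    Finset.sum_congr rfl fun a _ => mul_comm _ _
  rw [sum_principal_gram, sum_principal_gram, hc]
  have h0 : ¬ (blk j = 0 ∧ blk l = 0) →
      ∑ a, (if idx0 a = j ∧ idx0 a = l then (1 : ℝ) else 0) = 0 := by
    intro h
    refine Finset.sum_eq_zero fun a _ => ?_
    rw [if_neg]
    rintro ⟨rfl, rfl⟩
    exact h ⟨rfl, rfl⟩
  have hfac : ∀ n : ℕ, n ≠ 0 → ((n.factorial : ℕ) : ℝ) = n * ((n - 1).factorial : ℕ) := by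
    intro n hn
    rw [← Nat.mul_factorial_pred hn]; push_cast; ring
  have hpos : ∀ n : ℕ, (0 : ℝ) < (n.factorial : ℕ) := fun n => by positivity
  -- In block `0` the factorial of the predecessor is a junk value, so these indices are treated
  -- apart.
  by_cases hj : blk j = 0 <;> by_cases hl : blk l = 0
  · simp only [hj, hl, if_true, gram, Matrix.of_apply, chain_of_blk_eq_zero B hj,
      chain_of_blk_eq_zero B hl]
    simp [eq_comm, ← ite_and, and_comm]
  · rw [h0 (by simp [hl]), if_pos hj, if_neg hl]
    simp only [gram, Matrix.of_apply, hj, hfac _ hl]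
    have : (blk l : ℝ) ≠ 0 := by exact_mod_cast hl
    have := (hpos (blk l - 1)).ne'
    field_simp
    simp
    field_simp
    ring
  · rw [h0 (by simp [hj]), if_neg hj, if_pos hl]
    simp only [gram, Matrix.of_apply, hl, hfac _ hj]
    have : (blk j : ℝ) ≠ 0 := by exact_mod_cast hj
    have := (hpos (blk j - 1)).ne'
    field_simp
    simp
    field_simp
    ring
  · rw [h0 (by simp [hj]), if_neg hj, if_neg hl]
    simp only [gram, Matrix.of_apply, hfac _ hj, hfac _ hl]
    have e1 : (blk j : ℝ) ≠ 0 := by exact_mod_cast hj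
    have e2 : (blk l : ℝ) ≠ 0 := by exact_mod_cast hl
    have e3 := (hpos (blk j - 1)).ne'
    have e4 := (hpos (blk l - 1)).ne'
    have e5 : (blk j : ℝ) + blk l ≠ 0 := by positivity
    have e6 : (blk l : ℝ) + blk j ≠ 0 := by positivity
    field_simp
    ring

variable {B}

/-- Each superdiagonal block has rank equal to its number of columns, so its columns are
independent. -/
theorem principal_injective (hB : DriftStructure B) {k : ℕ} {y : Idx m → ℝ}
    (hy : ∀ i, blk i ≠ k + 1 → y i = 0) (h : (principal B).mulVec y = 0) : y = 0 := by
  by_cases hk : k < d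
  swap
  · funext i
    exact hy i (by have := i.1.2; simp only [blk]; omega)
  set κ : Fin d := ⟨k, hk⟩ with hκ
  set A := B.submatrix (fun i : Fin (m κ.castSucc) => (⟨κ.castSucc, i⟩ : Idx m))
      (fun j : Fin (m κ.succ) => (⟨κ.succ, j⟩ : Idx m)) with hA
  have hinj : Function.Injective A.mulVec := by
    rw [Matrix.mulVec_injective_iff, linearIndependent_iff_card_eq_finrank_span]
    exact (Fintype.card_fin _).trans
      ((hB.rank_block κ).symm.trans (Matrix.rank_eq_finrank_span_cols _))
  have hz : (fun j : Fin (m κ.succ) => y ⟨κ.succ, j⟩) = 0 := by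
    refine hinj ?_
    rw [Matrix.mulVec_zero]
    funext i
    have hi := congrFun h ⟨κ.castSucc, i⟩
    simp only [Matrix.mulVec, dotProduct, Pi.zero_apply] at hi ⊢
    rw [← hi, ← Finset.univ_sigma_univ, Finset.sum_sigma, Finset.sum_eq_single κ.succ]
    · refine Finset.sum_congr rfl fun j _ => ?_
      rw [principal_apply, if_pos (by simp [blk])]
      rfl
    · intro l _ hl
      refine Finset.sum_eq_zero fun j _ => ?_
      rw [hy ⟨l, j⟩, mul_zero]
      intro hlk
      exact hl (Fin.ext (by simpa [blk, hκ] using hlk))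
    · simp
  funext i
  by_cases hi : blk i = k + 1
  · obtain ⟨l, j⟩ := i
    have hl : l = κ.succ := Fin.ext (by simpa [blk, hκ] using hi)
    subst hl
    exact congrFun hz j
  · exact hy i hi

/-- A product of injective blocks is injective: the `k`-th power of the principal part sends block
`k` faithfully into block `0`. This is the controllability condition. -/
theorem chain_injective (hB : DriftStructure B) (k : ℕ) : ∀ y : Idx m → ℝ,
    (∀ i, blk i ≠ k → y i = 0) → (∀ a, ((principal B ^ k).mulVec y) (idx0 a) = 0) → y = 0 := by
  induction k with
  | zero =>
    intro y hy h
    funext i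
    by_cases hi : blk i = 0
    · obtain ⟨a, rfl⟩ := exists_idx0_of_blk hi
      simpa using h a
    · exact hy i hi
  | succ k ih =>
    intro y hy h
    refine principal_injective hB hy (ih _ ?_ ?_)
    · intro i hi
      simp only [Matrix.mulVec, dotProduct]
      refine Finset.sum_eq_zero fun j _ => ?_
      by_cases hj : blk j = k + 1
      · rw [principal_apply, if_neg (by omega), zero_mul]
      · rw [hy j hj, mul_zero]
    · intro a
      rw [Matrix.mulVec_mulVec, ← pow_succ]
      exact h a

-- The quadratic form of the Gramian is `∑_a ∫₀¹ P_a(s)² ds` for polynomials `P_a` whose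
-- coefficients are the chain vectors contracted with `x`. If it vanishes, all coefficients vanish,
-- and controllability gives `x = 0` one block at a time.
open Polynomial in
theorem gram_quadratic_pos (hB : DriftStructure B) {x : Idx m → ℝ} (hx : x ≠ 0) :
    0 < ∑ i, ∑ j, x i * gram B i j * x j := by
  set P : Fin (m 0) → ℝ[X] := fun a => ∑ i, C (x i * chain B i a / (blk i).factorial) * X ^ blk i
    with hP
  have hsq : ∀ a, ∫ s in (0 : ℝ)..1, ((P a).eval s) ^ 2 = ∑ i, ∑ j,
      (x i * chain B i a / (blk i).factorial) * (x j * chain B j a / (blk j).factorial) /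
        ((blk i : ℝ) + blk j + 1) := by
    intro a
    have h1 : ∀ s : ℝ, ((P a).eval s) ^ 2 = ∑ i, ∑ j, (x i * chain B i a / (blk i).factorial) *
        (x j * chain B j a / (blk j).factorial) * s ^ (blk i + blk j) := by
      intro s
      simp only [hP, eval_finsetSum, eval_mul, eval_C, eval_pow, eval_X, sq, Finset.sum_mul_sum]
      refine Finset.sum_congr rfl fun i _ => Finset.sum_congr rfl fun j _ => ?_
      rw [pow_add]; ring
    simp only [h1]
    rw [intervalIntegral.integral_finsetSum]
    · refine Finset.sum_congr rfl fun i _ => ?_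
      rw [intervalIntegral.integral_finsetSum]
      · refine Finset.sum_congr rfl fun j _ => ?_
        rw [intervalIntegral.integral_const_mul, integral_pow]
        push_cast
        simp
        ring
      · intro j _
        exact Continuous.intervalIntegrable (by fun_prop) _ _
    · intro i _
      exact Continuous.intervalIntegrable (by fun_prop) _ _
  have hsum : ∑ i, ∑ j, x i * gram B i j * x j = ∑ a, ∫ s in (0 : ℝ)..1, ((P a).eval s) ^ 2 := by
    simp only [hsq]
    simp only [gram, Matrix.of_apply]
    rw [Finset.sum_comm (s := (Finset.univ : Finset (Fin (m 0))))]
    simp only [fun i : Idx m => Finset.sum_comm (s := (Finset.univ : Finset (Fin (m 0))))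
      (t := (Finset.univ : Finset (Idx m))) (f := fun a j =>
      (x i * chain B i a / (blk i).factorial) * (x j * chain B j a / (blk j).factorial) /
        ((blk i : ℝ) + blk j + 1))]
    refine Finset.sum_congr rfl fun i _ => Finset.sum_congr rfl fun j _ => ?_
    rw [Finset.sum_div, Finset.mul_sum, Finset.sum_mul]
    refine Finset.sum_congr rfl fun a _ => ?_
    field_simp
  have hnn : ∀ a, 0 ≤ ∫ s in (0 : ℝ)..1, ((P a).eval s) ^ 2 := fun a =>
    intervalIntegral.integral_nonneg zero_le_one fun s _ => sq_nonneg _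
  rw [hsum]
  refine lt_of_le_of_ne (Finset.sum_nonneg fun a _ => hnn a) fun h0 => hx ?_
  have hz : ∀ a, ∫ s in (0 : ℝ)..1, ((P a).eval s) ^ 2 = 0 := fun a =>
    (Finset.sum_eq_zero_iff_of_nonneg fun a _ => hnn a).1 h0.symm a (Finset.mem_univ a)
  have hPz : ∀ a, P a = 0 := by
    intro a
    have hcont : Continuous fun s : ℝ => ((P a).eval s) ^ 2 := by fun_prop
    refine Polynomial.eq_zero_of_infinite_isRoot _ (Set.Infinite.mono (s := Set.Ioo (0 : ℝ) 1) ?_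
      (Set.Ioo_infinite zero_lt_one))
    intro s hs
    by_contra hne
    have hpos : 0 < ((P a).eval s) ^ 2 := by
      have : (P a).eval s ≠ 0 := hne
      positivity
    have := intervalIntegral.integral_pos (a := 0) (b := 1) zero_lt_one hcont.continuousOn
      (fun x _ => sq_nonneg _) ⟨s, ⟨hs.1.le, hs.2.le⟩, hpos⟩
    exact this.ne' (hz a)
  funext i
  set k := blk i with hk
  have h1 := chain_injective hB k (fun j => if blk j = k then x j else 0)
    (fun j hj => if_neg hj) (fun a => by
      have h2 : (P a).coeff k = 0 := by rw [hPz a, coeff_zero]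
      simp only [hP, finsetSum_coeff, coeff_C_mul, coeff_X_pow] at h2
      simp only [Matrix.mulVec, dotProduct]
      have h3 : ∑ j, (principal B ^ k) (idx0 a) j * (if blk j = k then x j else 0) =
          (k.factorial : ℝ) * ∑ j, x j * chain B j a / (blk j).factorial *
            (if k = blk j then 1 else 0) := by
        rw [Finset.mul_sum]
        refine Finset.sum_congr rfl fun j _ => ?_
        by_cases hj : blk j = k
        · have : ((k.factorial : ℕ) : ℝ) ≠ 0 := by positivity
          simp only [hj, if_true, chain]
          field_simp
        · simp [hj, Ne.symm hj]
      rw [h3, h2, mul_zero])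
  simpa [hk] using congrFun h1 i

/-- The inverse Gramian. -/
theorem exists_lyapunov_form (hB : DriftStructure B) : ∃ S : Matrix (Idx m) (Idx m) ℝ,
    (∀ i j, S i j = S j i) ∧
    (∃ R : ℝ, 0 < R ∧ ∀ (y : Idx m → ℝ) i, y i ^ 2 ≤ R ^ 2 * ∑ j, y j * S.mulVec y j) ∧
    ∑ a, S (idx0 a) (idx0 a) = (homDim m : ℝ) ∧
    ∀ x : Idx m → ℝ, ∑ i, S.mulVec x i * (2 * ∑ l, principal B l i * x l - (2 * blk i + 1) * x i) =
      -∑ a, S.mulVec x (idx0 a) ^ 2 := by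
  have hsymm : (gram B).IsSymm := Matrix.ext fun i j => gram_symm B j i
  have hpos : (gram B).PosDef := by
    refine Matrix.PosDef.of_dotProduct_mulVec_pos ?_ fun x hx => ?_
    · rw [Matrix.IsHermitian, Matrix.conjTranspose_eq_transpose_of_trivial]; exact hsymm
    · have := gram_quadratic_pos hB hx
      simp only [dotProduct, Matrix.mulVec, Finset.mul_sum, Pi.star_apply, star_trivial]
      simpa only [mul_assoc] using this
  have hdet : IsUnit (gram B).det := hpos.det_pos.ne'.isUnit
  obtain ⟨S, hS⟩ : ∃ S, S = (gram B)⁻¹ := ⟨_, rfl⟩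
  have hCS : gram B * S = 1 := by rw [hS]; exact Matrix.mul_nonsing_inv _ hdet
  have hSC : S * gram B = 1 := by rw [hS]; exact Matrix.nonsing_inv_mul _ hdet
  have hSsymm : S.IsSymm := by
    rw [hS, Matrix.IsSymm, Matrix.transpose_nonsing_inv, hsymm]
  have hSij : ∀ i j, S i j = S j i := fun i j => hSsymm.apply j i
  have hSpos : S.PosDef := by rw [hS]; exact hpos.inv
  have hxz : ∀ x i, x i = ∑ j, gram B i j * S.mulVec x j := by
    intro x i
    have : (gram B).mulVec (S.mulVec x) = x := by
      rw [Matrix.mulVec_mulVec, hCS, Matrix.one_mulVec]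
    exact (congrFun this i).symm
  have hdiag : ∀ i, 0 < gram B i i := fun i => hpos.diag_pos
  refine ⟨S, hSij, ?_, ?_, ?_⟩
  -- Cauchy–Schwarz for the form `S` between `y` and the column `C e_i` of the Gramian: `⟨y, S C
  -- e_i⟩ = y_i` and `⟨C e_i, S C e_i⟩ = C_ii`. It is obtained from positivity at `y - t C e_i` with
  -- the minimising `t`.
  · have hcs : ∀ (y : Idx m → ℝ) i, y i ^ 2 ≤ gram B i i * ∑ j, y j * S.mulVec y j := by
      intro y i
      set t := y i / gram B i i with ht
      set e : Idx m → ℝ := (gram B).mulVec (Pi.single i 1) with he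
      have hSe : S.mulVec e = Pi.single i 1 := by
        rw [he, Matrix.mulVec_mulVec, hSC, Matrix.one_mulVec]
      have hei : e i = gram B i i := by simp [he]
      have h := hSpos.posSemidef.dotProduct_mulVec_nonneg (y - t • e)
      have hsw : e ⬝ᵥ S.mulVec y = y ⬝ᵥ S.mulVec e := by
        rw [Matrix.dotProduct_mulVec, ← Matrix.mulVec_transpose, hSsymm, dotProduct_comm]
      rw [star_trivial, Matrix.mulVec_sub, Matrix.mulVec_smul, sub_dotProduct, dotProduct_sub,
        dotProduct_sub, smul_dotProduct, smul_dotProduct, dotProduct_smul, dotProduct_smul, hsw,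
        hSe] at h
      simp only [dotProduct_single, hei, mul_one, smul_eq_mul] at h
      have hg := hdiag i
      have e1 : t * gram B i i = y i := by rw [ht]; field_simp
      have e2 : y ⬝ᵥ S.mulVec y = ∑ j, y j * S.mulVec y j := rfl
      rw [e2] at h
      rw [e1] at h
      have h3 : 0 ≤ (∑ j, y j * S.mulVec y j) - t * y i := by linarith
      have h4 : t * y i * gram B i i = y i ^ 2 := by
        calc t * y i * gram B i i = (t * gram B i i) * y i := by ring
          _ = _ := by rw [e1]; ring
      nlinarith
    refine ⟨1 + ∑ i, gram B i i, ?_, fun y i => (hcs y i).trans ?_⟩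
    · have : 0 ≤ ∑ i, gram B i i := Finset.sum_nonneg fun i _ => (hdiag i).le
      linarith
    · have h1 : gram B i i ≤ ∑ i, gram B i i :=
        Finset.single_le_sum (f := fun i => gram B i i) (fun i _ => (hdiag i).le)
          (Finset.mem_univ i)
      have h2 : 0 ≤ ∑ i, gram B i i := Finset.sum_nonneg fun i _ => (hdiag i).le
      have h3 : 0 ≤ ∑ j, y j * S.mulVec y j := by
        simpa [dotProduct] using hSpos.posSemidef.dotProduct_mulVec_nonneg y
      gcongr
      nlinarith
  -- The Lyapunov identity is paired with `S`. The two terms with the principal part become its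
  -- trace, zero because it lies strictly above the diagonal, and the weights add up to `∑ (2 blk j
  -- + 1) = Q`.
  · have h1 : ∑ j, ∑ l, S l j * (∑ i, principal B i j * gram B i l +
        ∑ i, principal B i l * gram B i j - ((blk j : ℝ) + blk l + 1) * gram B j l) =
        -∑ a, S (idx0 a) (idx0 a) := by
      simp only [lyapunov, ite_and]
      simp only [mul_neg, Finset.mul_sum, Finset.sum_neg_distrib]
      congr 1
      rw [Finset.sum_congr rfl fun j _ => Finset.sum_comm, Finset.sum_comm]
      refine Finset.sum_congr rfl fun a _ => ?_
      simp
    have hCSij : ∀ i j, ∑ l, gram B i l * S l j = if i = j then 1 else 0 := by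
      intro i j
      rw [← Matrix.mul_apply, hCS, Matrix.one_apply]
    have t1 : ∑ j, ∑ l, S l j * ∑ i, principal B i j * gram B i l = 0 := by
      refine Finset.sum_eq_zero fun j _ => ?_
      have : ∀ l, S l j * ∑ i, principal B i j * gram B i l =
          ∑ i, principal B i j * (gram B i l * S l j) := fun l => by
        rw [Finset.mul_sum]; exact Finset.sum_congr rfl fun i _ => by ring
      simp only [this]
      rw [Finset.sum_comm]
      simp only [← Finset.mul_sum, hCSij]
      simp [principal_apply]
    have t2 : ∑ j, ∑ l, S l j * ∑ i, principal B i l * gram B i j = 0 := by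
      rw [Finset.sum_comm]
      simpa only [hSij] using t1
    have hw : ∀ (f : Idx m → ℝ), ∑ j, ∑ l, S l j * (f j * gram B j l) = ∑ j, f j := by
      intro f
      refine Finset.sum_congr rfl fun j _ => ?_
      have : ∀ l, S l j * (f j * gram B j l) = f j * (gram B j l * S l j) := fun l => by ring
      simp only [this, ← Finset.mul_sum, hCSij]
      simp
    have t3 : ∑ j, ∑ l, S l j * (((blk j : ℝ) + blk l + 1) * gram B j l) = homDim m := by
      have e : ∀ j l, S l j * (((blk j : ℝ) + blk l + 1) * gram B j l) =
          S l j * (((blk j : ℝ) + 1) * gram B j l) + S j l * ((blk l : ℝ) * gram B l j) := by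
        intro j l
        rw [hSij j l, gram_symm B l j]; ring
      simp only [e, Finset.sum_add_distrib]
      rw [hw, Finset.sum_comm (f := fun j l => S j l * ((blk l : ℝ) * gram B l j)), hw]
      rw [← Finset.sum_add_distrib, homDim, ← Finset.univ_sigma_univ, Finset.sum_sigma]
      push_cast
      refine Finset.sum_congr rfl fun k _ => ?_
      simp [blk]
      ring
    simp only [mul_sub, mul_add, Finset.sum_sub_distrib, Finset.sum_add_distrib] at h1 t3
    rw [t1, t2, t3] at h1
    linarith
  -- The Lyapunov identity is now paired with `z ⊗ z` for `z = S x`, using `x = C z`.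
  · intro x
    set z := S.mulVec x with hz
    have hx : ∀ i, x i = ∑ j, gram B i j * z j := hxz x
    have h1 : ∑ j, ∑ l, z j * z l * (∑ i, principal B i j * gram B i l +
        ∑ i, principal B i l * gram B i j - ((blk j : ℝ) + blk l + 1) * gram B j l) =
        -∑ a, z (idx0 a) ^ 2 := by
      simp only [lyapunov, ite_and]
      simp only [mul_neg, Finset.mul_sum, Finset.sum_neg_distrib]
      congr 1
      rw [Finset.sum_congr rfl fun j _ => Finset.sum_comm, Finset.sum_comm]
      refine Finset.sum_congr rfl fun a _ => ?_
      simp [sq]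
    have t1 : ∑ j, ∑ l, z j * z l * ∑ i, principal B i j * gram B i l =
        ∑ j, z j * ∑ i, principal B i j * x i := by
      refine Finset.sum_congr rfl fun j _ => ?_
      have : ∀ l, z j * z l * ∑ i, principal B i j * gram B i l =
          z j * ∑ i, principal B i j * (gram B i l * z l) := fun l => by
        rw [mul_assoc, Finset.mul_sum]
        congr 1
        exact Finset.sum_congr rfl fun i _ => by ring
      simp only [this, ← Finset.mul_sum]
      rw [Finset.sum_comm]
      simp only [← Finset.mul_sum, ← hx]
    have t2 : ∑ j, ∑ l, z j * z l * ∑ i, principal B i l * gram B i j =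
        ∑ j, z j * ∑ i, principal B i j * x i := by
      rw [Finset.sum_comm, ← t1]
      exact Finset.sum_congr rfl fun j _ => Finset.sum_congr rfl fun l _ => by ring
    have hw : ∀ f : Idx m → ℝ, ∑ j, ∑ l, z j * z l * (f j * gram B j l) = ∑ j, f j * z j * x j := by
      intro f
      refine Finset.sum_congr rfl fun j _ => ?_
      rw [hx j, Finset.mul_sum]
      exact Finset.sum_congr rfl fun l _ => by ring
    have t3 : ∑ j, ∑ l, z j * z l * (((blk j : ℝ) + blk l + 1) * gram B j l) =
        ∑ j, (2 * blk j + 1) * z j * x j := by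
      have e : ∀ j l, z j * z l * (((blk j : ℝ) + blk l + 1) * gram B j l) =
          z j * z l * (((blk j : ℝ) + 1) * gram B j l) +
            z l * z j * ((blk l : ℝ) * gram B l j) := by
        intro j l
        rw [gram_symm B l j]; ring
      simp only [e, Finset.sum_add_distrib]
      rw [hw, Finset.sum_comm (f := fun j l => z l * z j * ((blk l : ℝ) * gram B l j)), hw]
      rw [← Finset.sum_add_distrib]
      exact Finset.sum_congr rfl fun j _ => by ring
    simp only [mul_sub, mul_add, Finset.sum_sub_distrib, Finset.sum_add_distrib] at h1 t3
    rw [t1, t2, t3] at h1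
    rw [← h1, ← Finset.sum_add_distrib, ← Finset.sum_sub_distrib]
    exact Finset.sum_congr rfl fun j _ => by ring

end Gramian

/-! ### The self-similar region and its kernels -/

/-- The points `w = (ξ, -s)`, `s > 0`, with `|ξ_i| ≤ R s ^ (α_i / 2)`. -/
def region (R : ℝ) : Set (Pt m) := {w | 0 < -w.2 ∧ ∀ i, |w.1 i| ≤ R * √(-w.2) ^ weight i}

theorem measurableSet_region (R : ℝ) : MeasurableSet (region (m := m) R) := by
  refine MeasurableSet.inter (measurableSet_lt measurable_const measurable_snd.neg) ?_
  have : {w : Pt m | ∀ i, |w.1 i| ≤ R * √(-w.2) ^ weight i} =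
      ⋂ i, {w : Pt m | |w.1 i| ≤ R * √(-w.2) ^ weight i} := by ext; simp
  change MeasurableSet {w : Pt m | ∀ i, |w.1 i| ≤ R * √(-w.2) ^ weight i}
  rw [this]
  exact MeasurableSet.iInter fun i => measurableSet_le (by fun_prop) (by fun_prop)

theorem sum_weight : ∑ i : Idx m, weight i = homDim m := by
  rw [homDim, ← Finset.univ_sigma_univ, Finset.sum_sigma]
  refine Finset.sum_congr rfl fun k _ => ?_
  simp [weight, mul_comm]

theorem volume_region_slice {R : ℝ} (hR : 0 < R) {s : ℝ} (hs : 0 < s) :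
    volume {ξ : Idx m → ℝ | ∀ i, |ξ i| ≤ R * √s ^ weight i} =
      ENNReal.ofReal ((2 * R) ^ Fintype.card (Idx m) * s ^ ((homDim m : ℝ) / 2)) := by
  have h1 : {ξ : Idx m → ℝ | ∀ i, |ξ i| ≤ R * √s ^ weight i} =
      Set.Icc (fun i => -(R * √s ^ weight i)) (fun i => R * √s ^ weight i) := by
    ext ξ
    simp only [Set.mem_ofPred_eq, abs_le, Set.mem_Icc, Pi.le_def, forall_and]
  have hq : 0 < √s := Real.sqrt_pos.2 hs
  rw [h1, Real.volume_Icc_pi, ← ENNReal.ofReal_prod_of_nonneg]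
  · congr 1
    have : ∀ i : Idx m, R * √s ^ weight i - -(R * √s ^ weight i) = 2 * R * √s ^ weight i :=
      fun i => by ring
    simp only [this, Finset.prod_mul_distrib, Finset.prod_const, Finset.prod_pow_eq_pow_sum,
      sum_weight]
    rw [Real.sqrt_eq_rpow, ← Real.rpow_mul_natCast hs.le, mul_pow]
    congr 2
    · ring_nf
  · intro i _
    have : 0 ≤ R * √s ^ weight i := by positivity
    linarith

/-- The slice at time `-s` is a box whose volume is proportional to `s` to half the sum of the
weights, that is `s^(Q/2)`. Integrals of functions of time over the region thereby become
one-dimensional. -/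
theorem lintegral_region {R : ℝ} (hR : 0 < R) {F : ℝ → ℝ≥0∞} (hF : Measurable F) :
    ∫⁻ w : Pt m, (region R).indicator (fun w => F (-w.2)) w =
      ∫⁻ s in Set.Ioi (0 : ℝ),
        ENNReal.ofReal ((2 * R) ^ Fintype.card (Idx m) * s ^ ((homDim m : ℝ) / 2)) * F s := by
  have hm : Measurable ((region R).indicator fun w : Pt m => F (-w.2)) :=
    (hF.comp measurable_snd.neg).indicator (measurableSet_region R)
  rw [Measure.volume_eq_prod, lintegral_prod_symm' _ hm, ← lintegral_neg_eq_self,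
    ← lintegral_indicator measurableSet_Ioi]
  refine lintegral_congr fun s => ?_
  by_cases hs : 0 < s
  · rw [Set.indicator_of_mem (Set.mem_Ioi.2 hs), ← volume_region_slice hR hs, mul_comm,
      ← setLIntegral_const, ← lintegral_indicator]
    · refine lintegral_congr fun ξ => ?_
      by_cases hξ : ∀ i, |ξ i| ≤ R * √s ^ weight i
      · rw [Set.indicator_of_mem (s := region R), Set.indicator_of_mem]
        · simp
        · exact hξ
        · exact ⟨by simpa using hs, by simpa using hξ⟩
      · rw [Set.indicator_of_notMem (s := region R), Set.indicator_of_notMem]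
        · exact hξ
        · rintro ⟨-, h⟩
          exact hξ (by simpa using h)
    · have : {ξ : Idx m → ℝ | ∀ i, |ξ i| ≤ R * √s ^ weight i} =
          ⋂ i, {ξ : Idx m → ℝ | |ξ i| ≤ R * √s ^ weight i} := by ext; simp
      exact this ▸ MeasurableSet.iInter fun i => measurableSet_le (by fun_prop) (by fun_prop)
  · rw [Set.indicator_of_notMem (by simpa using hs)]
    refine (lintegral_congr fun ξ => ?_).trans lintegral_zero
    rw [Set.indicator_of_notMem]
    rintro ⟨h, -⟩
    exact hs (by simpa using h)

/-- The kernel `s ^ (-e)` on the region. -/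
def regKer (R e : ℝ) (w : Pt m) : ℝ≥0∞ :=
  (region R).indicator (fun w => ENNReal.ofReal ((-w.2) ^ (-e))) w

theorem measurable_regKer (R e : ℝ) : Measurable (regKer (m := m) R e) := by
  refine Measurable.indicator ?_ (measurableSet_region R)
  exact ENNReal.measurable_ofReal.comp (by fun_prop)

/-! ### A smooth step -/

/-- The derivative of the smooth step. -/
def stepD (x : ℝ) : ℝ := deriv Real.smoothTransition x

theorem contDiff_step : ContDiff ℝ ∞ Real.smoothTransition := Real.smoothTransition.contDiff

theorem hasDerivAt_step (x : ℝ) : HasDerivAt Real.smoothTransition (stepD x) x :=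
  ((contDiff_step.differentiable (by simp)) x).hasDerivAt

theorem contDiff_stepD : ContDiff ℝ ∞ stepD :=
  (contDiff_infty_iff_deriv.1 contDiff_step).2

theorem stepD_nonneg (x : ℝ) : 0 ≤ stepD x := Real.smoothTransition.monotone.deriv_nonneg

theorem stepD_of_neg {x : ℝ} (h : x < 0) : stepD x = 0 := by
  have : Real.smoothTransition =ᶠ[nhds x] fun _ => 0 :=
    (gt_mem_nhds h).mono fun y hy => Real.smoothTransition.zero_of_nonpos (le_of_lt hy)
  rw [stepD, this.deriv_eq, deriv_const]

theorem stepD_of_one_lt {x : ℝ} (h : 1 < x) : stepD x = 0 := by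
  have : Real.smoothTransition =ᶠ[nhds x] fun _ => 1 :=
    (lt_mem_nhds h).mono fun y hy => Real.smoothTransition.one_of_one_le (le_of_lt hy)
  rw [stepD, this.deriv_eq, deriv_const]

theorem stepD_of_nonpos {x : ℝ} (h : x ≤ 0) : stepD x = 0 := by
  have h1 : IsClosed {y | stepD y = 0} := isClosed_eq contDiff_stepD.continuous continuous_const
  have h2 : Set.Iio (0 : ℝ) ⊆ {y | stepD y = 0} := fun y hy => stepD_of_neg hy
  have := h1.closure_subset_iff.2 h2
  rw [closure_Iio] at this
  exact this h

theorem exists_stepD_bound : ∃ M : ℝ, 0 < M ∧ ∀ x, |stepD x| ≤ M := by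
  obtain ⟨M, hM⟩ := (isCompact_Icc (a := (0 : ℝ)) (b := 1)).exists_bound_of_continuousOn
    contDiff_stepD.continuous.continuousOn
  refine ⟨max M 1, by positivity, fun x => ?_⟩
  by_cases h0 : x < 0
  · rw [stepD_of_neg h0, abs_zero]; positivity
  by_cases h1 : 1 < x
  · rw [stepD_of_one_lt h1, abs_zero]; positivity
  · exact (hM x ⟨not_lt.1 h0, not_lt.1 h1⟩).trans (le_max_left _ _)

/-! ### Smoothness in the past of the origin -/

/-- The explicit formulas are smooth only at negative times; vanishing up to age `δ` removes the
singularity at the pole. -/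
theorem contDiff_of_past {f : Pt m → ℝ} {δ : ℝ} (hδ : 0 < δ)
    (h1 : ∀ w : Pt m, 0 < -w.2 → ContDiffAt ℝ ∞ f w) (h2 : ∀ w : Pt m, -w.2 ≤ δ → f w = 0) :
    ContDiff ℝ ∞ f := by
  refine contDiff_iff_contDiffAt.2 fun w => ?_
  by_cases hw : 0 < -w.2
  · exact h1 w hw
  · have hw' : -w.2 < δ := by linarith
    have : f =ᶠ[nhds w] fun _ => 0 := by
      have hc : Continuous fun v : Pt m => -v.2 := by fun_prop
      exact (hc.continuousAt.eventually (gt_mem_nhds hw')).mono fun v hv => h2 v (le_of_lt hv)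
    exact contDiffAt_const.congr_of_eventuallyEq this

theorem fderiv_of_past {f : Pt m → ℝ} {δ : ℝ} (h2 : ∀ w : Pt m, -w.2 ≤ δ → f w = 0) {w : Pt m}
    (hw : -w.2 < δ) : fderiv ℝ f w = 0 := by
  have : f =ᶠ[nhds w] fun _ => 0 := by
    have hc : Continuous fun v : Pt m => -v.2 := by fun_prop
    exact (hc.continuousAt.eventually (gt_mem_nhds hw)).mono fun v hv => h2 v (le_of_lt hv)
  rw [this.fderiv_eq]
  simp

/-! ### The self-similar quadratic form -/

/-- Rescaled coordinates. -/
def scl (w : Pt m) (i : Idx m) : ℝ := w.1 i * ((-w.2) ^ (blk i + 1))⁻¹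

/-- The self-similar quadratic form. -/
def sqForm (S : Matrix (Idx m) (Idx m) ℝ) (w : Pt m) : ℝ :=
  (-w.2) * ∑ i, scl w i * S.mulVec (scl w) i

theorem hasFDerivAt_scl {w : Pt m} (hw : 0 < -w.2) (i : Idx m) :
    ∃ L : Pt m →L[ℝ] ℝ, HasFDerivAt (fun w => scl w i) L w ∧
      ∀ v, L v = v.1 i * ((-w.2) ^ (blk i + 1))⁻¹ + (blk i + 1) * scl w i * v.2 / (-w.2) := by
  have h1 : HasFDerivAt (fun w : Pt m => w.1 i)
      ((ContinuousLinearMap.proj (R := ℝ) i).comp (ContinuousLinearMap.fst ℝ _ _)) w :=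
    ((ContinuousLinearMap.proj (R := ℝ) (φ := fun _ : Idx m => ℝ) i).comp
      (ContinuousLinearMap.fst ℝ (Idx m → ℝ) ℝ)).hasFDerivAt
  have h2 := ((hasDerivAt_pow (blk i + 1) (-w.2)).inv (pow_ne_zero _ hw.ne')).comp_hasFDerivAt w
    (hasFDerivAt_snd (𝕜 := ℝ) (E := Idx m → ℝ) (F := ℝ) (p := w)).neg
  refine ⟨_, h1.mul h2, fun v => ?_⟩
  have hs : w.2 ≠ 0 := by intro h; rw [h] at hw; simp at hw
  simp [scl]
  field_simp
  ring

theorem hasFDerivAt_mulVec_scl (S : Matrix (Idx m) (Idx m) ℝ) {w : Pt m} (hw : 0 < -w.2)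
    (a : Fin (m 0)) :
    ∃ L : Pt m →L[ℝ] ℝ, HasFDerivAt (fun w => S.mulVec (scl w) (idx0 a)) L w ∧
      L (Pi.single (idx0 a) 1, 0) = S (idx0 a) (idx0 a) / (-w.2) := by
  choose L hL hLv using fun i => hasFDerivAt_scl hw i
  refine ⟨∑ j, S (idx0 a) j • L j, ?_, ?_⟩
  · simp only [Matrix.mulVec, dotProduct]
    exact HasFDerivAt.fun_sum fun j _ => (hL j).const_mul _
  · simp only [_root_.sum_apply, _root_.smul_apply, hLv, smul_eq_mul]
    rw [Finset.sum_eq_single (idx0 a)]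
    · simp [blk_idx0, div_eq_mul_inv]
    · intro j _ hj
      simp [hj]
    · simp

theorem hasFDerivAt_sqForm {S : Matrix (Idx m) (Idx m) ℝ} (hS : ∀ i j, S i j = S j i) {w : Pt m}
    (hw : 0 < -w.2) :
    ∃ L : Pt m →L[ℝ] ℝ, HasFDerivAt (sqForm S) L w ∧
      ∀ v, L v = -v.2 * ∑ i, scl w i * S.mulVec (scl w) i + 2 * ∑ i, S.mulVec (scl w) i *
        (v.1 i * (-w.2) * ((-w.2) ^ (blk i + 1))⁻¹ + (blk i + 1) * scl w i * v.2) := by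
  choose L hL hLv using fun i => hasFDerivAt_scl hw i
  have h1 : HasFDerivAt (fun w => ∑ i, scl w i * S.mulVec (scl w) i)
      (∑ i, (scl w i • (∑ j, S i j • L j) + S.mulVec (scl w) i • L i)) w := by
    refine HasFDerivAt.fun_sum fun i _ => (hL i).mul ?_
    simp only [Matrix.mulVec, dotProduct]
    exact HasFDerivAt.fun_sum fun j _ => (hL j).const_mul _
  have h2 := (hasFDerivAt_snd (𝕜 := ℝ) (E := Idx m → ℝ) (F := ℝ) (p := w)).neg.mul h1
  refine ⟨_, h2, fun v => ?_⟩
  have h3 : ∑ i, scl w i * ∑ j, S i j * L j v = ∑ i, S.mulVec (scl w) i * L i v := by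
    simp only [Finset.mul_sum, Matrix.mulVec, dotProduct, Finset.sum_mul]
    rw [Finset.sum_comm]
    refine Finset.sum_congr rfl fun i _ => Finset.sum_congr rfl fun j _ => ?_
    rw [hS j i]; ring
  have h4 : (-w.2) * ∑ i, S.mulVec (scl w) i * L i v = ∑ i, S.mulVec (scl w) i *
        (v.1 i * (-w.2) * ((-w.2) ^ (blk i + 1))⁻¹ + (blk i + 1) * scl w i * v.2) := by
    rw [Finset.mul_sum]
    refine Finset.sum_congr rfl fun i _ => ?_
    rw [hLv]
    have hs : w.2 ≠ 0 := by intro h; rw [h] at hw; simp at hw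
    field_simp
    ring
  simp only [_root_.add_apply, _root_.smul_apply,
    _root_.sum_apply, smul_eq_mul, _root_.neg_apply,
    ContinuousLinearMap.coe_snd', Finset.sum_add_distrib, h3]
  rw [← h4, Pi.neg_apply]
  ring

theorem contDiffAt_scl {w : Pt m} (hw : 0 < -w.2) (i : Idx m) :
    ContDiffAt ℝ ∞ (fun w => scl w i) w := by
  unfold scl
  refine ContDiffAt.mul ?_ (ContDiffAt.inv ?_ (pow_ne_zero _ hw.ne'))
  · exact ((contDiff_apply ℝ ℝ i).comp contDiff_fst).contDiffAt
  · exact (contDiff_snd.neg.pow _).contDiffAt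

theorem contDiffAt_mulVec_scl (S : Matrix (Idx m) (Idx m) ℝ) {w : Pt m} (hw : 0 < -w.2)
    (i : Idx m) : ContDiffAt ℝ ∞ (fun w => S.mulVec (scl w) i) w := by
  simp only [Matrix.mulVec, dotProduct]
  exact ContDiffAt.sum fun j _ => contDiffAt_const.mul (contDiffAt_scl hw j)

theorem contDiffAt_sqForm (S : Matrix (Idx m) (Idx m) ℝ) {w : Pt m} (hw : 0 < -w.2) :
    ContDiffAt ℝ ∞ (sqForm S) w := by
  unfold sqForm
  exact contDiff_snd.neg.contDiffAt.mul
    (ContDiffAt.sum fun i _ => (contDiffAt_scl hw i).mul (contDiffAt_mulVec_scl S hw i))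

section Bounds

variable {S : Matrix (Idx m) (Idx m) ℝ} {R : ℝ}

/-- `√s` times the rescaled coordinate is `w_i s^(-α_i/2)`, the dilation-invariant coordinate, in
which the form is the fixed form of `S`. -/
theorem sqrt_mul_abs_scl_le (hR0 : 0 < R)
    (hR : ∀ (y : Idx m → ℝ) i, y i ^ 2 ≤ R ^ 2 * ∑ j, y j * S.mulVec y j)
    {w : Pt m} (hw : 0 < -w.2) (hq : sqForm S w ≤ 1) (i : Idx m) : √(-w.2) * |scl w i| ≤ R := by
  have h := hR (fun j => √(-w.2) * scl w j) i
  have e : ∑ j, (√(-w.2) * scl w j) * S.mulVec (fun j => √(-w.2) * scl w j) j = sqForm S w := by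
    have e1 : (fun j => √(-w.2) * scl w j) = √(-w.2) • scl w := rfl
    rw [e1, Matrix.mulVec_smul, sqForm, Finset.mul_sum]
    refine Finset.sum_congr rfl fun j _ => ?_
    simp only [Pi.smul_apply, smul_eq_mul]
    calc √(-w.2) * scl w j * (√(-w.2) * S.mulVec (scl w) j)
        = (√(-w.2) * √(-w.2)) * (scl w j * S.mulVec (scl w) j) := by ring
      _ = _ := by rw [Real.mul_self_sqrt hw.le]
  rw [e] at h
  rw [← abs_of_nonneg (Real.sqrt_nonneg (-w.2)), ← abs_mul]
  refine abs_le_of_sq_le_sq (h.trans ?_) hR0.le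
  nlinarith

theorem sqrt_mul_abs_mulVec_scl_le (hR0 : 0 < R)
    (hR : ∀ (y : Idx m → ℝ) i, y i ^ 2 ≤ R ^ 2 * ∑ j, y j * S.mulVec y j)
    {w : Pt m} (hw : 0 < -w.2) (hq : sqForm S w ≤ 1) (i : Idx m) :
    √(-w.2) * |S.mulVec (scl w) i| ≤ R * ∑ k, ∑ l, |S k l| := by
  have h1 : |S.mulVec (scl w) i| ≤ ∑ l, |S i l| * |scl w l| := by
    simp only [Matrix.mulVec, dotProduct, ← abs_mul]
    exact Finset.abs_sum_le_sum_abs _ _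
  calc √(-w.2) * |S.mulVec (scl w) i| ≤ √(-w.2) * ∑ l, |S i l| * |scl w l| := by gcongr
    _ = ∑ l, |S i l| * (√(-w.2) * |scl w l|) := by
        rw [Finset.mul_sum]; exact Finset.sum_congr rfl fun l _ => by ring
    _ ≤ ∑ l, |S i l| * R := by
        gcongr with l; exact sqrt_mul_abs_scl_le hR0 hR hw hq l
    _ = R * ∑ l, |S i l| := by rw [← Finset.sum_mul, mul_comm]
    _ ≤ R * ∑ k, ∑ l, |S k l| := by
        refine mul_le_mul_of_nonneg_left ?_ hR0.le
        exact Finset.single_le_sum (f := fun k => ∑ l, |S k l|)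
          (fun k _ => Finset.sum_nonneg fun l _ => abs_nonneg _) (Finset.mem_univ i)

theorem mem_region_of_sqForm_le (hR0 : 0 < R)
    (hR : ∀ (y : Idx m → ℝ) i, y i ^ 2 ≤ R ^ 2 * ∑ j, y j * S.mulVec y j)
    {w : Pt m} (hw : 0 < -w.2) (hq : sqForm S w ≤ 1) : w ∈ region R := by
  refine ⟨hw, fun i => ?_⟩
  have h := sqrt_mul_abs_scl_le hR0 hR hw hq i
  have hr : 0 < √(-w.2) := Real.sqrt_pos.2 hw
  have hs : √(-w.2) ^ 2 = -w.2 := Real.sq_sqrt hw.le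
  have e : |w.1 i| = (√(-w.2) * |scl w i|) * √(-w.2) ^ weight i := by
    have e1 : |w.1 i| = |scl w i| * (-w.2) ^ (blk i + 1) := by
      rw [scl, abs_mul, abs_of_pos (a := ((-w.2) ^ (blk i + 1))⁻¹) (by positivity)]
      have : (-w.2) ^ (blk i + 1) ≠ 0 := pow_ne_zero _ hw.ne'
      field_simp
    have e2 : √(-w.2) * √(-w.2) ^ weight i = (-w.2) ^ (blk i + 1) := by
      rw [← pow_succ', ← hs, ← pow_mul]
      simp only [weight, blk, Real.sqrt_sq hr.le]
      congr 1
    rw [e1, ← e2]; ring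
  rw [e]
  gcongr

/-- This converse inclusion serves only to bound the mass of the approximate identity from below. -/
theorem sqForm_le_of_mem_region {r : ℝ} (hr0 : 0 < r) {w : Pt m} (hw : w ∈ region r) :
    sqForm S w ≤ r ^ 2 * ∑ k, ∑ l, |S k l| := by
  obtain ⟨hw, h⟩ := hw
  have hr : 0 < √(-w.2) := Real.sqrt_pos.2 hw
  have hs : √(-w.2) ^ 2 = -w.2 := Real.sq_sqrt hw.le
  have h1 : ∀ i, √(-w.2) * |scl w i| ≤ r := by
    intro i
    have e2 : √(-w.2) * √(-w.2) ^ weight i = (-w.2) ^ (blk i + 1) := by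
      rw [← pow_succ', ← hs, ← pow_mul]
      simp only [weight, blk, Real.sqrt_sq hr.le]
      congr 1
    rw [scl, abs_mul, abs_of_pos (a := ((-w.2) ^ (blk i + 1))⁻¹) (by positivity), ← e2]
    calc √(-w.2) * (|w.1 i| * (√(-w.2) * √(-w.2) ^ weight i)⁻¹)
        = |w.1 i| / √(-w.2) ^ weight i := by field_simp
      _ ≤ r := by rw [div_le_iff₀ (by positivity)]; exact h i
  calc sqForm S w = ∑ k, ∑ l, S k l * ((√(-w.2) * scl w k) * (√(-w.2) * scl w l)) := by
        rw [sqForm, Finset.mul_sum]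
        refine Finset.sum_congr rfl fun k _ => ?_
        simp only [Matrix.mulVec, dotProduct, Finset.mul_sum]
        refine Finset.sum_congr rfl fun l _ => ?_
        calc -w.2 * (scl w k * (S k l * scl w l))
            = √(-w.2) ^ 2 * (scl w k * (S k l * scl w l)) := by rw [hs]
          _ = _ := by ring
    _ ≤ ∑ k, ∑ l, |S k l| * (r * r) := by
        refine Finset.sum_le_sum fun k _ => Finset.sum_le_sum fun l _ => ?_
        refine (le_abs_self _).trans ?_
        rw [abs_mul, abs_mul, abs_mul, abs_mul, abs_of_pos hr]
        gcongr
        · exact h1 k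
        · exact h1 l
    _ = _ := by
        simp only [← Finset.sum_mul]; ring

end Bounds

/-! ### The parametrix -/

section Parametrix

/-- The profile in the quadratic form: it is `1` on `[0, 1/2]` and `0` on `[1, ∞)`. -/
def profile (x : ℝ) : ℝ := Real.smoothTransition (2 - 2 * x)

theorem contDiff_profile : ContDiff ℝ ∞ profile := contDiff_step.comp (by fun_prop)

theorem hasDerivAt_profile (x : ℝ) : HasDerivAt profile (-2 * stepD (2 - 2 * x)) x := by
  have h := (hasDerivAt_step (2 - 2 * x)).comp x (((hasDerivAt_id x).const_mul 2).const_sub 2)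
  exact h.congr_deriv (by ring)

variable (m) in
/-- The time factor `η (s / ε) s ^ (-Q / 2)`. -/
def timeFac (ε s : ℝ) : ℝ :=
  Real.smoothTransition (2 / ε * s - 1) * s ^ (-((homDim m : ℝ) / 2))

variable (m) in
/-- The factor `(η (s / ε))' s ^ (-Q / 2)`. -/
def timeFacD (ε s : ℝ) : ℝ :=
  2 / ε * stepD (2 / ε * s - 1) * s ^ (-((homDim m : ℝ) / 2))

theorem timeFac_nonneg (ε : ℝ) {s : ℝ} (hs : 0 ≤ s) : 0 ≤ timeFac m ε s :=
  mul_nonneg (Real.smoothTransition.nonneg _) (Real.rpow_nonneg hs _)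

theorem timeFac_le (ε : ℝ) {s : ℝ} (hs : 0 ≤ s) :
    timeFac m ε s ≤ s ^ (-((homDim m : ℝ) / 2)) :=
  mul_le_of_le_one_left (Real.rpow_nonneg hs _) (Real.smoothTransition.le_one _)

theorem timeFac_eq_zero {ε s : ℝ} (hε : 0 < ε) (hs : s ≤ ε / 2) : timeFac m ε s = 0 := by
  have h : 2 / ε * s ≤ 1 := by
    calc 2 / ε * s ≤ 2 / ε * (ε / 2) := by gcongr
      _ = 1 := by field_simp
  rw [timeFac, Real.smoothTransition.zero_of_nonpos (by linarith), zero_mul]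

theorem timeFacD_eq_zero {ε s : ℝ} (hε : 0 < ε) (hs : s ≤ ε / 2) : timeFacD m ε s = 0 := by
  have h : 2 / ε * s ≤ 1 := by
    calc 2 / ε * s ≤ 2 / ε * (ε / 2) := by gcongr
      _ = 1 := by field_simp
  rw [timeFacD, stepD_of_nonpos (by linarith), mul_zero, zero_mul]

theorem timeFacD_eq_zero_of_lt {ε s : ℝ} (hε : 0 < ε) (hs : ε < s) : timeFacD m ε s = 0 := by
  have h : 2 < 2 / ε * s := by
    calc 2 = 2 / ε * ε := by field_simp
      _ < 2 / ε * s := by gcongr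
  rw [timeFacD, stepD_of_one_lt (by linarith), mul_zero, zero_mul]

theorem timeFacD_nonneg {ε : ℝ} (hε : 0 < ε) {s : ℝ} (hs : 0 ≤ s) : 0 ≤ timeFacD m ε s :=
  mul_nonneg (mul_nonneg (by positivity) (stepD_nonneg _)) (Real.rpow_nonneg hs _)

theorem hasDerivAt_timeFac (ε : ℝ) {s : ℝ} (hs : 0 < s) :
    HasDerivAt (timeFac m ε) (timeFacD m ε s - (homDim m : ℝ) / 2 / s * timeFac m ε s) s := by
  have h1 := (hasDerivAt_step (2 / ε * s - 1)).comp s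
    (((hasDerivAt_id s).const_mul (2 / ε)).sub_const 1)
  have h2 := Real.hasDerivAt_rpow_const (x := s) (p := -((homDim m : ℝ) / 2)) (Or.inl hs.ne')
  refine (h1.mul h2).congr_deriv ?_
  rw [Real.rpow_sub_one hs.ne']
  simp only [timeFac, timeFacD, Function.comp_apply, id_eq]
  ring

theorem contDiffAt_timeFac (ε : ℝ) {s : ℝ} (hs : 0 < s) : ContDiffAt ℝ ∞ (timeFac m ε) s := by
  unfold timeFac
  exact (contDiff_step.comp (by fun_prop)).contDiffAt.mul
    (Real.contDiffAt_rpow_const_of_ne hs.ne')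

theorem contDiffAt_timeFacD (ε : ℝ) {s : ℝ} (hs : 0 < s) : ContDiffAt ℝ ∞ (timeFacD m ε) s := by
  unfold timeFacD
  exact (contDiff_const.mul (contDiff_stepD.comp (by fun_prop))).contDiffAt.mul
    (Real.contDiffAt_rpow_const_of_ne hs.ne')

/-- The weight `s^(Q/2)` cancels the factor `s^(-Q/2)`, and what is left is the total increase of
the step between ages `ε / 2` and `ε`, which is `1` for every `ε`. -/
theorem lintegral_timeFacD {ε : ℝ} (hε : 0 < ε) :
    1 ≤ ∫⁻ s in Set.Ioi (0 : ℝ), ENNReal.ofReal (s ^ ((homDim m : ℝ) / 2)) *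
      ENNReal.ofReal (timeFacD m ε s) := by
  have hd : ∀ s ∈ Set.uIcc 0 ε, HasDerivAt (fun s => Real.smoothTransition (2 / ε * s - 1))
      (2 / ε * stepD (2 / ε * s - 1)) s := by
    intro s _
    have h1 := (hasDerivAt_step (2 / ε * s - 1)).comp s
      (((hasDerivAt_id s).const_mul (2 / ε)).sub_const 1)
    exact h1.congr_deriv (by ring)
  have hcont : Continuous fun s => 2 / ε * stepD (2 / ε * s - 1) :=
    continuous_const.mul (contDiff_stepD.continuous.comp (by fun_prop))
  have h2 := intervalIntegral.integral_eq_sub_of_hasDerivAt hd (hcont.intervalIntegrable _ _)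
  have e1 : 2 / ε * ε - 1 = 1 := by field_simp; norm_num
  rw [e1, mul_zero, Real.smoothTransition.one,
    Real.smoothTransition.zero_of_nonpos (by norm_num), sub_zero,
    intervalIntegral.integral_of_le hε.le] at h2
  have h3 := ofReal_integral_eq_lintegral_ofReal (μ := volume.restrict (Set.Ioc 0 ε))
    (hcont.integrableOn_Ioc (μ := volume))
    (Filter.Eventually.of_forall fun s => mul_nonneg (by positivity) (stepD_nonneg _))
  rw [h2, ENNReal.ofReal_one] at h3
  rw [h3]
  calc ∫⁻ s in Set.Ioc 0 ε, ENNReal.ofReal (2 / ε * stepD (2 / ε * s - 1))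
      = ∫⁻ s in Set.Ioc 0 ε, ENNReal.ofReal (s ^ ((homDim m : ℝ) / 2)) *
        ENNReal.ofReal (timeFacD m ε s) := by
        refine setLIntegral_congr_fun measurableSet_Ioc fun s hs => ?_
        have hs0 : (0 : ℝ) < s := hs.1
        rw [← ENNReal.ofReal_mul (by positivity)]
        congr 1
        rw [timeFacD, Real.rpow_neg hs0.le]
        have : s ^ ((homDim m : ℝ) / 2) ≠ 0 := (Real.rpow_pos_of_pos hs0 _).ne'
        field_simp
    _ ≤ _ := lintegral_mono_set Set.Ioc_subset_Ioi_self

variable {B S : Matrix (Idx m) (Idx m) ℝ}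

theorem hasFDerivAt_timeFac_mul_profile (hS : ∀ i j, S i j = S j i) (ε : ℝ) {w : Pt m}
    (hw : 0 < -w.2) (v : Pt m) :
    fderiv ℝ (fun w => timeFac m ε (-w.2) * profile (sqForm S w)) w v =
      -(timeFacD m ε (-w.2) - (homDim m : ℝ) / 2 / (-w.2) * timeFac m ε (-w.2)) * v.2 *
        profile (sqForm S w) +
      timeFac m ε (-w.2) * (-2 * stepD (2 - 2 * sqForm S w)) * fderiv ℝ (sqForm S) w v := by
  obtain ⟨L, hL, -⟩ := hasFDerivAt_sqForm hS hw
  have h1 := (hasDerivAt_timeFac (m := m) ε hw).comp_hasFDerivAt w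
    (hasFDerivAt_snd (𝕜 := ℝ) (E := Idx m → ℝ) (F := ℝ) (p := w)).neg
  have h2 := (hasDerivAt_profile (sqForm S w)).comp_hasFDerivAt w hL
  have h3 : fderiv ℝ (fun w => timeFac m ε (-w.2) * profile (sqForm S w)) w = _ :=
    (h1.mul h2).fderiv
  rw [h3, hL.fderiv]
  simp only [_root_.add_apply, _root_.smul_apply, smul_eq_mul, _root_.neg_apply,
    ContinuousLinearMap.coe_snd', Function.comp_apply, Pi.neg_apply]
  ring

theorem fderiv_sqForm_idx0 (hS : ∀ i j, S i j = S j i) {w : Pt m} (hw : 0 < -w.2)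
    (a : Fin (m 0)) :
    fderiv ℝ (sqForm S) w (Pi.single (idx0 a) 1, 0) = 2 * S.mulVec (scl w) (idx0 a) := by
  obtain ⟨L, hL, hLv⟩ := hasFDerivAt_sqForm hS hw
  rw [hL.fderiv, hLv]
  simp only [neg_zero, zero_mul, mul_zero, add_zero, zero_add]
  rw [Finset.sum_eq_single (idx0 a)]
  · rw [Pi.single_eq_same, blk_idx0, zero_add, pow_one, one_mul, mul_inv_cancel₀ hw.ne', mul_one]
  · intro j _ hj
    rw [Pi.single_eq_of_ne hj, zero_mul, zero_mul, mul_zero]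
  · simp

variable (B) in
/-- The part of the drift matrix below the principal part. -/
def lowerPart : Matrix (Idx m) (Idx m) ℝ := B - principal B

theorem lowerPart_eq_zero (hB : DriftStructure B) {l i : Idx m} (h : blk l < blk i) :
    lowerPart B l i = 0 := by
  rw [lowerPart, Matrix.sub_apply, principal_apply]
  split_ifs with h1
  · simp
  · rw [hB.eq_zero l i (by simp only [blk] at h h1; omega), sub_zero]

/-- Up to a constant factor the form is the exponent of the Gaussian kernel of the principal part,
and the Lyapunov identity says that it solves the corresponding Hamilton–Jacobi equation. The
remainder collects the blocks of `B` on and below the diagonal, which are of lower order for the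
dilations. -/
theorem fderiv_sqForm_yVec (hS : ∀ i j, S i j = S j i)
    (hL : ∀ x : Idx m → ℝ, ∑ i, S.mulVec x i *
      (2 * ∑ l, principal B l i * x l - (2 * blk i + 1) * x i) =
      -∑ a, S.mulVec x (idx0 a) ^ 2) {w : Pt m} (hw : 0 < -w.2) :
    fderiv ℝ (sqForm S) w (yVec B w) + ∑ a, S.mulVec (scl w) (idx0 a) ^ 2 =
      2 * ∑ i, S.mulVec (scl w) i *
        ∑ l, lowerPart B l i * scl w l * ((-w.2) ^ (blk l + 1) * ((-w.2) ^ blk i)⁻¹) := by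
  obtain ⟨L, hL', hLv⟩ := hasFDerivAt_sqForm hS hw
  have hs : -w.2 ≠ 0 := hw.ne'
  have e1 : ∀ i, B.transpose.mulVec w.1 i * (-w.2) * ((-w.2) ^ (blk i + 1))⁻¹ =
      ∑ l, principal B l i * scl w l +
      ∑ l, lowerPart B l i * scl w l * ((-w.2) ^ (blk l + 1) * ((-w.2) ^ blk i)⁻¹) := by
    intro i
    simp only [Matrix.mulVec, dotProduct, Matrix.transpose_apply, Finset.sum_mul]
    rw [← Finset.sum_add_distrib]
    refine Finset.sum_congr rfl fun l _ => ?_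
    have hB : B l i = principal B l i + lowerPart B l i := by simp [lowerPart]
    have hl : w.1 l = scl w l * (-w.2) ^ (blk l + 1) := by
      rw [scl, mul_assoc, inv_mul_cancel₀ (pow_ne_zero _ hs), mul_one]
    rw [hl, hB]
    by_cases h : blk i = blk l + 1
    · rw [← h]
      have : (-w.2) ^ blk i ≠ 0 := pow_ne_zero _ hs
      field_simp
      ring
    · rw [principal_apply, if_neg h]
      field_simp
      ring
  rw [hL'.fderiv, hLv, ← neg_eq_iff_eq_neg.2 (hL (scl w))]
  simp only [yVec, e1, mul_sub, mul_add, Finset.sum_sub_distrib, Finset.sum_add_distrib]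
  have e2 : ∑ i, scl w i * S.mulVec (scl w) i = ∑ i, S.mulVec (scl w) i * scl w i :=
    Finset.sum_congr rfl fun i _ => mul_comm _ _
  have e3 : ∑ i, S.mulVec (scl w) i * ((blk i + 1) * scl w i * -1) =
      -∑ i, S.mulVec (scl w) i * ((2 * blk i + 1) * scl w i) / 2
      - ∑ i, S.mulVec (scl w) i * scl w i / 2 := by
    rw [← Finset.sum_neg_distrib, ← Finset.sum_sub_distrib]
    exact Finset.sum_congr rfl fun i _ => by ring
  have e4 : ∑ i, S.mulVec (scl w) i * (2 * ∑ l, principal B l i * scl w l) =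
      2 * ∑ i, S.mulVec (scl w) i * ∑ l, principal B l i * scl w l := by
    rw [Finset.mul_sum]
    exact Finset.sum_congr rfl fun i _ => by ring
  rw [e2, e3, e4, ← Finset.sum_div, ← Finset.sum_div]
  ring

theorem rpow_mul_inv_sqrt {s : ℝ} (hs : 0 < s) (Q : ℝ) :
    s ^ (-(Q / 2)) * (√s)⁻¹ = s ^ (-((Q + 1) / 2)) := by
  rw [Real.sqrt_eq_rpow, ← Real.rpow_neg hs.le, ← Real.rpow_add hs]
  congr 1
  ring

theorem ofReal_le_regKer {R e C x : ℝ} (hC : 0 ≤ C) {w : Pt m}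
    (h1 : w ∈ region R → x ≤ C * (-w.2) ^ (-e)) (h2 : w ∉ region R → x ≤ 0) :
    ENNReal.ofReal x ≤ ENNReal.ofReal C * regKer R e w := by
  by_cases hw : w ∈ region R
  · rw [regKer, Set.indicator_of_mem hw, ← ENNReal.ofReal_mul hC]
    exact ENNReal.ofReal_le_ofReal (h1 hw)
  · rw [ENNReal.ofReal_of_nonpos (h2 hw)]
    exact bot_le

/-- A parametrix with pole at the origin, truncated at the time scale `ε`. -/
theorem exists_parametrix (hB : DriftStructure B) : ∃ R c C : ℝ, 0 < R ∧ 0 < c ∧ 0 < C ∧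
    ∀ ε : ℝ, 0 < ε → ∃ (Ψ : Pt m → ℝ) (J : Fin (m 0) → Pt m → ℝ) (k e : Pt m → ℝ),
      ContDiff ℝ ∞ Ψ ∧ (∀ a, ContDiff ℝ ∞ (J a)) ∧ ContDiff ℝ ∞ k ∧ Continuous e ∧
      (∀ w, fieldY B Ψ w = ∑ a, gradD (J a) w a + k w + e w) ∧
      (∀ w, 0 ≤ Ψ w) ∧ (∀ w, 0 ≤ k w) ∧
      (∀ w : Pt m, -w.2 ≤ ε / 2 → Ψ w = 0 ∧ (∀ a, J a w = 0) ∧ k w = 0 ∧ e w = 0) ∧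
      (∀ w, k w ≠ 0 → w ∈ region R ∧ -w.2 ≤ ε) ∧
      ENNReal.ofReal c ≤ ∫⁻ w, ENNReal.ofReal (k w) ∧
      ∀ w : Pt m, -w.2 ≤ 1 →
        ENNReal.ofReal (Ψ w) ≤ ENNReal.ofReal C * regKer R ((homDim m : ℝ) / 2) w ∧
        ENNReal.ofReal |e w| ≤ ENNReal.ofReal C * regKer R ((homDim m : ℝ) / 2) w ∧
        (∀ a, ENNReal.ofReal |J a w| ≤
          ENNReal.ofReal C * regKer R (((homDim m : ℝ) + 1) / 2) w) ∧
        (∀ a, ENNReal.ofReal |gradD Ψ w a| ≤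
          ENNReal.ofReal C * regKer R (((homDim m : ℝ) + 1) / 2) w) := by
  obtain ⟨S, hS, ⟨R, hR0, hR⟩, htr, hL⟩ := exists_lyapunov_form hB
  obtain ⟨M, hM0, hM⟩ := exists_stepD_bound
  obtain ⟨A, hA⟩ : ∃ A, A = ∑ k, ∑ l, |S k l| := ⟨_, rfl⟩
  have hA0 : 0 ≤ A := by
    rw [hA]; exact Finset.sum_nonneg fun _ _ => Finset.sum_nonneg fun _ _ => abs_nonneg _
  obtain ⟨A', hA'⟩ : ∃ A', A' = ∑ k, ∑ l, |lowerPart B l k| := ⟨_, rfl⟩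
  have hA'0 : 0 ≤ A' := by
    rw [hA']; exact Finset.sum_nonneg fun _ _ => Finset.sum_nonneg fun _ _ => abs_nonneg _
  -- On the region of this small radius the form is at most `1 / 2`, where the profile equals `1`;
  -- this yields a lower bound for the mass of `k` that does not depend on `ε`.
  obtain ⟨ρ, hρ0, hρ⟩ : ∃ ρ : ℝ, 0 < ρ ∧ ρ ^ 2 * A ≤ 1 / 2 := by
    refine ⟨1 / √(2 * (A + 1)), by positivity, ?_⟩
    rw [div_pow, Real.sq_sqrt (by positivity), one_pow, div_mul_eq_mul_div, one_mul,
      div_le_iff₀ (by positivity)]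
    linarith
  obtain ⟨C, hC⟩ : ∃ C, C = 1 + R * A + 4 * M * (R * A) + 4 * M * (R * A) * (R * A') := ⟨_, rfl⟩
  have hRA : 0 ≤ R * A := by positivity
  have hRA' : 0 ≤ R * A' := by positivity
  have hC0 : 0 < C := by rw [hC]; positivity
  have hC1 : 1 ≤ C := by
    have : 0 ≤ R * A + 4 * M * (R * A) + 4 * M * (R * A) * (R * A') := by positivity
    linarith
  have hC2 : R * A ≤ C := by
    have : 0 ≤ 4 * M * (R * A) + 4 * M * (R * A) * (R * A') := by positivity
    linarith
  have hC3 : 4 * M * (R * A) ≤ C := by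
    have : 0 ≤ 4 * M * (R * A) * (R * A') := by positivity
    linarith
  have hC4 : 4 * M * (R * A) * (R * A') ≤ C := by
    have : 0 ≤ 4 * M * (R * A) := by positivity
    linarith
  refine ⟨R, (2 * ρ) ^ Fintype.card (Idx m), C, hR0, by positivity, hC0, fun ε hε => ?_⟩
  have hε2 : 0 < ε / 2 := by positivity
  set z : Fin (m 0) → Pt m → ℝ := fun a w => S.mulVec (scl w) (idx0 a) with hz
  set Ψ : Pt m → ℝ := fun w => timeFac m ε (-w.2) * profile (sqForm S w) with hΨ
  -- The divergence of `J` has two parts. One is `-(Q / 2s) Ψ`, because the block-`0` trace of `S`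
  -- is `Q`; it cancels the derivative of `s^(-Q/2)`. The other carries `∑ z_a²` and cancels the
  -- leading part of `Y` of the form. Both cancellations hold for any profile, so one of compact
  -- support can replace the Gaussian.
  set J : Fin (m 0) → Pt m → ℝ := fun a w => -(1 / 2) * z a w * Ψ w with hJ
  set k : Pt m → ℝ := fun w => timeFacD m ε (-w.2) * profile (sqForm S w) with hk
  have hprof : ∀ {w : Pt m}, 0 < -w.2 → ContDiffAt ℝ ∞ (fun w => profile (sqForm S w)) w :=
    fun {w} hw => contDiff_profile.contDiffAt.comp w (contDiffAt_sqForm S hw)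
  have hΨ0 : ∀ w : Pt m, -w.2 ≤ ε / 2 → Ψ w = 0 := fun w hw => by
    simp only [hΨ, timeFac_eq_zero hε hw, zero_mul]
  have hJ0 : ∀ a, ∀ w : Pt m, -w.2 ≤ ε / 2 → J a w = 0 := fun a w hw => by
    simp only [hJ, hΨ0 w hw, mul_zero]
  have hk0 : ∀ w : Pt m, -w.2 ≤ ε / 2 → k w = 0 := fun w hw => by
    simp only [hk, timeFacD_eq_zero hε hw, zero_mul]
  have hΨat : ∀ w : Pt m, 0 < -w.2 → ContDiffAt ℝ ∞ Ψ w := fun w hw =>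
    (ContDiffAt.comp (g := timeFac m ε) w (contDiffAt_timeFac ε hw)
      contDiff_snd.neg.contDiffAt).mul (hprof hw)
  have hΨs : ContDiff ℝ ∞ Ψ := contDiff_of_past hε2 hΨat hΨ0
  have hJs : ∀ a, ContDiff ℝ ∞ (J a) := fun a => contDiff_of_past hε2
    (fun w hw => (contDiffAt_const.mul (contDiffAt_mulVec_scl S hw _)).mul (hΨat w hw)) (hJ0 a)
  have hks : ContDiff ℝ ∞ k := contDiff_of_past hε2 (fun w hw =>
    (ContDiffAt.comp (g := timeFacD m ε) w (contDiffAt_timeFacD ε hw)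
      contDiff_snd.neg.contDiffAt).mul (hprof hw)) hk0
  have hgJ : ∀ a, Continuous fun w => gradD (J a) w a := fun a => by
    simp only [gradD]
    exact (hJs a).continuous_fderiv_apply (by simp) |>.comp (continuous_id.prodMk continuous_const)
  have hYΨ : Continuous fun w => fieldY B Ψ w := by
    simp only [fieldY_eq]
    refine (hΨs.continuous_fderiv_apply (by simp)).comp (continuous_id.prodMk ?_)
    exact ((Continuous.matrix_mulVec continuous_const continuous_fst)).prodMk continuous_const
  -- The error is defined as whatever remains; `hef` identifies it as a lower-order term.
  set e : Pt m → ℝ := fun w => fieldY B Ψ w - ∑ a, gradD (J a) w a - k w with he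
  have hgΨ : ∀ w : Pt m, 0 < -w.2 → ∀ a, fderiv ℝ Ψ w (Pi.single (idx0 a) 1, 0) =
      timeFac m ε (-w.2) * (-2 * stepD (2 - 2 * sqForm S w)) * (2 * z a w) := by
    intro w hw a
    rw [hΨ, hasFDerivAt_timeFac_mul_profile hS ε hw, fderiv_sqForm_idx0 hS hw]
    simp only [hz, mul_zero, zero_mul, zero_add]
  have hef : ∀ w : Pt m, 0 < -w.2 → e w =
      timeFac m ε (-w.2) * (-2 * stepD (2 - 2 * sqForm S w)) * (2 * ∑ i, S.mulVec (scl w) i *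
        ∑ l, lowerPart B l i * scl w l * ((-w.2) ^ (blk l + 1) * ((-w.2) ^ blk i)⁻¹)) := by
    intro w hw
    rw [← fderiv_sqForm_yVec hS hL hw]
    have h1 : ∀ a, gradD (J a) w a = -(1 / 2) * (S (idx0 a) (idx0 a) / (-w.2) * Ψ w + z a w *
        (timeFac m ε (-w.2) * (-2 * stepD (2 - 2 * sqForm S w)) * (2 * z a w))) := by
      intro a
      obtain ⟨L, hL1, hL2⟩ := hasFDerivAt_mulVec_scl S hw a
      have h2 := ((hL1.const_mul (-(1 / 2))).mul
        ((hΨat w hw).differentiableAt (by simp)).hasFDerivAt).fderiv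
      change fderiv ℝ (fun w => -(1 / 2) * S.mulVec (scl w) (idx0 a) * Ψ w) w
        (Pi.single (idx0 a) 1, 0) = _
      have h3 : fderiv ℝ (fun w => -(1 / 2) * S.mulVec (scl w) (idx0 a) * Ψ w) w = _ := h2
      rw [h3]
      simp only [_root_.add_apply, _root_.smul_apply, smul_eq_mul, hL2, hgΨ w hw]
      simp only [hz]
      ring
    have h4 : ∑ a, gradD (J a) w a = -(1 / 2) * ((homDim m : ℝ) / (-w.2) * Ψ w +
        timeFac m ε (-w.2) * (-2 * stepD (2 - 2 * sqForm S w)) * (2 * ∑ a, z a w ^ 2)) := by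
      simp only [h1]
      rw [← Finset.mul_sum, Finset.sum_add_distrib, ← Finset.sum_mul, ← Finset.sum_div, htr,
        Finset.mul_sum, Finset.mul_sum]
      congr 2
      exact Finset.sum_congr rfl fun a _ => by ring
    simp only [he]
    rw [h4, fieldY_eq]
    rw [hΨ, hasFDerivAt_timeFac_mul_profile hS ε hw]
    simp only [hk, hz, yVec]
    ring
  have hstep0 : ∀ w : Pt m, 1 < sqForm S w → stepD (2 - 2 * sqForm S w) = 0 := fun w hw =>
    stepD_of_neg (by linarith)
  have hprof0 : ∀ w : Pt m, 1 < sqForm S w → profile (sqForm S w) = 0 := fun w hw =>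
    Real.smoothTransition.zero_of_nonpos (by linarith)
  have hmem : ∀ w : Pt m, 0 < -w.2 → sqForm S w ≤ 1 → w ∈ region R := fun w =>
    mem_region_of_sqForm_le hR0 hR
  have hnreg : ∀ w : Pt m, w ∉ region R → -w.2 ≤ 0 ∨ (0 < -w.2 ∧ 1 < sqForm S w) := by
    intro w hw
    by_cases h : 0 < -w.2
    · exact Or.inr ⟨h, not_le.1 fun h' => hw (hmem w h h')⟩
    · exact Or.inl (not_lt.1 h)
  have he0 : ∀ w : Pt m, -w.2 ≤ ε / 2 → e w = 0 := by
    intro w hw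
    by_cases h : 0 < -w.2
    · rw [hef w h, timeFac_eq_zero hε hw, zero_mul, zero_mul]
    · have hw' : -w.2 < ε / 2 := by linarith
      simp only [he, fieldY_eq, gradD, fderiv_of_past hΨ0 hw', fun a => fderiv_of_past (hJ0 a) hw',
        hk0 w hw]
      simp
  have hT : ∀ w : Pt m, 0 < -w.2 → |timeFac m ε (-w.2)| ≤ (-w.2) ^ (-((homDim m : ℝ) / 2)) :=
    fun w hw => by rw [abs_of_nonneg (timeFac_nonneg ε hw.le)]; exact timeFac_le ε hw.le
  have hzb : ∀ w : Pt m, 0 < -w.2 → sqForm S w ≤ 1 → ∀ i,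
      |S.mulVec (scl w) i| ≤ R * A * (√(-w.2))⁻¹ := by
    intro w hw hq i
    have h := sqrt_mul_abs_mulVec_scl_le hR0 hR hw hq i
    have hr : 0 < √(-w.2) := Real.sqrt_pos.2 hw
    rw [hA, ← div_eq_mul_inv, le_div_iff₀ hr, mul_comm]
    exact h
  refine ⟨Ψ, J, k, e, hΨs, hJs, hks, ?_, ?_, ?_, ?_, ?_, ?_, ?_, ?_⟩
  · exact (hYΨ.sub (continuous_finsetSum _ fun a _ => hgJ a)).sub hks.continuous
  · intro w
    simp only [he]
    ring
  · intro w
    by_cases hw : -w.2 ≤ ε / 2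
    · rw [hΨ0 w hw]
    · exact mul_nonneg (timeFac_nonneg ε (by linarith)) (Real.smoothTransition.nonneg _)
  · intro w
    by_cases hw : -w.2 ≤ ε / 2
    · rw [hk0 w hw]
    · exact mul_nonneg (timeFacD_nonneg hε (by linarith)) (Real.smoothTransition.nonneg _)
  · exact fun w hw => ⟨hΨ0 w hw, fun a => hJ0 a w hw, hk0 w hw, he0 w hw⟩
  · intro w hw
    have hw1 : 0 < -w.2 := by
      by_contra h
      exact hw (hk0 w (by linarith))
    refine ⟨hmem w hw1 (not_lt.1 fun h => hw ?_), not_lt.1 fun h => hw ?_⟩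
    · simp only [hk, hprof0 w h, mul_zero]
    · simp only [hk, timeFacD_eq_zero_of_lt hε h, zero_mul]
  · have hmT : Measurable fun s => ENNReal.ofReal (timeFacD m ε s) := by
      refine ENNReal.measurable_ofReal.comp ?_
      unfold timeFacD
      exact (measurable_const.mul (contDiff_stepD.continuous.measurable.comp (by fun_prop))).mul
        (by fun_prop)
    calc ENNReal.ofReal ((2 * ρ) ^ Fintype.card (Idx m))
        ≤ ENNReal.ofReal ((2 * ρ) ^ Fintype.card (Idx m)) *
          ∫⁻ s in Set.Ioi (0 : ℝ), ENNReal.ofReal (s ^ ((homDim m : ℝ) / 2)) *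
            ENNReal.ofReal (timeFacD m ε s) :=
          le_mul_of_one_le_right bot_le (lintegral_timeFacD hε)
      _ = ∫⁻ w : Pt m, (region ρ).indicator (fun w => ENNReal.ofReal (timeFacD m ε (-w.2))) w := by
          rw [lintegral_region (F := fun s => ENNReal.ofReal (timeFacD m ε s)) hρ0 hmT,
            ← lintegral_const_mul' _ _ ENNReal.ofReal_ne_top]
          refine lintegral_congr fun s => ?_
          rw [ENNReal.ofReal_mul (by positivity), mul_assoc]
      _ ≤ ∫⁻ w, ENNReal.ofReal (k w) := by
          refine lintegral_mono fun w => ?_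
          by_cases hw : w ∈ region ρ
          · rw [Set.indicator_of_mem hw]
            have h1 : sqForm S w ≤ 1 / 2 := by
              refine (sqForm_le_of_mem_region hρ0 hw).trans ?_
              rw [← hA]; exact hρ
            have h2 : profile (sqForm S w) = 1 :=
              Real.smoothTransition.one_of_one_le (by linarith)
            simp only [hk, h2, mul_one]
            exact le_rfl
          · rw [Set.indicator_of_notMem hw]
            exact bot_le
  · intro w hw1
    have hprof1 : ∀ x, profile x ≤ 1 := fun x => Real.smoothTransition.le_one _
    have hprofn : ∀ x, 0 ≤ profile x := fun x => Real.smoothTransition.nonneg _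
    refine ⟨?_, ?_, fun a => ?_, fun a => ?_⟩
    · refine ofReal_le_regKer hC0.le (fun hw => ?_) fun hw => ?_
      · have hp : 0 ≤ (-w.2) ^ (-((homDim m : ℝ) / 2)) := Real.rpow_nonneg hw.1.le _
        calc Ψ w ≤ (-w.2) ^ (-((homDim m : ℝ) / 2)) * 1 :=
              mul_le_mul (timeFac_le ε hw.1.le) (hprof1 _) (hprofn _) hp
          _ ≤ _ := by nlinarith
      · rcases hnreg w hw with h | ⟨_, h⟩
        · rw [hΨ0 w (by linarith)]
        · simp only [hΨ, hprof0 w h, mul_zero, le_refl]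
    · refine ofReal_le_regKer hC0.le (fun hw => ?_) fun hw => ?_
      · have hs0 : 0 < -w.2 := hw.1
        have hp : 0 ≤ (-w.2) ^ (-((homDim m : ℝ) / 2)) := Real.rpow_nonneg hs0.le _
        rw [hef w hs0]
        by_cases hq : 1 < sqForm S w
        · rw [hstep0 w hq, mul_zero, mul_zero, zero_mul, abs_zero]
          positivity
        · have hq' := not_lt.1 hq
          have hr : 0 < √(-w.2) := Real.sqrt_pos.2 hs0
          have hlow : |∑ i, S.mulVec (scl w) i * ∑ l, lowerPart B l i * scl w l *
              ((-w.2) ^ (blk l + 1) * ((-w.2) ^ blk i)⁻¹)| ≤ (R * A) * (R * A') := by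
            calc |∑ i, S.mulVec (scl w) i * ∑ l, lowerPart B l i * scl w l *
                  ((-w.2) ^ (blk l + 1) * ((-w.2) ^ blk i)⁻¹)|
                ≤ ∑ i, (R * A * (√(-w.2))⁻¹) * ∑ l, |lowerPart B l i| * (R * √(-w.2)) := by
                  refine (Finset.abs_sum_le_sum_abs _ _).trans (Finset.sum_le_sum fun i _ => ?_)
                  rw [abs_mul]
                  refine mul_le_mul (hzb w hs0 hq' i) ?_ (abs_nonneg _) (by positivity)
                  refine (Finset.abs_sum_le_sum_abs _ _).trans (Finset.sum_le_sum fun l _ => ?_)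
                  rw [abs_mul, abs_mul, mul_assoc]
                  by_cases hli : blk l < blk i
                  · rw [lowerPart_eq_zero hB hli, abs_zero, zero_mul, zero_mul]
                  · refine mul_le_mul_of_nonneg_left ?_ (abs_nonneg _)
                    have h1 := sqrt_mul_abs_scl_le hR0 hR hs0 hq' l
                    -- Only pairs with `blk i ≤ blk l` contribute, so a surplus factor `s` is
                    -- available as long as `s ≤ 1`. It compensates the two factors `s^(-1/2)`
                    -- coming from the rescaled coordinates.
                    have h2 : |(-w.2) ^ (blk l + 1) * ((-w.2) ^ blk i)⁻¹| ≤ -w.2 := by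
                      rw [abs_of_pos (by positivity), ← div_eq_mul_inv, div_le_iff₀ (by positivity),
                        pow_succ']
                      refine mul_le_mul_of_nonneg_left ?_ hs0.le
                      exact pow_le_pow_of_le_one hs0.le hw1 (not_lt.1 hli)
                    calc |scl w l| * |(-w.2) ^ (blk l + 1) * ((-w.2) ^ blk i)⁻¹|
                        ≤ |scl w l| * (-w.2) := by gcongr
                      _ = (√(-w.2) * |scl w l|) * √(-w.2) := by
                          nth_rewrite 1 [← Real.mul_self_sqrt hs0.le]; ring
                      _ ≤ R * √(-w.2) := by gcongr
              _ = (R * A) * (R * A') := by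
                  rw [hA', ← Finset.mul_sum]
                  simp only [← Finset.sum_mul]
                  field_simp
          calc |timeFac m ε (-w.2) * (-2 * stepD (2 - 2 * sqForm S w)) * (2 * ∑ i,
                S.mulVec (scl w) i * ∑ l, lowerPart B l i * scl w l *
                ((-w.2) ^ (blk l + 1) * ((-w.2) ^ blk i)⁻¹))|
              ≤ (-w.2) ^ (-((homDim m : ℝ) / 2)) * (2 * M) * (2 * ((R * A) * (R * A'))) := by
                rw [abs_mul, abs_mul, abs_mul, abs_mul]
                have h2 : |(-2 : ℝ)| = 2 := by norm_num
                have h3 : |(2 : ℝ)| = 2 := by norm_num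
                rw [h2, h3]
                gcongr
                · exact hT w hs0
                · exact hM _
            _ = (4 * M * (R * A) * (R * A')) * (-w.2) ^ (-((homDim m : ℝ) / 2)) := by ring
            _ ≤ _ := by gcongr
      · rcases hnreg w hw with h | ⟨h', h⟩
        · rw [he0 w (by linarith), abs_zero]
        · rw [hef w h', hstep0 w h, mul_zero, mul_zero, zero_mul, abs_zero]
    · refine ofReal_le_regKer hC0.le (fun hw => ?_) fun hw => ?_
      · have hs0 : 0 < -w.2 := hw.1
        have hp : 0 ≤ (-w.2) ^ (-((homDim m : ℝ) / 2)) := Real.rpow_nonneg hs0.le _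
        rw [← rpow_mul_inv_sqrt hs0]
        by_cases hq : 1 < sqForm S w
        · simp only [hJ, hΨ, hprof0 w hq, mul_zero, abs_zero]
          positivity
        · have hq' := not_lt.1 hq
          calc |J a w| = (1 / 2) * |z a w| * (|timeFac m ε (-w.2)| * |profile (sqForm S w)|) := by
                simp only [hJ, hΨ, abs_mul]
                norm_num
            _ ≤ (1 / 2) * (R * A * (√(-w.2))⁻¹) * ((-w.2) ^ (-((homDim m : ℝ) / 2)) * 1) := by
                gcongr
                · exact hzb w hs0 hq' _
                · exact hT w hs0
                · rw [abs_of_nonneg (hprofn _)]; exact hprof1 _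
            _ = (R * A / 2) * ((-w.2) ^ (-((homDim m : ℝ) / 2)) * (√(-w.2))⁻¹) := by ring
            _ ≤ _ := by gcongr; linarith
      · rcases hnreg w hw with h | ⟨_, h⟩
        · rw [hJ0 a w (by linarith), abs_zero]
        · simp only [hJ, hΨ, hprof0 w h, mul_zero, abs_zero, le_refl]
    · change ENNReal.ofReal |fderiv ℝ Ψ w (Pi.single (idx0 a) 1, 0)| ≤ _
      refine ofReal_le_regKer hC0.le (fun hw => ?_) fun hw => ?_
      · have hs0 : 0 < -w.2 := hw.1
        have hp : 0 ≤ (-w.2) ^ (-((homDim m : ℝ) / 2)) := Real.rpow_nonneg hs0.le _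
        rw [← rpow_mul_inv_sqrt hs0, hgΨ w hs0]
        by_cases hq : 1 < sqForm S w
        · rw [hstep0 w hq, mul_zero, mul_zero, zero_mul, abs_zero]
          positivity
        · have hq' := not_lt.1 hq
          calc |timeFac m ε (-w.2) * (-2 * stepD (2 - 2 * sqForm S w)) * (2 * z a w)|
              ≤ (-w.2) ^ (-((homDim m : ℝ) / 2)) * (2 * M) * (2 * (R * A * (√(-w.2))⁻¹)) := by
                rw [abs_mul, abs_mul, abs_mul, abs_mul]
                have h2 : |(-2 : ℝ)| = 2 := by norm_num
                have h3 : |(2 : ℝ)| = 2 := by norm_num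
                rw [h2, h3]
                gcongr
                · exact hT w hs0
                · exact hM _
                · exact hzb w hs0 hq' _
            _ = (4 * M * (R * A)) * ((-w.2) ^ (-((homDim m : ℝ) / 2)) * (√(-w.2))⁻¹) := by ring
            _ ≤ _ := by gcongr
      · rcases hnreg w hw with h | ⟨h', h⟩
        · rw [fderiv_of_past hΨ0 (by linarith)]; simp
        · rw [hgΨ w h', hstep0 w h, mul_zero, mul_zero, zero_mul, abs_zero]

end Parametrix

/-! ### Left-invariant kernels -/

section GroupKernel

variable (B : Matrix (Idx m) (Idx m) ℝ)

/-- The left-invariant kernel `s ^ (-e)` on the region, truncated at `s ≤ 1`. -/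
def grpKer (R e : ℝ) (z ζ : Pt m) : ℝ≥0∞ :=
  if -(groupMul B (groupInv B z) ζ).2 ≤ 1 then regKer R e (groupMul B (groupInv B z) ζ) else 0

theorem measurable_relPos :
    Measurable fun p : Pt m × Pt m => groupMul B (groupInv B p.1) p.2 :=
  ((contDiff_groupMul B).continuous.comp
    (((contDiff_groupInv B).continuous.comp continuous_fst).prodMk continuous_snd)).measurable

theorem measurable_grpKer (R e : ℝ) : Measurable (Function.uncurry (grpKer B R e)) := by
  have h := measurable_relPos B
  exact Measurable.ite (measurableSet_le (measurable_snd.comp h).neg measurable_const)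
    ((measurable_regKer R e).comp h) measurable_const

theorem lintegral_row_le {R : ℝ} (hR : 0 < R) {F : Pt m → ℝ≥0∞} (hF : Measurable F)
    {G : ℝ → ℝ≥0∞} (hG : Measurable G) (h : ∀ w ∈ region R, F w ≤ G (-w.2))
    (h0 : ∀ w ∉ region R, F w = 0) (z : Pt m) :
    ∫⁻ ζ, F (groupMul B (groupInv B z) ζ) ≤ ∫⁻ s in Set.Ioi (0 : ℝ),
      ENNReal.ofReal ((2 * R) ^ Fintype.card (Idx m) * s ^ ((homDim m : ℝ) / 2)) * G s := by
  rw [lintegral_groupMul_left B _ hF, ← lintegral_region hR hG]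
  refine lintegral_mono fun w => ?_
  by_cases hw : w ∈ region R
  · rw [Set.indicator_of_mem hw]; exact h w hw
  · rw [h0 w hw]; exact bot_le

/-- Columns differ from rows by the Jacobian of inversion, bounded because the kernel vanishes
beyond elapsed time `1`. -/
theorem lintegral_col_le {R : ℝ} (hR : 0 < R) {F : Pt m → ℝ≥0∞} (hF : Measurable F)
    {G : ℝ → ℝ≥0∞} (hG : Measurable G) (h : ∀ w ∈ region R, F w ≤ G (-w.2))
    (h0 : ∀ w ∉ region R, F w = 0) (h1 : ∀ w : Pt m, 1 < -w.2 → F w = 0) {D : ℝ}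
    (hD : ∀ τ : ℝ, |τ| ≤ 1 → |(expE B τ).det|⁻¹ ≤ D) (ζ : Pt m) :
    ∫⁻ z, F (groupMul B (groupInv B z) ζ) ≤ ENNReal.ofReal D * ∫⁻ s in Set.Ioi (0 : ℝ),
      ENNReal.ofReal ((2 * R) ^ Fintype.card (Idx m) * s ^ ((homDim m : ℝ) / 2)) * G s := by
  rw [lintegral_groupInv_left B _ hF, ← lintegral_region hR hG,
    ← lintegral_const_mul' _ _ ENNReal.ofReal_ne_top]
  refine lintegral_mono fun w => ?_
  by_cases hw : w ∈ region R
  · rw [Set.indicator_of_mem hw]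
    by_cases hw1 : 1 < -w.2
    · rw [h1 w hw1, mul_zero]; exact bot_le
    · gcongr
      · refine hD _ ?_
        have := hw.1
        rw [abs_le]; constructor <;> linarith
      · exact h w hw
  · rw [h0 w hw, mul_zero]; exact bot_le

theorem lintegral_power_lt {Q e τ c : ℝ} (hτ : 0 < τ) (hc : 0 ≤ c) (ha : 0 < Q / 2 + 1 - e) :
    ∫⁻ s in Set.Ioi (0 : ℝ), ENNReal.ofReal (c * s ^ (Q / 2)) *
      (if s < τ then ENNReal.ofReal (s ^ (-e)) else 0) =
      ENNReal.ofReal (c / (Q / 2 + 1 - e) * τ ^ (Q / 2 + 1 - e)) := by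
  -- The layer formula evaluated at `τ` is the integral of a power over `(0, τ)`.
  have h := lintegral_layer_rpow (ENNReal.ofReal τ) ha
  rw [ENNReal.ofReal_mul (by positivity), ← ENNReal.ofReal_rpow_of_pos hτ, ← h,
    ← lintegral_const_mul' _ _ ENNReal.ofReal_ne_top]
  refine setLIntegral_congr_fun measurableSet_Ioi fun s hs => ?_
  have hs0 : (0 : ℝ) < s := hs
  simp only [ENNReal.ofReal_lt_ofReal_iff hτ]
  split_ifs
  · rw [← ENNReal.ofReal_mul (by positivity), ← ENNReal.ofReal_mul (by positivity)]
    congr 1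
    have : s ^ (Q / 2 + 1 - e - 1) = s ^ (Q / 2) * s ^ (-e) := by
      rw [← Real.rpow_add hs0]; congr 1; ring
    rw [this, ← mul_assoc, ← mul_assoc, div_mul_cancel₀ _ ha.ne', mul_assoc]
  · simp

theorem lintegral_power_ge {Q e τ c : ℝ} (hτ : 0 < τ) (hc : 0 ≤ c) (hb : 0 < e - (Q / 2 + 1)) :
    ∫⁻ s in Set.Ioi (0 : ℝ), ENNReal.ofReal (c * s ^ (Q / 2)) *
      (if s < τ then 0 else ENNReal.ofReal (s ^ (-e))) =
      ENNReal.ofReal (c / (e - (Q / 2 + 1)) * τ ^ (-(e - (Q / 2 + 1)))) := by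
  have h1 : ∫⁻ s in Set.Ioi (0 : ℝ), ENNReal.ofReal (c * s ^ (Q / 2)) *
      (if s < τ then 0 else ENNReal.ofReal (s ^ (-e))) =
      ∫⁻ s in Set.Ici τ, ENNReal.ofReal (c * s ^ (Q / 2 - e)) := by
    rw [← lintegral_indicator measurableSet_Ioi, ← lintegral_indicator measurableSet_Ici]
    refine lintegral_congr fun s => ?_
    by_cases hs : s < τ
    · rw [Set.indicator_of_notMem (s := Set.Ici τ) (by simpa using hs)]
      by_cases hs0 : s ∈ Set.Ioi (0 : ℝ)
      · rw [Set.indicator_of_mem hs0]; simp [hs]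
      · rw [Set.indicator_of_notMem hs0]
    · have hs0 : 0 < s := hτ.trans_le (not_lt.1 hs)
      rw [Set.indicator_of_mem (Set.mem_Ioi.2 hs0), Set.indicator_of_mem (by simpa using hs),
        if_neg hs, ← ENNReal.ofReal_mul (by positivity), sub_eq_add_neg, Real.rpow_add hs0,
        mul_assoc]
  have hlt : Q / 2 - e < -1 := by linarith
  have hint := (integrableOn_Ioi_rpow_of_lt hlt hτ).const_mul c
  rw [h1, setLIntegral_congr Ioi_ae_eq_Ici.symm, ← ofReal_integral_eq_lintegral_ofReal hint]
  · congr 1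
    rw [integral_const_mul, integral_Ioi_rpow_of_lt hlt hτ]
    rw [show Q / 2 - e + 1 = -(e - (Q / 2 + 1)) by ring]
    field_simp
  · refine (ae_restrict_mem measurableSet_Ioi).mono fun s hs => ?_
    have hs0 : 0 < s := hτ.trans hs
    positivity

theorem relPos_snd (z ζ : Pt m) : -(groupMul B (groupInv B z) ζ).2 = z.2 - ζ.2 := by
  rw [groupInv_groupMul_eq]; simp

/-- The Hardy–Littlewood–Sobolev inequality for the left-invariant kernels. -/
theorem hls_grpKer {R : ℝ} (hR : 0 < R) {e p p' q b : ℝ} (hpp : p.HolderConjugate p')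
    (ha : 0 < (homDim m : ℝ) / 2 + 1 - e) (hb : 0 < b)
    (hbe : b * p' = e * p' - ((homDim m : ℝ) / 2 + 1))
    (hq : q * b = p * ((homDim m : ℝ) / 2 + 1 - e + b)) :
    ∃ C : ℝ≥0, 0 < C ∧ ∀ f : Pt m → ℝ≥0∞, AEMeasurable f volume →
      lnorm volume q (kerOp volume (grpKer B R e) f) ≤ C * lnorm volume p f := by
  obtain ⟨D, hD0, hD⟩ := exists_det_bound B
  have hp' : 0 < p' := hpp.symm.pos
  -- The elapsed time serves as the threshold variable. Against the slice volume `s^(Q/2)`, the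
  -- kernel `s^(-e)` integrates over `s < τ` to a multiple of `τ^a`, and its power `p'` over `s ≥ τ`
  -- to a multiple of `τ^(-b p')`.
  set a := (homDim m : ℝ) / 2 + 1 - e with ha_def
  set c := (2 * R) ^ Fintype.card (Idx m) with hc
  have hc0 : 0 < c := by positivity
  set σ : Pt m → Pt m → ℝ := fun z ζ => -(groupMul B (groupInv B z) ζ).2 with hσ
  have hσm : Measurable (Function.uncurry σ) := (measurable_snd.comp (measurable_relPos B)).neg
  have hbp : 0 < b * p' := by positivity
  obtain ⟨A, hA⟩ : ∃ A, A = (1 + D) * (c / a) + (c / (b * p')) ^ (1 / p') := ⟨_, rfl⟩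
  have hA0 : 0 < A := by rw [hA]; positivity
  have hA1 : c / a ≤ A := by
    have h1 : 0 ≤ D * (c / a) := by positivity
    have h2 : 0 ≤ (c / (b * p')) ^ (1 / p') := by positivity
    rw [hA]; linarith
  have hA2 : D * (c / a) ≤ A := by
    have h1 : 0 ≤ c / a := by positivity
    have h2 : 0 ≤ (c / (b * p')) ^ (1 / p') := by positivity
    rw [hA]; linarith
  have hA3 : (c / (b * p')) ^ (1 / p') ≤ A := by
    have h1 : 0 ≤ (1 + D) * (c / a) := by positivity
    rw [hA]; linarith
  have hm1 : Measurable fun w : Pt m => if -w.2 ≤ 1 then regKer R e w else 0 :=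
    Measurable.ite (measurableSet_le measurable_snd.neg measurable_const) (measurable_regKer R e)
      measurable_const
  refine hls (K := grpKer B R e) (σ := σ) (measurable_grpKer B R e) hσm hpp ha hb hA0 hq ?_ ?_ ?_
  · intro τ hτ z
    refine (lintegral_row_le B hR (F := fun w => if -w.2 < τ then
      (if -w.2 ≤ 1 then regKer R e w else 0) else 0)
      (G := fun s => if s < τ then ENNReal.ofReal (s ^ (-e)) else 0) ?_ ?_ ?_ ?_ z).trans ?_
    · exact Measurable.ite (measurableSet_lt measurable_snd.neg measurable_const) hm1
        measurable_const
    · exact Measurable.ite measurableSet_Iio (by fun_prop) measurable_const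
    · intro w hw
      simp only [regKer, Set.indicator_of_mem hw]
      split_ifs <;> simp
    · intro w hw
      simp [regKer, Set.indicator_of_notMem hw]
    · rw [lintegral_power_lt hτ hc0.le ha]
      exact ENNReal.ofReal_le_ofReal (by gcongr)
  · intro τ hτ ζ
    refine (lintegral_col_le B hR (F := fun w => if -w.2 < τ then
      (if -w.2 ≤ 1 then regKer R e w else 0) else 0)
      (G := fun s => if s < τ then ENNReal.ofReal (s ^ (-e)) else 0) ?_ ?_ ?_ ?_ ?_ hD ζ).trans ?_
    · exact Measurable.ite (measurableSet_lt measurable_snd.neg measurable_const) hm1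
        measurable_const
    · exact Measurable.ite measurableSet_Iio (by fun_prop) measurable_const
    · intro w hw
      simp only [regKer, Set.indicator_of_mem hw]
      split_ifs <;> simp
    · intro w hw
      simp [regKer, Set.indicator_of_notMem hw]
    · intro w hw
      simp [not_le.2 hw]
    · rw [lintegral_power_lt hτ hc0.le ha, ← ENNReal.ofReal_mul hD0.le, ← mul_assoc]
      exact ENNReal.ofReal_le_ofReal (by gcongr)
  · intro τ hτ z
    have h1 := lintegral_row_le B hR (F := fun w => (if -w.2 < τ then 0 else
      (if -w.2 ≤ 1 then regKer R e w else 0)) ^ p')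
      (G := fun s => if s < τ then 0 else ENNReal.ofReal (s ^ (-(e * p')))) ?_ ?_ ?_ ?_ z
    · rw [lintegral_power_ge hτ hc0.le (by rw [← hbe]; exact hbp), ← hbe] at h1
      refine (ENNReal.rpow_le_rpow h1 (by positivity)).trans ?_
      rw [ENNReal.ofReal_rpow_of_nonneg (by positivity) (by positivity),
        Real.mul_rpow (by positivity) (by positivity), ← Real.rpow_mul hτ.le]
      have : -(b * p') * (1 / p') = -b := by field_simp
      rw [this]
      exact ENNReal.ofReal_le_ofReal (by gcongr)
    · exact (Measurable.ite (measurableSet_lt measurable_snd.neg measurable_const)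
        measurable_const hm1).pow_const _
    · exact Measurable.ite measurableSet_Iio measurable_const (by fun_prop)
    · intro w hw
      simp only [regKer, Set.indicator_of_mem hw]
      split_ifs
      · simp [hp']
      · rw [ENNReal.ofReal_rpow_of_pos (Real.rpow_pos_of_pos hw.1 _), ← Real.rpow_mul hw.1.le,
          neg_mul]
      · simp [hp']
    · intro w hw
      simp [regKer, Set.indicator_of_notMem hw, hp']

/-- Uniform integrability of the columns of the left-invariant kernels. -/
theorem exists_col_bound {R : ℝ} (hR : 0 < R) {e p : ℝ} (hp : 0 < p)
    (ha : 0 < (homDim m : ℝ) / 2 + 1 - e * p) :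
    ∃ C : ℝ≥0, ∀ ζ, (∫⁻ z, grpKer B R e z ζ ^ p) ^ (1 / p) ≤ C := by
  obtain ⟨D, hD0, hD⟩ := exists_det_bound B
  set c := (2 * R) ^ Fintype.card (Idx m) with hc
  have hc0 : 0 < c := by positivity
  refine ⟨((ENNReal.ofReal D * ENNReal.ofReal (c / ((homDim m : ℝ) / 2 + 1 - e * p) *
    2 ^ ((homDim m : ℝ) / 2 + 1 - e * p))) ^ (1 / p)).toNNReal, fun ζ => ?_⟩
  rw [ENNReal.coe_toNNReal (ENNReal.rpow_ne_top_of_nonneg (by positivity)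
    (ENNReal.mul_ne_top ENNReal.ofReal_ne_top ENNReal.ofReal_ne_top))]
  refine ENNReal.rpow_le_rpow ?_ (by positivity)
  refine (lintegral_col_le B hR (F := fun w => (if -w.2 ≤ 1 then regKer R e w else 0) ^ p)
      -- Any bound above `1` would do: the kernel lives on `s ≤ 1`, whereas the integral formula
      -- uses a strict inequality.
      (G := fun s => if s < 2 then ENNReal.ofReal (s ^ (-(e * p))) else 0)
      ?_ ?_ ?_ ?_ ?_ hD ζ).trans ?_
  · exact (Measurable.ite (measurableSet_le measurable_snd.neg measurable_const)
      (measurable_regKer R e) measurable_const).pow_const _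
  · exact Measurable.ite measurableSet_Iio (by fun_prop) measurable_const
  · intro w hw
    by_cases h : -w.2 ≤ 1
    · rw [if_pos h, if_pos (by linarith), regKer, Set.indicator_of_mem hw,
        ENNReal.ofReal_rpow_of_pos (Real.rpow_pos_of_pos hw.1 _), ← Real.rpow_mul hw.1.le, neg_mul]
    · rw [if_neg h, ENNReal.zero_rpow_of_pos hp]; exact bot_le
  · intro w hw
    simp [regKer, Set.indicator_of_notMem hw, hp]
  · intro w hw
    simp [not_le.2 hw, hp]
  · rw [lintegral_power_lt two_pos hc0.le ha]

end GroupKernel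

/-! ### Approximation of the identity in `L²` -/

/-- A continuous family of transformations near the identity with bounded Jacobians. -/
structure NearIdentity (Θ : Pt m → Pt m → Pt m) : Prop where
  continuous : Continuous (Function.uncurry Θ)
  zero : ∀ z, Θ 0 z = z
  bound : ∃ D : ℝ≥0, ∀ w : Pt m, ‖w‖ ≤ 1 → ∀ F : Pt m → ℝ≥0∞, Measurable F →
    ∫⁻ z, F (Θ w z) ≤ D * ∫⁻ z, F z
  proper : ∀ K : Set (Pt m), IsCompact K →
    Bornology.IsBounded {z | ∃ w : Pt m, ‖w‖ ≤ 1 ∧ Θ w z ∈ K}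

theorem nearIdentity_right (B : Matrix (Idx m) (Idx m) ℝ) :
    NearIdentity fun w z => groupMul B z w where
  continuous := (contDiff_groupMul B).continuous.comp continuous_swap
  zero z := groupMul_zero B z
  bound := by
    obtain ⟨D, hD0, hD⟩ := exists_det_bound B
    refine ⟨D.toNNReal, fun w hw F hF => ?_⟩
    rw [lintegral_groupMul_right B w hF]
    gcongr
    have h : |w.2| ≤ 1 := (norm_snd_le w).trans hw
    exact ENNReal.ofReal_le_ofReal (hD _ h)
  proper K hK := by
    refine (((hK.prod (isCompact_closedBall (0 : Pt m) 1)).image ((contDiff_groupMul B).continuous.comp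
      (continuous_fst.prodMk ((contDiff_groupInv B).continuous.comp
        continuous_snd)))).isBounded).subset ?_
    rintro z ⟨w, hw, hz⟩
    refine ⟨(groupMul B z w, w), ⟨hz, by simpa using hw⟩, ?_⟩
    change groupMul B (groupMul B z w) (groupInv B w) = z
    rw [groupMul_assoc, groupMul_groupInv, groupMul_zero]

theorem nearIdentity_left (B : Matrix (Idx m) (Idx m) ℝ) : NearIdentity (groupMul B) where
  continuous := (contDiff_groupMul B).continuous
  zero z := zero_groupMul B z
  bound := ⟨1, fun w _ F hF => by rw [lintegral_groupMul_left B w hF]; simp⟩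
  proper K hK := by
    refine (((hK.prod (isCompact_closedBall (0 : Pt m) 1)).image ((contDiff_groupMul B).continuous.comp
      (((contDiff_groupInv B).continuous.comp
        continuous_snd).prodMk continuous_fst))).isBounded).subset ?_
    rintro z ⟨w, hw, hz⟩
    refine ⟨(groupMul B w z, w), ⟨hz, by simpa using hw⟩, ?_⟩
    exact groupInv_groupMul_cancel B w z

/-- The squared `L²` distance of `v` and `v ∘ Θ w`. -/
def shiftDist (Θ : Pt m → Pt m → Pt m) (v : Pt m → ℝ) (w : Pt m) : ℝ≥0∞ :=
  ∫⁻ z, ‖v (Θ w z) - v z‖ₑ ^ 2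

theorem ENNReal_sq_add_le (a b c : ℝ≥0∞) : (a + b + c) ^ 2 ≤ 3 * (a ^ 2 + b ^ 2 + c ^ 2) := by
  have h2 : ∀ x y : ℝ≥0∞, 2 * (x * y) ≤ x ^ 2 + y ^ 2 := by
    intro x y
    by_cases hx : x = ⊤
    · simp [hx]
    by_cases hy : y = ⊤
    · simp [hy]
    lift x to ℝ≥0 using hx
    lift y to ℝ≥0 using hy
    norm_cast
    have : (2 : ℝ) * (x * y) ≤ x ^ 2 + y ^ 2 := by nlinarith [sq_nonneg ((x : ℝ) - y)]
    exact_mod_cast this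
  calc (a + b + c) ^ 2 = a ^ 2 + b ^ 2 + c ^ 2 + (2 * (a * b) + 2 * (a * c) + 2 * (b * c)) := by ring
    _ ≤ a ^ 2 + b ^ 2 + c ^ 2 + ((a ^ 2 + b ^ 2) + (a ^ 2 + c ^ 2) + (b ^ 2 + c ^ 2)) := by
        gcongr <;> exact h2 _ _
    _ = _ := by ring

theorem tendsto_shiftDist_of_continuous {Θ : Pt m → Pt m → Pt m} (hΘ : NearIdentity Θ)
    {g : Pt m → ℝ} (hg : Continuous g) (hgc : HasCompactSupport g) :
    Filter.Tendsto (shiftDist Θ g) (nhds 0) (nhds 0) := by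
  obtain ⟨M, hM⟩ := hg.bounded_above_of_compact_support hgc
  set T : Set (Pt m) := {z | ∃ w : Pt m, ‖w‖ ≤ 1 ∧ Θ w z ∈ tsupport g} with hT
  have hTb : Bornology.IsBounded T := hΘ.proper _ hgc
  have hTc : IsCompact (closure T) := hTb.isCompact_closure
  have hM0 : 0 ≤ M := (norm_nonneg _).trans (hM 0)
  have hout : ∀ z ∉ closure T, ∀ w : Pt m, ‖w‖ ≤ 1 → g (Θ w z) = 0 := by
    intro z hz w hw
    by_contra hne
    exact hz (subset_closure ⟨w, hw, subset_tsupport g hne⟩)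
  have hlim := tendsto_lintegral_filter_of_dominated_convergence (μ := volume) (l := nhds (0 : Pt m))
    (F := fun w z => ‖g (Θ w z) - g z‖ₑ ^ 2) (f := fun _ => 0)
    ((closure T).indicator fun _ => ENNReal.ofReal (2 * M) ^ 2) ?_ ?_ ?_ ?_
  · have e : shiftDist Θ g = fun w => ∫⁻ z, ‖g (Θ w z) - g z‖ₑ ^ 2 := rfl
    rw [e]
    simpa using hlim
  · refine Filter.Eventually.of_forall fun w => ?_
    have : Continuous fun z => g (Θ w z) - g z :=
      (hg.comp (hΘ.continuous.comp (Continuous.prodMk_right w))).sub hg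
    exact (this.measurable.enorm).pow_const 2
  · have h1 : ∀ᶠ w : Pt m in nhds 0, ‖w‖ ≤ 1 := by
      filter_upwards [Metric.closedBall_mem_nhds (0 : Pt m) one_pos] with w hw
      simpa using hw
    filter_upwards [h1] with w hw
    refine Filter.Eventually.of_forall fun z => ?_
    by_cases hz : z ∈ closure T
    · rw [Set.indicator_of_mem hz]
      gcongr
      rw [← ofReal_norm]
      refine ENNReal.ofReal_le_ofReal ((norm_sub_le _ _).trans ?_)
      have := hM (Θ w z)
      have := hM z
      linarith
    · have e1 := hout z hz w hw
      have e2 := hout z hz 0 (by simp)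
      rw [hΘ.zero] at e2
      simp [e1, e2]
  · rw [lintegral_indicator hTc.measurableSet, setLIntegral_const]
    exact ENNReal.mul_ne_top (ENNReal.pow_ne_top ENNReal.ofReal_ne_top) hTc.measure_lt_top.ne
  · refine Filter.Eventually.of_forall fun z => ?_
    have h1 : Filter.Tendsto (fun w => g (Θ w z) - g z) (nhds 0) (nhds 0) := by
      have : Continuous fun w => g (Θ w z) - g z :=
        (hg.comp (hΘ.continuous.comp (Continuous.prodMk_left z))).sub continuous_const
      simpa [hΘ.zero] using this.tendsto 0
    have h2 := ((ENNReal.continuous_pow 2).tendsto _).comp h1.enorm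
    simpa [Function.comp_def] using h2

/-- Continuous functions of compact support are dense in `L²`, and the bounded Jacobians control the
shift of the small remainder. -/
theorem tendsto_shiftDist {Θ : Pt m → Pt m → Pt m} (hΘ : NearIdentity Θ)
    {v : Pt m → ℝ} (hv : Measurable v) (hv2 : MemLp v 2) :
    Filter.Tendsto (shiftDist Θ v) (nhds 0) (nhds 0) := by
  obtain ⟨D, hD⟩ := hΘ.bound
  refine ENNReal.tendsto_nhds_zero.2 fun ε hε => ?_
  by_cases hεt : ε = ⊤
  · exact Filter.Eventually.of_forall fun w => by rw [hεt]; exact le_top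
  obtain ⟨δ, hδ0, hδ⟩ : ∃ δ : ℝ≥0∞, δ ≠ 0 ∧ 3 * ((D + 1) * δ ^ 2 + δ ^ 2) ≤ ε := by
    have h1 : ((3 : ℝ≥0∞) * (D + 2)) ≠ 0 := by simp
    have h2 : ((3 : ℝ≥0∞) * (D + 2)) ≠ ⊤ :=
      ENNReal.mul_ne_top (by simp) (ENNReal.add_ne_top.2 ⟨ENNReal.coe_ne_top, by simp⟩)
    refine ⟨(ε / (3 * (D + 2))) ^ (1 / 2 : ℝ), ?_, ?_⟩
    · have : ε / (3 * (D + 2)) ≠ 0 := ENNReal.div_ne_zero.2 ⟨hε.ne', h2⟩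
      simpa [ENNReal.rpow_eq_zero_iff] using this
    · rw [← ENNReal.rpow_natCast, ← ENNReal.rpow_mul]
      norm_num
      calc 3 * ((↑D + 1) * (ε / (3 * (↑D + 2))) + ε / (3 * (↑D + 2)))
          = (3 * (D + 2)) * (ε / (3 * (D + 2))) := by ring
        _ = ε := ENNReal.mul_div_cancel h1 h2
        _ ≤ ε := le_rfl
  obtain ⟨g, hgc, hgv, hg, hg2⟩ := hv2.exists_hasCompactSupport_eLpNorm_sub_le (by simp) hδ0
  have hI : ∫⁻ z, ‖v z - g z‖ₑ ^ 2 ≤ δ ^ 2 := by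
    have h := hgv
    rw [eLpNorm_eq_lintegral_rpow_enorm_toReal (by simp) (by simp)] at h
    have h3 := pow_le_pow_left' h 2
    rw [← ENNReal.rpow_natCast, ← ENNReal.rpow_mul] at h3
    simpa using h3
  have hm : Measurable fun z => ‖v z - g z‖ₑ ^ 2 := ((hv.sub hg.measurable).enorm).pow_const 2
  have h1 : ∀ᶠ w : Pt m in nhds 0, ‖w‖ ≤ 1 := by
    filter_upwards [Metric.closedBall_mem_nhds (0 : Pt m) one_pos] with w hw
    simpa using hw
  filter_upwards [h1, ENNReal.tendsto_nhds_zero.1 (tendsto_shiftDist_of_continuous hΘ hg hgc) (δ ^ 2)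
    (by positivity)] with w hw hgw
  have hΘw : Measurable (Θ w) := (hΘ.continuous.comp (Continuous.prodMk_right w)).measurable
  calc shiftDist Θ v w
      ≤ ∫⁻ z, 3 * (‖v (Θ w z) - g (Θ w z)‖ₑ ^ 2 + ‖g (Θ w z) - g z‖ₑ ^ 2 + ‖v z - g z‖ₑ ^ 2) := by
        refine lintegral_mono fun z => (pow_le_pow_left' ?_ 2).trans (ENNReal_sq_add_le _ _ _)
        have : v (Θ w z) - v z = (v (Θ w z) - g (Θ w z)) + (g (Θ w z) - g z) + -(v z - g z) := by
          ring
        rw [this]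
        refine (enorm_add_le _ _).trans ?_
        rw [enorm_neg]
        gcongr
        exact enorm_add_le _ _
    _ = 3 * ((∫⁻ z, ‖v (Θ w z) - g (Θ w z)‖ₑ ^ 2) + shiftDist Θ g w + ∫⁻ z, ‖v z - g z‖ₑ ^ 2) := by
        rw [lintegral_const_mul' _ _ (by simp), lintegral_add_right _ hm, lintegral_add_left]
        · rfl
        · exact hm.comp hΘw
    _ ≤ 3 * (D * δ ^ 2 + δ ^ 2 + δ ^ 2) := by
        gcongr
        exact (hD w hw _ hm).trans (by gcongr)
    _ = 3 * ((D + 1) * δ ^ 2 + δ ^ 2) := by ring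
    _ ≤ ε := hδ

/-- Cauchy–Schwarz for the measure with density `f`. -/
theorem ENNReal_lintegral_mul_sq_le {μ : Measure (Pt m)} {f g : Pt m → ℝ≥0∞} (hf : Measurable f)
    (hg : Measurable g) :
    (∫⁻ w, f w * g w ∂μ) ^ 2 ≤ (∫⁻ w, f w ∂μ) * ∫⁻ w, f w * g w ^ 2 ∂μ := by
  have h := ENNReal.lintegral_mul_le_Lp_mul_Lq μ (f := fun w => f w ^ (1 / 2 : ℝ))
    (g := fun w => f w ^ (1 / 2 : ℝ) * g w) Real.HolderConjugate.two_two
    (hf.pow_const _).aemeasurable ((hf.pow_const _).mul hg).aemeasurable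
  have e1 : ∀ w, f w ^ (1 / 2 : ℝ) * (f w ^ (1 / 2 : ℝ) * g w) = f w * g w := fun w => by
    rw [← mul_assoc, ← ENNReal.rpow_add_of_nonneg _ _ (by norm_num) (by norm_num)]
    norm_num
  have e2 : ∀ w, (f w ^ (1 / 2 : ℝ)) ^ (2 : ℝ) = f w := fun w => by
    rw [← ENNReal.rpow_mul]; norm_num
  have e3 : ∀ w, (f w ^ (1 / 2 : ℝ) * g w) ^ (2 : ℝ) = f w * g w ^ 2 := fun w => by
    rw [ENNReal.mul_rpow_of_nonneg _ _ (by norm_num), e2, ENNReal.rpow_two]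
  simp only [Pi.mul_apply, e1, e2, e3] at h
  have h2 := pow_le_pow_left' h 2
  rw [mul_pow, ← ENNReal.rpow_natCast (_ ^ (1 / 2 : ℝ)), ← ENNReal.rpow_mul,
    ← ENNReal.rpow_natCast (_ ^ (1 / 2 : ℝ)), ← ENNReal.rpow_mul] at h2
  simpa using h2

/-- Averages of `v ∘ Θ w` over small `w` are close to `v` in `L²`. -/
theorem lintegral_average_sq_le {Θ : Pt m → Pt m → Pt m} (hΘ : NearIdentity Θ) {v : Pt m → ℝ}
    (hv : Measurable v) {k : Pt m → ℝ≥0∞} (hk : Measurable k) {δ : ℝ≥0∞}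
    (hδ : ∀ w, k w ≠ 0 → shiftDist Θ v w ≤ δ) :
    ∫⁻ z, (∫⁻ w, k w * ‖v (Θ w z) - v z‖ₑ) ^ 2 ≤ (∫⁻ w, k w) ^ 2 * δ := by
  have hm : Measurable fun p : Pt m × Pt m => ‖v (Θ p.2 p.1) - v p.1‖ₑ :=
    ((hv.comp (hΘ.continuous.measurable.comp measurable_swap)).sub
      (hv.comp measurable_fst)).enorm
  calc ∫⁻ z, (∫⁻ w, k w * ‖v (Θ w z) - v z‖ₑ) ^ 2
      ≤ ∫⁻ z, (∫⁻ w, k w) * ∫⁻ w, k w * ‖v (Θ w z) - v z‖ₑ ^ 2 :=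
        lintegral_mono fun z => ENNReal_lintegral_mul_sq_le hk (hm.comp measurable_prodMk_left)
    _ = (∫⁻ w, k w) * ∫⁻ z, ∫⁻ w, k w * ‖v (Θ w z) - v z‖ₑ ^ 2 := by
        refine lintegral_const_mul _ ?_
        exact Measurable.lintegral_prod_right' (f := fun p : Pt m × Pt m =>
          k p.2 * ‖v (Θ p.2 p.1) - v p.1‖ₑ ^ 2) ((hk.comp measurable_snd).mul (hm.pow_const 2))
    _ = (∫⁻ w, k w) * ∫⁻ w, ∫⁻ z, k w * ‖v (Θ w z) - v z‖ₑ ^ 2 := by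
        congr 1
        exact lintegral_lintegral_swap
          ((hk.comp measurable_snd).mul (hm.pow_const 2)).aemeasurable
    _ ≤ (∫⁻ w, k w) * ∫⁻ w, k w * δ := by
        gcongr with w
        rw [lintegral_const_mul]
        · by_cases h : k w = 0
          · simp [h]
          · gcongr
            exact hδ w h
        · exact (hm.comp measurable_prodMk_right).pow_const 2
    _ = _ := by
        rw [lintegral_mul_const _ hk]; ring

/-! ### The integral inequality against the parametrix -/

/-- `v ≥ 0`, supported in `U`, satisfies
`∑ ∂_i (a_ij ∂_j v) + Y v ≥ H` weakly in `U`, where `Dv = D_{m₀} v`. -/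
structure LocalIneq (B : Matrix (Idx m) (Idx m) ℝ) (a : Pt m → Matrix (Fin (m 0)) (Fin (m 0)) ℝ)
    (U : Set (Pt m)) (v : Pt m → ℝ) (Dv : Pt m → Grad m) (H : Pt m → ℝ) : Prop where
  nonneg : ∀ z, 0 ≤ v z
  meas : Measurable v
  meas_grad : Measurable Dv
  meas_rhs : Measurable H
  memLp : MemLp v 2
  memLp_grad : MemLp Dv 2
  integrable : Integrable H
  eq_zero : ∀ z ∉ U, v z = 0 ∧ Dv z = 0 ∧ H z = 0
  grad_eq : ∀ φ : Pt m → ℝ, IsTest U φ → ∀ i, ∫ z, v z * gradD φ z i = -∫ z, Dv z i * φ z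
  ineq : ∀ φ : Pt m → ℝ, IsTest U φ → (∀ z, 0 ≤ φ z) →
    ∫ z, φ z * H z ≤ (∫ z, v z * (-fieldY B φ z - B.trace * φ z)) -
      ∫ z, ∑ i, ∑ j, Dv z i * a z i j * gradD φ z j

/-- A cut-off function adapted to `U` and the times before `t₀`. -/
structure Cutoff (B : Matrix (Idx m) (Idx m) ℝ) (U : Set (Pt m)) (t₀ L : ℝ) (χ : Pt m → ℝ) :
    Prop where
  smooth : ContDiff ℝ ∞ χ
  nonneg : ∀ z, 0 ≤ χ z
  le_one : ∀ z, χ z ≤ 1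
  grad_le : ∀ z i, |gradD χ z i| ≤ L
  fieldY_le : ∀ z, |fieldY B χ z| ≤ L
  compact : HasCompactSupport χ
  subset : ∀ z ∈ tsupport χ, z.2 < t₀ → z ∈ U
  time : ∀ z ∈ U, t₀ - z.2 ≤ 1

theorem gradD_mul {φ ψ : Pt m → ℝ} (hφ : Differentiable ℝ φ) (hψ : Differentiable ℝ ψ) (z : Pt m)
    (i : Fin (m 0)) : gradD (fun z => φ z * ψ z) z i = φ z * gradD ψ z i + ψ z * gradD φ z i := by
  simp only [gradD]
  rw [fderiv_fun_mul (hφ z) (hψ z)]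
  simp [smul_eq_mul]

theorem fieldY_mul (B : Matrix (Idx m) (Idx m) ℝ) {φ ψ : Pt m → ℝ} (hφ : Differentiable ℝ φ)
    (hψ : Differentiable ℝ ψ) (z : Pt m) :
    fieldY B (fun z => φ z * ψ z) z = φ z * fieldY B ψ z + ψ z * fieldY B φ z := by
  simp only [fieldY_eq]
  rw [fderiv_fun_mul (hφ z) (hψ z)]
  simp [smul_eq_mul]

theorem continuous_gradD {φ : Pt m → ℝ} (hφ : ContDiff ℝ ∞ φ) (i : Fin (m 0)) :
    Continuous fun z => gradD φ z i :=
  (hφ.continuous_fderiv (by simp)).clm_apply continuous_const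

theorem continuous_fieldY (B : Matrix (Idx m) (Idx m) ℝ) {φ : Pt m → ℝ} (hφ : ContDiff ℝ ∞ φ) :
    Continuous fun z => fieldY B φ z := by
  simp only [fieldY_eq]
  refine (hφ.continuous_fderiv (by simp)).clm_apply ?_
  unfold yVec
  refine Continuous.prodMk ?_ continuous_const
  exact Continuous.matrix_mulVec continuous_const continuous_fst

theorem hasCompactSupport_gradD {φ : Pt m → ℝ} (hφ : HasCompactSupport φ) (i : Fin (m 0)) :
    HasCompactSupport fun z => gradD φ z i :=
  (hφ.fderiv (𝕜 := ℝ)).mono fun z hz h => hz (by simp [gradD, h])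

theorem hasCompactSupport_fieldY (B : Matrix (Idx m) (Idx m) ℝ) {φ : Pt m → ℝ}
    (hφ : HasCompactSupport φ) : HasCompactSupport fun z => fieldY B φ z :=
  (hφ.fderiv (𝕜 := ℝ)).mono fun z hz h => hz (by simp [fieldY_eq, h])

theorem integrable_mul_of_hasCompactSupport {v φ : Pt m → ℝ} (hv : LocallyIntegrable v)
    (hφ : Continuous φ) (hc : HasCompactSupport φ) : Integrable fun z => v z * φ z := by
  have := hv.integrable_smul_left_of_hasCompactSupport hφ hc
  simpa [mul_comm] using this

/-- The product of the cut-off and a function of the past of `z` is a test function. -/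
theorem Cutoff.isTest {B : Matrix (Idx m) (Idx m) ℝ} {U : Set (Pt m)} {t₀ L : ℝ} {χ : Pt m → ℝ}
    (hχ : Cutoff B U t₀ L χ) {Ψ : Pt m → ℝ} (hΨ : ContDiff ℝ ∞ Ψ) {ε : ℝ} (hε : 0 < ε)
    (h0 : ∀ w : Pt m, -w.2 ≤ ε → Ψ w = 0) {z : Pt m} (hz : z.2 ≤ t₀) :
    IsTest U fun ζ => χ ζ * Ψ (groupMul B (groupInv B z) ζ) where
  smooth := hχ.smooth.mul (hΨ.comp (contDiff_groupMul_left B _))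
  compact := hχ.compact.mul_right
  subset := by
    intro ζ hζ
    have h1 : ζ ∈ tsupport χ := closure_mono (Function.support_mul_subset_left _ _) hζ
    have h2 : ζ ∈ {ζ : Pt m | ζ.2 ≤ z.2 - ε} := by
      -- `Ψ` vanishes at ages up to `ε`, so the product is supported at times at most `z.2 - ε <
      -- t₀`. For this reason the cut-off need not vanish near the top `t = t₀` of the truncated
      -- ball.
      have hcl : IsClosed {ζ : Pt m | ζ.2 ≤ z.2 - ε} :=
        isClosed_le continuous_snd continuous_const
      refine closure_minimal ?_ hcl hζ
      intro ζ hζ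
      by_contra hne
      have : ¬ (ζ.2 ≤ z.2 - ε) := hne
      refine hζ ?_
      change χ ζ * Ψ (groupMul B (groupInv B z) ζ) = 0
      rw [h0 _ (by rw [relPos_snd]; linarith), mul_zero]
    have h3 : ζ.2 ≤ z.2 - ε := h2
    exact hχ.subset ζ h1 (by linarith)

/-- The inequality tested with `χ Ψ(z⁻¹ ∘ ·)` produces `-v χ div J`, and the definition of `Dv`
tested with `χ J_a(z⁻¹ ∘ ·)` produces `+v χ div J`. Their sum involves only `Ψ`, `DΨ`, `J`, `e` and
derivatives of `χ`, all with integrable bounds. The bound on `a` is its only property used. -/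
theorem lintegral_mul_parametrix_le {B : Matrix (Idx m) (Idx m) ℝ}
    {a : Pt m → Matrix (Fin (m 0)) (Fin (m 0)) ℝ} {U : Set (Pt m)} {v : Pt m → ℝ}
    {Dv : Pt m → Grad m} {H : Pt m → ℝ} (hv : LocalIneq B a U v Dv H)
    {A : ℝ} (hA0 : 0 ≤ A) (hAm : ∀ i j, AEStronglyMeasurable (fun z => a z i j) volume)
    (hA : ∀ᵐ z, ∀ i j, |a z i j| ≤ A)
    {t₀ L : ℝ} (hL : 1 ≤ L) {χ : Pt m → ℝ} (hχ : Cutoff B U t₀ L χ)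
    {ε C : ℝ} (hε : 0 < ε) (hC : 0 ≤ C) {Ψ : Pt m → ℝ} {J : Fin (m 0) → Pt m → ℝ}
    {k e κ₁ κ₂ : Pt m → ℝ} (hκ₁ : ∀ w, 0 ≤ κ₁ w)
    (hΨ : ContDiff ℝ ∞ Ψ) (hJ : ∀ a, ContDiff ℝ ∞ (J a)) (hk : ContDiff ℝ ∞ k)
    (hY : ∀ w, fieldY B Ψ w = ∑ a, gradD (J a) w a + k w + e w)
    (hΨ0 : ∀ w, 0 ≤ Ψ w) (hk0 : ∀ w, 0 ≤ k w)
    (hpast : ∀ w : Pt m, -w.2 ≤ ε → Ψ w = 0 ∧ (∀ a, J a w = 0) ∧ k w = 0 ∧ e w = 0)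
    (hbd : ∀ w : Pt m, -w.2 ≤ 1 → Ψ w ≤ C * κ₁ w ∧ Ψ w ≤ C * κ₂ w ∧ |e w| ≤ C * κ₁ w ∧
      (∀ a, |J a w| ≤ C * κ₁ w) ∧ ∀ a, |gradD Ψ w a| ≤ C * κ₁ w) {z : Pt m} (hz : z.2 ≤ t₀) :
    ∫⁻ ζ, ENNReal.ofReal (v ζ * χ ζ * k (groupMul B (groupInv B z) ζ)) ≤
      ∫⁻ ζ, ENNReal.ofReal
        (C * (2 + |B.trace| + m 0 + m 0 * m 0 * (2 * A)) * L * κ₁ (groupMul B (groupInv B z) ζ) *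
            (v ζ + ‖Dv ζ‖) +
          C * κ₂ (groupMul B (groupInv B z) ζ) * (χ ζ * |H ζ|)) := by
  obtain ⟨g, hg⟩ : ∃ g, g = groupMul B (groupInv B z) := ⟨_, rfl⟩
  have hgc : Continuous g := hg ▸ continuous_groupMul_left B _
  have hvl : LocallyIntegrable v := hv.memLp.locallyIntegrable (by norm_num)
  have hDl : ∀ i, LocallyIntegrable fun z => Dv z i := fun i => by
    refine (hv.memLp_grad.locallyIntegrable (by norm_num)).mono
      ((EuclideanSpace.proj (𝕜 := ℝ) i).continuous.measurable.comp hv.meas_grad).aestronglyMeasurable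
      (Filter.Eventually.of_forall fun z => PiLp.norm_apply_le _ i)
  have hDal : ∀ i j, LocallyIntegrable fun z => Dv z i * a z i j := fun i j => by
    refine ((hDl i).smul A).mono ((hDl i).aestronglyMeasurable.mul (hAm i j)) ?_
    filter_upwards [hA] with z hz
    simp only [Pi.smul_apply, smul_eq_mul, norm_mul, Real.norm_eq_abs, abs_of_nonneg hA0]
    rw [mul_comm]
    gcongr
    exact hz i j
  set φ : Pt m → ℝ := fun ζ => χ ζ * Ψ (g ζ) with hφd
  have hφ : IsTest U φ := by
    rw [hφd, hg]; exact hχ.isTest hΨ hε (fun w hw => (hpast w hw).1) hz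
  have hη : ∀ a, IsTest U fun ζ => χ ζ * J a (g ζ) := fun a => by
    rw [hg]; exact hχ.isTest (hJ a) hε (fun w hw => (hpast w hw).2.1 a) hz
  have hχd : Differentiable ℝ χ := hχ.smooth.differentiable (by simp)
  have hcomp : ∀ {F : Pt m → ℝ}, ContDiff ℝ ∞ F → Differentiable ℝ fun ζ => F (g ζ) := fun hF => by
    rw [hg]; exact (hF.comp (contDiff_groupMul_left B _)).differentiable (by simp)
  have eφD : ∀ ζ j, gradD φ ζ j = χ ζ * gradD Ψ (g ζ) j + Ψ (g ζ) * gradD χ ζ j := fun ζ j => by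
    rw [hφd, gradD_mul hχd (hcomp hΨ), hg, gradD_comp_groupMul B (hΨ.differentiable (by simp))]
  have eφY : ∀ ζ, fieldY B φ ζ = χ ζ * fieldY B Ψ (g ζ) + Ψ (g ζ) * fieldY B χ ζ := fun ζ => by
    rw [hφd, fieldY_mul B hχd (hcomp hΨ), hg, fieldY_comp_groupMul B (hΨ.differentiable (by simp))]
  have eηD : ∀ a ζ, gradD (fun ζ => χ ζ * J a (g ζ)) ζ a =
      χ ζ * gradD (J a) (g ζ) a + J a (g ζ) * gradD χ ζ a := fun a ζ => by
    rw [gradD_mul hχd (hcomp (hJ a)), hg, gradD_comp_groupMul B ((hJ a).differentiable (by simp))]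
  have i1 : Integrable fun ζ => v ζ * (-fieldY B φ ζ - B.trace * φ ζ) := by
    refine integrable_mul_of_hasCompactSupport hvl ?_ ?_
    · exact (continuous_fieldY B hφ.smooth).neg.sub (continuous_const.mul hφ.smooth.continuous)
    · exact (hasCompactSupport_fieldY B hφ.compact).neg.sub hφ.compact.mul_left
  have i2 : Integrable fun ζ => ∑ i, ∑ j, Dv ζ i * a ζ i j * gradD φ ζ j :=
    integrable_finsetSum _ fun i _ => integrable_finsetSum _ fun j _ =>
      integrable_mul_of_hasCompactSupport (hDal i j) (continuous_gradD hφ.smooth j)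
        (hasCompactSupport_gradD hφ.compact j)
  have i3 : ∀ a, Integrable fun ζ => v ζ * gradD (fun ζ => χ ζ * J a (g ζ)) ζ a := fun a =>
    integrable_mul_of_hasCompactSupport hvl (continuous_gradD (hη a).smooth a)
      (hasCompactSupport_gradD (hη a).compact a)
  have i4 : ∀ a, Integrable fun ζ => Dv ζ a * (χ ζ * J a (g ζ)) := fun a =>
    integrable_mul_of_hasCompactSupport (hDl a) (hη a).smooth.continuous (hη a).compact
  have i5 : Integrable fun ζ => φ ζ * H ζ := by
    simpa [mul_comm] using integrable_mul_of_hasCompactSupport hv.integrable.locallyIntegrable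
      hφ.smooth.continuous hφ.compact
  have i6 : Integrable fun ζ => v ζ * χ ζ * k (g ζ) := by
    have := integrable_mul_of_hasCompactSupport hvl (φ := fun ζ => χ ζ * k (g ζ))
      (hχ.smooth.continuous.mul (hk.continuous.comp hgc)) hχ.compact.mul_right
    simpa [mul_assoc] using this
  have i34 : ∀ a, Integrable fun ζ => v ζ * gradD (fun ζ => χ ζ * J a (g ζ)) ζ a +
      Dv ζ a * (χ ζ * J a (g ζ)) := fun a => (i3 a).add (i4 a)
  have hmain := hv.ineq φ hφ fun ζ => mul_nonneg (hχ.nonneg ζ) (hΨ0 _)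
  have hgr : ∀ a, ∫ ζ, (v ζ * gradD (fun ζ => χ ζ * J a (g ζ)) ζ a +
      Dv ζ a * (χ ζ * J a (g ζ))) = 0 := fun a => by
    rw [integral_add (i3 a) (i4 a), hv.grad_eq _ (hη a) a]; ring
  -- Adding `v χ k` makes the terms `div J` and `k` disappear from `E` pointwise (`hEe`), while the
  -- tested inequality says that the rest of `E` has non-negative integral (`hPE`).
  set E : Pt m → ℝ := fun ζ => v ζ * (-fieldY B φ ζ - B.trace * φ ζ) -
    (∑ i, ∑ j, Dv ζ i * a ζ i j * gradD φ ζ j) +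
    (∑ a, (v ζ * gradD (fun ζ => χ ζ * J a (g ζ)) ζ a + Dv ζ a * (χ ζ * J a (g ζ)))) -
    φ ζ * H ζ + v ζ * χ ζ * k (g ζ) with hE
  have i7 : Integrable E :=
    (((i1.sub i2).add (integrable_finsetSum _ fun a _ => i34 a)).sub i5).add i6
  have hPE : ∫ ζ, v ζ * χ ζ * k (g ζ) ≤ ∫ ζ, E ζ := by
    have i8 := (i1.sub i2).add (integrable_finsetSum Finset.univ fun a _ => i34 a)
    have : ∫ ζ, E ζ = (∫ ζ, v ζ * (-fieldY B φ ζ - B.trace * φ ζ)) -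
        (∫ ζ, ∑ i, ∑ j, Dv ζ i * a ζ i j * gradD φ ζ j) + 0 - (∫ ζ, φ ζ * H ζ) +
        ∫ ζ, v ζ * χ ζ * k (g ζ) := by
      have e0 : ∫ ζ, (∑ a, (v ζ * gradD (fun ζ => χ ζ * J a (g ζ)) ζ a +
          Dv ζ a * (χ ζ * J a (g ζ)))) = 0 := by
        rw [integral_finsetSum _ fun a _ => i34 a]
        exact Finset.sum_eq_zero fun a _ => hgr a
      rw [← e0, ← integral_sub i1 i2]
      have s1 := integral_add (i1.sub i2)
        (integrable_finsetSum Finset.univ fun a _ => i34 a)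
      have s2 := integral_sub i8 i5
      have s3 := integral_add (i8.sub i5) i6
      simp only [Pi.add_apply, Pi.sub_apply] at s1 s2 s3
      rw [hE, s3, s2, s1]
    rw [this]; linarith
  have hptw : ∀ᵐ ζ, |E ζ| ≤
      C * (2 + |B.trace| + m 0 + m 0 * m 0 * (2 * A)) * L * κ₁ (g ζ) * (v ζ + ‖Dv ζ‖) +
        C * κ₂ (g ζ) * (χ ζ * |H ζ|) := by
    filter_upwards [hA] with ζ hAζ
    by_cases hU : ζ ∈ U
    swap
    · obtain ⟨h1, h2, h3⟩ := hv.eq_zero ζ hU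
      simp [hE, h1, h2, h3]
    have ht : -(g ζ).2 ≤ 1 := by
      rw [hg, relPos_snd]; linarith [hχ.time ζ hU]
    obtain ⟨b1, b2, b3, b4, b5⟩ := hbd _ ht
    have hχ0 := hχ.nonneg ζ
    have hχ1 := hχ.le_one ζ
    have hv0 := hv.nonneg ζ
    have hK : 0 ≤ C * κ₁ (g ζ) := mul_nonneg hC (hκ₁ _)
    have hEe : E ζ = v ζ * (-(Ψ (g ζ) * fieldY B χ ζ) - χ ζ * e (g ζ) -
          B.trace * (χ ζ * Ψ (g ζ)) + ∑ a, J a (g ζ) * gradD χ ζ a) +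
        (∑ a, Dv ζ a * (χ ζ * J a (g ζ))) -
        (∑ i, ∑ j, Dv ζ i * a ζ i j * (χ ζ * gradD Ψ (g ζ) j + Ψ (g ζ) * gradD χ ζ j)) -
        χ ζ * Ψ (g ζ) * H ζ := by
      have e1 : ∑ a, (v ζ * gradD (fun ζ => χ ζ * J a (g ζ)) ζ a + Dv ζ a * (χ ζ * J a (g ζ))) =
          v ζ * (χ ζ * ∑ a, gradD (J a) (g ζ) a + ∑ a, J a (g ζ) * gradD χ ζ a) +
            ∑ a, Dv ζ a * (χ ζ * J a (g ζ)) := by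
        simp only [eηD, Finset.sum_add_distrib, mul_add, Finset.mul_sum]
      have e2 : φ ζ = χ ζ * Ψ (g ζ) := rfl
      simp only [hE]
      rw [e1, eφY, hY, e2]
      simp only [eφD]
      ring
    have hDi : ∀ i, |Dv ζ i| ≤ ‖Dv ζ‖ := fun i => PiLp.norm_apply_le (Dv ζ) i
    have hΨz := hΨ0 (g ζ)
    have hKL : 1 * (C * κ₁ (g ζ)) ≤ C * κ₁ (g ζ) * L := by
      rw [one_mul]; exact le_mul_of_one_le_right hK hL
    have n1 : |∑ a, J a (g ζ) * gradD χ ζ a| ≤ m 0 * (C * κ₁ (g ζ) * L) := by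
      refine (Finset.abs_sum_le_sum_abs _ _).trans ?_
      refine (Finset.sum_le_card_nsmul _ _ (C * κ₁ (g ζ) * L) fun a _ => ?_).trans (by simp)
      rw [abs_mul]
      exact mul_le_mul (b4 a) (hχ.grad_le ζ a) (abs_nonneg _) hK
    have n2 : |∑ a, Dv ζ a * (χ ζ * J a (g ζ))| ≤ m 0 * (‖Dv ζ‖ * (C * κ₁ (g ζ))) := by
      refine (Finset.abs_sum_le_sum_abs _ _).trans ?_
      refine (Finset.sum_le_card_nsmul _ _ (‖Dv ζ‖ * (C * κ₁ (g ζ))) fun a _ => ?_).trans (by simp)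
      rw [abs_mul, abs_mul, abs_of_nonneg hχ0]
      refine mul_le_mul (hDi a) ?_ (by positivity) (norm_nonneg _)
      exact (mul_le_of_le_one_left (abs_nonneg _) hχ1).trans (b4 a)
    have n3 : |∑ i, ∑ j, Dv ζ i * a ζ i j * (χ ζ * gradD Ψ (g ζ) j + Ψ (g ζ) * gradD χ ζ j)| ≤
        m 0 * (m 0 * (‖Dv ζ‖ * A * (C * κ₁ (g ζ) * (2 * L)))) := by
      refine (Finset.abs_sum_le_sum_abs _ _).trans ?_
      refine (Finset.sum_le_card_nsmul _ _
        (m 0 * (‖Dv ζ‖ * A * (C * κ₁ (g ζ) * (2 * L)))) fun i _ => ?_).trans (by simp)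
      refine (Finset.abs_sum_le_sum_abs _ _).trans ?_
      refine (Finset.sum_le_card_nsmul _ _
        (‖Dv ζ‖ * A * (C * κ₁ (g ζ) * (2 * L))) fun j _ => ?_).trans (by simp)
      rw [abs_mul, abs_mul]
      refine mul_le_mul (mul_le_mul (hDi i) (hAζ i j) (abs_nonneg _) (norm_nonneg _)) ?_
        (abs_nonneg _) (by positivity)
      calc |χ ζ * gradD Ψ (g ζ) j + Ψ (g ζ) * gradD χ ζ j|
          ≤ |χ ζ * gradD Ψ (g ζ) j| + |Ψ (g ζ) * gradD χ ζ j| := abs_add_le _ _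
        _ ≤ 1 * (C * κ₁ (g ζ)) + C * κ₁ (g ζ) * L := by
            rw [abs_mul, abs_mul, abs_of_nonneg hχ0, abs_of_nonneg (hΨ0 _)]
            gcongr
            · exact b5 j
            · exact hχ.grad_le ζ j
        _ ≤ C * κ₁ (g ζ) * (2 * L) := by nlinarith
    have n4 : |-(Ψ (g ζ) * fieldY B χ ζ) - χ ζ * e (g ζ) - B.trace * (χ ζ * Ψ (g ζ))| ≤
        C * κ₁ (g ζ) * L * (2 + |B.trace|) := by
      have q1 : |Ψ (g ζ) * fieldY B χ ζ| ≤ C * κ₁ (g ζ) * L := by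
        rw [abs_mul, abs_of_nonneg (hΨ0 _)]
        exact mul_le_mul b1 (hχ.fieldY_le ζ) (abs_nonneg _) hK
      have q2 : |χ ζ * e (g ζ)| ≤ C * κ₁ (g ζ) * L := by
        rw [abs_mul, abs_of_nonneg hχ0]
        calc χ ζ * |e (g ζ)| ≤ 1 * (C * κ₁ (g ζ)) := by gcongr
          _ ≤ _ := hKL
      have q3 : |B.trace * (χ ζ * Ψ (g ζ))| ≤ |B.trace| * (C * κ₁ (g ζ) * L) := by
        rw [abs_mul, abs_mul, abs_of_nonneg hχ0, abs_of_nonneg (hΨ0 _)]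
        refine mul_le_mul_of_nonneg_left ?_ (abs_nonneg _)
        calc χ ζ * Ψ (g ζ) ≤ 1 * (C * κ₁ (g ζ)) := by gcongr
          _ ≤ _ := hKL
      have := abs_le.1 q1
      have := abs_le.1 q2
      have := abs_le.1 q3
      rw [abs_le]
      constructor <;> linarith
    have n5 : |χ ζ * Ψ (g ζ) * H ζ| ≤ C * κ₂ (g ζ) * (χ ζ * |H ζ|) := by
      rw [abs_mul, abs_mul, abs_of_nonneg hχ0, abs_of_nonneg (hΨ0 _)]
      calc χ ζ * Ψ (g ζ) * |H ζ| = Ψ (g ζ) * (χ ζ * |H ζ|) := by ring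
        _ ≤ _ := mul_le_mul_of_nonneg_right b2 (mul_nonneg hχ0 (abs_nonneg _))
    have n6 : |v ζ * (-(Ψ (g ζ) * fieldY B χ ζ) - χ ζ * e (g ζ) -
          B.trace * (χ ζ * Ψ (g ζ)) + ∑ a, J a (g ζ) * gradD χ ζ a)| ≤
        v ζ * (C * κ₁ (g ζ) * L * (2 + |B.trace|) + m 0 * (C * κ₁ (g ζ) * L)) := by
      rw [abs_mul, abs_of_nonneg hv0]
      gcongr
      exact (abs_add_le _ _).trans (add_le_add n4 n1)
    have hm0 : (0 : ℝ) ≤ m 0 := by positivity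
    have hsum : |E ζ| ≤ v ζ * (C * κ₁ (g ζ) * L * (2 + |B.trace|) + m 0 * (C * κ₁ (g ζ) * L)) +
        m 0 * (‖Dv ζ‖ * (C * κ₁ (g ζ))) + m 0 * (m 0 * (‖Dv ζ‖ * A * (C * κ₁ (g ζ) * (2 * L)))) +
        C * κ₂ (g ζ) * (χ ζ * |H ζ|) := by
      rw [hEe]
      refine (abs_sub _ _).trans (add_le_add ((abs_sub _ _).trans (add_le_add
        ((abs_add_le _ _).trans (add_le_add n6 n2)) n3)) n5)
    refine hsum.trans ?_
    have hD0 := norm_nonneg (Dv ζ)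
    have hT := abs_nonneg B.trace
    have hL0 : 0 ≤ L := by linarith
    have r1 : m 0 * (‖Dv ζ‖ * (C * κ₁ (g ζ))) ≤ m 0 * (‖Dv ζ‖ * (C * κ₁ (g ζ))) * L :=
      le_mul_of_one_le_right (by positivity) hL
    have r2 : 0 ≤ C * κ₁ (g ζ) * L * (2 + |B.trace|) * ‖Dv ζ‖ := by positivity
    have r3 : 0 ≤ C * κ₁ (g ζ) * L * (m 0 * m 0 * (2 * A)) * v ζ := by positivity
    nlinarith
  calc ∫⁻ ζ, ENNReal.ofReal (v ζ * χ ζ * k (groupMul B (groupInv B z) ζ))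
      = ENNReal.ofReal (∫ ζ, v ζ * χ ζ * k (g ζ)) := by
        rw [← hg, ofReal_integral_eq_lintegral_ofReal i6]
        exact Filter.Eventually.of_forall fun ζ =>
          mul_nonneg (mul_nonneg (hv.nonneg ζ) (hχ.nonneg ζ)) (hk0 _)
    _ ≤ ENNReal.ofReal (∫ ζ, |E ζ|) :=
        ENNReal.ofReal_le_ofReal (hPE.trans (integral_mono i7 i7.abs fun ζ => le_abs_self _))
    _ = ∫⁻ ζ, ENNReal.ofReal |E ζ| :=
        ofReal_integral_eq_lintegral_ofReal i7.abs (Filter.Eventually.of_forall fun _ => abs_nonneg _)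
    _ ≤ _ := by
        rw [← hg]
        exact lintegral_mono_ae (hptw.mono fun ζ h => ENNReal.ofReal_le_ofReal h)

/-! ### The pointwise bound by potentials -/

theorem regKer_ne_top (R e : ℝ) (w : Pt m) : regKer R e w ≠ ⊤ := by
  unfold regKer
  by_cases h : w ∈ region R <;> simp [h]

theorem regKer_mono {R e e' : ℝ} (h : e ≤ e') {w : Pt m} (hw : -w.2 ≤ 1) :
    regKer R e w ≤ regKer R e' w := by
  unfold regKer
  by_cases hR : w ∈ region R
  · rw [Set.indicator_of_mem hR, Set.indicator_of_mem hR]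
    exact ENNReal.ofReal_le_ofReal
      (Real.rpow_le_rpow_of_exponent_ge hR.1 hw (neg_le_neg h))
  · simp [hR]

theorem le_mul_toReal_regKer {R e C x : ℝ} (hC : 0 ≤ C) {w : Pt m}
    (h : ENNReal.ofReal x ≤ ENNReal.ofReal C * regKer R e w) : x ≤ C * (regKer R e w).toReal := by
  rw [← ENNReal.ofReal_toReal (regKer_ne_top R e w), ← ENNReal.ofReal_mul hC,
    ENNReal.ofReal_le_ofReal_iff (by positivity)] at h
  exact h

theorem norm_le_of_mem_region {R ε : ℝ} (hR : 0 < R) (hε1 : ε ≤ 1) {w : Pt m}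
    (hw : w ∈ region R) (hwε : -w.2 ≤ ε) : ‖w‖ ≤ (R + 1) * √ε := by
  have h0 : 0 < ε := hw.1.trans_le hwε
  have hs1 : √ε ≤ 1 := Real.sqrt_le_one.2 hε1
  have hs0 := Real.sqrt_nonneg ε
  refine max_le ((pi_norm_le_iff_of_nonneg (by positivity)).2 fun i => ?_) ?_
  · calc ‖w.1 i‖ ≤ R * √(-w.2) ^ weight i := hw.2 i
      _ ≤ R * √ε ^ weight i := by gcongr
      _ ≤ R * √ε ^ 1 := by
          gcongr R * ?_
          exact pow_le_pow_of_le_one hs0 hs1 (by simp [weight])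
      _ ≤ (R + 1) * √ε := by nlinarith
  · rw [Real.norm_eq_abs, abs_of_neg (by have := hw.1; linarith)]
    calc -w.2 ≤ ε := hwε
      _ = √ε * √ε := (Real.mul_self_sqrt h0.le).symm
      _ ≤ _ := by nlinarith

/-- At scale `ε` the average of `χ v` against `k`, of mass at least `c`, is bounded by potentials
that do not depend on `ε`. Averages converge to `χ v` in `L²` after division by the mass, so the
inequality survives almost everywhere in the limit, with the constant divided by `c`. -/
theorem pointwise_bound {B : Matrix (Idx m) (Idx m) ℝ} (hB : DriftStructure B) {A : ℝ}
    (hA0 : 0 ≤ A) : ∃ R C : ℝ, 0 < R ∧ 0 < C ∧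
    ∀ (a : Pt m → Matrix (Fin (m 0)) (Fin (m 0)) ℝ),
      (∀ i j, AEStronglyMeasurable (fun z => a z i j) volume) → (∀ᵐ z, ∀ i j, |a z i j| ≤ A) →
    ∀ (U : Set (Pt m)) (v : Pt m → ℝ) (Dv : Pt m → Grad m) (H : Pt m → ℝ),
      LocalIneq B a U v Dv H →
    ∀ (t₀ L : ℝ) (χ : Pt m → ℝ), 1 ≤ L → Cutoff B U t₀ L χ → (∀ z ∈ U, z.2 ≤ t₀) →
      ∀ᵐ z, ENNReal.ofReal (χ z * v z) ≤
        ENNReal.ofReal (C * L) * kerOp volume (grpKer B R (((homDim m : ℝ) + 1) / 2))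
          (fun ζ => ENNReal.ofReal (v ζ + ‖Dv ζ‖)) z +
        ENNReal.ofReal C * kerOp volume (grpKer B R ((homDim m : ℝ) / 2))
          (fun ζ => ENNReal.ofReal (χ ζ * |H ζ|)) z := by
  obtain ⟨R, c, C, hR, hc, hC, hpar⟩ := exists_parametrix hB
  set K : ℝ := 2 + |B.trace| + m 0 + m 0 * m 0 * (2 * A) with hK
  have hm0 : (0 : ℝ) ≤ m 0 := by positivity
  have hK1 : 1 ≤ K := by
    have := abs_nonneg B.trace
    have : 0 ≤ (m 0 : ℝ) * m 0 * (2 * A) := by positivity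
    rw [hK]; linarith
  have hcE : ENNReal.ofReal c ≠ 0 := by simpa using hc
  refine ⟨R, C * K / c, hR, by positivity, ?_⟩
  intro a ham ha U v Dv H hv t₀ L χ hL hχ hU
  set Q : ℝ := (homDim m : ℝ) with hQ
  set f₁ : Pt m → ℝ≥0∞ := fun ζ => ENNReal.ofReal (v ζ + ‖Dv ζ‖) with hf₁
  set f₂ : Pt m → ℝ≥0∞ := fun ζ => ENNReal.ofReal (χ ζ * |H ζ|) with hf₂
  have hf₁m : Measurable f₁ := (hv.meas.add hv.meas_grad.norm).ennreal_ofReal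
  have hf₂m : Measurable f₂ :=
    (hχ.smooth.continuous.measurable.mul (by simpa using hv.meas_rhs.norm)).ennreal_ofReal
  obtain ⟨F, hF⟩ : ∃ F : Pt m → ℝ≥0∞, F = fun z => ENNReal.ofReal (C * K * L) *
    kerOp volume (grpKer B R ((Q + 1) / 2)) f₁ z +
    ENNReal.ofReal C * kerOp volume (grpKer B R (Q / 2)) f₂ z := ⟨_, rfl⟩
  have hKm : ∀ e z, Measurable (grpKer B R e z) := fun e z =>
    Measurable.of_uncurry_left (measurable_grpKer B R e)
  have hFm : Measurable F := hF ▸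
    ((measurable_kerOp (measurable_grpKer B R _) hf₁m.aemeasurable).const_mul _).add
      ((measurable_kerOp (measurable_grpKer B R _) hf₂m.aemeasurable).const_mul _)
  set y : Pt m → ℝ := fun z => v z * χ z with hy
  have hym : Measurable y := hv.meas.mul hχ.smooth.continuous.measurable
  have hy0 : ∀ z, 0 ≤ y z := fun z => mul_nonneg (hv.nonneg z) (hχ.nonneg z)
  have hy2 : MemLp y 2 := by
    refine hv.memLp.mono hym.aestronglyMeasurable (Filter.Eventually.of_forall fun z => ?_)
    rw [hy, norm_mul, Real.norm_of_nonneg (hχ.nonneg z)]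
    exact mul_le_of_le_one_right (norm_nonneg _) (hχ.le_one z)
  -- Truncated subtraction keeps only the positive part of `y - F / c`, the part that has to vanish.
  have key : ∀ δ : ℝ≥0∞, δ ≠ 0 →
      ∫⁻ z in {z : Pt m | z.2 ≤ t₀}, (ENNReal.ofReal (y z) - F z / ENNReal.ofReal c) ^ 2 ≤ δ := by
    intro δ hδ
    -- The pole stays at `z` and the average runs over `z ∘ w` with `w` in the support of `k`, so
    -- the continuity needed is that of right translations.
    obtain ⟨η, hη0, hη⟩ := Metric.eventually_nhds_iff.1 (ENNReal.tendsto_nhds_zero.1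
      (tendsto_shiftDist (nearIdentity_right B) hym hy2) δ (pos_iff_ne_zero.2 hδ))
    obtain ⟨ε, hε0, hε1, hεη⟩ : ∃ ε : ℝ, 0 < ε ∧ ε ≤ 1 ∧ (R + 1) * √ε < η := by
      refine ⟨min 1 ((η / (2 * (R + 1))) ^ 2), by positivity, min_le_left _ _, ?_⟩
      calc (R + 1) * √(min 1 ((η / (2 * (R + 1))) ^ 2))
          ≤ (R + 1) * √((η / (2 * (R + 1))) ^ 2) := by
            gcongr; exact min_le_right _ _
        _ = η / 2 := by
            rw [Real.sqrt_sq (by positivity)]; field_simp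
        _ < η := by linarith
    obtain ⟨Ψ, J, k, e, hΨ, hJ, hk, he, hY, hΨ0, hk0, hpast, hkR, hmass, hbd⟩ := hpar ε hε0
    have hsmall : ∀ w, k w ≠ 0 → ‖w‖ ≤ (R + 1) * √ε := fun w hw =>
      norm_le_of_mem_region hR hε1 (hkR w hw).1 (hkR w hw).2
    have hkm : Measurable fun w => ENNReal.ofReal (k w) := hk.continuous.measurable.ennreal_ofReal
    obtain ⟨n, hn⟩ : ∃ n, n = ∫⁻ w : Pt m, ENNReal.ofReal (k w) := ⟨_, rfl⟩
    have hcn : ENNReal.ofReal c ≤ n := hn ▸ hmass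
    have hn0 : n ≠ 0 := fun h => hcE (by simpa [h] using hcn)
    have hnt : n ≠ ⊤ := by
      have hcs : HasCompactSupport k := by
        refine HasCompactSupport.of_support_subset_isCompact
          (isCompact_closedBall (0 : Pt m) ((R + 1) * √ε)) fun w hw => ?_
        simpa using hsmall w hw
      have hi := (hk.continuous.integrable_of_hasCompactSupport hcs (μ := volume)).lintegral_lt_top
      rw [hn]; exact hi.ne
    set D : Pt m → ℝ≥0∞ := fun z =>
      ∫⁻ w, ENNReal.ofReal (k w) * ‖y (groupMul B z w) - y z‖ₑ with hD
    have hDle : ∫⁻ z, D z ^ 2 ≤ n ^ 2 * δ := by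
      rw [hn]
      refine lintegral_average_sq_le (nearIdentity_right B) hym hkm fun w hw => ?_
      have hkw : k w ≠ 0 := fun h => hw (by simp [h])
      exact hη (by simpa using (hsmall w hkw).trans_lt hεη)
    have hpt : ∀ z : Pt m, z.2 ≤ t₀ →
        ENNReal.ofReal (y z) - F z / ENNReal.ofReal c ≤ D z / n := by
      intro z hz
      have h1 := lintegral_mul_parametrix_le hv hA0 ham ha hL hχ (half_pos hε0) hC.le
        (κ₁ := fun w => (regKer R ((Q + 1) / 2) w).toReal)
        (κ₂ := fun w => (regKer R (Q / 2) w).toReal) (fun _ => ENNReal.toReal_nonneg)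
        hΨ hJ hk hY hΨ0 hk0 hpast (fun w hw => by
          obtain ⟨b1, b2, b3, b4⟩ := hbd w hw
          have hm : regKer R (Q / 2) w ≤ regKer R ((Q + 1) / 2) w :=
            regKer_mono (by linarith) hw
          exact ⟨le_mul_toReal_regKer hC.le (b1.trans (by gcongr)), le_mul_toReal_regKer hC.le b1,
            le_mul_toReal_regKer hC.le (b2.trans (by gcongr)),
            fun a => le_mul_toReal_regKer hC.le (b3 a),
            fun a => le_mul_toReal_regKer hC.le (b4 a)⟩) hz
      have h2 : ∫⁻ ζ, ENNReal.ofReal (v ζ * χ ζ * k (groupMul B (groupInv B z) ζ)) ≤ F z := by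
        refine h1.trans ?_
        rw [hF]
        simp only [kerOp]
        have m1 : Measurable fun ζ => grpKer B R ((Q + 1) / 2) z ζ * f₁ ζ := (hKm _ z).mul hf₁m
        have m2 : Measurable fun ζ => grpKer B R (Q / 2) z ζ * f₂ ζ := (hKm _ z).mul hf₂m
        rw [← lintegral_const_mul _ m1, ← lintegral_const_mul _ m2,
          ← lintegral_add_left (m1.const_mul _)]
        refine lintegral_mono fun ζ => ?_
        by_cases hζ : ζ ∈ U
        · have ht : -(groupMul B (groupInv B z) ζ).2 ≤ 1 := by
            rw [relPos_snd]; linarith [hχ.time ζ hζ]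
          simp only [grpKer, if_pos ht, hf₁, hf₂]
          have hv0 := hv.nonneg ζ
          have hχ0 := hχ.nonneg ζ
          have hA' : 0 ≤ χ ζ * |H ζ| := mul_nonneg hχ0 (abs_nonneg _)
          rw [ENNReal.ofReal_add (by positivity) (by positivity), ENNReal.ofReal_mul (by positivity),
            ENNReal.ofReal_mul (by positivity), ENNReal.ofReal_mul (p := C * (regKer R (Q / 2) _).toReal) (by positivity),
            ENNReal.ofReal_mul hC.le, ENNReal.ofReal_toReal (regKer_ne_top _ _ _),
            ENNReal.ofReal_toReal (regKer_ne_top _ _ _), mul_assoc, mul_assoc,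
            mul_assoc (ENNReal.ofReal C)]
        · obtain ⟨q1, q2, q3⟩ := hv.eq_zero ζ hζ
          simp [q1, q2, q3]
      have h3 : ENNReal.ofReal (y z) * n ≤ F z + D z := by
        have e1 : ∫⁻ ζ, ENNReal.ofReal (v ζ * χ ζ * k (groupMul B (groupInv B z) ζ)) =
            ∫⁻ w, ENNReal.ofReal (k w) * ENNReal.ofReal (y (groupMul B z w)) := by
          rw [← lintegral_groupMul_left B z]
          · refine lintegral_congr fun w => ?_
            rw [groupInv_groupMul_cancel, ENNReal.ofReal_mul (hy0 _), mul_comm]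
          · exact (hym.mul (hk.continuous.comp
              (continuous_groupMul_left B _)).measurable).ennreal_ofReal
        rw [hn, ← lintegral_const_mul _ hkm]
        calc ∫⁻ w, ENNReal.ofReal (y z) * ENNReal.ofReal (k w)
            ≤ ∫⁻ w, (ENNReal.ofReal (k w) * ENNReal.ofReal (y (groupMul B z w)) +
                ENNReal.ofReal (k w) * ‖y (groupMul B z w) - y z‖ₑ) := by
              refine lintegral_mono fun w => ?_
              rw [← mul_add, mul_comm]
              gcongr
              rw [← ofReal_norm, ← ENNReal.ofReal_add (hy0 _) (norm_nonneg _)]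
              refine ENNReal.ofReal_le_ofReal ?_
              have := neg_le_abs (y (groupMul B z w) - y z)
              rw [Real.norm_eq_abs]; linarith
          _ = (∫⁻ w, ENNReal.ofReal (k w) * ENNReal.ofReal (y (groupMul B z w))) + D z := by
              rw [lintegral_add_left]
              exact hkm.mul (hym.comp (continuous_groupMul_left B z).measurable).ennreal_ofReal
          _ ≤ F z + D z := by
              rw [← e1]; gcongr
      have h4 : ENNReal.ofReal (y z) ≤ (F z + D z) / n :=
        (ENNReal.le_div_iff_mul_le (Or.inl hn0) (Or.inl hnt)).2 h3
      rw [ENNReal.add_div] at h4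
      refine tsub_le_iff_left.2 (h4.trans ?_)
      gcongr
    calc ∫⁻ z in {z : Pt m | z.2 ≤ t₀}, (ENNReal.ofReal (y z) - F z / ENNReal.ofReal c) ^ 2
        ≤ ∫⁻ z in {z : Pt m | z.2 ≤ t₀}, (D z / n) ^ 2 := by
          refine setLIntegral_mono' (measurableSet_le measurable_snd measurable_const) fun z hz => ?_
          exact pow_le_pow_left' (hpt z hz) 2
      _ ≤ ∫⁻ z, (D z / n) ^ 2 := setLIntegral_le_lintegral _ _
      _ = (∫⁻ z, D z ^ 2) * (n⁻¹) ^ 2 := by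
          simp only [div_eq_mul_inv, mul_pow]
          exact lintegral_mul_const' _ _ (ENNReal.pow_ne_top (ENNReal.inv_ne_top.2 hn0))
      _ ≤ n ^ 2 * δ * (n⁻¹) ^ 2 := by gcongr
      _ = (n * n⁻¹) ^ 2 * δ := by ring
      _ = δ := by rw [ENNReal.mul_inv_cancel hn0 hnt]; simp
  have hzero : ∫⁻ z in {z : Pt m | z.2 ≤ t₀},
      (ENNReal.ofReal (y z) - F z / ENNReal.ofReal c) ^ 2 = 0 := by
    by_contra h
    have h1 := key _ (ENNReal.half_pos h).ne'
    by_cases ht : ∫⁻ z in {z : Pt m | z.2 ≤ t₀},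
      (ENNReal.ofReal (y z) - F z / ENNReal.ofReal c) ^ 2 = ⊤
    · have := key 1 one_ne_zero
      rw [ht] at this
      simp at this
    · exact absurd h1 (not_le.2 (ENNReal.half_lt_self h ht))
  have hm3 : Measurable fun z => (ENNReal.ofReal (y z) - F z / ENNReal.ofReal c) ^ 2 :=
    ((hym.ennreal_ofReal).sub (hFm.div_const _)).pow_const 2
  rw [lintegral_eq_zero_iff hm3,
    Filter.EventuallyEq, ae_restrict_iff' (measurableSet_le measurable_snd measurable_const)] at hzero
  filter_upwards [hzero] with z hz
  by_cases hzU : z ∈ U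
  · have h1 := hz (hU z hzU)
    have h2 : ENNReal.ofReal (y z) ≤ F z / ENNReal.ofReal c := by
      simpa [tsub_eq_zero_iff_le] using h1
    rw [mul_comm (χ z)]
    refine h2.trans ?_
    have e1 : ENNReal.ofReal (C * K / c * L) = ENNReal.ofReal (C * K * L) * ENNReal.ofReal c⁻¹ := by
      rw [← ENNReal.ofReal_mul (by positivity)]; congr 1; field_simp
    have e2 : ENNReal.ofReal C * ENNReal.ofReal c⁻¹ ≤ ENNReal.ofReal (C * K / c) := by
      rw [← ENNReal.ofReal_mul hC.le]
      refine ENNReal.ofReal_le_ofReal ?_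
      rw [div_eq_mul_inv]
      gcongr
      nlinarith
    simp only [hF]
    rw [div_eq_mul_inv, ← ENNReal.ofReal_inv_of_pos hc, add_mul, e1]
    refine add_le_add (le_of_eq (by ring)) ?_
    calc _ = ENNReal.ofReal C * ENNReal.ofReal c⁻¹ * kerOp volume (grpKer B R (Q / 2)) f₂ z := by
          ring
      _ ≤ _ := by gcongr
  · simp [(hv.eq_zero z hzU).1]

/-! ### Cut-off functions -/

theorem contDiff_normSum (r : ℝ) : ContDiff ℝ ∞ fun w : Pt m => normSum w r := by
  unfold normSum
  refine ContDiff.add (ContDiff.sum fun i _ => ?_) ?_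
  · exact ((contDiff_apply ℝ ℝ i).comp contDiff_fst |>.pow 2).div_const _
  · exact (contDiff_snd.pow 2).div_const _

theorem fderiv_normSum (r : ℝ) (w h : Pt m) : fderiv ℝ (fun w : Pt m => normSum w r) w h =
    ∑ i, 2 * w.1 i * h.1 i / r ^ (2 * weight i) + 2 * w.2 * h.2 / r ^ 4 := by
  have h1 : HasDerivAt (fun s : ℝ => normSum (w + s • h) r)
      (∑ i, 2 * w.1 i * h.1 i / r ^ (2 * weight i) + 2 * w.2 * h.2 / r ^ 4) 0 := by
    have hl : ∀ a b : ℝ, HasDerivAt (fun s : ℝ => (a + s * b) ^ 2) (2 * a * b) 0 := fun a b => by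
      have := (((hasDerivAt_id (0 : ℝ)).mul_const b).const_add a).pow 2
      refine this.congr_deriv ?_
      simp
    unfold normSum
    refine HasDerivAt.add (HasDerivAt.fun_sum fun i _ => ?_) ?_
    · simpa using (hl (w.1 i) (h.1 i)).div_const (r ^ (2 * weight i))
    · simpa using (hl w.2 h.2).div_const (r ^ 4)
  have h2 : HasDerivAt (fun s : ℝ => normSum (w + s • h) r)
      (fderiv ℝ (fun w : Pt m => normSum w r) w h) 0 := by
    have hd := ((contDiff_normSum (m := m) r).differentiable (by simp) w).hasFDerivAt
    have hline : HasDerivAt (fun s : ℝ => w + s • h) h 0 := by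
      simpa using ((hasDerivAt_id (0 : ℝ)).smul_const h).const_add w
    have hd' : HasFDerivAt (fun w : Pt m => normSum w r)
        (fderiv ℝ (fun w : Pt m => normSum w r) w) (w + (0 : ℝ) • h) := by simpa using hd
    exact hd'.comp_hasDerivAt (0 : ℝ) hline
  exact h2.unique h1

/-- The lower bound `1 / 2` on the radius keeps the negative powers of `r` bounded. -/
theorem abs_fderiv_normSum_le {r : ℝ} (hr : 1 / 2 ≤ r) (hr1 : r ≤ 1) {w h : Pt m}
    (hw : normSum w r ≤ 1) {A : ℝ} (hA : 0 ≤ A) (h1 : ∀ i, |h.1 i| ≤ A) (h2 : |h.2| ≤ A) :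
    |fderiv ℝ (fun w : Pt m => normSum w r) w h| ≤
      (∑ i : Idx m, 2 * 2 ^ (2 * weight i) + 2 * 2 ^ 4) * A := by
  have hr0 : 0 < r := by linarith
  obtain ⟨hw1, hw2⟩ := abs_le_one_of_normSum_le hr0 hr1 hw
  have hterm : ∀ (x y : ℝ) (n : ℕ), |x| ≤ 1 → |y| ≤ A → |2 * x * y / r ^ n| ≤ 2 * 2 ^ n * A := by
    intro x y n hx hy
    rw [abs_div, abs_mul, abs_mul, abs_two, abs_of_pos (pow_pos hr0 n), div_le_iff₀ (by positivity)]
    have : 1 ≤ (2 * r) ^ n := one_le_pow₀ (by linarith)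
    calc 2 * |x| * |y| ≤ 2 * 1 * A := by gcongr
      _ = 2 * A * 1 := by ring
      _ ≤ 2 * A * (2 * r) ^ n := by gcongr
      _ = _ := by rw [mul_pow]; ring
  rw [fderiv_normSum, add_mul, Finset.sum_mul]
  refine (abs_add_le _ _).trans (add_le_add ((Finset.abs_sum_le_sum_abs _ _).trans
    (Finset.sum_le_sum fun i _ => hterm _ _ _ (hw1 i) (h1 i))) (hterm _ _ _ hw2 h2))

/-- Every exponent in the sum is at least `1`, so each term gains at least one factor `ρ / r`. -/
theorem normSum_le_of_le {ρ r : ℝ} (hρ : 0 < ρ) (hr : ρ ≤ r) {w : Pt m} (hw : normSum w ρ ≤ 1) :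
    normSum w r ≤ ρ / r := by
  have hr0 : 0 < r := hρ.trans_le hr
  have hq : ρ / r ≤ 1 := (div_le_one hr0).2 hr
  have hterm : ∀ (x : ℝ) (n : ℕ), n ≠ 0 → x ^ 2 / r ^ n ≤ ρ / r * (x ^ 2 / ρ ^ n) := by
    intro x n hn
    have : x ^ 2 / r ^ n = (ρ / r) ^ n * (x ^ 2 / ρ ^ n) := by
      rw [div_pow]; field_simp
    rw [this]
    gcongr
    exact pow_le_of_le_one (by positivity) hq hn
  calc normSum w r ≤ ρ / r * normSum w ρ := by
        unfold normSum
        rw [mul_add, Finset.mul_sum]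
        exact add_le_add (Finset.sum_le_sum fun i _ => hterm _ _ (by simp [weight]))
          (hterm _ _ (by norm_num))
    _ ≤ ρ / r * 1 := by gcongr
    _ = ρ / r := mul_one _

/-- The cut-off is a function of `normSum · r` at `z₀⁻¹ ∘ z`. By left invariance its derivatives
need only be bounded near the origin, where the coefficients of `Y` are bounded uniformly in `z₀`.
-/
theorem exists_cutoff (B : Matrix (Idx m) (Idx m) ℝ) : ∃ L : ℝ, 1 ≤ L ∧
    ∀ (z₀ : Pt m) (ρ r : ℝ), 1 / 2 ≤ ρ → ρ < r → r ≤ 1 → ∃ χ : Pt m → ℝ,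
      Cutoff B (openBall B r z₀) z₀.2 (L / (r - ρ)) χ ∧ ∀ z ∈ ballMinus B ρ z₀, χ z = 1 := by
  obtain ⟨M, hM0, hM⟩ := exists_stepD_bound
  obtain ⟨A, hA⟩ : ∃ A, A = 1 + ∑ i, ∑ j, |B i j| := ⟨_, rfl⟩
  have hA1 : 1 ≤ A := by
    have : 0 ≤ ∑ i, ∑ j, |B i j| :=
      Finset.sum_nonneg fun _ _ => Finset.sum_nonneg fun _ _ => abs_nonneg _
    linarith
  obtain ⟨K, hK⟩ : ∃ K : ℝ, K = ∑ i : Idx m, 2 * 2 ^ (2 * weight i) + 2 * 2 ^ 4 := ⟨_, rfl⟩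
  have hK0 : 0 ≤ K := by rw [hK]; positivity
  refine ⟨1 + M * 2 * (K * A), by
    have : 0 ≤ M * 2 * (K * A) := by positivity
    linarith, ?_⟩
  intro z₀ ρ r hρ hρr hr1
  obtain ⟨δ, hδ⟩ : ∃ δ, δ = r - ρ := ⟨_, rfl⟩
  have hδ0 : 0 < δ := by rw [hδ]; linarith
  have hr0 : 0 < r := by linarith
  set g := groupMul B (groupInv B z₀) with hg
  -- The transition takes place where `normSum` runs from `1 - δ` to `1 - δ / 2`, with `δ = r - ρ`.
  -- On the smaller ball `normSum` is at most `ρ / r`, which is at most `1 - δ` because `r ≤ 1`.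
  set θ : Pt m → ℝ := fun w => (1 - δ / 2 - normSum w r) / (δ / 2) with hθ
  set χ₀ : Pt m → ℝ := fun w => Real.smoothTransition (θ w) with hχ₀
  have hθs : ContDiff ℝ ∞ θ := (contDiff_const.sub (contDiff_normSum r)).div_const _
  have hχ₀s : ContDiff ℝ ∞ χ₀ := contDiff_step.comp hθs
  have hχ₀d : Differentiable ℝ χ₀ := hχ₀s.differentiable (by simp)
  have hfd : ∀ w h, fderiv ℝ χ₀ w h =
      stepD (θ w) * (-fderiv ℝ (fun w : Pt m => normSum w r) w h / (δ / 2)) := by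
    intro w h
    have hd := ((contDiff_normSum (m := m) r).differentiable (by simp) w).hasFDerivAt
    have h1 : HasFDerivAt θ ((δ / 2)⁻¹ • -fderiv ℝ (fun w : Pt m => normSum w r) w) w := by
      have := (hd.const_sub (1 - δ / 2)).const_mul (δ / 2)⁻¹
      refine this.congr_of_eventuallyEq (Filter.Eventually.of_forall fun w => ?_)
      simp only [hθ]; rw [div_eq_inv_mul]
    have h2 := (hasDerivAt_step (θ w)).comp_hasFDerivAt w h1
    have h3 : fderiv ℝ χ₀ w = _ := h2.fderiv
    rw [h3]
    simp [div_eq_inv_mul]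
  have hfb : ∀ (w h : Pt m), (normSum w r ≤ 1 → (∀ i, |h.1 i| ≤ A) ∧ |h.2| ≤ A) →
      |fderiv ℝ χ₀ w h| ≤ (1 + M * 2 * (K * A)) / (r - ρ) := by
    intro w h hh
    rw [hfd, ← hδ]
    by_cases hn : normSum w r ≤ 1
    · obtain ⟨h1, h2⟩ := hh hn
      have hb := abs_fderiv_normSum_le (by linarith) hr1 hn (by linarith) h1 h2
      rw [← hK] at hb
      rw [abs_mul, abs_div, abs_neg, abs_of_pos (half_pos hδ0)]
      calc |stepD (θ w)| * (|fderiv ℝ (fun w : Pt m => normSum w r) w h| / (δ / 2))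
          ≤ M * (K * A / (δ / 2)) := by gcongr; exact hM _
        _ = M * 2 * (K * A) / δ := by field_simp
        _ ≤ _ := by gcongr; linarith
    · have : stepD (θ w) = 0 := by
        refine stepD_of_nonpos ?_
        simp only [hθ]
        exact div_nonpos_of_nonpos_of_nonneg (by linarith [not_le.1 hn]) (by positivity)
      rw [this, zero_mul, abs_zero]; positivity
  have hts : tsupport (fun z => χ₀ (g z)) ⊆ {z | normSum (g z) r ≤ 1 - δ / 2} := by
    refine closure_minimal (fun z hz => ?_)
      (isClosed_le ((continuous_normSum r).comp (continuous_groupMul_left B _)) continuous_const)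
    by_contra hne
    have hne' : 1 - δ / 2 < normSum (g z) r := not_le.1 hne
    refine hz (Real.smoothTransition.zero_of_nonpos ?_)
    exact div_nonpos_of_nonpos_of_nonneg (by linarith) (by positivity)
  refine ⟨fun z => χ₀ (g z), ⟨hχ₀s.comp (contDiff_groupMul_left B _),
    fun z => Real.smoothTransition.nonneg _, fun z => Real.smoothTransition.le_one _, ?_, ?_, ?_, ?_,
    ?_⟩, ?_⟩
  · intro z i
    rw [hg, gradD_comp_groupMul B hχ₀d]
    refine hfb _ _ fun _ => ⟨fun j => ?_, by simp; linarith⟩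
    by_cases hj : j = ⟨0, i⟩
    · subst hj; simpa using hA1
    · simp [hj]; linarith
  · intro z
    rw [hg, fieldY_comp_groupMul B hχ₀d, fieldY_eq]
    refine hfb _ _ fun hn => ⟨fun j => ?_, by simpa [yVec] using hA1⟩
    obtain ⟨hw1, -⟩ := abs_le_one_of_normSum_le hr0 hr1 hn
    simp only [yVec, Matrix.mulVec, dotProduct, Matrix.transpose_apply]
    calc |∑ i, B i j * (groupMul B (groupInv B z₀) z).1 i|
        ≤ ∑ i, |B i j * (groupMul B (groupInv B z₀) z).1 i| := Finset.abs_sum_le_sum_abs _ _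
      _ ≤ ∑ i, ∑ j, |B i j| := by
          refine Finset.sum_le_sum fun i _ => ?_
          rw [abs_mul]
          refine (mul_le_of_le_one_right (abs_nonneg _) (hw1 i)).trans ?_
          exact Finset.single_le_sum (f := fun j => |B i j|) (fun _ _ => abs_nonneg _)
            (Finset.mem_univ j)
      _ ≤ A := by rw [hA]; linarith
  · refine (Metric.isCompact_of_isClosed_isBounded (isClosed_tsupport _) ?_)
    refine isBounded_of_groupMul (B := B) z₀ (isBounded_normSum_le hr0 hr1) fun z hz => ?_
    have : normSum (g z) r ≤ 1 - δ / 2 := hts hz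
    change normSum (g z) r ≤ 1
    linarith
  · intro z hz ht
    have : normSum (g z) r ≤ 1 - δ / 2 := hts hz
    exact ⟨by change normSum (g z) r < 1; linarith, ht⟩
  · intro z hz
    have h1 := (abs_le_one_of_normSum_le hr0 hr1 hz.1.le).2
    have h2 := relPos_snd B z₀ z
    have h3 := (abs_le.1 h1).1
    linarith
  · intro z hz
    have h1 := ((mem_ballMinus_iff (by linarith)).1 hz).1
    have h2 := normSum_le_of_le (by linarith) hρr.le h1
    refine Real.smoothTransition.one_of_one_le ?_
    rw [le_div_iff₀ (by positivity)]
    have h3 : ρ / r ≤ 1 - δ := by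
      rw [div_le_iff₀ hr0, hδ]; nlinarith
    change 1 * (δ / 2) ≤ 1 - δ / 2 - normSum (g z) r
    linarith

/-! ### Absorption of the potential term -/

section Absorption

variable {X : Type*} [MeasurableSpace X] {μ : Measure X}

theorem lnorm_mono {p : ℝ} (hp : 0 < p) {f g : X → ℝ≥0∞} (h : f ≤ᵐ[μ] g) :
    lnorm μ p f ≤ lnorm μ p g := by
  unfold lnorm
  refine ENNReal.rpow_le_rpow (lintegral_mono_ae (h.mono fun x hx => ?_)) (by positivity)
  exact ENNReal.rpow_le_rpow hx hp.le

theorem lnorm_add_le {p : ℝ} (hp : 1 ≤ p) {f g : X → ℝ≥0∞} (hf : AEMeasurable f μ)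
    (hg : AEMeasurable g μ) : lnorm μ p (fun x => f x + g x) ≤ lnorm μ p f + lnorm μ p g :=
  ENNReal.lintegral_Lp_add_le hf hg hp

theorem lnorm_mul_le {p q r : ℝ} (hp : 0 < p) (hpq : p < q) (hpqr : 1 / p = 1 / q + 1 / r)
    {f g : X → ℝ≥0∞} (hf : AEMeasurable f μ) (hg : AEMeasurable g μ) :
    lnorm μ p (fun x => f x * g x) ≤ lnorm μ q f * lnorm μ r g :=
  ENNReal.lintegral_Lp_mul_le_Lq_mul_Lr hp hpq hpqr μ hf hg

theorem lnorm_const_mul {p : ℝ} (hp : 0 < p) {c : ℝ≥0∞} (hc : c ≠ ⊤) (f : X → ℝ≥0∞) :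
    lnorm μ p (fun x => c * f x) = c * lnorm μ p f := by
  unfold lnorm
  simp only [ENNReal.mul_rpow_of_nonneg _ _ hp.le]
  rw [lintegral_const_mul' _ _ (ENNReal.rpow_ne_top_of_nonneg hp.le hc),
    ENNReal.mul_rpow_of_nonneg _ _ (by positivity), ← ENNReal.rpow_mul, mul_one_div_cancel hp.ne',
    ENNReal.rpow_one]

/-- If the operator `f ↦ K (V f)` is a contraction of `L^s` and of the weighted `L¹`, then
`y ≤ g + K (V y)` bounds `y` by `g` in `L^s`. -/
theorem lnorm_le_of_contraction [SFinite μ] {K : X → X → ℝ≥0∞}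
    (hK : Measurable (Function.uncurry K)) {V : X → ℝ≥0∞} (hV : Measurable V) {s : ℝ} (hs : 1 ≤ s)
    {A : ℝ≥0∞} (hA : A ≠ ⊤)
    (h1 : ∀ f : X → ℝ≥0∞, Measurable f →
      lnorm μ s (kerOp μ K fun x => V x * f x) ≤ 2⁻¹ * lnorm μ s f)
    (h2 : ∀ y, ∫⁻ x, V x * K x y ∂μ ≤ 2⁻¹) (h3 : ∀ y, ∫⁻ x, K x y ∂μ ≤ A)
    {y g : X → ℝ≥0∞} (hy : Measurable y) (hg : Measurable g)
    (hle : ∀ᵐ x ∂μ, y x ≤ g x + kerOp μ K (fun x => V x * y x) x)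
    (hfin : ∫⁻ x, V x * y x ∂μ ≠ ⊤) : lnorm μ s y ≤ 2 * lnorm μ s g := by
  have hs0 : 0 < s := by linarith
  have hKx : ∀ x, Measurable (K x) := fun x => Measurable.of_uncurry_left hK
  set S : (X → ℝ≥0∞) → X → ℝ≥0∞ := fun f => kerOp μ K fun x => V x * f x with hS
  have hSm : ∀ f, Measurable f → Measurable (S f) := fun f hf =>
    measurable_kerOp hK (hV.mul hf).aemeasurable
  have hSmono : ∀ f f', f ≤ᵐ[μ] f' → ∀ x, S f x ≤ S f' x := fun f f' h x =>
    kerOp_mono (h.mono fun x hx => show V x * f x ≤ V x * f' x by gcongr) x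
  have hSadd : ∀ f f', Measurable f → ∀ x, S (fun x => f x + f' x) x = S f x + S f' x :=
    fun f f' hf x => by
      simp only [hS, mul_add]
      exact kerOp_add hKx (hV.mul hf).aemeasurable x
  -- Picard iteration: `y ≤ G_n + T_n` with `T_n = Sⁿ y`. The `G_n` are bounded in `L^s` by a
  -- geometric series, whereas the `T_n` tend to zero in `L¹`. The latter is enough for `y ≤ sup
  -- G_n` almost everywhere and requires no prior bound of `y` in `L^s`.
  let G : ℕ → X → ℝ≥0∞ := fun n => Nat.rec (fun _ => 0) (fun _ f x => g x + S f x) n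
  let T : ℕ → X → ℝ≥0∞ := fun n => Nat.rec y (fun _ f => S f) n
  have hG0 : G 0 = fun _ => 0 := rfl
  have hGs : ∀ n, G (n + 1) = fun x => g x + S (G n) x := fun n => rfl
  have hTs : ∀ n, T (n + 1) = S (T n) := fun n => rfl
  have hGm : ∀ n, Measurable (G n) := fun n => by
    induction n with
    | zero => exact measurable_const
    | succ n ih => rw [hGs]; exact hg.add (hSm _ ih)
  have hTm : ∀ n, Measurable (T n) := fun n => by
    induction n with
    | zero => exact hy
    | succ n ih => rw [hTs]; exact hSm _ ih
  have hyle : ∀ n, ∀ᵐ x ∂μ, y x ≤ G n x + T n x := fun n => by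
    induction n with
    | zero => exact Filter.Eventually.of_forall fun x => by simp [hG0, T]
    | succ n ih =>
      filter_upwards [hle] with x hx
      refine hx.trans ?_
      rw [hGs, hTs, add_assoc, ← hSadd _ _ (hGm n)]
      exact add_le_add le_rfl (hSmono _ _ ih x)
  have hGmono : ∀ n x, G n x ≤ G (n + 1) x := fun n => by
    induction n with
    | zero => intro x; simp [hG0]
    | succ n ih =>
      intro x
      rw [hGs, hGs (n + 1)]
      refine add_le_add le_rfl ?_
      exact hSmono _ _ (Filter.Eventually.of_forall ih) x
  have hGnorm : ∀ n, lnorm μ s (G n) ≤ 2 * lnorm μ s g := fun n => by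
    induction n with
    | zero =>
      have : lnorm μ s (G 0) = 0 := by
        rw [hG0, lnorm]
        simp [ENNReal.zero_rpow_of_pos hs0, ENNReal.zero_rpow_of_pos (inv_pos.2 hs0)]
      rw [this]; exact bot_le
    | succ n ih =>
      rw [hGs]
      calc lnorm μ s (fun x => g x + S (G n) x)
          ≤ lnorm μ s g + lnorm μ s (S (G n)) :=
            lnorm_add_le hs hg.aemeasurable (hSm _ (hGm n)).aemeasurable
        _ ≤ lnorm μ s g + 2⁻¹ * (2 * lnorm μ s g) := by
            gcongr
            exact (h1 _ (hGm n)).trans (by gcongr)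
        _ = 2 * lnorm μ s g := by
            rw [← mul_assoc, ENNReal.inv_mul_cancel (by simp) (by simp), one_mul, two_mul]
  have hTV : ∀ n, ∫⁻ x, V x * T n x ∂μ ≤ (2⁻¹) ^ n * ∫⁻ x, V x * y x ∂μ := fun n => by
    induction n with
    | zero => simp [T]
    | succ n ih =>
      rw [hTs, hS]
      refine (lintegral_kerOp_le hK hV h2 (hV.mul (hTm n)).aemeasurable).trans ?_
      rw [pow_succ', mul_assoc]
      gcongr
      exact ih
  have hT1 : ∀ n, ∫⁻ x, T (n + 1) x ∂μ ≤ A * ((2⁻¹) ^ n * ∫⁻ x, V x * y x ∂μ) := fun n => by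
    have := lintegral_kerOp_le (μ := μ) (ν := μ) hK (V := fun _ => 1) measurable_const (A := A)
      (by simpa using h3) (hV.mul (hTm n)).aemeasurable
    simp only [one_mul] at this
    exact this.trans (mul_le_mul_right (hTV n) A)
  have hlim : Filter.Tendsto (fun n : ℕ => A * ((2⁻¹) ^ n * ∫⁻ x, V x * y x ∂μ)) Filter.atTop
      (nhds 0) := by
    have h := ENNReal.tendsto_pow_atTop_nhds_zero_of_lt_one (r := 2⁻¹) (by simp)
    have h' := ENNReal.Tendsto.const_mul (ENNReal.Tendsto.mul_const h (Or.inr hfin)) (Or.inr hA)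
    simpa using h'
  have hsup : Measurable fun x => ⨆ n, G n x := Measurable.iSup hGm
  have hysup : ∀ᵐ x ∂μ, y x ≤ ⨆ n, G n x := by
    have hz : ∫⁻ x, (y x - ⨆ n, G n x) ∂μ = 0 := by
      refine le_antisymm (ge_of_tendsto' hlim fun n => ?_) bot_le
      refine (lintegral_mono_ae ?_).trans (hT1 n)
      filter_upwards [hyle (n + 1)] with x hx
      refine tsub_le_iff_left.2 (hx.trans ?_)
      gcongr
      exact le_iSup (fun n => G n x) (n + 1)
    have hm : Measurable fun x => y x - ⨆ n, G n x := hy.sub hsup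
    rw [lintegral_eq_zero_iff hm] at hz
    filter_upwards [hz] with x hx
    simpa [tsub_eq_zero_iff_le] using hx
  refine (lnorm_mono hs0 hysup).trans ?_
  unfold lnorm
  have hmono : Monotone fun n x => G n x ^ s :=
    monotone_nat_of_le_succ fun n x => ENNReal.rpow_le_rpow (hGmono n x) hs0.le
  have hpow : ∀ x, (⨆ n, G n x) ^ s = ⨆ n, G n x ^ s := fun x =>
    (ENNReal.orderIsoRpow s hs0).map_iSup _
  simp only [hpow]
  rw [lintegral_iSup (fun n => (hGm n).pow_const s) hmono]
  rw [one_div, ENNReal.rpow_inv_le_iff hs0]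
  refine iSup_le fun n => ?_
  rw [← ENNReal.rpow_inv_le_iff hs0, ← one_div]
  exact hGnorm n

theorem lnorm_le_of_pow_le {q s : ℝ} (hq : 0 < q) (hs : 0 < s) {V W : X → ℝ≥0∞} {c : ℝ≥0∞}
    (hc : c ≠ ⊤) (h : ∀ x, W x ^ s ≤ c * V x ^ q) :
    lnorm μ s W ≤ c ^ (1 / s) * lnorm μ q V ^ (q / s) := by
  unfold lnorm
  rw [← ENNReal.rpow_mul, one_div_mul_eq_div, div_div_cancel_left' hq.ne', inv_eq_one_div,
    ← ENNReal.mul_rpow_of_nonneg _ _ (by positivity), ← lintegral_const_mul' _ _ hc]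
  exact ENNReal.rpow_le_rpow (lintegral_mono h) (by positivity)

/-- The part of `V` above the level `M`. -/
def highPart (M : ℝ≥0) (V : X → ℝ≥0∞) (x : X) : ℝ≥0∞ := if (M : ℝ≥0∞) < V x then V x else 0

/-- The part of `V` below the level `M`. -/
def lowPart (M : ℝ≥0) (V : X → ℝ≥0∞) (x : X) : ℝ≥0∞ := if (M : ℝ≥0∞) < V x then 0 else V x

theorem highPart_add_lowPart {X : Type*} (M : ℝ≥0) (V : X → ℝ≥0∞) (x : X) :
    highPart M V x + lowPart M V x = V x := by
  unfold highPart lowPart; split_ifs <;> simp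

theorem measurable_highPart (M : ℝ≥0) {V : X → ℝ≥0∞} (hV : Measurable V) :
    Measurable (highPart M V) :=
  Measurable.ite (measurableSet_lt measurable_const hV) hV measurable_const

theorem measurable_lowPart (M : ℝ≥0) {V : X → ℝ≥0∞} (hV : Measurable V) :
    Measurable (lowPart M V) :=
  Measurable.ite (measurableSet_lt measurable_const hV) measurable_const hV

/-- Above the level, `V^s ≤ M^(s-q) V^q` since `s ≤ q`: lowering the exponent gains a negative power
of the level. -/
theorem lnorm_highPart_le {q s : ℝ} (hs : 0 < s) (hsq : s ≤ q) {M : ℝ≥0} (hM : M ≠ 0)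
    {V : X → ℝ≥0∞} (hV : ∀ x, V x ≠ ⊤) :
    lnorm μ s (highPart M V) ≤ (M : ℝ≥0∞) ^ (1 - q / s) * lnorm μ q V ^ (q / s) := by
  have hM' : (M : ℝ≥0∞) ≠ 0 := by simpa using hM
  have e : (M : ℝ≥0∞) ^ (1 - q / s) = ((M : ℝ≥0∞) ^ (s - q)) ^ (1 / s) := by
    rw [← ENNReal.rpow_mul]; congr 1; field_simp
  rw [e]
  refine lnorm_le_of_pow_le (hs.trans_le hsq) hs (ENNReal.rpow_ne_top_of_ne_zero hM' (by simp))
    fun x => ?_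
  unfold highPart
  split_ifs with h
  · have hx0 : V x ≠ 0 := (bot_le.trans_lt h).ne'
    calc V x ^ s = V x ^ (s - q) * V x ^ q := by
          rw [← ENNReal.rpow_add _ _ hx0 (hV x)]; congr 1; ring
      _ ≤ (M : ℝ≥0∞) ^ (s - q) * V x ^ q := by
          gcongr ?_ * _
          rw [show s - q = -(q - s) by ring, ENNReal.rpow_neg, ENNReal.rpow_neg, ENNReal.inv_le_inv]
          exact ENNReal.rpow_le_rpow h.le (by linarith)
  · rw [ENNReal.zero_rpow_of_pos hs]; exact bot_le

/-- Below the level, `V^s ≤ M^(s-q) V^q` since `s ≥ q`: raising the exponent costs a positive power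
of the level. -/
theorem lnorm_lowPart_le {q s : ℝ} (hq : 0 < q) (hsq : q ≤ s) (M : ℝ≥0)
    (V : X → ℝ≥0∞) :
    lnorm μ s (lowPart M V) ≤ (M : ℝ≥0∞) ^ (1 - q / s) * lnorm μ q V ^ (q / s) := by
  have hs : 0 < s := hq.trans_le hsq
  have e : (M : ℝ≥0∞) ^ (1 - q / s) = ((M : ℝ≥0∞) ^ (s - q)) ^ (1 / s) := by
    rw [← ENNReal.rpow_mul]; congr 1; field_simp
  rw [e]
  refine lnorm_le_of_pow_le hq hs (ENNReal.rpow_ne_top_of_nonneg (by linarith) (by simp))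
    fun x => ?_
  unfold lowPart
  split_ifs with h
  · rw [ENNReal.zero_rpow_of_pos hs]; exact bot_le
  · calc V x ^ s = V x ^ (s - q) * V x ^ q := by
          rw [← ENNReal.rpow_add_of_nonneg _ _ (by linarith) hq.le]; congr 1; ring
      _ ≤ (M : ℝ≥0∞) ^ (s - q) * V x ^ q := by
          gcongr ?_ * _
          exact ENNReal.rpow_le_rpow (not_lt.1 h) (by linarith)

theorem tendsto_lnorm_highPart {q : ℝ} (hq : 0 < q) {V : X → ℝ≥0∞} (hVm : Measurable V)
    (hV : ∀ x, V x ≠ ⊤) (hfin : lnorm μ q V ≠ ⊤) :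
    Filter.Tendsto (fun n : ℕ => lnorm μ q (highPart n V)) Filter.atTop (nhds 0) := by
  have hfin' : ∫⁻ x, V x ^ q ∂μ ≠ ⊤ := fun h => hfin (by
    rw [lnorm, h, ENNReal.top_rpow_of_pos (by positivity)])
  have h := tendsto_lintegral_of_dominated_convergence (μ := μ)
    (F := fun (n : ℕ) x => highPart n V x ^ q) (f := fun _ => 0) (fun x => V x ^ q)
    (fun n => (measurable_highPart _ hVm).pow_const q)
    (fun n => Filter.Eventually.of_forall fun x => by
      refine ENNReal.rpow_le_rpow ?_ hq.le
      unfold highPart; split_ifs <;> simp) hfin'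
    (Filter.Eventually.of_forall fun x => by
      obtain ⟨N, hN⟩ := ENNReal.exists_nat_gt (hV x)
      refine tendsto_const_nhds.congr' ?_
      filter_upwards [Filter.eventually_ge_atTop N] with n hn
      have : ¬ (((n : ℝ≥0) : ℝ≥0∞) < V x) := by
        refine not_lt.2 (hN.le.trans ?_)
        simpa using hn
      rw [highPart, if_neg this, ENNReal.zero_rpow_of_pos hq])
  have h2 := (ENNReal.continuous_rpow_const (y := 1 / q)).tendsto _ |>.comp h
  simpa [Function.comp_def, lnorm, hq] using h2

theorem le_two_mul_of_le_add_half {a b : ℝ≥0∞} (ha : a ≠ ⊤) (h : a ≤ b + 2⁻¹ * a) : a ≤ 2 * b := by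
  have h1 : a = 2⁻¹ * a + 2⁻¹ * a := by
    rw [← add_mul, ENNReal.inv_two_add_inv_two, one_mul]
  have h2 : 2⁻¹ * a ≠ ⊤ := ENNReal.mul_ne_top (by simp) ha
  have h3 : 2⁻¹ * a ≤ b := by
    refine (ENNReal.add_le_add_iff_right h2).1 ?_
    rw [← h1]; exact h
  calc a = 2 * (2⁻¹ * a) := by
        rw [← mul_assoc, ENNReal.mul_inv_cancel (by simp) (by simp), one_mul]
    _ ≤ 2 * b := by gcongr

/-- The level is chosen so that the high part acts with norm exactly `1 / 2`; inserted into the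
bound of the low part, it yields the power of `p`. For `σ = (Q + 2) / 2` the exponent `q / (2 (q -
σ))` is `q / (2q - Q - 2)`. -/
theorem absorption_level {σ q : ℝ} (hσ : 0 < σ) (hq : σ < q) {C K : ℝ≥0} (hC : C ≠ 0) (hK : K ≠ 0)
    {p : ℝ≥0} (hp : p ≠ 0) : ∃ M : ℝ≥0, M ≠ 0 ∧
      C * (M ^ (1 - q / σ) * (p * K) ^ (q / σ)) = 2⁻¹ ∧
      M ^ (1 - q / (2 * σ)) * (p * K) ^ (q / (2 * σ)) =
        (2 * C) ^ (σ / (q - σ) * (1 - q / (2 * σ))) * K ^ (q / (2 * (q - σ))) *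
          p ^ (q / (2 * (q - σ))) := by
  have hd : q - σ ≠ 0 := by linarith
  have hσ' := hσ.ne'
  have hpK : p * K ≠ 0 := mul_ne_zero hp hK
  have h2C : 2 * C ≠ 0 := mul_ne_zero two_ne_zero hC
  refine ⟨(2 * C * (p * K) ^ (q / σ)) ^ (σ / (q - σ)), ?_, ?_, ?_⟩
  · have : (p * K) ^ (q / σ) ≠ 0 := (NNReal.rpow_pos (pos_iff_ne_zero.2 hpK)).ne'
    exact (NNReal.rpow_pos (pos_iff_ne_zero.2 (mul_ne_zero h2C this))).ne'
  · have e : σ / (q - σ) * (1 - q / σ) = -1 := by field_simp; ring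
    rw [← NNReal.rpow_mul, e, NNReal.rpow_neg_one, mul_inv, mul_assoc,
      inv_mul_cancel₀ (NNReal.rpow_pos (pos_iff_ne_zero.2 hpK)).ne', mul_one, mul_inv]
    field_simp
  · rw [← NNReal.rpow_mul, NNReal.mul_rpow, ← NNReal.rpow_mul, mul_assoc, ← NNReal.rpow_add hpK]
    have e : q / σ * (σ / (q - σ) * (1 - q / (2 * σ))) + q / (2 * σ) = q / (2 * (q - σ)) := by
      field_simp; ring
    rw [e, NNReal.mul_rpow (x := p)]
    ring

/-- `L^((Q+2)/2)` is the critical space for a potential, and a large level makes the high part of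
`V` small in it because `q` is larger. The low part lies in `L^(Q+2)`, since `q ≤ Q + 2`, and pairs
with `y` in `L²`. Subtracting half of the norm of `y` presupposes that this norm is finite, which
has to be proved first. -/
theorem lnorm_absorb [SFinite μ] {Q q q' : ℝ} (hQ : 0 < Q) (hq : (Q + 2) / 2 < q) (hq2 : q ≤ Q + 2)
    (hqq : q.HolderConjugate q') {K : X → X → ℝ≥0∞} (hK : Measurable (Function.uncurry K))
    {C₁ C₂ A K₀ : ℝ≥0} (hC₁ : C₁ ≠ 0) (hK₀ : K₀ ≠ 0)
    (hls : ∀ f : X → ℝ≥0∞, AEMeasurable f μ → lnorm μ (2 * (1 + 2 / Q)) (kerOp μ K f) ≤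
      C₁ * lnorm μ ((2 * Q + 4) / (Q + 4)) f)
    (h2 : ∀ y, (∫⁻ x, K x y ^ q' ∂μ) ^ (1 / q') ≤ C₂) (h3 : ∀ y, ∫⁻ x, K x y ∂μ ≤ A) :
    ∃ C : ℝ≥0, ∀ p : ℝ≥0, p ≠ 0 → ∀ V y g : X → ℝ≥0∞, Measurable V → Measurable y → Measurable g →
      (∀ x, V x ≠ ⊤) → lnorm μ q V ≤ p * K₀ → ∫⁻ x, V x * y x ∂μ ≠ ⊤ →
      (∀ᵐ x ∂μ, y x ≤ g x + kerOp μ K (fun x => V x * y x) x) →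
      lnorm μ (2 * (1 + 2 / Q)) y ≤ 2 * lnorm μ (2 * (1 + 2 / Q)) g +
        C * (p : ℝ≥0∞) ^ (q / (2 * q - Q - 2)) * lnorm μ 2 y := by
  obtain ⟨σ, hσ⟩ : ∃ σ, σ = (Q + 2) / 2 := ⟨_, rfl⟩
  obtain ⟨s, hs⟩ : ∃ s, s = 2 * (1 + 2 / Q) := ⟨_, rfl⟩
  obtain ⟨r, hr⟩ : ∃ r, r = (2 * Q + 4) / (Q + 4) := ⟨_, rfl⟩
  rw [← hs, ← hr] at hls
  rw [← hs]
  have hσ0 : 0 < σ := by rw [hσ]; linarith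
  have hσq : σ < q := hσ ▸ hq
  have hq0 : 0 < q := hσ0.trans hσq
  have hs1 : 1 ≤ s := by
    have : 0 < 2 / Q := by positivity
    rw [hs]; linarith
  have hs0 : 0 < s := by linarith
  have hr0 : 0 < r := by rw [hr]; positivity
  have hrσ : r < σ := by
    rw [hr, hσ, div_lt_div_iff₀ (by positivity) (by positivity)]; nlinarith
  have er : 1 / r = 1 / σ + 1 / s := by rw [hr, hσ, hs]; field_simp; ring
  have er2 : 1 / r = 1 / (Q + 2) + 1 / 2 := by rw [hr]; field_simp; ring
  have e2σ : Q + 2 = 2 * σ := by rw [hσ]; ring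
  set a := (2 * C₁) ^ (σ / (q - σ) * (1 - q / (2 * σ))) * K₀ ^ (q / (2 * (q - σ))) with ha
  refine ⟨2 * (C₁ * a), ?_⟩
  intro p hp V y g hV hy hg hVt hVN hVy hle
  obtain ⟨M, hM0, hM1, hM2⟩ := absorption_level hσ0 hσq hC₁ hK₀ hp
  have hNt : lnorm μ q V ≠ ⊤ := ne_top_of_le_ne_top (by finiteness) hVN
  have hhigh : ∀ L : ℝ≥0, M ≤ L → ∀ f : X → ℝ≥0∞, Measurable f →
      lnorm μ s (kerOp μ K fun x => highPart L V x * f x) ≤ 2⁻¹ * lnorm μ s f := by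
    intro L hL f hf
    have hm := measurable_highPart L hV
    have hL0 : L ≠ 0 := fun h => hM0 (by simpa [h] using hL)
    refine (hls (fun x => highPart L V x * f x) (hm.mul hf).aemeasurable).trans ?_
    have h1 := lnorm_mul_le hr0 hrσ er hm.aemeasurable hf.aemeasurable (μ := μ)
    have h4 := lnorm_highPart_le (μ := μ) hσ0 hσq.le hL0 hVt
    have h5 : (L : ℝ≥0∞) ^ (1 - q / σ) ≤ (M : ℝ≥0∞) ^ (1 - q / σ) := by
      have : 1 ≤ q / σ := (one_le_div hσ0).2 hσq.le
      rw [show 1 - q / σ = -(q / σ - 1) by ring, ENNReal.rpow_neg, ENNReal.rpow_neg,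
        ENNReal.inv_le_inv]
      exact ENNReal.rpow_le_rpow (by exact_mod_cast hL) (by linarith)
    have h6 : (C₁ : ℝ≥0∞) * ((M : ℝ≥0∞) ^ (1 - q / σ) * (p * K₀ : ℝ≥0∞) ^ (q / σ)) = 2⁻¹ := by
      rw [← ENNReal.coe_rpow_of_ne_zero hM0, ← ENNReal.coe_mul,
        ← ENNReal.coe_rpow_of_nonneg _ (by positivity), ← ENNReal.coe_mul, ← ENNReal.coe_mul, hM1]
      simp
    calc (C₁ : ℝ≥0∞) * lnorm μ r (fun x => highPart L V x * f x)
        ≤ C₁ * (((M : ℝ≥0∞) ^ (1 - q / σ) * (p * K₀ : ℝ≥0∞) ^ (q / σ)) * lnorm μ s f) := by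
          refine mul_le_mul_right (h1.trans (mul_le_mul_left (h4.trans ?_) _)) _
          exact mul_le_mul' h5 (ENNReal.rpow_le_rpow hVN (by positivity))
      _ = 2⁻¹ * lnorm μ s f := by rw [← mul_assoc, h6]
  have hlow : ∀ L : ℝ≥0, ∀ f : X → ℝ≥0∞, Measurable f →
      lnorm μ s (kerOp μ K fun x => lowPart L V x * f x) ≤
        C₁ * ((L : ℝ≥0∞) ^ (1 - q / (2 * σ)) * (p * K₀ : ℝ≥0∞) ^ (q / (2 * σ)) * lnorm μ 2 f) := by
    intro L f hf
    have hm := measurable_lowPart L hV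
    refine (hls (fun x => lowPart L V x * f x) (hm.mul hf).aemeasurable).trans ?_
    have h1 := lnorm_mul_le hr0 (by linarith) er2 hm.aemeasurable hf.aemeasurable (μ := μ)
    have h4 := lnorm_lowPart_le (μ := μ) hq0 hq2 L V
    rw [e2σ] at h1 h4
    refine mul_le_mul_right (h1.trans (mul_le_mul_left (h4.trans ?_) _)) _
    exact mul_le_mul_right (ENNReal.rpow_le_rpow hVN (by positivity)) _
  have hsplit : ∀ (L : ℝ≥0), ∀ᵐ x ∂μ, y x ≤
      (g x + kerOp μ K (fun x => lowPart L V x * y x) x) +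
        kerOp μ K (fun x => highPart L V x * y x) x := by
    intro L
    filter_upwards [hle] with x hx
    refine hx.trans (le_of_eq ?_)
    have hadd := kerOp_add (ν := μ) (fun x => Measurable.of_uncurry_left (x := x) hK)
      (f := fun x => lowPart L V x * y x) (g := fun x => highPart L V x * y x)
      ((measurable_lowPart L hV).mul hy).aemeasurable x
    rw [add_assoc, ← hadd]
    congr 2
    funext x
    rw [← add_mul, add_comm, highPart_add_lowPart]
  have hkm : ∀ W : X → ℝ≥0∞, Measurable W → Measurable (kerOp μ K fun x => W x * y x) :=
    fun W hW => measurable_kerOp hK (hW.mul hy).aemeasurable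
  by_cases hgt : lnorm μ s g = ⊤
  · rw [hgt]; simp
  by_cases hyt : lnorm μ 2 y = ⊤
  · rw [hyt, ENNReal.mul_top]
    · simp
    · have h1 : a ≠ 0 := (mul_pos (NNReal.rpow_pos (by positivity))
        (NNReal.rpow_pos (by positivity))).ne'
      have h2 : (p : ℝ≥0∞) ^ (q / (2 * q - Q - 2)) ≠ 0 := by
        rw [Ne, ENNReal.rpow_eq_zero_iff]; simp [hp]
      refine mul_ne_zero ?_ h2
      exact_mod_cast mul_ne_zero two_ne_zero (mul_ne_zero hC₁ h1)
  -- For the contraction in weighted `L¹` the level has to make the `L^q` tail of `V` small, and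
  -- such a level depends on `V` itself. Only finiteness is retained from this step; the constant
  -- comes from the level `M`.
  have hysfin : lnorm μ s y ≠ ⊤ := by
    obtain ⟨n, hn1, hn2⟩ : ∃ n : ℕ, M ≤ n ∧ lnorm μ q (highPart n V) * C₂ ≤ 2⁻¹ := by
      have ht : Filter.Tendsto (fun n : ℕ => lnorm μ q (highPart n V) * C₂) Filter.atTop (nhds 0) := by
        simpa using ENNReal.Tendsto.mul_const (tendsto_lnorm_highPart hq0 hV hVt hNt)
          (Or.inr (ENNReal.coe_ne_top (r := C₂)))
      obtain ⟨N, hN⟩ := exists_nat_ge M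
      obtain ⟨n, h1, h2⟩ := ((ENNReal.tendsto_nhds_zero.1 ht 2⁻¹ (by simp)).and
        (Filter.eventually_ge_atTop N)).exists
      exact ⟨n, hN.trans (by exact_mod_cast h2), h1⟩
    have hmh := measurable_highPart (n : ℝ≥0) hV
    have h := lnorm_le_of_contraction (μ := μ) hK hmh hs1 (A := A) (by simp) (hhigh n hn1)
      (fun z => by
        refine le_trans ?_ ((mul_le_mul_right (h2 z) _).trans hn2)
        exact ENNReal.lintegral_mul_le_Lp_mul_Lq μ hqq hmh.aemeasurable
          (Measurable.of_uncurry_right hK).aemeasurable) h3 hy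
      (hg.add (hkm _ (measurable_lowPart n hV))) (hsplit n)
      (ne_top_of_le_ne_top hVy (lintegral_mono fun x => by
        gcongr; rw [← highPart_add_lowPart n V x]; exact le_self_add))
    refine ne_top_of_le_ne_top ?_ (h.trans (mul_le_mul_right (lnorm_add_le hs1 hg.aemeasurable
      (hkm _ (measurable_lowPart n hV)).aemeasurable) _))
    refine ENNReal.mul_ne_top (by simp) (ENNReal.add_ne_top.2 ⟨hgt, ?_⟩)
    refine ne_top_of_le_ne_top ?_ (hlow n y hy)
    have hexp : 0 ≤ 1 - q / (2 * σ) := by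
      rw [sub_nonneg, div_le_one (by positivity)]; linarith
    have h1 : ((n : ℝ≥0) : ℝ≥0∞) ^ (1 - q / (2 * σ)) ≠ ⊤ :=
      ENNReal.rpow_ne_top_of_nonneg hexp (by simp)
    have h2 : (p * K₀ : ℝ≥0∞) ^ (q / (2 * σ)) ≠ ⊤ :=
      ENNReal.rpow_ne_top_of_nonneg (by positivity) (by finiteness)
    exact ENNReal.mul_ne_top (by simp) (ENNReal.mul_ne_top (ENNReal.mul_ne_top h1 h2) hyt)
  have hfinal : lnorm μ s y ≤ (lnorm μ s g +
      C₁ * ((M : ℝ≥0∞) ^ (1 - q / (2 * σ)) * (p * K₀ : ℝ≥0∞) ^ (q / (2 * σ)) * lnorm μ 2 y)) +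
        2⁻¹ * lnorm μ s y := by
    have hm1 := hkm _ (measurable_lowPart M hV)
    have hm2 := hkm _ (measurable_highPart M hV)
    refine (lnorm_mono hs0 (hsplit M)).trans ((lnorm_add_le hs1 (hg.add hm1).aemeasurable
      hm2.aemeasurable).trans (add_le_add ((lnorm_add_le hs1 hg.aemeasurable
        hm1.aemeasurable).trans (add_le_add le_rfl (hlow M y hy))) (hhigh M le_rfl y hy)))
  refine (le_two_mul_of_le_add_half hysfin hfinal).trans (le_of_eq ?_)
  have e1 : (M : ℝ≥0∞) ^ (1 - q / (2 * σ)) * (p * K₀ : ℝ≥0∞) ^ (q / (2 * σ)) =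
      a * (p : ℝ≥0∞) ^ (q / (2 * q - Q - 2)) := by
    rw [← ENNReal.coe_rpow_of_ne_zero hM0, ← ENNReal.coe_mul,
      ← ENNReal.coe_rpow_of_nonneg _ (by positivity), ← ENNReal.coe_mul, hM2, ENNReal.coe_mul,
      ENNReal.coe_rpow_of_ne_zero hp]
    congr 3
    rw [hσ]; ring
  rw [e1, mul_add]
  push_cast
  ring

end Absorption

theorem homDim_pos {B : Matrix (Idx m) (Idx m) ℝ} (hB : DriftStructure B) :
    (0 : ℝ) < homDim m := by
  have h1 : m 0 ≤ homDim m := by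
    have := Finset.single_le_sum (f := fun k : Fin (d + 1) => (2 * (k : ℕ) + 1) * m k)
      (fun _ _ => Nat.zero_le _) (Finset.mem_univ 0)
    simpa [homDim] using this
  have := hB.one_le
  exact_mod_cast (by omega : 0 < homDim m)

/-- The integrability gain for non-negative functions with `D_i (a_ij D_j v) + Y v ≥ H`, where `H`
is controlled by `|Dv|`, by a potential times `v`, and by a source. -/
theorem lnorm_cutoff_mul_le {B : Matrix (Idx m) (Idx m) ℝ} (hB : DriftStructure B) {A : ℝ}
    (hA : 0 ≤ A) {q : ℝ} (hq : ((homDim m : ℝ) + 2) / 2 < q) (hq2 : q ≤ (homDim m : ℝ) + 2)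
    (Kb : ℝ≥0) : ∃ C₀ : ℝ≥0, ∀ K₀ : ℝ≥0, K₀ ≠ 0 → ∃ C : ℝ≥0,
    ∀ (a : Pt m → Matrix (Fin (m 0)) (Fin (m 0)) ℝ),
      (∀ i j, AEStronglyMeasurable (fun z => a z i j) volume) → (∀ᵐ z, ∀ i j, |a z i j| ≤ A) →
    ∀ (z₀ : Pt m) (r L : ℝ) (χ v : Pt m → ℝ) (Dv : Pt m → Grad m) (H : Pt m → ℝ),
      LocalIneq B a (openBall B r z₀) v Dv H → 1 ≤ L → Cutoff B (openBall B r z₀) z₀.2 L χ →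
    ∀ (p : ℝ≥0) (b W S : Pt m → ℝ≥0∞), 1 ≤ p → Measurable b → Measurable W → Measurable S →
      (∀ z, W z ≠ ⊤) → lnorm volume ((homDim m : ℝ) + 2) b ≤ Kb → lnorm volume q W ≤ p * K₀ →
      ∫⁻ z, W z * ENNReal.ofReal (v z) ≠ ⊤ →
      (∀ᵐ z, ENNReal.ofReal |H z| ≤ b z * ‖Dv z‖ₑ + W z * ENNReal.ofReal (v z) + S z) →
      lnorm volume (2 * (1 + 2 / (homDim m : ℝ))) (fun z => ENNReal.ofReal (χ z * v z)) ≤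
        C * ENNReal.ofReal L * ((p : ℝ≥0∞) ^ (q / (2 * q - homDim m - 2)) *
          lnorm volume 2 (fun z => ENNReal.ofReal (v z)) + lnorm volume 2 fun z => ‖Dv z‖ₑ) +
        C₀ * lnorm volume ((2 * (homDim m : ℝ) + 4) / ((homDim m : ℝ) + 4)) S := by
  have hQ := homDim_pos hB
  obtain ⟨R, C, hR, hC, hpt⟩ := pointwise_bound hB hA
  obtain ⟨Q, hQd⟩ : ∃ Q : ℝ, Q = homDim m := ⟨_, rfl⟩
  rw [← hQd] at hq hq2 hQ hpt ⊢
  -- The potential of order one, from `L²`: the splitting exponents are `a = 1 / 2` and `b = Q / 4`.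
  have hlsK1 := hls_grpKer B hR (e := (Q + 1) / 2) (p := 2) (p' := 2)
    (q := 2 * (1 + 2 / Q)) (b := Q / 4) Real.HolderConjugate.two_two
    (by rw [hQd]; linarith) (by positivity) (by rw [hQd]; ring)
    (by rw [← hQd]; field_simp; ring)
  have hpp : ((2 * Q + 4) / (Q + 4)).HolderConjugate ((2 * Q + 4) / Q) := by
    rw [Real.holderConjugate_iff]
    refine ⟨by rw [lt_div_iff₀ (by positivity)]; linarith, ?_⟩
    rw [inv_div, inv_div]; field_simp; ring
  -- The potential of order two, from `L^((2Q+4)/(Q+4))` to the same target: here `a = 1` and `b = Q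
  -- / 4`.
  have hlsK2 := hls_grpKer B hR (e := Q / 2) (q := 2 * (1 + 2 / Q)) (b := Q / 4) hpp
    (by rw [hQd]; linarith) (by positivity)
    (by rw [← hQd]; field_simp; ring) (by rw [← hQd]; field_simp; ring)
  obtain ⟨C₁, hC₁0, hC₁⟩ := hlsK1
  obtain ⟨C₂, hC₂0, hC₂⟩ := hlsK2
  have hq1 : 1 < q := by linarith
  have hqq := Real.HolderConjugate.conjExponent hq1
  -- The columns `s^(-Q/2)` lie in the dual space of `L^q` because `q > (Q + 2) / 2`.
  obtain ⟨C₃, hC₃⟩ := exists_col_bound B hR (e := Q / 2) (p := q.conjExponent) hqq.symm.pos (by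
    rw [← hQd, Real.conjExponent]
    have : 0 < q - 1 := by linarith
    have e : Q / 2 + 1 - Q / 2 * (q / (q - 1)) = (q - (Q + 2) / 2) / (q - 1) := by
      field_simp; ring
    rw [e]; exact div_pos (by linarith) this)
  obtain ⟨C₄, hC₄⟩ := exists_col_bound B hR (e := Q / 2) (p := 1) one_pos (by
    rw [← hQd]; linarith)
  simp only [div_one, ENNReal.rpow_one] at hC₄
  -- The constant of the source term is fixed before `K₀`; the estimate of powers picks its `K₀` in
  -- terms of it.
  refine ⟨2 * C.toNNReal * C₂, fun K₀ hK₀ => ?_⟩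
  have hCN : C.toNNReal ≠ 0 := (Real.toNNReal_pos.2 hC).ne'
  obtain ⟨C₅, hC₅⟩ := lnorm_absorb (μ := (volume : Measure (Pt m))) hQ hq hq2 hqq
    (measurable_grpKer B R (Q / 2)) hC₂0.ne' (mul_ne_zero hCN hK₀) hC₂ hC₃ hC₄
  obtain ⟨E, hE⟩ : ∃ E : ℝ≥0, E = C.toNNReal := ⟨_, rfl⟩
  have hEC : ENNReal.ofReal C = (E : ℝ≥0∞) := by rw [hE]; rfl
  rw [← hE] at hC₅ ⊢
  refine ⟨2 * E * C₁ + 2 * E * C₂ * Kb + C₅, ?_⟩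
  intro a ham haA z₀ r L χ v Dv H hv hL hχ p b W S hp hb hW hS hWt hbK hWK hWv hH
  have hyle := hpt a ham haA _ v Dv H hv z₀.2 L χ hL hχ fun z hz => hz.2.le
  obtain ⟨s, hs⟩ : ∃ s, s = 2 * (1 + 2 / Q) := ⟨_, rfl⟩
  obtain ⟨t, ht⟩ : ∃ t, t = (2 * Q + 4) / (Q + 4) := ⟨_, rfl⟩
  rw [← hs] at hC₁ hC₂ hC₅ ⊢
  rw [← ht] at hC₂ ⊢
  have hs1 : 1 ≤ s := by
    have : 0 < 2 / Q := by positivity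
    rw [hs]; linarith
  have ht0 : 0 < t := by rw [ht]; positivity
  have ht1 : 1 ≤ t := by rw [ht, le_div_iff₀ (by positivity)]; linarith
  have htQ : t < Q + 2 := by rw [ht, div_lt_iff₀ (by positivity)]; nlinarith
  have et : 1 / t = 1 / (Q + 2) + 1 / 2 := by rw [ht]; field_simp; ring
  have hs0 : 0 < s := by linarith
  set y : Pt m → ℝ≥0∞ := fun z => ENNReal.ofReal (χ z * v z) with hy
  have hym : Measurable y := (hχ.smooth.continuous.measurable.mul hv.meas).ennreal_ofReal
  set N : Pt m → ℝ≥0∞ := fun z => ‖Dv z‖ₑ with hN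
  have hNm : Measurable N := hv.meas_grad.enorm
  have hvm : Measurable fun z => ENNReal.ofReal (v z) := hv.meas.ennreal_ofReal
  have hyv : ∀ z, y z ≤ ENNReal.ofReal (v z) := fun z => ENNReal.ofReal_le_ofReal
    (mul_le_of_le_one_left (hv.nonneg z) (hχ.le_one z))
  set f₁ : Pt m → ℝ≥0∞ := fun z => ENNReal.ofReal (v z) + N z with hf₁
  set f₂ : Pt m → ℝ≥0∞ := fun z => b z * N z + S z with hf₂
  have hf₁m : Measurable f₁ := hvm.add hNm
  have hf₂m : Measurable f₂ := (hb.mul hNm).add hS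
  have hKx : ∀ e z, Measurable (grpKer B R e z) := fun e z =>
    Measurable.of_uncurry_left (measurable_grpKer B R e)
  obtain ⟨g, hg⟩ : ∃ g : Pt m → ℝ≥0∞, g = fun z =>
      (E * ENNReal.ofReal L) * kerOp volume (grpKer B R ((Q + 1) / 2)) f₁ z +
        E * kerOp volume (grpKer B R (Q / 2)) f₂ z := ⟨_, rfl⟩
  have hk1m := measurable_kerOp (ν := (volume : Measure (Pt m)))
    (measurable_grpKer B R ((Q + 1) / 2)) hf₁m.aemeasurable
  have hk2m := measurable_kerOp (ν := (volume : Measure (Pt m)))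
    (measurable_grpKer B R (Q / 2)) hf₂m.aemeasurable
  have hgm : Measurable g := hg ▸ (hk1m.const_mul _).add (hk2m.const_mul _)
  -- The cut-off is kept inside the potential term, so that the same `y` stands on both sides; in
  -- the other terms it is bounded by `1`.
  have hyg : ∀ᵐ z, y z ≤ g z + kerOp volume (grpKer B R (Q / 2)) (fun z => (E * W z) * y z) z := by
    filter_upwards [hyle] with z hz
    refine hz.trans ?_
    have e1 : (fun ζ => ENNReal.ofReal (v ζ + ‖Dv ζ‖)) = f₁ := by
      funext ζ
      rw [ENNReal.ofReal_add (hv.nonneg ζ) (norm_nonneg _), ofReal_norm]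
    have e2 : kerOp volume (grpKer B R (Q / 2)) (fun ζ => ENNReal.ofReal (χ ζ * |H ζ|)) z ≤
        kerOp volume (grpKer B R (Q / 2)) (fun ζ => f₂ ζ + W ζ * y ζ) z := by
      refine kerOp_mono ?_ z
      filter_upwards [hH] with ζ hζ
      have h0 := hχ.nonneg ζ
      have hχ1 : ENNReal.ofReal (χ ζ) ≤ 1 := by simpa using hχ.le_one ζ
      rw [ENNReal.ofReal_mul h0]
      calc ENNReal.ofReal (χ ζ) * ENNReal.ofReal |H ζ|
          ≤ ENNReal.ofReal (χ ζ) * (b ζ * N ζ + W ζ * ENNReal.ofReal (v ζ) + S ζ) := by gcongr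
        _ = ENNReal.ofReal (χ ζ) * (b ζ * N ζ + S ζ) +
            W ζ * (ENNReal.ofReal (χ ζ) * ENNReal.ofReal (v ζ)) := by ring
        _ ≤ 1 * (b ζ * N ζ + S ζ) + W ζ * y ζ := by
            have e : y ζ = ENNReal.ofReal (χ ζ) * ENNReal.ofReal (v ζ) := ENNReal.ofReal_mul h0
            rw [e]; gcongr
        _ = f₂ ζ + W ζ * y ζ := by rw [one_mul]
    rw [e1, ENNReal.ofReal_mul hC.le, hEC, hg]
    have e3 : kerOp volume (grpKer B R (Q / 2)) (fun z => (E * W z) * y z) z =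
        E * kerOp volume (grpKer B R (Q / 2)) (fun z => W z * y z) z := by
      rw [← kerOp_const_mul (by simp)]; simp only [mul_assoc]
    have e4 := kerOp_add (ν := (volume : Measure (Pt m))) (hKx (Q / 2)) (f := f₂)
      (g := fun ζ => W ζ * y ζ) hf₂m.aemeasurable z
    rw [e4] at e2
    rw [e3, add_assoc, ← mul_add]
    exact add_le_add le_rfl (mul_le_mul_right e2 _)
  have hmain := hC₅ p (by positivity) (fun z => E * W z) y g (hW.const_mul _) hym hgm
    (fun z => ENNReal.mul_ne_top (by simp) (hWt z))
    (by
      rw [lnorm_const_mul (by linarith) (by simp)]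
      refine (mul_le_mul_right hWK _).trans (le_of_eq ?_)
      push_cast; ring)
    (by
      simp only [mul_assoc]
      rw [lintegral_const_mul' _ _ (by simp)]
      refine ENNReal.mul_ne_top (by simp) (ne_top_of_le_ne_top hWv (lintegral_mono fun z => ?_))
      gcongr
      exact hyv z) hyg
  have hy2 : lnorm volume 2 y ≤ lnorm volume 2 fun z => ENNReal.ofReal (v z) :=
    lnorm_mono two_pos (Filter.Eventually.of_forall hyv)
  obtain ⟨x, hx⟩ : ∃ x, x = lnorm volume 2 fun z => ENNReal.ofReal (v z) := ⟨_, rfl⟩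
  obtain ⟨w, hw⟩ : ∃ w, w = lnorm volume 2 N := ⟨_, rfl⟩
  have hg1 : lnorm volume s g ≤ E * ENNReal.ofReal L * (C₁ * (x + w)) +
      E * (C₂ * (Kb * w + lnorm volume t S)) := by
    rw [hg]
    refine (lnorm_add_le hs1 (hk1m.const_mul _).aemeasurable (hk2m.const_mul _).aemeasurable).trans ?_
    rw [lnorm_const_mul hs0 (by finiteness), lnorm_const_mul hs0 (by simp)]
    refine add_le_add (mul_le_mul_right ((hC₁ _ hf₁m.aemeasurable).trans
      (mul_le_mul_right ?_ _)) _) (mul_le_mul_right ((hC₂ _ hf₂m.aemeasurable).trans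
      (mul_le_mul_right ?_ _)) _)
    · rw [hx, hw]
      exact lnorm_add_le one_le_two hvm.aemeasurable hNm.aemeasurable
    · rw [hw]
      refine (lnorm_add_le ht1 (hb.mul hNm).aemeasurable hS.aemeasurable).trans (add_le_add ?_ le_rfl)
      exact (lnorm_mul_le ht0 htQ et hb.aemeasurable hNm.aemeasurable).trans
        (mul_le_mul_left hbK _)
  rw [← hx, ← hw]
  obtain ⟨P, hP⟩ : ∃ P, P = (p : ℝ≥0∞) ^ (q / (2 * q - Q - 2)) := ⟨_, rfl⟩
  have hP1 : 1 ≤ P := by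
    rw [hP]
    refine ENNReal.one_le_rpow (by exact_mod_cast hp) (div_pos (by linarith) (by linarith))
  have hL1 : 1 ≤ ENNReal.ofReal L := by simpa using hL
  rw [← hP] at hmain ⊢
  rw [← hx] at hy2
  set Λ := ENNReal.ofReal L with hΛ
  have hxP : x ≤ P * x := le_mul_of_one_le_left bot_le hP1
  obtain ⟨T, hT⟩ : ∃ T, T = Λ * (P * x + w) := ⟨_, rfl⟩
  obtain ⟨n, hn⟩ : ∃ n, n = lnorm volume t S := ⟨_, rfl⟩
  rw [← hn] at hg1 ⊢
  have i0 : x + w ≤ P * x + w := add_le_add hxP le_rfl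
  have i1 : w ≤ T := hT ▸ le_add_self.trans (le_mul_of_one_le_left bot_le hL1)
  have i2 : P * x ≤ T := hT ▸ le_self_add.trans (le_mul_of_one_le_left bot_le hL1)
  calc lnorm volume s y ≤ 2 * (E * Λ * (C₁ * (x + w)) + E * (C₂ * (Kb * w + n))) +
        C₅ * P * x := hmain.trans (add_le_add (mul_le_mul_right hg1 _) (mul_le_mul_right hy2 _))
    _ = 2 * E * C₁ * (Λ * (x + w)) + 2 * E * C₂ * Kb * w + C₅ * (P * x) + 2 * E * C₂ * n := by ring
    _ ≤ 2 * E * C₁ * T + 2 * E * C₂ * Kb * T + C₅ * T + 2 * E * C₂ * n := by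
        rw [hT] at i1 i2 ⊢
        gcongr
    _ = _ := by rw [hT]; push_cast; ring

/-! ### Mollification by left translations -/

/-- A left-invariant vector field `ξ` with constant divergence `κ`. -/
structure LeftInvariantField (B : Matrix (Idx m) (Idx m) ℝ) (ξ : Pt m → Pt m) (κ : ℝ) : Prop where
  continuous : Continuous ξ
  comp : ∀ φ : Pt m → ℝ, Differentiable ℝ φ → ∀ w ζ,
    fderiv ℝ (fun z => φ (groupMul B w z)) ζ (ξ ζ) =
      fderiv ℝ φ (groupMul B w ζ) (ξ (groupMul B w ζ))
  integral_eq : ∀ η : Pt m → ℝ, ContDiff ℝ 1 η → HasCompactSupport η →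
    ∫ z, (fderiv ℝ η z (ξ z) + κ * η z) = 0

/-- `g` is the derivative of `u` along `ξ` on `U` in the sense of distributions. -/
def IsWeakDeriv (U : Set (Pt m)) (ξ : Pt m → Pt m) (κ : ℝ) (u g : Pt m → ℝ) : Prop :=
  ∀ φ : Pt m → ℝ, IsTest U φ →
    ∫ z, u z * (-fderiv ℝ φ z (ξ z) - κ * φ z) = ∫ z, g z * φ z

instance isAddHaarMeasure_volume : (volume : Measure (Pt m)).IsAddHaarMeasure :=
  inferInstanceAs ((volume : Measure (Idx m → ℝ)).prod (volume : Measure ℝ)).IsAddHaarMeasure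

theorem integral_fderiv_eq_zero {η : Pt m → ℝ} (hη : ContDiff ℝ 1 η) (hc : HasCompactSupport η)
    (v : Pt m) : ∫ z, fderiv ℝ η z v = 0 := by
  have hi : Integrable fun z => fderiv ℝ η z v :=
    ((hη.continuous_fderiv (by simp)).clm_apply continuous_const).integrable_of_hasCompactSupport
      ((hc.fderiv (𝕜 := ℝ)).mono fun z hz h => hz (by simp [h]))
  have h := integral_mul_fderiv_eq_neg_fderiv_mul_of_integrable (μ := (volume : Measure (Pt m)))
    (f := fun _ : Pt m => (1 : ℝ)) (g := η) (v := v) (by simp) (by simpa using hi)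
    (by simpa using hη.continuous.integrable_of_hasCompactSupport hc) (by simp)
    (fun z _ => hη.differentiable (by simp) z)
  simpa using h

theorem leftInvariantField_coord (B : Matrix (Idx m) (Idx m) ℝ) (i : Fin (m 0)) :
    LeftInvariantField B (fun _ => (Pi.single (⟨0, i⟩ : Idx m) 1, 0)) 0 where
  continuous := continuous_const
  comp φ hφ w ζ := by
    have h := congrArg (fun v : Grad m => v i) (gradD_comp_groupMul B hφ w ζ)
    exact h
  integral_eq η hη hc := by
    simpa using integral_fderiv_eq_zero hη hc _

theorem leftInvariantField_yVec (B : Matrix (Idx m) (Idx m) ℝ) :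
    LeftInvariantField B (yVec B) B.trace where
  continuous := by
    unfold yVec
    exact Continuous.prodMk (Continuous.matrix_mulVec continuous_const continuous_fst)
      continuous_const
  comp φ hφ w ζ := by
    have h := fieldY_comp_groupMul B hφ w ζ
    rwa [fieldY_eq, fieldY_eq] at h
  integral_eq η hη hc := by
    have hd : Differentiable ℝ η := hη.differentiable (by simp)
    have hl : ∀ i : Idx m, ContDiff ℝ 1 fun z : Pt m => z.1 i := fun i =>
      (contDiff_apply ℝ ℝ i).comp contDiff_fst
    have hs : ∀ i, ContDiff ℝ 1 fun z : Pt m => z.1 i * η z := fun i => (hl i).mul hη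
    have hsc : ∀ i, HasCompactSupport fun z : Pt m => z.1 i * η z := fun i => hc.mul_left
    have e : ∀ z, fderiv ℝ η z (yVec B z) + B.trace * η z =
        ∑ i, ∑ j, B i j * fderiv ℝ (fun z : Pt m => z.1 i * η z) z (Pi.single j 1, 0) -
          fderiv ℝ η z (0, 1) := by
      intro z
      rw [← fieldY_eq, fieldY]
      have e1 : ∀ i j : Idx m, fderiv ℝ (fun z : Pt m => z.1 i * η z) z (Pi.single j 1, 0) =
          z.1 i * fderiv ℝ η z (Pi.single j 1, 0) + η z * (if i = j then 1 else 0) := by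
        intro i j
        rw [fderiv_fun_mul ((hl i).differentiable (by simp) z) (hd z)]
        have e2 : HasFDerivAt (fun z : Pt m => z.1 i)
            ((ContinuousLinearMap.proj i).comp (ContinuousLinearMap.fst ℝ (Idx m → ℝ) ℝ)) z :=
          ((ContinuousLinearMap.proj (R := ℝ) (φ := fun _ : Idx m => ℝ) i).comp
            (ContinuousLinearMap.fst ℝ (Idx m → ℝ) ℝ)).hasFDerivAt
        rw [e2.fderiv]
        simp [smul_eq_mul, Pi.single_apply]
      have e3 : ∀ i, ∑ j, B i j * (η z * if i = j then 1 else 0) = B i i * η z := by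
        intro i; simp
      simp only [e1, mul_add, Finset.sum_add_distrib, e3, Matrix.trace, Matrix.diag_apply,
        Finset.sum_mul]
      simp only [← mul_assoc]
      ring
    have hi : ∀ (F : Pt m → ℝ), ContDiff ℝ 1 F → HasCompactSupport F → ∀ v,
        Integrable fun z => fderiv ℝ F z v := fun F hF hFc v =>
      ((hF.continuous_fderiv (by simp)).clm_apply continuous_const).integrable_of_hasCompactSupport
        ((hFc.fderiv (𝕜 := ℝ)).mono fun z hz h => hz (by simp [h]))
    simp only [e]
    rw [integral_sub, integral_finsetSum]
    · simp only [integral_fderiv_eq_zero hη hc, sub_zero]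
      refine Finset.sum_eq_zero fun i _ => ?_
      rw [integral_finsetSum]
      · refine Finset.sum_eq_zero fun j _ => ?_
        rw [integral_const_mul, integral_fderiv_eq_zero (hs i) (hsc i), mul_zero]
      · exact fun j _ => (hi _ (hs i) (hsc i) _).const_mul _
    · exact fun i _ => integrable_finsetSum _ fun j _ => (hi _ (hs i) (hsc i) _).const_mul _
    · exact integrable_finsetSum _ fun i _ =>
        integrable_finsetSum _ fun j _ => (hi _ (hs i) (hsc i) _).const_mul _
    · exact hi _ hη hc _

theorem LeftInvariantField.integral_mul {B : Matrix (Idx m) (Idx m) ℝ} {ξ : Pt m → Pt m} {κ : ℝ}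
    (hξ : LeftInvariantField B ξ κ) {F ψ : Pt m → ℝ} (hF : ContDiff ℝ 1 F) (hψ : ContDiff ℝ 1 ψ)
    (hc : HasCompactSupport ψ) :
    ∫ z, F z * (-fderiv ℝ ψ z (ξ z) - κ * ψ z) = ∫ z, fderiv ℝ F z (ξ z) * ψ z := by
  have h := hξ.integral_eq (fun z => F z * ψ z) (hF.mul hψ) hc.mul_left
  have e : ∀ z, fderiv ℝ (fun z => F z * ψ z) z (ξ z) + κ * (F z * ψ z) =
      fderiv ℝ F z (ξ z) * ψ z - F z * (-fderiv ℝ ψ z (ξ z) - κ * ψ z) := by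
    intro z
    rw [fderiv_fun_mul (hF.differentiable (by simp) z) (hψ.differentiable (by simp) z)]
    simp [smul_eq_mul]; ring
  simp only [e] at h
  rw [integral_sub] at h
  · linarith
  · refine Continuous.integrable_of_hasCompactSupport ?_ hc.mul_left
    exact ((hF.continuous_fderiv (by simp)).clm_apply hξ.continuous).mul hψ.continuous
  · refine Continuous.integrable_of_hasCompactSupport ?_ (HasCompactSupport.mul_left ?_)
    · exact hF.continuous.mul (((hψ.continuous_fderiv (by simp)).clm_apply hξ.continuous).neg.sub
        (continuous_const.mul hψ.continuous))
    · exact ((hc.fderiv (𝕜 := ℝ)).mono fun z hz h => hz (by simp [h])).neg.sub hc.mul_left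

/-- The average of the left translates of `g` with weight `ρ`. -/
def mollify (B : Matrix (Idx m) (Idx m) ℝ) (ρ g : Pt m → ℝ) (z : Pt m) : ℝ :=
  ∫ w, ρ w * g (groupMul B w z)

theorem map_groupMul_right (B : Matrix (Idx m) (Idx m) ℝ) (z : Pt m) :
    Measure.map (fun w => groupMul B w z) volume =
      ENNReal.ofReal |(expE B z.2).det|⁻¹ • (volume : Measure (Pt m)) := by
  have hm : Measurable fun w => groupMul B w z :=
    ((contDiff_groupMul B).continuous.comp (Continuous.prodMk_left z)).measurable
  ext s hs
  have h := lintegral_groupMul_right B z (F := s.indicator 1) (measurable_one.indicator hs)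
  rw [lintegral_indicator_one hs] at h
  rw [Measure.smul_apply, smul_eq_mul, ← h, ← lintegral_indicator_one hs, lintegral_map
    (measurable_one.indicator hs) hm]

theorem integral_groupMul_right (B : Matrix (Idx m) (Idx m) ℝ) (z : Pt m) {F : Pt m → ℝ}
    (hF : Measurable F) :
    ∫ w, F (groupMul B w z) = |(expE B z.2).det|⁻¹ * ∫ w, F w := by
  have hm : Measurable fun w => groupMul B w z :=
    ((contDiff_groupMul B).continuous.comp (Continuous.prodMk_left z)).measurable
  rw [← integral_map hm.aemeasurable hF.aestronglyMeasurable, map_groupMul_right,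
    integral_smul_measure, ENNReal.toReal_ofReal (by positivity), smul_eq_mul]

/-- The substitution `ζ = w ∘ z` moves the dependence on `z` from `g` into the kernel, at the cost
of a smooth Jacobian. The integral is then a convolution with a smooth kernel depending on the
parameter `z`, evaluated at the origin. -/
theorem contDiff_mollify (B : Matrix (Idx m) (Idx m) ℝ) {ρ g : Pt m → ℝ} (hρ : ContDiff ℝ ∞ ρ)
    (hρc : HasCompactSupport ρ) (hg : Measurable g) (hgi : Integrable g) :
    ContDiff ℝ ∞ (mollify B ρ g) := by
  have hdet : ContDiff ℝ ∞ fun z : Pt m => |(expE B z.2).det|⁻¹ := by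
    have h1 : ContDiff ℝ ∞ fun z : Pt m => (expE B z.2).det := by
      simp only [Matrix.det_apply]
      refine ContDiff.sum fun σ _ => ContDiff.const_smul _ (contDiff_prod fun i _ => ?_)
      exact (contDiff_expE_entry B _ _).comp contDiff_snd
    exact (h1.abs fun z => det_expE_ne_zero B _).inv fun z => abs_ne_zero.2 (det_expE_ne_zero B _)
  set k : Pt m → Pt m → ℝ := fun p y => ρ (groupMul B (-y) (groupInv B p)) with hk
  have hks : ContDiff ℝ ∞ (Function.uncurry k) :=
    hρ.comp ((contDiff_groupMul B).comp
      ((contDiff_snd.neg).prodMk ((contDiff_groupInv B).comp contDiff_fst)))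
  have e : mollify B ρ g = fun z => |(expE B z.2).det|⁻¹ *
      (convolution g (k z) (ContinuousLinearMap.mul ℝ ℝ) volume) 0 := by
    funext z
    have hρm : Measurable fun ζ => ρ (groupMul B ζ (groupInv B z)) :=
      (hρ.continuous.comp ((contDiff_groupMul B).continuous.comp
        (Continuous.prodMk_left _))).measurable
    have h := integral_groupMul_right B z (hρm.mul hg)
    simp only [Pi.mul_apply, groupMul_assoc, groupMul_groupInv, groupMul_zero] at h
    rw [mollify, h, convolution_def]
    congr 2
    funext ζ
    simp [hk, mul_comm]
  rw [e]
  refine hdet.mul ?_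
  refine contDiff_iff_contDiffAt.2 fun p₀ => ?_
  obtain ⟨K, hK, hKs⟩ : ∃ K : Set (Pt m), IsCompact K ∧
      ∀ p ∈ Metric.ball p₀ 1, ∀ y, y ∉ K → k p y = 0 := by
    refine ⟨(fun q : Pt m × Pt m => -groupMul B q.1 q.2) '' (tsupport ρ ×ˢ Metric.closedBall p₀ 1),
      ?_, ?_⟩
    · exact (IsCompact.prod hρc (isCompact_closedBall p₀ 1)).image
        (contDiff_groupMul B).continuous.neg
    · intro p hp y hy
      by_contra hne
      refine hy ⟨(groupMul B (-y) (groupInv B p), p), ⟨subset_tsupport _ hne,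
        Metric.ball_subset_closedBall hp⟩, ?_⟩
      have hinv : groupMul B (groupInv B p) p = 0 := groupInv_groupMul B p
      simp only [groupMul_assoc, hinv, groupMul_zero, neg_neg]
  have h := contDiffOn_convolution_right_with_param_comp (μ := (volume : Measure (Pt m)))
    (n := ⊤) (ContinuousLinearMap.mul ℝ ℝ) (s := Metric.ball p₀ 1) (v := fun _ => (0 : Pt m))
    contDiffOn_const (f := g) (g := k) Metric.isOpen_ball hK (fun p x hp hx => hKs p hp x hx)
    hgi.locallyIntegrable hks.contDiffOn
  exact h.contDiffAt (Metric.ball_mem_nhds p₀ one_pos)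

theorem integrable_mollify_kernel (B : Matrix (Idx m) (Idx m) ℝ) {ρ g : Pt m → ℝ}
    (hρ : Continuous ρ) (hρc : HasCompactSupport ρ) (hg : Measurable g) (hgi : Integrable g) :
    Integrable (fun q : Pt m × Pt m => ρ q.1 * g (groupMul B q.1 q.2))
      ((volume : Measure (Pt m)).prod volume) := by
  have hm : Measurable fun q : Pt m × Pt m => ρ q.1 * g (groupMul B q.1 q.2) :=
    (hρ.measurable.comp measurable_fst).mul (hg.comp (contDiff_groupMul B).continuous.measurable)
  refine (integrable_prod_iff hm.aestronglyMeasurable).2 ⟨?_, ?_⟩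
  · refine Filter.Eventually.of_forall fun w => ?_
    exact ((measurePreserving_groupMul_left B w).integrable_comp_of_integrable hgi).const_mul (ρ w)
  · have e : ∀ w, ∫ z, ‖ρ w * g (groupMul B w z)‖ = ‖ρ w‖ * ∫ z, ‖g z‖ := fun w => by
      simp only [norm_mul]
      rw [integral_const_mul]
      congr 1
      have h := integral_map (μ := (volume : Measure (Pt m))) (φ := groupMul B w)
        (continuous_groupMul_left B w).measurable.aemeasurable (f := fun z => ‖g z‖)
        hg.norm.aestronglyMeasurable
      rw [(measurePreserving_groupMul_left B w).map_eq] at h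
      exact h.symm
    simp only [e]
    exact (hρ.integrable_of_hasCompactSupport hρc).norm.mul_const _

theorem integral_mollify_mul (B : Matrix (Idx m) (Idx m) ℝ) {ρ g ψ : Pt m → ℝ}
    (hρ : Continuous ρ) (hρc : HasCompactSupport ρ) (hg : Measurable g) (hgi : Integrable g)
    (hψ : Continuous ψ) (hψc : HasCompactSupport ψ) :
    ∫ z, mollify B ρ g z * ψ z =
      ∫ w, ρ w * ∫ ζ, g ζ * ψ (groupMul B (groupInv B w) ζ) := by
  obtain ⟨M, hM⟩ := hψ.bounded_above_of_compact_support hψc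
  have hi : Integrable (fun q : Pt m × Pt m => ρ q.1 * g (groupMul B q.1 q.2) * ψ q.2)
      ((volume : Measure (Pt m)).prod volume) :=
    (integrable_mollify_kernel B hρ hρc hg hgi).mul_bdd
      (hψ.measurable.comp measurable_snd).aestronglyMeasurable
      (Filter.Eventually.of_forall fun q => hM q.2)
  calc ∫ z, mollify B ρ g z * ψ z = ∫ z, ∫ w, ρ w * g (groupMul B w z) * ψ z := by
        congr 1; funext z
        rw [mollify, ← integral_mul_const]
    _ = ∫ w, ∫ z, ρ w * g (groupMul B w z) * ψ z := (integral_integral_swap hi).symm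
    _ = _ := by
        congr 1; funext w
        simp only [mul_assoc]
        rw [integral_const_mul]
        congr 1
        have h := integral_map (μ := (volume : Measure (Pt m))) (φ := groupMul B w)
          (continuous_groupMul_left B w).measurable.aemeasurable
          (f := fun ζ => g ζ * ψ (groupMul B (groupInv B w) ζ))
          (hg.mul (hψ.comp (continuous_groupMul_left B _)).measurable).aestronglyMeasurable
        rw [(measurePreserving_groupMul_left B w).map_eq] at h
        simp only [groupInv_groupMul_cancel] at h
        exact h.symm

/-- Mollification by left translations commutes with left-invariant fields. -/
theorem fderiv_mollify {B : Matrix (Idx m) (Idx m) ℝ} {ξ : Pt m → Pt m} {κ : ℝ}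
    (hξ : LeftInvariantField B ξ κ) {U V : Set (Pt m)} (hV : IsOpen V) {u g : Pt m → ℝ}
    (hu : Measurable u) (hui : Integrable u) (hg : Measurable g) (hgi : Integrable g)
    (h : IsWeakDeriv U ξ κ u g) {ρ : Pt m → ℝ} (hρ : ContDiff ℝ ∞ ρ) (hρc : HasCompactSupport ρ)
    (hUV : ∀ w, ρ w ≠ 0 → ∀ z ∈ V, groupMul B w z ∈ U) :
    ∀ᵐ z, z ∈ V → fderiv ℝ (mollify B ρ u) z (ξ z) = mollify B ρ g z := by
  have hsu := contDiff_mollify B hρ hρc hu hui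
  have hsg := contDiff_mollify B hρ hρc hg hgi
  have hc1 : Continuous fun z => fderiv ℝ (mollify B ρ u) z (ξ z) :=
    (hsu.continuous_fderiv (by simp)).clm_apply hξ.continuous
  have key := hV.ae_eq_zero_of_integral_contDiff_smul_eq_zero (μ := (volume : Measure (Pt m)))
    (f := fun z => fderiv ℝ (mollify B ρ u) z (ξ z) - mollify B ρ g z)
    ((hc1.sub hsg.continuous).locallyIntegrable.locallyIntegrableOn V) ?_
  · filter_upwards [key] with z hz hzV
    exact sub_eq_zero.1 (hz hzV)
  intro ψ hψ hψc hψV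
  have hψ1 : ContDiff ℝ 1 ψ := hψ.of_le (by simp)
  have hψd : Differentiable ℝ ψ := hψ.differentiable (by simp)
  have hXc : Continuous fun z => -fderiv ℝ ψ z (ξ z) - κ * ψ z :=
    ((hψ.continuous_fderiv (by simp)).clm_apply hξ.continuous).neg.sub
      (continuous_const.mul hψ.continuous)
  have hXcs : HasCompactSupport fun z => -fderiv ℝ ψ z (ξ z) - κ * ψ z :=
    ((hψc.fderiv (𝕜 := ℝ)).mono fun z hz h => hz (by simp [h])).neg.sub hψc.mul_left
  have e1 := hξ.integral_mul (hsu.of_le (by simp)) hψ1 hψc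
  have e2 := integral_mollify_mul B hρ.continuous hρc hu hui hXc hXcs
  have e3 := integral_mollify_mul B hρ.continuous hρc hg hgi hψ.continuous hψc
  have e4 : ∀ w, ρ w * ∫ ζ, u ζ * (-fderiv ℝ ψ (groupMul B (groupInv B w) ζ)
      (ξ (groupMul B (groupInv B w) ζ)) - κ * ψ (groupMul B (groupInv B w) ζ)) =
      ρ w * ∫ ζ, g ζ * ψ (groupMul B (groupInv B w) ζ) := by
    intro w
    by_cases hw : ρ w = 0
    · simp [hw]
    congr 1
    -- The translation is transferred to the test function, where it commutes with the field by left
    -- invariance. No commutator appears, although the coefficients of `Y` are not constant.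
    have ht : IsTest U fun ζ => ψ (groupMul B (groupInv B w) ζ) := by
      have hco : Continuous (groupMul B (groupInv B w)) := continuous_groupMul_left B _
      have hsub : tsupport (fun ζ => ψ (groupMul B (groupInv B w) ζ)) ⊆
          groupMul B w '' tsupport ψ := by
        refine closure_minimal (fun ζ hζ => ?_)
          (IsCompact.image hψc (continuous_groupMul_left B w)).isClosed
        exact ⟨_, subset_tsupport _ hζ, groupMul_groupInv_cancel B w ζ⟩
      refine ⟨hψ.comp (contDiff_groupMul_left B _), ?_, ?_⟩
      · exact (IsCompact.image hψc (continuous_groupMul_left B w)).of_isClosed_subset (isClosed_tsupport _) hsub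
      · refine hsub.trans ?_
        rintro _ ⟨z, hz, rfl⟩
        exact hUV w hw z (hψV hz)
    have := h _ ht
    simp only [hξ.comp ψ hψd] at this
    exact this
  have e5 : ∫ z, fderiv ℝ (mollify B ρ u) z (ξ z) * ψ z = ∫ z, mollify B ρ g z * ψ z := by
    rw [← e1, e2, e3]
    exact integral_congr_ae (Filter.Eventually.of_forall e4)
  have i1 : Integrable fun z => fderiv ℝ (mollify B ρ u) z (ξ z) * ψ z :=
    (hc1.mul hψ.continuous).integrable_of_hasCompactSupport hψc.mul_left
  have i2 : Integrable fun z => mollify B ρ g z * ψ z :=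
    (hsg.continuous.mul hψ.continuous).integrable_of_hasCompactSupport hψc.mul_left
  calc ∫ z, ψ z • (fderiv ℝ (mollify B ρ u) z (ξ z) - mollify B ρ g z)
      = ∫ z, (fderiv ℝ (mollify B ρ u) z (ξ z) * ψ z - mollify B ρ g z * ψ z) := by
        congr 1; funext z; rw [smul_eq_mul]; ring
    _ = 0 := by rw [integral_sub i1 i2, e5, sub_self]

/-! ### Approximation by smooth functions and the chain rule -/

theorem exists_mollifiers : ∃ ρ : ℕ → Pt m → ℝ, ∀ n, ContDiff ℝ ∞ (ρ n) ∧ HasCompactSupport (ρ n) ∧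
    (∀ w, 0 ≤ ρ n w) ∧ (∫ w, ρ n w = 1) ∧ ∀ w, ρ n w ≠ 0 → ‖w‖ < 1 / ((n : ℝ) + 1) := by
  let f : ℕ → ContDiffBump (0 : Pt m) := fun n =>
    ⟨1 / ((n : ℝ) + 1) / 2, 1 / ((n : ℝ) + 1), by positivity, half_lt_self (by positivity)⟩
  refine ⟨fun n => (f n).normed volume, fun n => ⟨(f n).contDiff_normed, (f n).hasCompactSupport_normed,
    (f n).nonneg_normed, (f n).integral_normed, fun w hw => ?_⟩⟩
  have h : w ∈ Function.support ((f n).normed volume) := hw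
  rw [(f n).support_normed_eq] at h
  simpa [f] using h

theorem eLpNorm_two_le_iff {f : Pt m → ℝ} {ε : ℝ≥0∞} :
    eLpNorm f 2 volume ≤ ε ↔ ∫⁻ z, ‖f z‖ₑ ^ 2 ≤ ε ^ 2 := by
  rw [eLpNorm_eq_lintegral_rpow_enorm_toReal (by simp) (by simp)]
  simp only [ENNReal.toReal_ofNat, ENNReal.rpow_two]
  rw [one_div, ENNReal.rpow_inv_le_iff two_pos, ENNReal.rpow_two]

theorem tendsto_mollify (B : Matrix (Idx m) (Idx m) ℝ) {ρ : ℕ → Pt m → ℝ}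
    (hρ : ∀ n, ContDiff ℝ ∞ (ρ n) ∧ HasCompactSupport (ρ n) ∧
      (∀ w, 0 ≤ ρ n w) ∧ (∫ w, ρ n w = 1) ∧ ∀ w, ρ n w ≠ 0 → ‖w‖ < 1 / ((n : ℝ) + 1))
    {g : Pt m → ℝ} (hg : Measurable g) (hgi : Integrable g) (hg2 : MemLp g 2) :
    Filter.Tendsto (fun n => eLpNorm (fun z => mollify B (ρ n) g z - g z) 2 volume) Filter.atTop
      (nhds 0) := by
  refine ENNReal.tendsto_nhds_zero.2 fun ε hε => ?_
  obtain ⟨η, hη0, hη⟩ := Metric.eventually_nhds_iff.1 (ENNReal.tendsto_nhds_zero.1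
    (tendsto_shiftDist (nearIdentity_left B) hg hg2) (ε ^ 2) (by positivity))
  obtain ⟨N, hN⟩ := exists_nat_one_div_lt hη0
  filter_upwards [Filter.eventually_ge_atTop N] with n hn
  obtain ⟨h1, h2, h3, h4, h5⟩ := hρ n
  have hsm : ∀ w, ENNReal.ofReal (ρ n w) ≠ 0 → shiftDist (groupMul B) g w ≤ ε ^ 2 := fun w hw => by
    refine hη ?_
    have : ρ n w ≠ 0 := fun h => hw (by simp [h])
    rw [dist_zero_right]
    refine (h5 w this).trans (lt_of_le_of_lt ?_ hN)
    gcongr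
  have hmass : ∫⁻ w, ENNReal.ofReal (ρ n w) = 1 := by
    rw [← ofReal_integral_eq_lintegral_ofReal (h1.continuous.integrable_of_hasCompactSupport h2)
      (Filter.Eventually.of_forall h3), h4, ENNReal.ofReal_one]
  have h := lintegral_average_sq_le (nearIdentity_left B) hg
    h1.continuous.measurable.ennreal_ofReal hsm
  rw [hmass, one_pow, one_mul] at h
  rw [eLpNorm_two_le_iff]
  refine le_trans (lintegral_mono_ae ?_) h
  filter_upwards [(integrable_mollify_kernel B h1.continuous h2 hg hgi).prod_left_ae] with z hz
  gcongr
  have e : mollify B (ρ n) g z - g z = ∫ w, ρ n w * (g (groupMul B w z) - g z) := by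
    simp only [mul_sub]
    rw [integral_sub hz ((h1.continuous.integrable_of_hasCompactSupport h2).mul_const _),
      integral_mul_const, h4, one_mul]
    rfl
  rw [e]
  refine (enorm_integral_le_lintegral_enorm _).trans (lintegral_mono fun w => ?_)
  rw [enorm_mul, Real.enorm_eq_ofReal (h3 w)]

/-- The sequence is chosen independently of the field, so that all left-invariant derivatives of `u`
in `L²` are approximated along the same functions. -/
theorem exists_smooth_approx (B : Matrix (Idx m) (Idx m) ℝ) {U K : Set (Pt m)} (hU : IsOpen U)
    (hK : IsCompact K) (hKU : K ⊆ U) {u : Pt m → ℝ} (hu : Measurable u) (hui : Integrable u)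
    (hu2 : MemLp u 2) (hu0 : ∀ z, 0 ≤ u z) : ∃ F : ℕ → Pt m → ℝ,
    (∀ n, ContDiff ℝ ∞ (F n)) ∧ (∀ n z, 0 ≤ F n z) ∧
    Filter.Tendsto (fun n => eLpNorm (fun z => F n z - u z) 2 volume) Filter.atTop (nhds 0) ∧
    (∀ᵐ z, Filter.Tendsto (fun n => F n z) Filter.atTop (nhds (u z))) ∧
    ∀ (ξ : Pt m → Pt m) (κ : ℝ) (g : Pt m → ℝ), LeftInvariantField B ξ κ → Measurable g →
      Integrable g → MemLp g 2 → IsWeakDeriv U ξ κ u g → ∃ G : ℕ → Pt m → ℝ,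
        (∀ n, Continuous (G n)) ∧
        Filter.Tendsto (fun n => eLpNorm (fun z => G n z - g z) 2 volume) Filter.atTop (nhds 0) ∧
        ∀ n, ∀ᵐ z, z ∈ K → fderiv ℝ (F n) z (ξ z) = G n z := by
  obtain ⟨ρ, hρ⟩ := exists_mollifiers (m := m)
  obtain ⟨W, V, hW, hV, hW0, hKV, hWV⟩ := generalized_tube_lemma (isCompact_singleton (x := (0 : Pt m)))
    hK (hU.preimage (contDiff_groupMul B).continuous) (by
      rintro ⟨w, z⟩ ⟨hw, hz⟩
      have hw' : w = 0 := hw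
      subst hw'
      change groupMul B 0 z ∈ U
      rw [zero_groupMul]; exact hKU hz)
  obtain ⟨η, hη0, hη⟩ := Metric.isOpen_iff.1 hW 0 (hW0 rfl)
  obtain ⟨N, hN⟩ := exists_nat_one_div_lt hη0
  have hlim := tendsto_mollify B hρ hu hui hu2
  have hmeas : Filter.Tendsto (fun n => eLpNorm (mollify B (ρ n) u - u) 2 volume) Filter.atTop
    (nhds 0) := hlim
  have hinM := tendstoInMeasure_of_tendsto_eLpNorm (p := 2) (by simp)
    (fun n => (contDiff_mollify B (hρ n).1 (hρ n).2.1 hu hui).continuous.aestronglyMeasurable)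
    hu.aestronglyMeasurable hmeas
  obtain ⟨ns, hns, hae⟩ := hinM.exists_seq_tendsto_ae
  -- The subsequence gives convergence almost everywhere, and the shift by `N` makes the
  -- translations so small that they keep `K` inside `U`.
  have hσ : Filter.Tendsto (fun n => ns (n + N)) Filter.atTop Filter.atTop :=
    hns.tendsto_atTop.comp (Filter.tendsto_add_atTop_nat N)
  have hge : ∀ n, N ≤ ns (n + N) := fun n => (Nat.le_add_left N n).trans (hns.id_le _)
  refine ⟨fun n => mollify B (ρ (ns (n + N))) u,
    fun n => contDiff_mollify B (hρ _).1 (hρ _).2.1 hu hui, fun n z => ?_, hlim.comp hσ, ?_, ?_⟩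
  · exact integral_nonneg fun w => mul_nonneg ((hρ _).2.2.1 w) (hu0 _)
  · filter_upwards [hae] with z hz
    exact hz.comp (Filter.tendsto_add_atTop_nat N)
  · intro ξ κ g hξ hg hgi hg2 hw
    refine ⟨fun n => mollify B (ρ (ns (n + N))) g,
      fun n => (contDiff_mollify B (hρ _).1 (hρ _).2.1 hg hgi).continuous,
      (tendsto_mollify B hρ hg hgi hg2).comp hσ, fun n => ?_⟩
    have h := fderiv_mollify hξ hV hu hui hg hgi hw (hρ (ns (n + N))).1 (hρ _).2.1
      (fun w hw z hz => ?_)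
    · filter_upwards [h] with z hz hzK
      exact hz (hKV hzK)
    · have hwW : w ∈ Metric.ball (0 : Pt m) η := ?_
      · have hmem : (w, z) ∈ W ×ˢ V := ⟨hη hwW, hz⟩
        exact hWV hmem
      rw [Metric.mem_ball, dist_zero_right]
      refine ((hρ _).2.2.2.2 w hw).trans (lt_of_le_of_lt ?_ hN)
      have : (N : ℝ) ≤ ns (n + N) := by exact_mod_cast hge n
      gcongr

theorem tendsto_integral_sub_mul {A : ℕ → Pt m → ℝ} {A' β : Pt m → ℝ} {b : ℕ → Pt m → ℝ}
    (hA : ∀ n, AEMeasurable (A n)) (hA' : AEMeasurable A')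
    (hlim : Filter.Tendsto (fun n => eLpNorm (fun z => A n z - A' z) 2 volume) Filter.atTop (nhds 0))
    (hβ : MemLp β 2) (hb : ∀ n, ∀ᵐ z, |b n z| ≤ β z) :
    Filter.Tendsto (fun n => ∫ z, (A n z - A' z) * b n z) Filter.atTop (nhds 0) := by
  have hle : ∀ n, ‖∫ z, (A n z - A' z) * b n z‖ₑ ≤
      eLpNorm (fun z => A n z - A' z) 2 volume * eLpNorm β 2 volume := fun n => by
    refine (enorm_integral_le_lintegral_enorm _).trans ?_
    have h := ENNReal.lintegral_mul_le_Lp_mul_Lq (volume : Measure (Pt m))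
      (f := fun z => ‖A n z - A' z‖ₑ) (g := fun z => ‖β z‖ₑ) Real.HolderConjugate.two_two
      ((hA n).sub hA').enorm hβ.aestronglyMeasurable.aemeasurable.enorm
    rw [eLpNorm_eq_lintegral_rpow_enorm_toReal (by simp) (by simp),
      eLpNorm_eq_lintegral_rpow_enorm_toReal (by simp) (by simp)]
    simp only [ENNReal.toReal_ofNat]
    refine (lintegral_mono_ae ?_).trans h
    filter_upwards [hb n] with z hz
    simp only [Pi.mul_apply]
    rw [enorm_mul]
    gcongr
    rw [← ofReal_norm, ← ofReal_norm]
    exact ENNReal.ofReal_le_ofReal (hz.trans (le_abs_self _))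
  have h0 : Filter.Tendsto (fun n => ‖∫ z, (A n z - A' z) * b n z‖ₑ) Filter.atTop (nhds 0) := by
    have h := ENNReal.Tendsto.mul_const (b := eLpNorm β 2 volume) hlim (Or.inr hβ.eLpNorm_ne_top)
    rw [zero_mul] at h
    exact tendsto_of_tendsto_of_tendsto_of_le_of_le tendsto_const_nhds h (fun _ => bot_le) hle
  rw [tendsto_iff_edist_tendsto_0]
  simpa [edist_zero_right] using h0

/-- The weak chain rule along a left-invariant field. -/
theorem IsWeakDeriv.comp {B : Matrix (Idx m) (Idx m) ℝ} {U : Set (Pt m)} (hU : IsOpen U)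
    {ξ : Pt m → Pt m} {κ : ℝ} (hξ : LeftInvariantField B ξ κ) {u g : Pt m → ℝ} (hu : Measurable u)
    (hui : Integrable u) (hu2 : MemLp u 2) (hu0 : ∀ z, 0 ≤ u z) (hg : Measurable g)
    (hgi : Integrable g) (hg2 : MemLp g 2) (h : IsWeakDeriv U ξ κ u g) {G G' : ℝ → ℝ}
    (hG : ∀ s, HasDerivAt G (G' s) s) (hG' : Continuous G') {C : ℝ} (hC : ∀ s, |G' s| ≤ C) :
    IsWeakDeriv U ξ κ (fun z => G (u z)) fun z => G' (u z) * g z := by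
  intro φ hφ
  obtain ⟨F, hF, hF0, hFu, hFae, hFX⟩ :=
    exists_smooth_approx B hU hφ.compact hφ.subset hu hui hu2 hu0
  obtain ⟨P, hP, hPg, hPF⟩ := hFX ξ κ g hξ hg hgi hg2 h
  have hC0 : 0 ≤ C := (abs_nonneg _).trans (hC 0)
  have hGd : Differentiable ℝ G := fun s => (hG s).differentiableAt
  have hGc : ContDiff ℝ 1 G := by
    rw [contDiff_one_iff_deriv]
    refine ⟨hGd, ?_⟩
    have : deriv G = G' := funext fun s => (hG s).deriv
    rwa [this]
  have hGl : ∀ s t, |G s - G t| ≤ C * |s - t| := fun s t => by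
    have := Convex.norm_image_sub_le_of_norm_hasDerivWithin_le (f := G) (f' := G') (s := Set.univ)
      (C := C) (x := t) (y := s) (fun x _ => (hG x).hasDerivWithinAt) (fun x _ => hC x) convex_univ
      trivial trivial
    simpa using this
  set η : Pt m → ℝ := fun z => -fderiv ℝ φ z (ξ z) - κ * φ z with hη
  have hηc : Continuous η := ((hφ.smooth.continuous_fderiv (by simp)).clm_apply hξ.continuous).neg.sub
    (continuous_const.mul hφ.smooth.continuous)
  have hηcs : HasCompactSupport η :=
    ((hφ.compact.fderiv (𝕜 := ℝ)).mono fun z hz h => hz (by simp [h])).neg.sub hφ.compact.mul_left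
  have hη2 : MemLp (fun z => |η z|) 2 := (hηc.memLp_of_hasCompactSupport hηcs).norm
  have hφ2 : MemLp (fun z => C * |φ z|) 2 :=
    (hφ.smooth.continuous.memLp_of_hasCompactSupport hφ.compact).norm.const_mul C
  have hφ0 : ∀ z, z ∉ tsupport φ → φ z = 0 := fun z hz => image_eq_zero_of_notMem_tsupport hz
  -- the identity for the approximations
  have hn : ∀ n, ∫ z, G (F n z) * η z = ∫ z, G' (F n z) * P n z * φ z := fun n => by
    rw [hξ.integral_mul (F := fun z => G (F n z)) (hGc.comp ((hF n).of_le (by simp)))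
      (hφ.smooth.of_le (by simp)) hφ.compact]
    refine integral_congr_ae ?_
    filter_upwards [hPF n] with z hz
    by_cases hzK : z ∈ tsupport φ
    · have hd : HasFDerivAt (fun z => G (F n z)) (G' (F n z) • fderiv ℝ (F n) z) z :=
        (hG (F n z)).comp_hasFDerivAt z ((hF n).differentiable (by simp) z).hasFDerivAt
      rw [hd.fderiv, ← hz hzK]
      simp
    · simp [hφ0 z hzK]
  -- the left-hand side
  have hGu_int : Integrable fun z => G (u z) * η z := by
    have hloc : LocallyIntegrable fun z => G (u z) := by
      have h1 : LocallyIntegrable fun z => |G 0| + C * |u z| :=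
        (locallyIntegrable_const _).add (hui.abs.const_mul C).locallyIntegrable
      refine h1.mono (hGd.continuous.measurable.comp hu).aestronglyMeasurable
        (Filter.Eventually.of_forall fun z => ?_)
      have h2 := hGl (u z) 0
      rw [sub_zero] at h2
      have h3 := abs_sub_abs_le_abs_sub (G (u z)) (G 0)
      have h4 : 0 ≤ |G 0| + C * |u z| := by positivity
      rw [Real.norm_eq_abs, Real.norm_eq_abs, abs_of_nonneg h4]
      linarith
    exact integrable_mul_of_hasCompactSupport hloc hηc hηcs
  have hL : Filter.Tendsto (fun n => ∫ z, G (F n z) * η z) Filter.atTop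
      (nhds (∫ z, G (u z) * η z)) := by
    have hGlim : Filter.Tendsto (fun n => eLpNorm (fun z => G (F n z) - G (u z)) 2 volume)
        Filter.atTop (nhds 0) := by
      have h1 := ENNReal.Tendsto.const_mul (a := ENNReal.ofReal C) hFu (Or.inr ENNReal.ofReal_ne_top)
      rw [mul_zero] at h1
      refine tendsto_of_tendsto_of_tendsto_of_le_of_le tendsto_const_nhds h1 (fun _ => bot_le)
        fun n => ?_
      exact eLpNorm_le_mul_eLpNorm_of_ae_le_mul
        (Filter.Eventually.of_forall fun z => hGl (F n z) (u z)) 2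
    have h2 := tendsto_integral_sub_mul (A := fun n z => G (F n z)) (A' := fun z => G (u z))
      (b := fun _ => η)
      (fun n => (hGd.continuous.comp (hF n).continuous).measurable.aemeasurable)
      (hGd.continuous.measurable.comp hu).aemeasurable hGlim hη2
      (fun n => Filter.Eventually.of_forall fun z => le_rfl)
    have h3 : ∀ n, ∫ z, (G (F n z) - G (u z)) * η z =
        (∫ z, G (F n z) * η z) - ∫ z, G (u z) * η z := fun n => by
      simp only [sub_mul]
      refine integral_sub ?_ hGu_int
      exact ((hGd.continuous.comp (hF n).continuous).mul hηc).integrable_of_hasCompactSupport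
        hηcs.mul_left
    simp only [h3] at h2
    simpa using h2.add_const (∫ z, G (u z) * η z)
  -- the right-hand side
  have hgφ : Integrable fun z => g z * φ z :=
    integrable_mul_of_hasCompactSupport hgi.locallyIntegrable hφ.smooth.continuous hφ.compact
  have hR : Filter.Tendsto (fun n => ∫ z, G' (F n z) * P n z * φ z) Filter.atTop
      (nhds (∫ z, G' (u z) * g z * φ z)) := by
    have h1 := tendsto_integral_sub_mul (A := P) (A' := g) (b := fun n z => G' (F n z) * φ z)
      (fun n => (hP n).measurable.aemeasurable) hg.aemeasurable hPg hφ2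
      (fun n => Filter.Eventually.of_forall fun z => by
        rw [abs_mul]; gcongr; exact hC _)
    have h2 : Filter.Tendsto (fun n => ∫ z, G' (F n z) * (g z * φ z)) Filter.atTop
        (nhds (∫ z, G' (u z) * (g z * φ z))) := by
      refine tendsto_integral_of_dominated_convergence (fun z => C * |g z * φ z|)
        (fun n => ((hG'.comp (hF n).continuous).measurable.mul
          (hg.mul hφ.smooth.continuous.measurable)).aestronglyMeasurable) (hgφ.abs.const_mul C)
        (fun n => Filter.Eventually.of_forall fun z => ?_) ?_
      · rw [norm_mul, Real.norm_eq_abs, Real.norm_eq_abs]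
        gcongr
        exact hC _
      · filter_upwards [hFae] with z hz
        exact ((hG'.tendsto _).comp hz).mul_const _
    -- The derivative `P n` converges in `L²` but `G' (F n)` only almost everywhere and boundedly,
    -- so the two limits are taken separately.
    have h3 : ∀ n, ∫ z, G' (F n z) * P n z * φ z =
        (∫ z, (P n z - g z) * (G' (F n z) * φ z)) + ∫ z, G' (F n z) * (g z * φ z) := fun n => by
      have i1 : Integrable fun z => G' (F n z) * P n z * φ z :=
        (((hG'.comp (hF n).continuous).mul (hP n)).mul
          hφ.smooth.continuous).integrable_of_hasCompactSupport hφ.compact.mul_left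
      have i2 : Integrable fun z => G' (F n z) * (g z * φ z) :=
        hgφ.bdd_mul (c := C) (hG'.comp (hF n).continuous).aestronglyMeasurable
          (Filter.Eventually.of_forall fun z => hC _)
      have e : ∀ z, (P n z - g z) * (G' (F n z) * φ z) =
          G' (F n z) * P n z * φ z - G' (F n z) * (g z * φ z) := fun z => by ring
      simp only [e]
      rw [integral_sub i1 i2]; ring
    simp only [h3]
    have h4 := h1.add h2
    simpa [mul_assoc] using h4
  simp only [hn] at hL
  exact tendsto_nhds_unique hL hR

/-! ### Functions of a sub-solution -/

/-- `u ≥ 0`, supported in `U`, with weak derivatives `Du = D_{m₀} u` and `Yu = Y u`, satisfies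
`∑ ∂_i (a_ij ∂_j u) + Y u ≥ H` weakly in `U`. -/
structure LocalSubsolution (B : Matrix (Idx m) (Idx m) ℝ)
    (a : Pt m → Matrix (Fin (m 0)) (Fin (m 0)) ℝ) (U : Set (Pt m)) (u : Pt m → ℝ)
    (Du : Pt m → Grad m) (Yu H : Pt m → ℝ) : Prop where
  nonneg : ∀ z, 0 ≤ u z
  meas : Measurable u
  meas_grad : Measurable Du
  meas_Y : Measurable Yu
  meas_rhs : Measurable H
  integrable : Integrable u
  integrable_grad : Integrable Du
  integrable_Y : Integrable Yu
  integrable_rhs : Integrable H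
  memLp : MemLp u 2
  memLp_grad : MemLp Du 2
  memLp_Y : MemLp Yu 2
  eq_zero : ∀ z ∉ U, u z = 0 ∧ Du z = 0 ∧ H z = 0
  weak_grad : ∀ i, IsWeakDeriv U (fun _ => (Pi.single (⟨0, i⟩ : Idx m) 1, 0)) 0 u fun z => Du z i
  weak_Y : IsWeakDeriv U (yVec B) B.trace u Yu
  ineq : ∀ φ : Pt m → ℝ, IsTest U φ → (∀ z, 0 ≤ φ z) →
    ∫ z, φ z * H z ≤ (∫ z, φ z * Yu z) - ∫ z, ∑ i, ∑ j, Du z i * a z i j * gradD φ z j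

theorem measurable_coord {g : Pt m → Grad m} (hg : Measurable g) (i : Fin (m 0)) :
    Measurable fun z => g z i :=
  (EuclideanSpace.proj (𝕜 := ℝ) i).continuous.measurable.comp hg

theorem integrable_coord {g : Pt m → Grad m} (hg : Integrable g) (i : Fin (m 0)) :
    Integrable fun z => g z i := by
  simpa using (EuclideanSpace.proj (𝕜 := ℝ) i : Grad m →L[ℝ] ℝ).integrable_comp hg

theorem MemLp.coord {g : Pt m → Grad m} {p : ℝ≥0∞} {μ : Measure (Pt m)} (hg : MemLp g p μ)
    (i : Fin (m 0)) : MemLp (fun z => g z i) p μ :=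
  (EuclideanSpace.proj (𝕜 := ℝ) i : Grad m →L[ℝ] ℝ).comp_memLp' hg

theorem memLp_flux {a : Pt m → Matrix (Fin (m 0)) (Fin (m 0)) ℝ}
    (ha : ∀ i j, MemLp (fun z => a z i j) ⊤ volume) {g : Pt m → Grad m} (hg : MemLp g 2)
    (j : Fin (m 0)) : MemLp (fun z => ∑ i, g z i * a z i j) 2 :=
  memLp_finsetSum _ fun i _ => (ha i j).mul (p := 2) (q := ⊤) (r := 2) (MemLp.coord hg i)

theorem tendsto_integral_comp_mul {F : ℕ → Pt m → ℝ} {u X : Pt m → ℝ} (hF : ∀ n, Continuous (F n))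
    (hFu : ∀ᵐ z, Filter.Tendsto (fun n => F n z) Filter.atTop (nhds (u z))) (hX : Integrable X)
    {h : ℝ → ℝ} (hh : Continuous h) {C : ℝ} (hC : ∀ s, |h s| ≤ C) :
    Filter.Tendsto (fun n => ∫ z, h (F n z) * X z) Filter.atTop (nhds (∫ z, h (u z) * X z)) := by
  refine tendsto_integral_of_dominated_convergence (fun z => C * |X z|)
    (fun n => (hh.comp (hF n)).aestronglyMeasurable.mul hX.aestronglyMeasurable)
    (hX.abs.const_mul C) (fun n => Filter.Eventually.of_forall fun z => ?_) ?_
  · rw [norm_mul, Real.norm_eq_abs, Real.norm_eq_abs]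
    gcongr
    exact hC _
  · filter_upwards [hFu] with z hz
    exact ((hh.tendsto _).comp hz).mul_const _

theorem integral_double_sum_eq {g : Pt m → Grad m} {a : Pt m → Matrix (Fin (m 0)) (Fin (m 0)) ℝ}
    (ψ : Pt m → ℝ) (z : Pt m) : ∑ i, ∑ j, g z i * a z i j * gradD ψ z j =
      ∑ j, (∑ i, g z i * a z i j) * gradD ψ z j := by
  rw [Finset.sum_comm]
  simp only [Finset.sum_mul]

/-- The sub-solution inequality tested with `φ h(u)`, for `h` and `h'` bounded and non-negative. -/
theorem LocalSubsolution.integral_comp_le {B : Matrix (Idx m) (Idx m) ℝ}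
    {a : Pt m → Matrix (Fin (m 0)) (Fin (m 0)) ℝ} {U : Set (Pt m)} (hU : IsOpen U) {u : Pt m → ℝ}
    {Du : Pt m → Grad m} {Yu H : Pt m → ℝ} (hu : LocalSubsolution B a U u Du Yu H)
    (ha : ∀ i j, MemLp (fun z => a z i j) ⊤ volume)
    (hpos : ∀ᵐ z, ∀ ξ : Fin (m 0) → ℝ, 0 ≤ ∑ i, ∑ j, a z i j * ξ i * ξ j)
    {h : ℝ → ℝ} (hh : ContDiff ℝ ∞ h) {C : ℝ} (hC : ∀ s, |h s| ≤ C) (hC' : ∀ s, |deriv h s| ≤ C)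
    (h0 : ∀ s, 0 ≤ s → 0 ≤ h s) (h0' : ∀ s, 0 ≤ s → 0 ≤ deriv h s) {φ : Pt m → ℝ}
    (hφ : IsTest U φ) (hφ0 : ∀ z, 0 ≤ φ z) :
    ∫ z, h (u z) * (φ z * H z) ≤ (∫ z, h (u z) * (φ z * Yu z)) -
      ∫ z, h (u z) * ∑ i, ∑ j, Du z i * a z i j * gradD φ z j := by
  obtain ⟨F, hF, hF0, hFu, hFae, hFX⟩ :=
    exists_smooth_approx B hU hφ.compact hφ.subset hu.meas hu.integrable hu.memLp hu.nonneg
  choose G hGc hGlim hGF using fun i => hFX _ 0 (fun z => Du z i) (leftInvariantField_coord B i)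
    (measurable_coord hu.meas_grad i) (integrable_coord hu.integrable_grad i)
    (MemLp.coord hu.memLp_grad i) (hu.weak_grad i)
  set P : Fin (m 0) → Pt m → ℝ := fun j z => ∑ i, Du z i * a z i j with hP
  have hP2 : ∀ j, MemLp (P j) 2 := memLp_flux ha hu.memLp_grad
  have hPl : ∀ j, LocallyIntegrable (P j) := fun j => (hP2 j).locallyIntegrable (by norm_num)
  have hC0 : 0 ≤ C := (abs_nonneg _).trans (hC 0)
  have hhd : Differentiable ℝ h := hh.differentiable (by simp)
  have hh' : Continuous (deriv h) := hh.continuous_deriv (by simp)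
  have hφc := hφ.smooth.continuous
  have iH : Integrable fun z => φ z * H z := by
    simpa [mul_comm] using integrable_mul_of_hasCompactSupport
      hu.integrable_rhs.locallyIntegrable hφc hφ.compact
  have iY : Integrable fun z => φ z * Yu z := by
    simpa [mul_comm] using integrable_mul_of_hasCompactSupport
      hu.integrable_Y.locallyIntegrable hφc hφ.compact
  have iP : ∀ j, Integrable fun z => P j z * gradD φ z j := fun j =>
    integrable_mul_of_hasCompactSupport (hPl j) (continuous_gradD hφ.smooth j)
      (hasCompactSupport_gradD hφ.compact j)
  have iS : Integrable fun z => ∑ j, P j z * gradD φ z j := integrable_finsetSum _ fun j _ => iP j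
  obtain ⟨M, hM⟩ := hφc.bounded_above_of_compact_support hφ.compact
  have hb : ∀ n z, |φ z * deriv h (F n z)| ≤ M * C := fun n z => by
    rw [abs_mul]
    exact mul_le_mul (hM z) (hC' _) (abs_nonneg _) ((norm_nonneg _).trans (hM z))
  -- the inequality for the approximations
  have hn : ∀ n, ∫ z, h (F n z) * (φ z * H z) ≤ (∫ z, h (F n z) * (φ z * Yu z)) -
      (∫ z, h (F n z) * ∑ j, P j z * gradD φ z j) -
      ∑ j, ∫ z, (G j n z - Du z j) * (P j z * (φ z * deriv h (F n z))) := fun n => by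
    have hs : ContDiff ℝ ∞ fun z => h (F n z) := hh.comp (hF n)
    have ht : IsTest U fun z => φ z * h (F n z) := ⟨hφ.smooth.mul hs, hφ.compact.mul_right,
      (tsupport_mul_subset_left).trans hφ.subset⟩
    have h1 := hu.ineq _ ht fun z => mul_nonneg (hφ0 z) (h0 _ (hF0 n z))
    have e1 : ∀ z, φ z * h (F n z) * H z = h (F n z) * (φ z * H z) := fun z => by ring
    have e2 : ∀ z, φ z * h (F n z) * Yu z = h (F n z) * (φ z * Yu z) := fun z => by ring
    simp only [e1, e2, integral_double_sum_eq] at h1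
    have i1 : Integrable fun z => h (F n z) * ∑ j, P j z * gradD φ z j :=
      iS.bdd_mul (c := C) (hh.continuous.comp (hF n).continuous).aestronglyMeasurable
        (Filter.Eventually.of_forall fun z => hC _)
    have i2 : ∀ j, Integrable fun z => (G j n z - Du z j) * (P j z * (φ z * deriv h (F n z))) :=
      fun j => by
        have hc1 : Continuous fun z => φ z * deriv h (F n z) :=
          hφc.mul (hh'.comp (hF n).continuous)
        have hc2 : HasCompactSupport fun z => φ z * deriv h (F n z) := hφ.compact.mul_right
        have a1 : Integrable fun z => P j z * (G j n z * (φ z * deriv h (F n z))) :=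
          integrable_mul_of_hasCompactSupport (hPl j) ((hGc j n).mul hc1) hc2.mul_left
        have a2 : Integrable fun z => Du z j * P j z :=
          (MemLp.coord hu.memLp_grad j).integrable_mul (hP2 j)
        have a3 : Integrable fun z => (φ z * deriv h (F n z)) * (Du z j * P j z) :=
          a2.bdd_mul (c := M * C) hc1.aestronglyMeasurable (Filter.Eventually.of_forall (hb n))
        refine (a1.sub a3).congr (Filter.Eventually.of_forall fun z => ?_)
        simp only [Pi.sub_apply]; ring
    have i3 : Integrable fun z =>
        ∑ j, (G j n z - Du z j) * (P j z * (φ z * deriv h (F n z))) :=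
      integrable_finsetSum _ fun j _ => i2 j
    -- The derivative falling on `h (F n)` gives `φ h'(F n)` times the flux against `D (F n)`. With
    -- `Du` in place of `D (F n)` this is a non-negative quadratic form, which is dropped; the
    -- replacement error is the last sum and tends to zero.
    have h2 : (∫ z, h (F n z) * ∑ j, P j z * gradD φ z j) +
        ∑ j, ∫ z, (G j n z - Du z j) * (P j z * (φ z * deriv h (F n z))) ≤
        ∫ z, ∑ j, P j z * gradD (fun z => φ z * h (F n z)) z j := by
      rw [← integral_finsetSum _ fun j _ => i2 j, ← integral_add i1 i3]
      refine integral_mono_ae (i1.add i3) (integrable_finsetSum _ fun j _ => ?_) ?_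
      · exact integrable_mul_of_hasCompactSupport (hPl j) (continuous_gradD ht.smooth j)
          (hasCompactSupport_gradD ht.compact j)
      · have hG : ∀ᵐ z, ∀ j, z ∈ tsupport φ →
            fderiv ℝ (F n) z (Pi.single (⟨0, j⟩ : Idx m) 1, 0) = G j n z :=
          ae_all_iff.2 fun j => hGF j n
        filter_upwards [hG, hpos] with z hz hzp
        simp only [gradD_mul (hφ.smooth.differentiable (by simp)) (hs.differentiable (by simp))]
        have e3 : ∀ j, gradD (fun z => h (F n z)) z j =
            deriv h (F n z) * fderiv ℝ (F n) z (Pi.single (⟨0, j⟩ : Idx m) 1, 0) := fun j => by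
          have hd : HasFDerivAt (fun z => h (F n z)) (deriv h (F n z) • fderiv ℝ (F n) z) z :=
            (hhd (F n z)).hasDerivAt.comp_hasFDerivAt z
              ((hF n).differentiable (by simp) z).hasFDerivAt
          simp [gradD, hd.fderiv]
        have e4 : ∀ j, φ z * fderiv ℝ (F n) z (Pi.single (⟨0, j⟩ : Idx m) 1, 0) =
            φ z * G j n z := fun j => by
          by_cases hzK : z ∈ tsupport φ
          · rw [hz j hzK]
          · simp [image_eq_zero_of_notMem_tsupport hzK]
        have e5 : ∀ j, P j z * (φ z * gradD (fun z => h (F n z)) z j + h (F n z) * gradD φ z j) =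
            h (F n z) * (P j z * gradD φ z j) +
            (G j n z - Du z j) * (P j z * (φ z * deriv h (F n z))) +
            φ z * deriv h (F n z) * (P j z * Du z j) := fun j => by
          rw [e3]
          linear_combination (P j z * deriv h (F n z)) * e4 j
        simp only [e5, Finset.sum_add_distrib, ← Finset.mul_sum]
        refine le_add_of_nonneg_right (mul_nonneg (mul_nonneg (hφ0 z) (h0' _ (hF0 n z))) ?_)
        have h3 := hzp fun i => Du z i
        rw [Finset.sum_comm] at h3
        refine h3.trans_eq (Finset.sum_congr rfl fun j _ => ?_)
        simp only [hP, Finset.sum_mul]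
        exact Finset.sum_congr rfl fun i _ => by ring
    linarith
  -- the limit
  have l1 := tendsto_integral_comp_mul (fun n => (hF n).continuous) hFae iH hh.continuous hC
  have l2 := tendsto_integral_comp_mul (fun n => (hF n).continuous) hFae iY hh.continuous hC
  have l3 := tendsto_integral_comp_mul (fun n => (hF n).continuous) hFae iS hh.continuous hC
  have l4 : ∀ j, Filter.Tendsto (fun n => ∫ z, (G j n z - Du z j) *
      (P j z * (φ z * deriv h (F n z)))) Filter.atTop (nhds 0) := fun j => by
    refine tendsto_integral_sub_mul (β := fun z => M * C * |P j z|)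
      (fun n => (hGc j n).measurable.aemeasurable)
      (measurable_coord hu.meas_grad j).aemeasurable (hGlim j) ((hP2 j).norm.const_mul _)
      fun n => Filter.Eventually.of_forall fun z => ?_
    rw [abs_mul, mul_comm]
    gcongr
    exact hb n z
  have l5 := (l2.sub l3).sub (tendsto_finsetSum Finset.univ fun j _ => l4 j)
  have := le_of_tendsto_of_tendsto' l1 l5 hn
  simp only [integral_double_sum_eq]
  simpa using this

/-! ### Powers of a sub-solution -/

theorem arctan_le_self {x : ℝ} (hx : 0 ≤ x) : Real.arctan x ≤ x := by
  have := Real.le_tan (Real.arctan_nonneg.2 hx) (Real.arctan_lt_pi_div_two x)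
  rwa [Real.tan_arctan] at this

theorem abs_arctan_le_two (x : ℝ) : |Real.arctan x| ≤ 2 := by
  have := Real.pi_le_four
  exact abs_le.2 ⟨by linarith [Real.neg_pi_div_two_lt_arctan x],
    by linarith [Real.arctan_lt_pi_div_two x]⟩

/-- A smooth bounded truncation of `p s^(p-1)` at height `1 / ε`. -/
def truncDeriv (p : ℕ) (ε s : ℝ) : ℝ := p * (Real.arctan (ε * s) / ε) ^ (p - 1)

theorem contDiff_truncDeriv (p : ℕ) (ε : ℝ) : ContDiff ℝ ∞ (truncDeriv p ε) := by
  unfold truncDeriv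
  exact contDiff_const.mul (((Real.contDiff_arctan.comp
    (contDiff_const.mul contDiff_id)).div_const _).pow _)

theorem deriv_truncDeriv (p : ℕ) {ε : ℝ} (hε : 0 < ε) (s : ℝ) : deriv (truncDeriv p ε) s =
    p * ((p - 1 : ℕ) * (Real.arctan (ε * s) / ε) ^ (p - 1 - 1) * (1 / (1 + (ε * s) ^ 2))) := by
  have h1 : HasDerivAt (fun s => Real.arctan (ε * s) / ε) (1 / (1 + (ε * s) ^ 2)) s := by
    have h := (((hasDerivAt_id s).const_mul ε).arctan).div_const ε
    refine h.congr_deriv ?_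
    simp only [id]
    field_simp
  exact ((h1.pow (p - 1)).const_mul (p : ℝ)).deriv

theorem truncDeriv_bounds (p : ℕ) {ε : ℝ} (hε : 0 < ε) : ∃ C, (∀ s, |truncDeriv p ε s| ≤ C) ∧
    ∀ s, |deriv (truncDeriv p ε) s| ≤ C := by
  have h1 : ∀ s, |Real.arctan (ε * s) / ε| ≤ 2 / ε := fun s => by
    rw [abs_div, abs_of_pos hε]
    gcongr
    exact abs_arctan_le_two _
  refine ⟨max (p * (2 / ε) ^ (p - 1)) (p * ((p - 1 : ℕ) * (2 / ε) ^ (p - 1 - 1) * 1)),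
    fun s => le_max_of_le_left ?_, fun s => le_max_of_le_right ?_⟩
  · rw [truncDeriv, abs_mul, abs_pow, Nat.abs_cast]
    gcongr
    exact h1 s
  · rw [deriv_truncDeriv p hε, abs_mul, abs_mul, abs_mul, abs_pow, Nat.abs_cast, Nat.abs_cast]
    gcongr
    · exact h1 s
    · rw [abs_of_nonneg (by positivity), div_le_one (by positivity)]
      nlinarith [sq_nonneg (ε * s)]

theorem truncDeriv_nonneg (p : ℕ) {ε : ℝ} (hε : 0 < ε) {s : ℝ} (hs : 0 ≤ s) :
    0 ≤ truncDeriv p ε s := by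
  have := Real.arctan_nonneg.2 (mul_nonneg hε.le hs)
  unfold truncDeriv; positivity

theorem deriv_truncDeriv_nonneg (p : ℕ) {ε : ℝ} (hε : 0 < ε) {s : ℝ} (hs : 0 ≤ s) :
    0 ≤ deriv (truncDeriv p ε) s := by
  have := Real.arctan_nonneg.2 (mul_nonneg hε.le hs)
  rw [deriv_truncDeriv p hε]; positivity

theorem truncDeriv_le (p : ℕ) {ε : ℝ} (hε : 0 < ε) {s : ℝ} (hs : 0 ≤ s) :
    truncDeriv p ε s ≤ p * s ^ (p - 1) := by
  have := Real.arctan_nonneg.2 (mul_nonneg hε.le hs)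
  unfold truncDeriv
  gcongr
  rw [div_le_iff₀ hε, mul_comm]
  exact arctan_le_self (by positivity)

/-- The truncation `arctan (t s) / t` is a difference quotient at `t = 0`, and the derivative there
is `s`. -/
theorem tendsto_truncDeriv (p : ℕ) (s : ℝ) : Filter.Tendsto
    (fun n : ℕ => truncDeriv p (1 / ((n : ℝ) + 1)) s) Filter.atTop (nhds (p * s ^ (p - 1))) := by
  have h1 : HasDerivAt (fun t => Real.arctan (t * s)) s 0 := by
    have h := ((hasDerivAt_id (0 : ℝ)).mul_const s).arctan
    simpa using h
  have h2 := h1.tendsto_slope_zero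
  have h3 : Filter.Tendsto (fun n : ℕ => 1 / ((n : ℝ) + 1)) Filter.atTop (nhdsWithin 0 {0}ᶜ) :=
    tendsto_nhdsWithin_iff.2 ⟨tendsto_one_div_add_atTop_nhds_zero_nat,
      Filter.Eventually.of_forall fun n => by
        have : (0 : ℝ) < 1 / ((n : ℝ) + 1) := by positivity
        exact this.ne'⟩
  have h4 := ((h2.comp h3).pow (p - 1)).const_mul (p : ℝ)
  refine h4.congr fun n => ?_
  simp [truncDeriv, div_eq_inv_mul]

/-- The primitive of `truncDeriv`, a truncation of `s ^ p`. -/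
def truncPow (p : ℕ) (ε s : ℝ) : ℝ := ∫ t in (0 : ℝ)..s, truncDeriv p ε t

theorem hasDerivAt_truncPow (p : ℕ) (ε s : ℝ) :
    HasDerivAt (truncPow p ε) (truncDeriv p ε s) s := by
  have hc := (contDiff_truncDeriv p ε).continuous
  exact intervalIntegral.integral_hasDerivAt_right (hc.intervalIntegrable _ _)
    (hc.stronglyMeasurableAtFilter _ _) hc.continuousAt

theorem integral_pow_pred {p : ℕ} (hp : p ≠ 0) (s : ℝ) :
    ∫ t in (0 : ℝ)..s, (p : ℝ) * t ^ (p - 1) = s ^ p := by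
  obtain ⟨k, rfl⟩ := Nat.exists_eq_succ_of_ne_zero hp
  have : (k : ℝ) + 1 ≠ 0 := by positivity
  simp [integral_pow]
  field_simp

theorem truncPow_nonneg (p : ℕ) {ε : ℝ} (hε : 0 < ε) {s : ℝ} (hs : 0 ≤ s) :
    0 ≤ truncPow p ε s :=
  intervalIntegral.integral_nonneg hs fun _ ht => truncDeriv_nonneg p hε ht.1

theorem truncPow_le {p : ℕ} (hp : p ≠ 0) {ε : ℝ} (hε : 0 < ε) {s : ℝ} (hs : 0 ≤ s) :
    truncPow p ε s ≤ s ^ p := by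
  rw [← integral_pow_pred hp s]
  refine intervalIntegral.integral_mono_on hs
    ((contDiff_truncDeriv p ε).continuous.intervalIntegrable _ _)
    ((by fun_prop : Continuous fun t : ℝ => (p : ℝ) * t ^ (p - 1)).intervalIntegrable _ _)
    fun t ht => truncDeriv_le p hε ht.1

theorem tendsto_truncPow {p : ℕ} (hp : p ≠ 0) {s : ℝ} (hs : 0 ≤ s) : Filter.Tendsto
    (fun n : ℕ => truncPow p (1 / ((n : ℝ) + 1)) s) Filter.atTop (nhds (s ^ p)) := by
  rw [← integral_pow_pred hp s]
  refine intervalIntegral.tendsto_integral_filter_of_dominated_convergence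
    (fun t => (p : ℝ) * t ^ (p - 1))
    (Filter.Eventually.of_forall fun n => (contDiff_truncDeriv p _).continuous.aestronglyMeasurable)
    (Filter.Eventually.of_forall fun n => Filter.Eventually.of_forall fun t ht => ?_)
    ((by fun_prop : Continuous fun t : ℝ => (p : ℝ) * t ^ (p - 1)).intervalIntegrable _ _)
    (Filter.Eventually.of_forall fun t _ => tendsto_truncDeriv p t)
  rw [Set.uIoc_of_le hs] at ht
  rw [Real.norm_eq_abs, abs_of_nonneg (truncDeriv_nonneg p (by positivity) ht.1.le)]
  exact truncDeriv_le p (by positivity) ht.1.le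

theorem IsWeakDeriv.ae_eq {U : Set (Pt m)} (hU : IsOpen U) {ξ : Pt m → Pt m} {κ : ℝ}
    {u g g' : Pt m → ℝ} (hg : Integrable g) (hg' : Integrable g') (h : IsWeakDeriv U ξ κ u g)
    (h' : IsWeakDeriv U ξ κ u g') : ∀ᵐ z, z ∈ U → g z = g' z := by
  have key := hU.ae_eq_zero_of_integral_contDiff_smul_eq_zero (μ := (volume : Measure (Pt m)))
    (f := fun z => g z - g' z) ((hg.sub hg').locallyIntegrable.locallyIntegrableOn U) ?_
  · filter_upwards [key] with z hz hzU
    exact sub_eq_zero.1 (hz hzU)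
  intro ψ hψ hψc hψU
  have hi : ∀ {f : Pt m → ℝ}, Integrable f → Integrable fun z => f z * ψ z := fun hf =>
    integrable_mul_of_hasCompactSupport hf.locallyIntegrable hψ.continuous hψc
  have e : ∀ z, ψ z • (g z - g' z) = g z * ψ z - g' z * ψ z := fun z => by
    rw [smul_eq_mul]; ring
  simp only [e]
  rw [integral_sub (hi hg) (hi hg'), ← h ψ ⟨hψ, hψc, hψU⟩, ← h' ψ ⟨hψ, hψc, hψU⟩, sub_self]

/-- If `u ^ p` has the weak derivative `g'`, then `g' = p u ^ (p - 1) g`. -/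
theorem IsWeakDeriv.eq_of_pow {B : Matrix (Idx m) (Idx m) ℝ} {U : Set (Pt m)} (hU : IsOpen U)
    {ξ : Pt m → Pt m} {κ : ℝ} (hξ : LeftInvariantField B ξ κ) {u g : Pt m → ℝ} (hu : Measurable u)
    (hui : Integrable u) (hu2 : MemLp u 2) (hu0 : ∀ z, 0 ≤ u z) (hg : Measurable g)
    (hgi : Integrable g) (hg2 : MemLp g 2) (h : IsWeakDeriv U ξ κ u g) {p : ℕ} (hp : p ≠ 0)
    {g' : Pt m → ℝ} (hwi : Integrable fun z => u z ^ p) (hw2 : MemLp (fun z => u z ^ p) 2)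
    (hg' : Measurable g') (hgi' : Integrable g') (hg2' : MemLp g' 2)
    (h' : IsWeakDeriv U ξ κ (fun z => u z ^ p) g') :
    ∀ᵐ z, z ∈ U → g' z = p * u z ^ (p - 1) * g z := by
  -- The chain rule is available for bounded derivatives only. The weak derivative of `arctan (u ^
  -- p)` is therefore computed twice, from `u` and from `u ^ p`, and the common factor `1 / (1 + u ^
  -- (2p))` is cancelled.
  have hb : ∀ s : ℝ, |(p : ℝ) * s ^ (p - 1) / (1 + (s ^ p) ^ 2)| ≤ (p : ℝ) := fun s => by
    rw [abs_div, abs_mul, abs_pow, Nat.abs_cast, abs_of_pos (by positivity : 0 < 1 + (s ^ p) ^ 2),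
      div_le_iff₀ (by positivity)]
    have : |s| ^ (p - 1) ≤ 1 + (s ^ p) ^ 2 := by
      rcases le_total |s| 1 with h | h
      · have := pow_le_one₀ (n := p - 1) (abs_nonneg s) h
        nlinarith [sq_nonneg (s ^ p)]
      · have h1 : |s| ^ (p - 1) ≤ |s| ^ (p * 2) := pow_le_pow_right₀ h (by omega)
        have h2 : |s| ^ (p * 2) = (s ^ p) ^ 2 := by rw [pow_mul, ← abs_pow, sq_abs]
        linarith
    exact mul_le_mul_of_nonneg_left this (by positivity)
  have hd1 : ∀ s : ℝ, HasDerivAt (fun s => Real.arctan (s ^ p))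
      (p * s ^ (p - 1) / (1 + (s ^ p) ^ 2)) s := fun s => by
    refine (hasDerivAt_pow p s).arctan.congr_deriv ?_
    ring
  have hd2 : ∀ s : ℝ, HasDerivAt Real.arctan (1 / (1 + s ^ 2)) s := Real.hasDerivAt_arctan
  have c1 : Continuous fun s : ℝ => p * s ^ (p - 1) / (1 + (s ^ p) ^ 2) :=
    Continuous.div (by fun_prop) (by fun_prop) fun s => by positivity
  have c2 : Continuous fun s : ℝ => 1 / (1 + s ^ 2) :=
    Continuous.div (by fun_prop) (by fun_prop) fun s => by positivity
  have hb2 : ∀ s : ℝ, |1 / (1 + s ^ 2)| ≤ 1 := fun s => by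
    rw [abs_of_nonneg (by positivity), div_le_one (by positivity)]
    nlinarith [sq_nonneg s]
  have w1 := h.comp hU hξ hu hui hu2 hu0 hg hgi hg2 hd1 c1 hb
  have w2 := h'.comp hU hξ (hu.pow_const p) hwi hw2 (fun z => pow_nonneg (hu0 z) p) hg' hgi' hg2'
    hd2 c2 hb2
  have i1 := hgi.bdd_mul (c := p) (c1.measurable.comp hu).aestronglyMeasurable
    (Filter.Eventually.of_forall fun z => hb (u z))
  have i2 := hgi'.bdd_mul (c := 1) (c2.measurable.comp (hu.pow_const p)).aestronglyMeasurable
    (Filter.Eventually.of_forall fun z => hb2 (u z ^ p))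
  filter_upwards [w2.ae_eq hU i2 i1 w1] with z hz hzU
  have h1 : 1 / (1 + (u z ^ p) ^ 2) * g' z = p * u z ^ (p - 1) / (1 + (u z ^ p) ^ 2) * g z :=
    hz hzU
  have h2 : 1 + (u z ^ p) ^ 2 ≠ 0 := by positivity
  rw [div_mul_eq_mul_div, div_mul_eq_mul_div, one_mul] at h1
  exact (div_left_inj' h2).1 h1

theorem LocalSubsolution.localIneq {B : Matrix (Idx m) (Idx m) ℝ}
    {a : Pt m → Matrix (Fin (m 0)) (Fin (m 0)) ℝ} {U : Set (Pt m)} {u : Pt m → ℝ}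
    {Du : Pt m → Grad m} {Yu H : Pt m → ℝ} (hu : LocalSubsolution B a U u Du Yu H) :
    LocalIneq B a U u Du H where
  nonneg := hu.nonneg
  meas := hu.meas
  meas_grad := hu.meas_grad
  meas_rhs := hu.meas_rhs
  memLp := hu.memLp
  memLp_grad := hu.memLp_grad
  integrable := hu.integrable_rhs
  eq_zero := hu.eq_zero
  grad_eq φ hφ i := by
    have h := hu.weak_grad i φ hφ
    simp only [zero_mul, sub_zero, mul_neg] at h
    rw [integral_neg] at h
    rw [← h, neg_neg]; rfl
  ineq φ hφ hφ0 := by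
    refine (hu.ineq φ hφ hφ0).trans_eq ?_
    congr 1
    have h := hu.weak_Y φ hφ
    simp only [fieldY_eq]
    rw [h]
    simp only [mul_comm]

theorem LocalSubsolution.grad_pow_eq {B : Matrix (Idx m) (Idx m) ℝ}
    {a : Pt m → Matrix (Fin (m 0)) (Fin (m 0)) ℝ} {U : Set (Pt m)} (hU : IsOpen U) {u : Pt m → ℝ}
    {Du : Pt m → Grad m} {Yu H : Pt m → ℝ} (hu : LocalSubsolution B a U u Du Yu H)
    {p : ℕ} (hp : p ≠ 0) {Dw : Pt m → Grad m} (hDw : Measurable Dw)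
    (hwi : Integrable fun z => u z ^ p) (hw2 : MemLp (fun z => u z ^ p) 2) (hDwi : Integrable Dw)
    (hDw2 : MemLp Dw 2) (hDw0 : ∀ z ∉ U, Dw z = 0)
    (hw : ∀ i, IsWeakDeriv U (fun _ => (Pi.single (⟨0, i⟩ : Idx m) 1, 0)) 0 (fun z => u z ^ p)
      fun z => Dw z i) :
    ∀ᵐ z, Dw z = ((p : ℝ) * u z ^ (p - 1)) • Du z := by
  have h1 : ∀ᵐ z, ∀ i, z ∈ U → Dw z i = p * u z ^ (p - 1) * Du z i :=
    ae_all_iff.2 fun i => (hu.weak_grad i).eq_of_pow hU (leftInvariantField_coord B i) hu.meas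
      hu.integrable hu.memLp hu.nonneg (measurable_coord hu.meas_grad i)
      (integrable_coord hu.integrable_grad i) (MemLp.coord hu.memLp_grad i) hp hwi hw2
      (measurable_coord hDw i) (integrable_coord hDwi i) (MemLp.coord hDw2 i) (hw i)
  filter_upwards [h1] with z hz
  by_cases hzU : z ∈ U
  · ext i
    simpa using hz i hzU
  · rw [hDw0 z hzU, (hu.eq_zero z hzU).2.1, smul_zero]

/-- The power `u ^ p` of a sub-solution satisfies a differential inequality. -/
theorem LocalSubsolution.pow {B : Matrix (Idx m) (Idx m) ℝ}
    {a : Pt m → Matrix (Fin (m 0)) (Fin (m 0)) ℝ} {U : Set (Pt m)} (hU : IsOpen U) {u : Pt m → ℝ}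
    {Du : Pt m → Grad m} {Yu H : Pt m → ℝ} (hu : LocalSubsolution B a U u Du Yu H)
    (ha : ∀ i j, MemLp (fun z => a z i j) ⊤ volume)
    (hpos : ∀ᵐ z, ∀ ξ : Fin (m 0) → ℝ, 0 ≤ ∑ i, ∑ j, a z i j * ξ i * ξ j)
    {p : ℕ} (hp : p ≠ 0) {Dw : Pt m → Grad m} (hDw : Measurable Dw)
    (hwi : Integrable fun z => u z ^ p) (hw2 : MemLp (fun z => u z ^ p) 2)
    (hDw2 : MemLp Dw 2) (hDw0 : ∀ z ∉ U, Dw z = 0)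
    (hw : ∀ i, IsWeakDeriv U (fun _ => (Pi.single (⟨0, i⟩ : Idx m) 1, 0)) 0 (fun z => u z ^ p)
      fun z => Dw z i)
    (hDeq : ∀ᵐ z, Dw z = ((p : ℝ) * u z ^ (p - 1)) • Du z)
    (hH : Integrable fun z => p * u z ^ (p - 1) * H z) :
    LocalIneq B a U (fun z => u z ^ p) Dw fun z => p * u z ^ (p - 1) * H z := by
  refine ⟨fun z => pow_nonneg (hu.nonneg z) p, hu.meas.pow_const p, hDw,
    ((hu.meas.pow_const _).const_mul _).mul hu.meas_rhs, hw2, hDw2, hH, fun z hz => ?_,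
    fun φ hφ i => ?_, fun φ hφ hφ0 => ?_⟩
  · obtain ⟨h1, h2, h3⟩ := hu.eq_zero z hz
    exact ⟨by simp [h1, hp], hDw0 z hz, by simp [h3]⟩
  · have h := hw i φ hφ
    simp only [zero_mul, sub_zero, mul_neg] at h
    rw [integral_neg] at h
    rw [← h, neg_neg]; rfl
  · have hφc := hφ.smooth.continuous
    set ε : ℕ → ℝ := fun n => 1 / ((n : ℝ) + 1) with hε
    have hε0 : ∀ n, 0 < ε n := fun n => by positivity
    set η : Pt m → ℝ := fun z => -fieldY B φ z - B.trace * φ z with hη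
    have hηc : Continuous η := (continuous_fieldY B hφ.smooth).neg.sub (continuous_const.mul hφc)
    have hηcs : HasCompactSupport η :=
      (hasCompactSupport_fieldY B hφ.compact).neg.sub hφ.compact.mul_left
    -- The sub-solution is tested with the truncated derivative, and `Y` is moved to the test
    -- function through the truncated power. No weak derivative `Y (u ^ p)` is then needed in the
    -- limit.
    have hn : ∀ n, ∫ z, truncDeriv p (ε n) (u z) * (φ z * H z) ≤
        (∫ z, truncPow p (ε n) (u z) * η z) -
        ∫ z, truncDeriv p (ε n) (u z) * ∑ i, ∑ j, Du z i * a z i j * gradD φ z j := fun n => by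
      obtain ⟨C, hC, hC'⟩ := truncDeriv_bounds p (hε0 n)
      refine (hu.integral_comp_le hU ha hpos (contDiff_truncDeriv p (ε n)) hC hC'
        (fun s hs => truncDeriv_nonneg p (hε0 n) hs)
        (fun s hs => deriv_truncDeriv_nonneg p (hε0 n) hs) hφ hφ0).trans_eq ?_
      congr 1
      have h := hu.weak_Y.comp hU (leftInvariantField_yVec B) hu.meas hu.integrable hu.memLp
        hu.nonneg hu.meas_Y hu.integrable_Y hu.memLp_Y (hasDerivAt_truncPow p (ε n))
        (contDiff_truncDeriv p (ε n)).continuous hC φ hφ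
      simp only [hη, fieldY_eq]
      rw [h]
      exact integral_congr_ae (Filter.Eventually.of_forall fun z => by ring)
    -- The truncation stays below `p u^(p-1)`, so that the limit itself is the dominating function.
    have hdom : ∀ X : Pt m → ℝ, AEStronglyMeasurable X volume →
        (Integrable fun z => p * u z ^ (p - 1) * X z) →
        Filter.Tendsto (fun n => ∫ z, truncDeriv p (ε n) (u z) * X z) Filter.atTop
          (nhds (∫ z, p * u z ^ (p - 1) * X z)) := fun X hXm hX => by
      refine tendsto_integral_of_dominated_convergence (fun z => |p * u z ^ (p - 1) * X z|)
        (fun n => ((contDiff_truncDeriv p (ε n)).continuous.measurable.comp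
          hu.meas).aestronglyMeasurable.mul hXm) hX.abs
        (fun n => Filter.Eventually.of_forall fun z => ?_)
        (Filter.Eventually.of_forall fun z => (tendsto_truncDeriv p (u z)).mul_const _)
      have h1 := truncDeriv_nonneg p (hε0 n) (hu.nonneg z)
      have h2 := truncDeriv_le p (hε0 n) (hu.nonneg z)
      rw [Real.norm_eq_abs, abs_mul, abs_mul, abs_of_nonneg h1, abs_of_nonneg (h1.trans h2)]
      gcongr
    have l1 := hdom (fun z => φ z * H z)
      (hφc.measurable.mul hu.meas_rhs).aestronglyMeasurable (by
        have := integrable_mul_of_hasCompactSupport hH.locallyIntegrable hφc hφ.compact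
        refine this.congr (Filter.Eventually.of_forall fun z => ?_)
        ring)
    have e3 : ∀ᵐ z, p * u z ^ (p - 1) * ∑ i, ∑ j, Du z i * a z i j * gradD φ z j =
        ∑ i, ∑ j, Dw z i * a z i j * gradD φ z j := by
      filter_upwards [hDeq] with z hz
      rw [hz]
      simp only [Finset.mul_sum, PiLp.smul_apply, smul_eq_mul]
      exact Finset.sum_congr rfl fun i _ => Finset.sum_congr rfl fun j _ => by ring
    have i3 : ∀ {g : Pt m → Grad m}, MemLp g 2 →
        Integrable fun z => ∑ i, ∑ j, g z i * a z i j * gradD φ z j := fun hg => by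
      simp only [integral_double_sum_eq]
      exact integrable_finsetSum _ fun j _ => integrable_mul_of_hasCompactSupport
        ((memLp_flux ha hg j).locallyIntegrable (by norm_num)) (continuous_gradD hφ.smooth j)
        (hasCompactSupport_gradD hφ.compact j)
    have l3 := hdom (fun z => ∑ i, ∑ j, Du z i * a z i j * gradD φ z j)
      (i3 hu.memLp_grad).aestronglyMeasurable ((i3 hDw2).congr (e3.mono fun z hz => hz.symm))
    rw [integral_congr_ae e3] at l3
    have l2 : Filter.Tendsto (fun n => ∫ z, truncPow p (ε n) (u z) * η z) Filter.atTop
        (nhds (∫ z, u z ^ p * η z)) := by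
      refine tendsto_integral_of_dominated_convergence (fun z => |u z ^ p * η z|)
        (fun n => (((continuous_iff_continuousAt.2 fun s =>
          (hasDerivAt_truncPow p (ε n) s).continuousAt).measurable.comp hu.meas).mul
            hηc.measurable).aestronglyMeasurable)
        (integrable_mul_of_hasCompactSupport hwi.locallyIntegrable hηc hηcs).abs
        (fun n => Filter.Eventually.of_forall fun z => ?_)
        (Filter.Eventually.of_forall fun z => (tendsto_truncPow hp (hu.nonneg z)).mul_const _)
      have h1 := truncPow_nonneg p (hε0 n) (hu.nonneg z)
      have h2 := truncPow_le hp (hε0 n) (hu.nonneg z)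
      rw [Real.norm_eq_abs, abs_mul, abs_mul, abs_of_nonneg h1, abs_of_nonneg (h1.trans h2)]
      gcongr
    refine le_of_eq_of_le (integral_congr_ae (Filter.Eventually.of_forall fun z => ?_))
      (le_of_tendsto_of_tendsto' l1 (l2.sub l3) hn)
    ring

/-! ### Localisation to a ball -/

/-- Extension by zero allows translation and integration over the whole space; finite measure turns
`L²` into `L¹`. -/
theorem exists_measurable_restriction {F : Type*} [NormedAddCommGroup F] [MeasurableSpace F]
    [BorelSpace F] {U : Set (Pt m)} (hU : MeasurableSet U) (hUf : volume U ≠ ⊤)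
    {g : Pt m → F} (hg : MemLp g 2 (volume.restrict U)) : ∃ g' : Pt m → F, Measurable g' ∧
      (∀ z ∉ U, g' z = 0) ∧ (∀ᵐ z, z ∈ U → g' z = g z) ∧ Integrable g' ∧ MemLp g' 2 := by
  have h1 : MemLp (hg.1.mk g) 2 (volume.restrict U) := hg.ae_eq hg.1.ae_eq_mk
  have h2 : MemLp (U.indicator (hg.1.mk g)) 2 volume := (memLp_indicator_iff_restrict hU).2 h1
  have : IsFiniteMeasure ((volume : Measure (Pt m)).restrict U) := ⟨by
    rw [Measure.restrict_apply_univ]; exact hUf.lt_top⟩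
  refine ⟨U.indicator (hg.1.mk g), hg.1.stronglyMeasurable_mk.measurable.indicator hU,
    fun z hz => Set.indicator_of_notMem hz _, ?_, ?_, h2⟩
  · filter_upwards [(ae_restrict_iff' hU).1 hg.1.ae_eq_mk] with z hz hzU
    rw [Set.indicator_of_mem hzU, hz hzU]
  · exact (integrable_indicator_iff hU).2 (h1.integrable one_le_two)

theorem IsTest.mono {U Ω : Set (Pt m)} {φ : Pt m → ℝ} (hφ : IsTest U φ) (h : U ⊆ Ω) :
    IsTest Ω φ := ⟨hφ.smooth, hφ.compact, hφ.subset.trans h⟩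

theorem IsTest.eq_zero {U : Set (Pt m)} {φ : Pt m → ℝ} (hφ : IsTest U φ) {z : Pt m} (hz : z ∉ U) :
    φ z = 0 ∧ (∀ i, gradD φ z i = 0) ∧ fderiv ℝ φ z = 0 := by
  have h1 : z ∉ tsupport φ := fun h => hz (hφ.subset h)
  have h2 : fderiv ℝ φ z = 0 := by
    by_contra h
    exact h1 (support_fderiv_subset ℝ h)
  exact ⟨image_eq_zero_of_notMem_tsupport h1, fun i => by simp [gradD, h2], h2⟩

theorem setIntegral_eq_integral_of_ae_eq {U Ω : Set (Pt m)} (hUΩ : U ⊆ Ω)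
    {X X' : Pt m → ℝ} (h0 : ∀ z ∉ U, X z = 0) (h0' : ∀ z ∉ U, X' z = 0)
    (h : ∀ᵐ z, z ∈ U → X' z = X z) : ∫ z in Ω, X z = ∫ z, X' z := by
  rw [setIntegral_eq_integral_of_forall_compl_eq_zero fun z hz => h0 z fun hzU => hz (hUΩ hzU)]
  refine integral_congr_ae ?_
  filter_upwards [h] with z hz
  by_cases hzU : z ∈ U
  · exact (hz hzU).symm
  · rw [h0 z hzU, h0' z hzU]

theorem IsWeakGrad.isWeakDeriv {U Ω : Set (Pt m)} (hUΩ : U ⊆ Ω)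
    {u u' : Pt m → ℝ} {g g' : Pt m → Grad m} (h : IsWeakGrad Ω u g)
    (hu : ∀ᵐ z, z ∈ U → u' z = u z) (hg : ∀ᵐ z, z ∈ U → g' z = g z) (i : Fin (m 0)) :
    IsWeakDeriv U (fun _ => (Pi.single (⟨0, i⟩ : Idx m) 1, 0)) 0 u' fun z => g' z i := by
  intro φ hφ
  have h1 := h.eq φ (hφ.mono hUΩ) i
  rw [setIntegral_eq_integral_of_ae_eq hUΩ (X' := fun z => u' z * gradD φ z i)
      (fun z hz => by simp [(hφ.eq_zero hz).2.1]) (fun z hz => by simp [(hφ.eq_zero hz).2.1])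
      (hu.mono fun z hz hzU => by rw [hz hzU]),
    setIntegral_eq_integral_of_ae_eq hUΩ (X' := fun z => g' z i * φ z)
      (fun z hz => by simp [(hφ.eq_zero hz).1]) (fun z hz => by simp [(hφ.eq_zero hz).1])
      (hg.mono fun z hz hzU => by rw [hz hzU])] at h1
  simp only [zero_mul, sub_zero, mul_neg]
  rw [integral_neg, ← neg_eq_iff_eq_neg.2 h1]
  rfl

theorem IsWeakY.isWeakDeriv {B : Matrix (Idx m) (Idx m) ℝ} {U Ω : Set (Pt m)}
    (hUΩ : U ⊆ Ω) {u u' v v' : Pt m → ℝ} (h : IsWeakY B Ω u v)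
    (hu : ∀ᵐ z, z ∈ U → u' z = u z) (hv : ∀ᵐ z, z ∈ U → v' z = v z) :
    IsWeakDeriv U (yVec B) B.trace u' v' := by
  intro φ hφ
  have h1 := h.eq φ (hφ.mono hUΩ)
  have e0 : ∀ z ∉ U, -fieldY B φ z - B.trace * φ z = 0 := fun z hz => by
    simp [fieldY_eq, hφ.eq_zero hz]
  rw [setIntegral_eq_integral_of_ae_eq hUΩ
      (X' := fun z => u' z * (-fieldY B φ z - B.trace * φ z))
      (fun z hz => by rw [e0 z hz, mul_zero]) (fun z hz => by rw [e0 z hz, mul_zero])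
      (hu.mono fun z hz hzU => by rw [hz hzU]),
    setIntegral_eq_integral_of_ae_eq hUΩ (X' := fun z => v' z * φ z)
      (fun z hz => by simp [(hφ.eq_zero hz).1]) (fun z hz => by simp [(hφ.eq_zero hz).1])
      (hv.mono fun z hz hzU => by rw [hz hzU])] at h1
  simpa only [fieldY_eq] using h1

theorem abs_sum_mul_le_norm_mul_norm (x y : Grad m) : |∑ i, x i * y i| ≤ ‖x‖ * ‖y‖ := by
  have h := abs_real_inner_le_norm x y
  rw [PiLp.inner_apply] at h
  simpa [mul_comm] using h

theorem measurable_rhs {b Du : Pt m → Grad m} {c u f : Pt m → ℝ} (hb : Measurable b)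
    (hD : Measurable Du) (hc : Measurable c) (hu : Measurable u) (hf : Measurable f) :
    Measurable fun z => (∑ i, b z i * Du z i) + c z * u z + f z :=
  ((Finset.measurable_fun_sum _ fun i _ => (measurable_coord hb i).mul (measurable_coord hD i)).add
    (hc.mul hu)).add hf

theorem integrable_rhs {b Du : Pt m → Grad m} {c u f : Pt m → ℝ} (hb : MemLp b 2)
    (hD : MemLp Du 2) (hc : MemLp c 2) (hu : MemLp u 2) (hf : Integrable f) :
    Integrable fun z => (∑ i, b z i * Du z i) + c z * u z + f z :=
  ((integrable_finsetSum _ fun i _ => (MemLp.coord hb i).integrable_mul (MemLp.coord hD i)).add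
    (hc.integrable_mul hu)).add hf

/-- Measurable representatives, extended by zero, of a sub-solution and its coefficients. -/
theorem IsWeakSubsolution.exists_localSubsolution {B : Matrix (Idx m) (Idx m) ℝ}
    {a : Pt m → Matrix (Fin (m 0)) (Fin (m 0)) ℝ} (ha : ∀ i j, MemLp (fun z => a z i j) ⊤ volume)
    {b : Pt m → Grad m} {c f : Pt m → ℝ} {Ω : Set (Pt m)} {u : Pt m → ℝ} {Du : Pt m → Grad m}
    {Yu : Pt m → ℝ} (h : IsWeakSubsolution B a b c f Ω u Du Yu)
    (hu0 : ∀ᵐ z ∂(volume.restrict Ω), 0 ≤ u z) {U K : Set (Pt m)} (hU : IsOpen U)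
    (hK : IsCompact K) (hUK : U ⊆ K) (hKΩ : K ⊆ Ω) :
    ∃ (b' Du' : Pt m → Grad m) (c' f' u' Yu' : Pt m → ℝ),
      LocalSubsolution B a U u' Du' Yu'
        (fun z => (∑ i, b' z i * Du' z i) + c' z * u' z + f' z) ∧
      (Measurable b' ∧ Measurable c' ∧ Measurable f') ∧
      (MemLp b' 2 ∧ MemLp c' 2 ∧ MemLp f' 2 ∧ Integrable f') ∧
      (∀ z ∉ U, b' z = 0 ∧ c' z = 0 ∧ f' z = 0) ∧
      ∀ᵐ z, z ∈ U → b' z = b z ∧ Du' z = Du z ∧ c' z = c z ∧ f' z = f z ∧ u' z = u z := by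
  have hUΩ := hUK.trans hKΩ
  have hUm := hU.measurableSet
  have hUf : volume U ≠ ⊤ := ne_top_of_le_ne_top hK.measure_lt_top.ne (measure_mono hUK)
  have hr : ∀ {F : Type} [NormedAddCommGroup F] {g : Pt m → F}, MemLpLoc g 2 Ω →
      MemLp g 2 (volume.restrict U) := fun hg =>
    (hg K hK hKΩ).mono_measure (Measure.restrict_mono hUK le_rfl)
  obtain ⟨b', bm, b0, bU, -, b2⟩ := exists_measurable_restriction hUm hUf (hr h.b_loc)
  obtain ⟨D', Dm, D0, DU, Di, D2⟩ := exists_measurable_restriction hUm hUf (hr h.Du_loc)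
  obtain ⟨c', cm, c0, cU, -, c2⟩ := exists_measurable_restriction hUm hUf (hr h.c_loc)
  obtain ⟨f', fm, f0, fU, fi, f2⟩ := exists_measurable_restriction hUm hUf (hr h.f_loc)
  obtain ⟨v, vm, v0, vU, vi, v2⟩ := exists_measurable_restriction hUm hUf (hr h.u_loc)
  obtain ⟨Y', Ym, Y0, YU, Yi, Y2⟩ := exists_measurable_restriction hUm hUf (hr h.Yu_loc)
  -- The absolute value makes the representative non-negative at every point, not merely almost
  -- everywhere.
  have uU : ∀ᵐ z, z ∈ U → |v z| = u z := by
    have h1 : ∀ᵐ z ∂(volume.restrict U), 0 ≤ u z :=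
      ae_mono (Measure.restrict_mono hUΩ le_rfl) hu0
    filter_upwards [vU, (ae_restrict_iff' hUm).1 h1] with z hz hz0 hzU
    rw [hz hzU, abs_of_nonneg (hz0 hzU)]
  have u0 : ∀ z ∉ U, |v z| = 0 := fun z hz => by rw [v0 z hz, abs_zero]
  have u2 : MemLp (fun z => |v z|) 2 := v2.norm
  have um : Measurable fun z => |v z| := by simpa [Real.norm_eq_abs] using vm.norm
  refine ⟨b', D', c', f', fun z => |v z|, Y', ⟨fun z => abs_nonneg _, um, Dm, Ym,
    measurable_rhs bm Dm cm um fm, vi.abs, Di, Yi, integrable_rhs b2 D2 c2 u2 fi, u2, D2, Y2,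
    fun z hz => ⟨u0 z hz, D0 z hz, by simp [D0 z hz, c0 z hz, f0 z hz]⟩,
    h.weakGrad.isWeakDeriv hUΩ uU DU, h.weakY.isWeakDeriv hUΩ uU YU,
    fun φ hφ hφ0 => ?_⟩, ⟨bm, cm, fm⟩, ⟨b2, c2, f2, fi⟩,
    fun z hz => ⟨b0 z hz, c0 z hz, f0 z hz⟩, ?_⟩
  · have h1 := h.ineq φ (hφ.mono hUΩ) hφ0
    have iY : Integrable fun z => φ z * Y' z := by
      simpa [mul_comm] using integrable_mul_of_hasCompactSupport
        Yi.locallyIntegrable hφ.smooth.continuous hφ.compact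
    have iS : Integrable fun z => ∑ i, ∑ j, D' z i * a z i j * gradD φ z j := by
      simp only [integral_double_sum_eq]
      exact integrable_finsetSum _ fun j _ => integrable_mul_of_hasCompactSupport
        ((memLp_flux ha D2 j).locallyIntegrable (by norm_num)) (continuous_gradD hφ.smooth j)
        (hasCompactSupport_gradD hφ.compact j)
    rw [← integral_sub iY iS]
    refine le_of_eq_of_le ?_ (h1.trans_eq ?_)
    · refine (setIntegral_eq_integral_of_ae_eq hUΩ (fun z hz => by simp [(hφ.eq_zero hz).1])
        (fun z hz => by simp [(hφ.eq_zero hz).1]) ?_).symm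
      filter_upwards [bU, DU, cU, uU, fU] with z h1 h2 h3 h4 h5 hz
      rw [h1 hz, h2 hz, h3 hz, h4 hz, h5 hz]
    · refine setIntegral_eq_integral_of_ae_eq hUΩ (fun z hz => by simp [hφ.eq_zero hz])
        (fun z hz => by simp [hφ.eq_zero hz]) ?_
      filter_upwards [DU, YU] with z h1 h2 hz
      rw [h1 hz, h2 hz]
  · filter_upwards [bU, DU, cU, uU, fU] with z h1 h2 h3 h4 h5 hz
    exact ⟨h1 hz, h2 hz, h3 hz, h5 hz, h4 hz⟩

/-! ### Norms on balls and the ellipticity condition -/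

theorem lnorm_enorm_le_eLpNorm {F : Type*} [NormedAddCommGroup F] {U S : Set (Pt m)}
    (hU : MeasurableSet U) (hUS : U ⊆ S) {g g' : Pt m → F} (h0 : ∀ z ∉ U, g' z = 0)
    (h : ∀ᵐ z, z ∈ U → g' z = g z) {p : ℝ} (hp : 0 < p) :
    lnorm volume p (fun z => ‖g' z‖ₑ) ≤ eLpNorm g (ENNReal.ofReal p) (volume.restrict S) := by
  rw [eLpNorm_eq_lintegral_rpow_enorm_toReal (by simpa using hp) (by simp),
    ENNReal.toReal_ofReal hp.le, lnorm]
  refine ENNReal.rpow_le_rpow ?_ (by positivity)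
  calc ∫⁻ z, ‖g' z‖ₑ ^ p = ∫⁻ z in U, ‖g' z‖ₑ ^ p := by
        rw [← lintegral_indicator hU]
        congr 1; funext z
        by_cases hz : z ∈ U
        · rw [Set.indicator_of_mem hz]
        · rw [Set.indicator_of_notMem hz, h0 z hz, enorm_zero, ENNReal.zero_rpow_of_pos hp]
    _ = ∫⁻ z in U, ‖g z‖ₑ ^ p := by
        refine lintegral_congr_ae ?_
        filter_upwards [(ae_restrict_iff' hU).2 h] with z hz
        rw [hz]
    _ ≤ ∫⁻ z in S, ‖g z‖ₑ ^ p := lintegral_mono' (Measure.restrict_mono hUS le_rfl) le_rfl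

theorem eLpNorm_le_lnorm {V : Set (Pt m)} (hV : MeasurableSet V) {g : Pt m → ℝ} {h : Pt m → ℝ≥0∞}
    (hgh : ∀ᵐ z, z ∈ V → ‖g z‖ₑ ≤ h z) {p : ℝ} (hp : 0 < p) :
    eLpNorm g (ENNReal.ofReal p) (volume.restrict V) ≤ lnorm volume p h := by
  rw [eLpNorm_eq_lintegral_rpow_enorm_toReal (by simpa using hp) (by simp),
    ENNReal.toReal_ofReal hp.le, lnorm]
  refine ENNReal.rpow_le_rpow ?_ (by positivity)
  refine (lintegral_mono_ae ?_).trans (setLIntegral_le_lintegral V _)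
  filter_upwards [(ae_restrict_iff' hV).2 hgh] with z hz
  gcongr

/-- Hölder's inequality on a set of finite measure. -/
theorem lnorm_le_lnorm_mul_volume {U : Set (Pt m)} (hU : MeasurableSet U) {g : Pt m → ℝ≥0∞}
    (hg : Measurable g) (h0 : ∀ z ∉ U, g z = 0) {p q : ℝ} (hp : 0 < p) (hpq : p ≤ q) :
    lnorm volume p g ≤ lnorm volume q g * volume U ^ (1 / p - 1 / q) := by
  rcases hpq.eq_or_lt with rfl | hlt
  · simp
  have hq : 0 < q := hp.trans hlt
  obtain ⟨s, hs⟩ : ∃ s, s = 1 / (1 / p - 1 / q) := ⟨_, rfl⟩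
  have hpos : 0 < 1 / p - 1 / q := sub_pos.2 (one_div_lt_one_div_of_lt hp hlt)
  have hs0 : 0 < s := hs ▸ one_div_pos.2 hpos
  have hs1 : 1 / s = 1 / p - 1 / q := by rw [hs, one_div_one_div]
  have h := lnorm_mul_le (μ := (volume : Measure (Pt m))) hp hlt (r := s) (by rw [hs1]; ring)
    hg.aemeasurable (measurable_one.indicator hU (f := (1 : Pt m → ℝ≥0∞))).aemeasurable
  have e1 : (fun z => g z * U.indicator 1 z) = g := by
    funext z
    by_cases hz : z ∈ U
    · simp [hz]
    · simp [hz, h0 z hz]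
  have e2 : lnorm volume s (U.indicator (1 : Pt m → ℝ≥0∞)) = volume U ^ (1 / p - 1 / q) := by
    rw [lnorm, hs1, ← lintegral_indicator_one hU]
    congr 2; funext z
    by_cases hz : z ∈ U
    · simp [hz]
    · simp [hz, ENNReal.zero_rpow_of_pos hs0]
  rwa [e1, e2] at h

/-- Left translation carries the ball into a fixed bounded set, so the bound does not depend on the
centre. -/
theorem exists_volume_openBall_le (B : Matrix (Idx m) (Idx m) ℝ) : ∃ V : ℝ≥0, 1 ≤ V ∧
    ∀ (z₀ : Pt m) (r : ℝ), 0 < r → r ≤ 1 → volume (openBall B r z₀) ≤ V := by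
  have hb : Bornology.IsBounded {w : Pt m | (∀ i, |w.1 i| ≤ 1) ∧ |w.2| ≤ 1} := by
    refine (Metric.isBounded_closedBall (x := (0 : Pt m)) (r := 1)).subset fun w hw => ?_
    rw [mem_closedBall_zero_iff, Prod.norm_def]
    exact max_le ((pi_norm_le_iff_of_nonneg zero_le_one).2 hw.1) hw.2
  obtain ⟨T, hT⟩ : ∃ T, T = closure {w : Pt m | (∀ i, |w.1 i| ≤ 1) ∧ |w.2| ≤ 1} := ⟨_, rfl⟩
  have hTf : volume T ≠ ⊤ := by
    rw [hT]; exact hb.isCompact_closure.measure_lt_top.ne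
  refine ⟨max 1 (volume T).toNNReal, le_max_left _ _, fun z₀ r hr hr1 => ?_⟩
  have h1 : openBall B r z₀ ⊆ groupMul B (groupInv B z₀) ⁻¹' T := fun z hz => by
    rw [hT]; exact subset_closure (abs_le_one_of_normSum_le hr hr1 hz.1.le)
  refine (measure_mono h1).trans ?_
  rw [(measurePreserving_groupMul_left B (groupInv B z₀)).measure_preimage
    (hT ▸ isClosed_closure.nullMeasurableSet), ENNReal.coe_max, ENNReal.coe_toNNReal hTf]
  exact le_max_right _ _

theorem ballMinus_subset_openBall {B : Matrix (Idx m) (Idx m) ℝ} {ρ r : ℝ} (hρ : 0 < ρ)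
    (hr : ρ < r) (z₀ : Pt m) : ballMinus B ρ z₀ ⊆ openBall B r z₀ := fun z hz => by
  obtain ⟨h1, h2⟩ := (mem_ballMinus_iff hρ).1 hz
  exact ⟨(normSum_le_of_le hρ hr.le h1).trans_lt ((div_lt_one (hρ.trans hr)).2 hr), h2⟩

theorem Elliptic.nonneg {lam : ℝ} (hlam : 0 < lam) {a : Pt m → Matrix (Fin (m 0)) (Fin (m 0)) ℝ}
    (ha : Elliptic lam a) :
    ∀ᵐ z, ∀ ξ : Fin (m 0) → ℝ, 0 ≤ ∑ i, ∑ j, a z i j * ξ i * ξ j := by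
  filter_upwards [ha.bounds] with z hz ξ
  exact le_trans (by positivity) (hz ξ).1

/-- Ellipticity bounds every coefficient. -/
theorem Elliptic.abs_le {lam : ℝ} (hlam : 0 < lam) {a : Pt m → Matrix (Fin (m 0)) (Fin (m 0)) ℝ}
    (ha : Elliptic lam a) : ∀ᵐ z, ∀ i j, |a z i j| ≤ lam := by
  filter_upwards [ha.bounds, ha.symm] with z hz hs i j
  have hquad : ∀ x y : ℝ, ∑ k, ∑ l, a z k l * (x * Pi.single (M := fun _ => ℝ) i 1 k +
      y * Pi.single (M := fun _ => ℝ) j 1 k) * (x * Pi.single (M := fun _ => ℝ) i 1 l +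
      y * Pi.single (M := fun _ => ℝ) j 1 l) =
      x ^ 2 * a z i i + 2 * x * y * a z i j + y ^ 2 * a z j j := fun x y => by
    have e : ∀ k l, a z k l * (x * Pi.single (M := fun _ => ℝ) i 1 k +
      y * Pi.single (M := fun _ => ℝ) j 1 k) * (x * Pi.single (M := fun _ => ℝ) i 1 l +
      y * Pi.single (M := fun _ => ℝ) j 1 l) =
      x ^ 2 * (a z k l * Pi.single (M := fun _ => ℝ) i 1 k * Pi.single (M := fun _ => ℝ) i 1 l) +
      x * y * (a z k l * Pi.single (M := fun _ => ℝ) i 1 k * Pi.single (M := fun _ => ℝ) j 1 l) +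
      x * y * (a z k l * Pi.single (M := fun _ => ℝ) j 1 k * Pi.single (M := fun _ => ℝ) i 1 l) +
      y ^ 2 * (a z k l * Pi.single (M := fun _ => ℝ) j 1 k * Pi.single (M := fun _ => ℝ) j 1 l) :=
      fun k l => by ring
    simp only [e, Finset.sum_add_distrib, ← Finset.mul_sum]
    simp [Pi.single_apply]
    rw [hs j i]; ring
  have hnorm : ∀ x y : ℝ, ∑ k, (x * Pi.single (M := fun _ => ℝ) i 1 k +
      y * Pi.single (M := fun _ => ℝ) j 1 k) ^ 2 ≤ 2 * x ^ 2 + 2 * y ^ 2 := fun x y => by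
    have e : ∀ k, (x * Pi.single (M := fun _ => ℝ) i 1 k +
      y * Pi.single (M := fun _ => ℝ) j 1 k) ^ 2 ≤
      2 * x ^ 2 * Pi.single (M := fun _ => ℝ) i 1 k ^ 2 +
      2 * y ^ 2 * Pi.single (M := fun _ => ℝ) j 1 k ^ 2 := fun k => by
      nlinarith [sq_nonneg (x * Pi.single (M := fun _ => ℝ) i 1 k -
        y * Pi.single (M := fun _ => ℝ) j 1 k)]
    refine (Finset.sum_le_sum fun k _ => e k).trans_eq ?_
    rw [Finset.sum_add_distrib, ← Finset.mul_sum, ← Finset.mul_sum]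
    simp [Pi.single_apply]
  -- Polarisation: the values of the form at `(e_i + e_j) / 2` and `(e_i - e_j) / 2` differ by
  -- `a_ij`, and both lie between `0` and `λ`, the two vectors having norm at most `1`.
  have h1 := hz fun k => (1 / 2) * Pi.single (M := fun _ => ℝ) i 1 k +
    (1 / 2) * Pi.single (M := fun _ => ℝ) j 1 k
  have h2 := hz fun k => (1 / 2) * Pi.single (M := fun _ => ℝ) i 1 k +
    (-(1 / 2)) * Pi.single (M := fun _ => ℝ) j 1 k
  have n1 := hnorm (1 / 2) (1 / 2)
  have n2 := hnorm (1 / 2) (-(1 / 2))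
  rw [hquad] at h1 h2
  have p1 : 0 ≤ (1 : ℝ) / lam * ∑ k, ((1 / 2) * Pi.single (M := fun _ => ℝ) i 1 k +
    (1 / 2) * Pi.single (M := fun _ => ℝ) j 1 k) ^ 2 := by positivity
  have p2 : 0 ≤ (1 : ℝ) / lam * ∑ k, ((1 / 2) * Pi.single (M := fun _ => ℝ) i 1 k +
    (-(1 / 2)) * Pi.single (M := fun _ => ℝ) j 1 k) ^ 2 := by positivity
  have q1 := mul_le_mul_of_nonneg_left n1 hlam.le
  have q2 := mul_le_mul_of_nonneg_left n2 hlam.le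
  rw [_root_.abs_le]
  constructor <;> nlinarith

/-! ### The Sobolev estimate -/

/-- The integrability gain on a smaller ball. -/
theorem eLpNorm_ballMinus_le {B : Matrix (Idx m) (Idx m) ℝ} (hB : DriftStructure B) {lam : ℝ}
    (hlam : 0 < lam) {q : ℝ} (hq : ((homDim m : ℝ) + 2) / 2 < q) (hq2 : q ≤ (homDim m : ℝ) + 2)
    (Kb : ℝ≥0) : ∃ C₀ : ℝ≥0, ∀ K₀ : ℝ≥0, K₀ ≠ 0 → ∃ C : ℝ≥0,
    ∀ (a : Pt m → Matrix (Fin (m 0)) (Fin (m 0)) ℝ), Elliptic lam a →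
    ∀ (z₀ : Pt m) (ρ r : ℝ), 1 / 2 ≤ ρ → ρ < r → r ≤ 1 →
    ∀ (v : Pt m → ℝ) (Dv : Pt m → Grad m) (H : Pt m → ℝ), LocalIneq B a (openBall B r z₀) v Dv H →
    ∀ (p : ℝ≥0) (b W S : Pt m → ℝ≥0∞), 1 ≤ p → Measurable b → Measurable W → Measurable S →
      (∀ z, W z ≠ ⊤) → lnorm volume ((homDim m : ℝ) + 2) b ≤ Kb → lnorm volume q W ≤ p * K₀ →
      ∫⁻ z, W z * ENNReal.ofReal (v z) ≠ ⊤ →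
      (∀ᵐ z, ENNReal.ofReal |H z| ≤ b z * ‖Dv z‖ₑ + W z * ENNReal.ofReal (v z) + S z) →
    ∀ g : Pt m → ℝ, (∀ᵐ z, z ∈ ballMinus B ρ z₀ → ‖g z‖ₑ ≤ ENNReal.ofReal (v z)) →
      eLpNorm g (ENNReal.ofReal (2 * (1 + 2 / (homDim m : ℝ))))
          (volume.restrict (ballMinus B ρ z₀)) ≤
        ENNReal.ofReal (C / (r - ρ)) * ((p : ℝ≥0∞) ^ (q / (2 * q - homDim m - 2)) *
          lnorm volume 2 (fun z => ENNReal.ofReal (v z)) + lnorm volume 2 fun z => ‖Dv z‖ₑ) +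
        C₀ * lnorm volume ((2 * (homDim m : ℝ) + 4) / ((homDim m : ℝ) + 4)) S := by
  have hQ := homDim_pos hB
  obtain ⟨C₀, hC₀⟩ := lnorm_cutoff_mul_le hB hlam.le hq hq2 Kb
  obtain ⟨L, hL, hcut⟩ := exists_cutoff B
  refine ⟨C₀, fun K₀ hK₀ => ?_⟩
  obtain ⟨C, hC⟩ := hC₀ K₀ hK₀
  refine ⟨C * L.toNNReal, ?_⟩
  intro a ha z₀ ρ r hρ hρr hr v Dv H hv p b W S hp hb hW hS hWt hbK hWK hWv hH g hg
  obtain ⟨χ, hχ, hχ1⟩ := hcut z₀ ρ r hρ hρr hr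
  have hδ : 0 < r - ρ := sub_pos.2 hρr
  have hL1 : 1 ≤ L / (r - ρ) := by
    rw [le_div_iff₀ hδ]; linarith
  have h := hC a (fun i j => (ha.bounded i j).aestronglyMeasurable) (ha.abs_le hlam) z₀ r _ χ v Dv H
    hv hL1 hχ p b W S hp hb hW hS hWt hbK hWK hWv hH
  refine (eLpNorm_le_lnorm (measurableSet_ballMinus (by linarith) z₀) ?_ (by positivity)).trans
    (h.trans_eq ?_)
  · filter_upwards [hg] with z hz hzρ
    rw [hχ1 z hzρ, one_mul]
    exact hz hzρ
  · congr 2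
    rw [NNReal.coe_mul, Real.coe_toNNReal _ (by linarith), mul_div_assoc,
      ENNReal.ofReal_mul (NNReal.coe_nonneg C), ENNReal.ofReal_coe_nnreal]

/-- The potential is `|c|` and the source `|f|`, with `p = 1`. The absorption works for exponents up
to `Q + 2` only, so a larger `q` is first lowered by Hölder's inequality on the ball, whose volume
is bounded. -/
theorem sobolev_estimate_one {B : Matrix (Idx m) (Idx m) ℝ} (hB : DriftStructure B) {lam : ℝ}
    (hlam : 0 < lam) {q : ℝ} (hq : ((homDim m : ℝ) + 2) / 2 < q) (Kb Kc : ℝ≥0) : ∃ C : ℝ, 0 < C ∧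
    ∀ (a : Pt m → Matrix (Fin (m 0)) (Fin (m 0)) ℝ), Elliptic lam a →
    ∀ (Ω : Set (Pt m)) (b : Pt m → Grad m) (c f : Pt m → ℝ) (u : Pt m → ℝ) (Du : Pt m → Grad m)
      (Yu : Pt m → ℝ), IsWeakSubsolution B a b c f Ω u Du Yu →
      (∀ᵐ z ∂(volume.restrict Ω), 0 ≤ u z) →
    ∀ (z₀ : Pt m) (ρ r : ℝ), 1 / 2 ≤ ρ → ρ < r → r ≤ 1 → closure (ballMinus B r z₀) ⊆ Ω →
      eLpNorm b (ENNReal.ofReal ((homDim m : ℝ) + 2))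
        (volume.restrict (ballMinus B r z₀)) ≤ Kb →
      eLpNorm c (ENNReal.ofReal q) (volume.restrict (ballMinus B r z₀)) ≤ Kc →
    ∀ φ : Pt m → ℝ, (∀ z ∈ ballMinus B ρ z₀, φ z = 1) →
      eLpNorm (fun z => φ z * u z) (ENNReal.ofReal (2 * (1 + 2 / (homDim m : ℝ))))
          (volume.restrict (ballMinus B ρ z₀)) ≤
        ENNReal.ofReal (C / (r - ρ)) * (eLpNorm u 2 (volume.restrict (ballMinus B r z₀)) +
          eLpNorm Du 2 (volume.restrict (ballMinus B r z₀))) +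
        ENNReal.ofReal C * eLpNorm f
          (ENNReal.ofReal ((2 * (homDim m : ℝ) + 4) / ((homDim m : ℝ) + 4)))
          (volume.restrict (ballMinus B r z₀)) := by
  have hQ := homDim_pos hB
  obtain ⟨V, hV1, hV⟩ := exists_volume_openBall_le B
  obtain ⟨q', hq'⟩ : ∃ q', q' = min q ((homDim m : ℝ) + 2) := ⟨_, rfl⟩
  have hq'1 : ((homDim m : ℝ) + 2) / 2 < q' := by
    rw [hq']; exact lt_min hq (by linarith)
  have hq'0 : 0 < q' := lt_trans (by positivity) hq'1
  have hq'q : q' ≤ q := hq' ▸ min_le_left _ _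
  have he : 0 ≤ 1 / q' - 1 / q := sub_nonneg.2 (one_div_le_one_div_of_le hq'0 hq'q)
  obtain ⟨C₀, hC₀⟩ := eLpNorm_ballMinus_le hB hlam hq'1 (hq' ▸ min_le_right _ _) Kb
  obtain ⟨C₁, hC₁⟩ := hC₀ (Kc * V ^ (1 / q' - 1 / q) + 1) (by positivity)
  refine ⟨C₁ + C₀ + 1, by positivity, ?_⟩
  intro a ha Ω b c f u Du Yu hu hu0 z₀ ρ r hρ hρr hr hcl hb hc φ hφ
  have hr0 : 0 < r := by linarith
  have hUo := isOpen_openBall B r z₀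
  have hUm := hUo.measurableSet
  have hUS := openBall_subset (B := B) hr0 z₀
  obtain ⟨b', D', c', f', u', Y', hsub, ⟨bm, cm, fm⟩, ⟨b2, c2, f2, fi⟩, h0, hae⟩ :=
    hu.exists_localSubsolution ha.bounded hu0 hUo
      (isBounded_ballMinus (B := B) hr0 hr z₀).isCompact_closure (hUS.trans subset_closure) hcl
  have hs0 : 0 < (2 * (homDim m : ℝ) + 4) / ((homDim m : ℝ) + 4) := by positivity
  have hb' : lnorm volume ((homDim m : ℝ) + 2) (fun z => ‖b' z‖ₑ) ≤ Kb :=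
    (lnorm_enorm_le_eLpNorm hUm hUS (fun z hz => (h0 z hz).1)
      (hae.mono fun z hz hzU => (hz hzU).1) (by positivity)).trans hb
  have hc' : lnorm volume q (fun z => ‖c' z‖ₑ) ≤ Kc :=
    (lnorm_enorm_le_eLpNorm hUm hUS (fun z hz => (h0 z hz).2.1)
      (hae.mono fun z hz hzU => (hz hzU).2.2.1) (hq'0.trans_le hq'q)).trans hc
  have hc'' : lnorm volume q' (fun z => ‖c' z‖ₑ) ≤
      ((1 : ℝ≥0) : ℝ≥0∞) * ((Kc * V ^ (1 / q' - 1 / q) + 1 : ℝ≥0) : ℝ≥0∞) := by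
    refine (lnorm_le_lnorm_mul_volume hUm cm.enorm (fun z hz => by simp [(h0 z hz).2.1]) hq'0
      hq'q).trans ?_
    rw [ENNReal.coe_one, one_mul, ENNReal.coe_add, ENNReal.coe_mul,
      ENNReal.coe_rpow_of_nonneg _ he]
    refine le_add_of_le_of_nonneg (mul_le_mul' hc' ?_) bot_le
    exact ENNReal.rpow_le_rpow (hV z₀ r hr0 hr) he
  have hu' : (fun z => ENNReal.ofReal (u' z)) = fun z => ‖u' z‖ₑ := funext fun z =>
    (Real.enorm_eq_ofReal (hsub.nonneg z)).symm
  have h := hC₁ a ha z₀ ρ r hρ hρr hr u' D' _ hsub.localIneq 1 (fun z => ‖b' z‖ₑ)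
    (fun z => ‖c' z‖ₑ) (fun z => ‖f' z‖ₑ) le_rfl bm.enorm cm.enorm fm.enorm (fun z => by simp)
    hb' hc'' (by
      have hi := (c2.integrable_mul hsub.memLp).2
      rw [hasFiniteIntegral_iff_enorm] at hi
      refine ne_top_of_le_ne_top hi.ne (lintegral_mono fun z => ?_)
      simp only [Pi.mul_apply, enorm_mul]
      rw [Real.enorm_eq_ofReal (hsub.nonneg z)])
    (Filter.Eventually.of_forall fun z => by
      have h1 : |(∑ i, b' z i * D' z i) + c' z * u' z + f' z| ≤
          ‖b' z‖ * ‖D' z‖ + ‖c' z‖ * u' z + ‖f' z‖ := by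
        refine (abs_add_three _ _ _).trans ?_
        rw [abs_mul (c' z), abs_of_nonneg (hsub.nonneg z)]
        exact add_le_add (add_le_add (abs_sum_mul_le_norm_mul_norm _ _) le_rfl) le_rfl
      refine (ENNReal.ofReal_le_ofReal h1).trans_eq ?_
      have := hsub.nonneg z
      rw [ENNReal.ofReal_add (by positivity) (by positivity), ENNReal.ofReal_add (by positivity)
        (by positivity), ENNReal.ofReal_mul (by positivity), ENNReal.ofReal_mul (by positivity),
        ofReal_norm, ofReal_norm, ofReal_norm, ofReal_norm])
    (fun z => φ z * u z) (by
      filter_upwards [hae] with z hz hzρ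
      have hzU := ballMinus_subset_openBall (by linarith) hρr z₀ hzρ
      rw [hφ z hzρ, one_mul, ← (hz hzU).2.2.2.2, Real.enorm_eq_ofReal (hsub.nonneg z)])
  rw [ENNReal.coe_one, ENNReal.one_rpow, one_mul, hu'] at h
  have n1 : lnorm volume 2 (fun z => ‖u' z‖ₑ) ≤ eLpNorm u 2 (volume.restrict (ballMinus B r z₀)) := by
    simpa using lnorm_enorm_le_eLpNorm hUm hUS (fun z hz => (hsub.eq_zero z hz).1)
      (hae.mono fun z hz hzU => (hz hzU).2.2.2.2) two_pos
  have n2 : lnorm volume 2 (fun z => ‖D' z‖ₑ) ≤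
      eLpNorm Du 2 (volume.restrict (ballMinus B r z₀)) := by
    simpa using lnorm_enorm_le_eLpNorm hUm hUS (fun z hz => (hsub.eq_zero z hz).2.1)
      (hae.mono fun z hz hzU => (hz hzU).2.1) two_pos
  have n3 := lnorm_enorm_le_eLpNorm hUm hUS (fun z hz => (h0 z hz).2.2)
    (hae.mono fun z hz hzU => (hz hzU).2.2.2.1) hs0
  have hδ : 0 < r - ρ := sub_pos.2 hρr
  refine h.trans (add_le_add (mul_le_mul' (ENNReal.ofReal_le_ofReal ?_) (add_le_add n1 n2))
    (mul_le_mul' ?_ n3))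
  · gcongr
    linarith [C₀.coe_nonneg]
  · rw [← ENNReal.ofReal_coe_nnreal]
    exact ENNReal.ofReal_le_ofReal (by linarith [C₁.coe_nonneg])

/-- Bernoulli's inequality for the ratio `κ / x`. -/
theorem mul_pow_pred_mul_le {p : ℕ} (hp : 1 < p) {x κ : ℝ} (hx : 0 ≤ x) (hκ : 0 ≤ κ) :
    p * x ^ (p - 1) * κ ≤ p * x ^ p + κ ^ p := by
  rcases hx.eq_or_lt with rfl | hx
  · rw [zero_pow (by omega), zero_pow (by omega)]
    have : 0 ≤ κ ^ p := by positivity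
    simpa
  have h := one_add_mul_le_pow (a := κ / x - 1) (by
    have : 0 ≤ κ / x := by positivity
    linarith) p
  rw [add_sub_cancel, div_pow, le_div_iff₀ (by positivity)] at h
  have e : x ^ p = x ^ (p - 1) * x := by rw [← pow_succ]; congr 1; omega
  have e2 : κ / x * x ^ p = κ * x ^ (p - 1) := by rw [e]; field_simp
  have h3 : 0 < x ^ p := by positivity
  have h4 : (1 + (p : ℝ) * (κ / x - 1)) * x ^ p = x ^ p + p * (κ / x * x ^ p) - p * x ^ p := by ring
  rw [h4, e2] at h
  linarith

/-- The choice of the splitting parameter in the source term. -/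
theorem mul_pow_pred_le_rpow {Q θ r D X : ℝ} {p : ℕ} (hp : 1 < p) (hX : X * 2 ^ (Q / 2) ≤ D)
    (hD : 1 ≤ D) (hr : 1 / 2 ≤ r) (hθ0 : 0 ≤ θ) (hθ : θ ≤ p + Q / 2) :
    X * (1 / (4 * D)) ^ (p - 1) ≤ r ^ θ := by
  have h2 : (0 : ℝ) < 2 ^ (Q / 2) := by positivity
  have h1 : ((1 : ℝ) / 2) ^ p / 2 ^ (Q / 2) ≤ r ^ θ := by
    calc ((1 : ℝ) / 2) ^ p / 2 ^ (Q / 2) = (1 / 2) ^ ((p : ℝ) + Q / 2) := by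
          rw [Real.rpow_add (by norm_num), Real.rpow_natCast, Real.div_rpow zero_le_one zero_le_two,
            Real.one_rpow (Q / 2), mul_one_div]
      _ ≤ (1 / 2) ^ θ := Real.rpow_le_rpow_of_exponent_ge (by norm_num) (by norm_num) hθ
      _ ≤ r ^ θ := Real.rpow_le_rpow (by norm_num) hr hθ0
  refine le_trans ?_ h1
  rw [le_div_iff₀ h2]
  calc X * (1 / (4 * D)) ^ (p - 1) * 2 ^ (Q / 2)
      = X * 2 ^ (Q / 2) * (1 / (4 * D)) ^ (p - 1) := by ring
    _ ≤ D * (1 / (4 * D)) ^ (p - 1) := by gcongr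
    _ = (1 / 4) ^ (p - 1) * (D / D ^ (p - 1)) := by
        rw [div_pow, div_pow, mul_pow]; field_simp
    _ ≤ (1 / 4) ^ (p - 1) * 1 := by
        gcongr
        rw [div_le_one (by positivity)]
        exact le_self_pow₀ hD (by omega)
    -- Here `p ≥ 2` enters, through `2 (p - 1) ≥ p`; the factor `4` next to `D` is there for this
    -- step.
    _ = (1 / 2) ^ (2 * (p - 1)) := by rw [mul_one, pow_mul]; norm_num
    _ ≤ (1 / 2) ^ p := pow_le_pow_of_le_one (by norm_num) (by norm_num) (by omega)

/-- The lower power is dominated: `u^(p-1) ≤ 1 + u^p`. -/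
theorem integrable_pow_pred_mul (p : ℕ) {u f : Pt m → ℝ} (hu : Measurable u) (hu0 : ∀ z, 0 ≤ u z)
    (hf : Integrable f) (hfu : Integrable fun z => f z * u z ^ p) :
    Integrable fun z => u z ^ (p - 1) * f z := by
  refine (hf.norm.add hfu.norm).mono ((hu.pow_const _).aestronglyMeasurable.mul
    hf.aestronglyMeasurable) (Filter.Eventually.of_forall fun z => ?_)
  have h1 := hu0 z
  have h3 : 0 ≤ u z ^ p := by positivity
  have h2 : u z ^ (p - 1) ≤ 1 + u z ^ p := by
    rcases le_total (u z) 1 with h | h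
    · have := pow_le_one₀ (n := p - 1) h1 h
      linarith
    · have := pow_le_pow_right₀ h (Nat.sub_le p 1)
      linarith
  rw [Pi.add_apply, Real.norm_of_nonneg (add_nonneg (norm_nonneg _) (norm_nonneg _)), norm_mul,
    norm_mul, Real.norm_of_nonneg (pow_nonneg h1 (p - 1)), Real.norm_of_nonneg h3]
  nlinarith [norm_nonneg (f z)]

/-- The height is `κ = F / (4D)`, for which both bounds are equalities; for `F = 0` any positive
height will do. -/
theorem exists_splitting_height {p : ℕ} (hp : 1 < p) {D F : ℝ} (hD : 0 < D) (hF : 0 ≤ F) :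
    ∃ κ : ℝ, 0 < κ ∧ κ⁻¹ * F ≤ 4 * D ∧ κ ^ (p - 1) * F ≤ (1 / (4 * D)) ^ (p - 1) * F ^ p := by
  rcases hF.eq_or_lt with rfl | hF
  · exact ⟨1, one_pos, by rw [mul_zero]; positivity, by simp [show p ≠ 0 by omega]⟩
  · refine ⟨1 / (4 * D) * F, by positivity, le_of_eq (by field_simp), le_of_eq ?_⟩
    rw [mul_pow, mul_assoc, ← pow_succ]
    congr 2; omega

-- The right-hand side for `u^p` is `b'·Dw + p c w + p u^(p-1) f`. In the last term `p u^(p-1) ≤ κ⁻¹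
-- p u^p + κ^(p-1)`: the first piece joins the potential `p (|c| + κ⁻¹ |f|)`, whose norm is at most
-- `p (Kc + 4D)` whatever `f` is, and the second is a source of size `κ^(p-1) ‖f‖`. The factor `(1 /
-- (4D))^(p-1)` it carries reduces all constants to the stated power of `r`, so no constant is left
-- in front of `‖f‖^p`.
set_option maxHeartbeats 800000 in
theorem sobolev_estimate_pow {B : Matrix (Idx m) (Idx m) ℝ} (hB : DriftStructure B) {lam : ℝ}
    (hlam : 0 < lam) {q : ℝ} (hq : ((homDim m : ℝ) + 2) / 2 < q) (hq2 : q < (homDim m : ℝ) + 2)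
    (Kb Kc : ℝ≥0) : ∃ C : ℝ, 0 < C ∧
    ∀ (a : Pt m → Matrix (Fin (m 0)) (Fin (m 0)) ℝ), Elliptic lam a →
    ∀ (Ω : Set (Pt m)) (b : Pt m → Grad m) (c f : Pt m → ℝ),
      MemLp f (ENNReal.ofReal q) (volume.restrict Ω) →
    ∀ (u : Pt m → ℝ) (Du : Pt m → Grad m)
      (Yu : Pt m → ℝ), IsWeakSubsolution B a b c f Ω u Du Yu →
      (∀ᵐ z ∂(volume.restrict Ω), 0 ≤ u z) →
    ∀ (z₀ : Pt m) (ρ r : ℝ), 1 / 2 ≤ ρ → ρ < r → r ≤ 1 → closure (ballMinus B r z₀) ⊆ Ω →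
      eLpNorm b (ENNReal.ofReal ((homDim m : ℝ) + 2))
        (volume.restrict (ballMinus B r z₀)) ≤ Kb →
      eLpNorm c (ENNReal.ofReal q) (volume.restrict (ballMinus B r z₀)) ≤ Kc →
    ∀ φ : Pt m → ℝ, (∀ z ∈ ballMinus B ρ z₀, φ z = 1) →
    ∀ p : ℕ, 1 < p → ∀ Dw : Pt m → Grad m,
      IsWeakGrad (interior (ballMinus B r z₀)) (fun z => u z ^ p) Dw →
      eLpNorm (fun z => φ z * u z ^ p) (ENNReal.ofReal (2 * (1 + 2 / (homDim m : ℝ))))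
          (volume.restrict (ballMinus B ρ z₀)) ≤
        ENNReal.ofReal (C / (r - ρ)) *
          (ENNReal.ofReal ((p : ℝ) ^ (q / (2 * q - homDim m - 2))) *
            eLpNorm (fun z => u z ^ p) 2 (volume.restrict (ballMinus B r z₀)) +
          eLpNorm Dw 2 (volume.restrict (ballMinus B r z₀))) +
        ENNReal.ofReal
            (r ^ ((p : ℝ) * (2 - ((homDim m : ℝ) + 2) / q) + (homDim m : ℝ) / 2)) *
          eLpNorm f (ENNReal.ofReal q) (volume.restrict (ballMinus B r z₀)) ^ p := by
  have hQ := homDim_pos hB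
  obtain ⟨Q, hQd⟩ : ∃ Q : ℝ, Q = homDim m := ⟨_, rfl⟩
  obtain ⟨V, hV1, hV⟩ := exists_volume_openBall_le B
  have hq0 : 0 < q := lt_trans (by positivity) hq
  obtain ⟨C₀, hC₀⟩ := eLpNorm_ballMinus_le hB hlam hq hq2.le Kb
  rw [← hQd] at hQ hq hq2 hC₀ ⊢
  obtain ⟨s, hs⟩ : ∃ s, s = (2 * Q + 4) / (Q + 4) := ⟨_, rfl⟩
  have hs0 : 0 < s := by rw [hs]; positivity
  have hsq : s ≤ q := by
    refine le_trans ?_ hq.le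
    rw [hs, div_le_div_iff₀ (by positivity) two_pos]; nlinarith
  have he : 0 ≤ 1 / s - 1 / q := sub_nonneg.2 (one_div_le_one_div_of_le hs0 hsq)
  obtain ⟨X, hX⟩ : ∃ X : ℝ≥0, X = C₀ * V ^ (1 / s - 1 / q) := ⟨_, rfl⟩
  -- `X` is the full constant in front of the source after Hölder's inequality on the ball. Taking
  -- `D` larger than `X 2^(Q/2)` compensates it together with the worst case `r = 1 / 2` of the
  -- factor `r^(Q/2)`.
  obtain ⟨D, hD⟩ : ∃ D : ℝ, D = max 1 (X * 2 ^ (Q / 2)) := ⟨_, rfl⟩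
  have hD1 : 1 ≤ D := hD ▸ le_max_left _ _
  have hDX : (X : ℝ) * 2 ^ (Q / 2) ≤ D := hD ▸ le_max_right _ _
  obtain ⟨C₁, hC₁⟩ := hC₀ (Kc + (4 * D).toNNReal) (by
    have : 0 < (4 * D).toNNReal := Real.toNNReal_pos.2 (by linarith)
    positivity)
  refine ⟨C₁ + 1, by positivity, ?_⟩
  intro a ha Ω b c f hfΩ u Du Yu hu hu0 z₀ ρ r hρ hρr hr hcl hb hc φ hφ p hp Dw hw
  have hδ : 0 < r - ρ := sub_pos.2 hρr
  have hp0 : p ≠ 0 := by omega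
  have hp1 : (1 : ℝ) < p := by exact_mod_cast hp
  have hpe : 0 < (p : ℝ) ^ (q / (2 * q - Q - 2)) := by positivity
  have hCδ : ENNReal.ofReal ((C₁ + 1) / (r - ρ)) ≠ 0 := by
    rw [Ne, ENNReal.ofReal_eq_zero, not_le]; positivity
  -- If either norm on the right is infinite the bound is trivial, because their coefficients are
  -- non-zero. Otherwise `u^p` and its gradient are in `L²` on the open ball.
  by_cases hwt : eLpNorm (fun z => u z ^ p) 2 (volume.restrict (ballMinus B r z₀)) = ⊤
  · rw [hwt, ENNReal.mul_top (by simpa using hpe), top_add, ENNReal.mul_top hCδ, top_add]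
    exact le_top
  by_cases hDt : eLpNorm Dw 2 (volume.restrict (ballMinus B r z₀)) = ⊤
  · rw [hDt, add_top, ENNReal.mul_top hCδ, top_add]
    exact le_top
  have hr0 : 0 < r := by linarith
  have hUo := isOpen_openBall B r z₀
  have hUm := hUo.measurableSet
  have hUS := openBall_subset (B := B) hr0 z₀
  have hUI : openBall B r z₀ ⊆ interior (ballMinus B r z₀) := interior_maximal hUS hUo
  have hUf : volume (openBall B r z₀) ≠ ⊤ := ne_top_of_le_ne_top (by simp) (hV z₀ r hr0 hr)
  obtain ⟨b', D', c', f', u', Y', hsub, ⟨bm, cm, fm⟩, ⟨b2, c2, f2, fi⟩, h0, hae⟩ :=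
    hu.exists_localSubsolution ha.bounded hu0 hUo
      (isBounded_ballMinus (B := B) hr0 hr z₀).isCompact_closure (hUS.trans subset_closure) hcl
  -- the power and its gradient
  have hresU : ∀ {F : Type} [NormedAddCommGroup F] {g : Pt m → F},
      LocallyIntegrableOn g (interior (ballMinus B r z₀)) →
      eLpNorm g 2 (volume.restrict (ballMinus B r z₀)) ≠ ⊤ →
      MemLp g 2 (volume.restrict (openBall B r z₀)) := fun hg hgt =>
    ⟨hg.aestronglyMeasurable.mono_measure (Measure.restrict_mono hUI le_rfl),
      (eLpNorm_mono_measure _ (Measure.restrict_mono hUS le_rfl)).trans_lt hgt.lt_top⟩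
  obtain ⟨G, Gm, G0, GU, Gi, G2⟩ := exists_measurable_restriction hUm hUf (hresU hw.locInt_grad hDt)
  obtain ⟨w, wm, w0, wU, wi, w2⟩ := exists_measurable_restriction hUm hUf (hresU hw.locInt hwt)
  have huw : ∀ᵐ z, z ∈ openBall B r z₀ → u' z ^ p = u z ^ p :=
    hae.mono fun z hz hzU => by rw [(hz hzU).2.2.2.2]
  have hup0 : ∀ z ∉ openBall B r z₀, u' z ^ p = 0 := fun z hz => by
    rw [(hsub.eq_zero z hz).1, zero_pow hp0]
  have hww : w =ᵐ[volume] fun z => u' z ^ p := by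
    filter_upwards [wU, huw] with z h1 h2
    by_cases hzU : z ∈ openBall B r z₀
    · rw [h1 hzU, h2 hzU]
    · rw [w0 z hzU, hup0 z hzU]
  have ui : Integrable fun z => u' z ^ p := wi.congr hww
  have u2 : MemLp (fun z => u' z ^ p) 2 := w2.ae_eq hww
  have hwd := fun i => hw.isWeakDeriv hUI huw GU i
  have hGD := hsub.grad_pow_eq hUo hp0 Gm ui u2 Gi G2 G0 hwd
  have epow : ∀ z, u' z ^ (p - 1) * u' z = u' z ^ p := fun z => by
    rw [← pow_succ]; congr 1; omega
  have hHeq : ∀ᵐ z, p * u' z ^ (p - 1) * ((∑ i, b' z i * D' z i) + c' z * u' z + f' z) =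
      (∑ i, b' z i * G z i) + p * (c' z * u' z ^ p) + p * (u' z ^ (p - 1) * f' z) := by
    filter_upwards [hGD] with z hz
    have e1 : ∑ i, b' z i * G z i = p * u' z ^ (p - 1) * ∑ i, b' z i * D' z i := by
      rw [hz, Finset.mul_sum]
      refine Finset.sum_congr rfl fun i _ => ?_
      simp only [PiLp.smul_apply, smul_eq_mul]; ring
    rw [e1, ← epow]; ring
  have hfu : Integrable fun z => f' z * u' z ^ p := f2.integrable_mul u2
  have hcu : Integrable fun z => c' z * u' z ^ p := c2.integrable_mul u2
  have hpf := integrable_pow_pred_mul p hsub.meas hsub.nonneg fi hfu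
  have hH : Integrable fun z =>
      p * u' z ^ (p - 1) * ((∑ i, b' z i * D' z i) + c' z * u' z + f' z) := by
    refine Integrable.congr ?_ (hHeq.mono fun z hz => hz.symm)
    exact ((integrable_finsetSum _ fun i _ =>
      (MemLp.coord b2 i).integrable_mul (MemLp.coord G2 i)).add (hcu.const_mul _)).add
        (hpf.const_mul _)
  have hloc := hsub.pow hUo ha.bounded (ha.nonneg hlam) hp0 Gm ui u2 G2 G0 hwd hGD hH
  -- norms of the coefficients
  have hb' : lnorm volume (Q + 2) (fun z => ‖b' z‖ₑ) ≤ Kb :=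
    (lnorm_enorm_le_eLpNorm hUm hUS (fun z hz => (h0 z hz).1)
      (hae.mono fun z hz hzU => (hz hzU).1) (by positivity)).trans hb
  have hc' : lnorm volume q (fun z => ‖c' z‖ₑ) ≤ Kc :=
    (lnorm_enorm_le_eLpNorm hUm hUS (fun z hz => (h0 z hz).2.1)
      (hae.mono fun z hz hzU => (hz hzU).2.2.1) hq0).trans hc
  have hf' := lnorm_enorm_le_eLpNorm hUm hUS (fun z hz => (h0 z hz).2.2)
      (hae.mono fun z hz hzU => (hz hzU).2.2.2.1) hq0
  have hft : lnorm volume q (fun z => ‖f' z‖ₑ) ≠ ⊤ := by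
    refine ne_top_of_le_ne_top ?_ (hf'.trans (eLpNorm_mono_measure _
      (Measure.restrict_mono (subset_closure.trans hcl) le_rfl)))
    exact hfΩ.2.ne
  obtain ⟨F, hF⟩ : ∃ F : ℝ≥0, (F : ℝ≥0∞) = lnorm volume q (fun z => ‖f' z‖ₑ) :=
    ⟨_, ENNReal.coe_toNNReal hft⟩
  rw [← hF] at hf'
  obtain ⟨κ, hκ0, hκ1, hκ2⟩ := exists_splitting_height hp (zero_lt_one.trans_le hD1) F.coe_nonneg
  have hW : lnorm volume q (fun z => ENNReal.ofReal p * (‖c' z‖ₑ + ENNReal.ofReal κ⁻¹ * ‖f' z‖ₑ)) ≤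
      ((p : ℝ≥0) : ℝ≥0∞) * ((Kc + (4 * D).toNNReal : ℝ≥0) : ℝ≥0∞) := by
    rw [lnorm_const_mul hq0 (by simp)]
    refine mul_le_mul' (by simp) ((lnorm_add_le (by linarith) cm.enorm.aemeasurable
      (fm.enorm.const_mul _).aemeasurable).trans ?_)
    rw [lnorm_const_mul hq0 (by simp), ENNReal.coe_add, ← hF]
    refine add_le_add hc' ?_
    rw [← ENNReal.ofReal_coe_nnreal (p := F), ← ENNReal.ofReal_mul (by positivity)]
    exact ENNReal.ofReal_le_ofReal hκ1
  have hWre : ∀ z, ENNReal.ofReal p * (‖c' z‖ₑ + ENNReal.ofReal κ⁻¹ * ‖f' z‖ₑ) *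
      ENNReal.ofReal (u' z ^ p) = ENNReal.ofReal (p * (‖c' z‖ + κ⁻¹ * ‖f' z‖) * u' z ^ p) :=
    fun z => by
      rw [ENNReal.ofReal_mul (by positivity), ENNReal.ofReal_mul (by positivity),
        ENNReal.ofReal_add (by positivity) (by positivity), ENNReal.ofReal_mul (by positivity),
        ofReal_norm, ofReal_norm]
  have hup : (fun z => ENNReal.ofReal (u' z ^ p)) = fun z => ‖u' z ^ p‖ₑ := funext fun z =>
    (Real.enorm_eq_ofReal (pow_nonneg (hsub.nonneg z) p)).symm
  have h := hC₁ a ha z₀ ρ r hρ hρr hr _ G _ hloc p (fun z => ‖b' z‖ₑ)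
    (fun z => ENNReal.ofReal p * (‖c' z‖ₑ + ENNReal.ofReal κ⁻¹ * ‖f' z‖ₑ))
    (fun z => ENNReal.ofReal (κ ^ (p - 1)) * ‖f' z‖ₑ) (by exact_mod_cast hp.le) bm.enorm
    ((cm.enorm.add (fm.enorm.const_mul _)).const_mul _) (fm.enorm.const_mul _)
    (fun z => by finiteness) hb' hW (by
      simp only [hWre]
      have hi : Integrable fun z => p * (‖c' z‖ + κ⁻¹ * ‖f' z‖) * u' z ^ p := by
        have e : ∀ z, p * (‖c' z‖ + κ⁻¹ * ‖f' z‖) * u' z ^ p =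
            p * (‖c' z * u' z ^ p‖ + κ⁻¹ * ‖f' z * u' z ^ p‖) := fun z => by
          rw [norm_mul, norm_mul, Real.norm_of_nonneg (pow_nonneg (hsub.nonneg z) p)]; ring
        simp only [e]
        exact (hcu.norm.add (hfu.norm.const_mul _)).const_mul _
      exact hi.lintegral_lt_top.ne)
    (by
      filter_upwards [hHeq] with z hz
      have h1 := hsub.nonneg z
      have h2 : 0 ≤ u' z ^ p := by positivity
      -- The Bernoulli bound divided by `κ`.
      have h3 : p * u' z ^ (p - 1) ≤ κ⁻¹ * (p * u' z ^ p) + κ ^ (p - 1) := by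
        have h4 := mul_pow_pred_mul_le hp h1 hκ0.le
        have h5 : κ ^ p = κ ^ (p - 1) * κ := by rw [← pow_succ]; congr 1; omega
        rw [← le_div_iff₀ hκ0, h5] at h4
        refine h4.trans_eq ?_
        field_simp
      have h6 : |p * u' z ^ (p - 1) * ((∑ i, b' z i * D' z i) + c' z * u' z + f' z)| ≤
          ‖b' z‖ * ‖G z‖ + p * (‖c' z‖ + κ⁻¹ * ‖f' z‖) * u' z ^ p + κ ^ (p - 1) * ‖f' z‖ := by
        rw [hz]
        refine (abs_add_three _ _ _).trans ?_
        have h7 := abs_sum_mul_le_norm_mul_norm (b' z) (G z)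
        have h8 : |p * (c' z * u' z ^ p)| = p * ‖c' z‖ * u' z ^ p := by
          rw [abs_mul, abs_mul, Nat.abs_cast, abs_of_nonneg h2, Real.norm_eq_abs]; ring
        have h9 : |p * (u' z ^ (p - 1) * f' z)| = p * u' z ^ (p - 1) * ‖f' z‖ := by
          rw [abs_mul, abs_mul, Nat.abs_cast, abs_of_nonneg (pow_nonneg h1 _), Real.norm_eq_abs]
          ring
        rw [h8, h9]
        have h10 := mul_le_mul_of_nonneg_right h3 (norm_nonneg (f' z))
        nlinarith
      refine (ENNReal.ofReal_le_ofReal h6).trans_eq ?_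
      rw [hWre, ENNReal.ofReal_add (by positivity) (by positivity),
        ENNReal.ofReal_add (by positivity) (by positivity), ENNReal.ofReal_mul (norm_nonneg (b' z)),
        ENNReal.ofReal_mul (pow_nonneg hκ0.le _), ofReal_norm, ofReal_norm, ofReal_norm])
    (fun z => φ z * u z ^ p) (by
      filter_upwards [huw] with z hz hzρ
      have hzU := ballMinus_subset_openBall (by linarith) hρr z₀ hzρ
      rw [hφ z hzρ, one_mul, ← hz hzU, Real.enorm_eq_ofReal (pow_nonneg (hsub.nonneg z) p)])
  rw [hup, ← hs] at h
  -- conclusion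
  have n1 : lnorm volume 2 (fun z => ‖u' z ^ p‖ₑ) ≤
      eLpNorm (fun z => u z ^ p) 2 (volume.restrict (ballMinus B r z₀)) := by
    simpa using lnorm_enorm_le_eLpNorm hUm hUS (g' := fun z => u' z ^ p) (g := fun z => u z ^ p)
      hup0 huw two_pos
  have n2 : lnorm volume 2 (fun z => ‖G z‖ₑ) ≤
      eLpNorm Dw 2 (volume.restrict (ballMinus B r z₀)) := by
    simpa using lnorm_enorm_le_eLpNorm hUm hUS G0 GU two_pos
  have n3 : C₀ * lnorm volume s (fun z => ENNReal.ofReal (κ ^ (p - 1)) * ‖f' z‖ₑ) ≤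
      ENNReal.ofReal (r ^ ((p : ℝ) * (2 - (Q + 2) / q) + Q / 2)) * (F : ℝ≥0∞) ^ p := by
    rw [lnorm_const_mul hs0 (by simp)]
    have k1 : lnorm volume s (fun z => ‖f' z‖ₑ) ≤
        ENNReal.ofReal ((F : ℝ) * (V : ℝ) ^ (1 / s - 1 / q)) := by
      refine (lnorm_le_lnorm_mul_volume hUm fm.enorm (fun z hz => by simp [(h0 z hz).2.2]) hs0
        hsq).trans ?_
      rw [← hF, ENNReal.ofReal_mul F.coe_nonneg, ENNReal.ofReal_coe_nnreal,
        ← ENNReal.ofReal_rpow_of_nonneg V.coe_nonneg he, ENNReal.ofReal_coe_nnreal]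
      exact mul_le_mul' le_rfl (ENNReal.rpow_le_rpow (hV z₀ r hr0 hr) he)
    have k2 : (F : ℝ≥0∞) ^ p = ENNReal.ofReal ((F : ℝ) ^ p) := by
      rw [ENNReal.ofReal_pow F.coe_nonneg, ENNReal.ofReal_coe_nnreal]
    refine (mul_le_mul' le_rfl (mul_le_mul' le_rfl k1)).trans ?_
    rw [k2, ← ENNReal.ofReal_coe_nnreal (p := C₀), ← ENNReal.ofReal_mul (by positivity),
      ← ENNReal.ofReal_mul (by positivity), ← ENNReal.ofReal_mul (by positivity)]
    refine ENNReal.ofReal_le_ofReal ?_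
    -- The upper bound on the exponent uses `q < Q + 2`, and its non-negativity below uses `q > (Q +
    -- 2) / 2`.
    have hθ : (p : ℝ) * (2 - (Q + 2) / q) + Q / 2 ≤ p + Q / 2 := by
      have : 1 ≤ (Q + 2) / q := (one_le_div hq0).2 hq2.le
      nlinarith
    have hθ0 : 0 ≤ (p : ℝ) * (2 - (Q + 2) / q) + Q / 2 := by
      have h2 : (Q + 2) / q ≤ 2 := by rw [div_le_iff₀ hq0]; linarith
      have : 0 ≤ (p : ℝ) * (2 - (Q + 2) / q) := mul_nonneg (by positivity) (sub_nonneg.2 h2)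
      positivity
    have k3 := mul_pow_pred_le_rpow hp hDX hD1 (hρ.trans hρr.le) hθ0 hθ
    have k4 : (X : ℝ) = C₀ * (V : ℝ) ^ (1 / s - 1 / q) := by
      rw [hX, NNReal.coe_mul, NNReal.coe_rpow]
    calc (C₀ : ℝ) * (κ ^ (p - 1) * (F * (V : ℝ) ^ (1 / s - 1 / q)))
        = X * (κ ^ (p - 1) * F) := by rw [k4]; ring
      _ ≤ X * ((1 / (4 * D)) ^ (p - 1) * (F : ℝ) ^ p) := by gcongr
      _ = X * (1 / (4 * D)) ^ (p - 1) * (F : ℝ) ^ p := by ring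
      _ ≤ _ := by gcongr
  have n4 : (((p : ℝ≥0) : ℝ≥0∞)) ^ (q / (2 * q - Q - 2)) =
      ENNReal.ofReal ((p : ℝ) ^ (q / (2 * q - Q - 2))) := by
    rw [← ENNReal.ofReal_rpow_of_pos (by linarith)]
    simp
  rw [n4] at h
  refine h.trans (add_le_add (mul_le_mul' (ENNReal.ofReal_le_ofReal ?_)
    (add_le_add (mul_le_mul' le_rfl n1) n2)) (n3.trans ?_))
  · gcongr; linarith
  · gcongr

end Ultraparabolic

end

/-! ### The two estimates with a common constant. -/

open Ultraparabolic in
theorem lemma3p4 {d : ℕ} (m : Fin (d + 1) → ℕ) (B : Matrix (Idx m) (Idx m) ℝ)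
    (hB : DriftStructure B) (lam : ℝ) (hlam : 0 < lam)
    (q : ℝ) (hq : ((homDim m : ℝ) + 2) / 2 < q) (Kb Kc : ℝ≥0) :
    ∃ C : ℝ, 0 < C ∧
      ∀ (a : Pt m → Matrix (Fin (m 0)) (Fin (m 0)) ℝ), Elliptic lam a →
      ∀ (Ω : Set (Pt m)), IsOpen Ω →
      ∀ (b : Pt m → Grad m) (c f : Pt m → ℝ),
        MemLp b (ENNReal.ofReal ((homDim m : ℝ) + 2)) (volume.restrict Ω) →
        MemLp c (ENNReal.ofReal q) (volume.restrict Ω) →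
        MemLp f (ENNReal.ofReal q) (volume.restrict Ω) →
      ∀ (u : Pt m → ℝ) (Du : Pt m → Grad m) (Yu : Pt m → ℝ),
        IsWeakSubsolution B a b c f Ω u Du Yu →
        (∀ᵐ z ∂(volume.restrict Ω), 0 ≤ u z) →
      ∀ (z₀ : Pt m) (ρ r : ℝ), z₀ ∈ Ω → 1 / 2 ≤ ρ → ρ < r → r ≤ 1 →
        closure (ballMinus B r z₀) ⊆ Ω →
        eLpNorm b (ENNReal.ofReal ((homDim m : ℝ) + 2))
          (volume.restrict (ballMinus B r z₀)) ≤ Kb →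
        eLpNorm c (ENNReal.ofReal q) (volume.restrict (ballMinus B r z₀)) ≤ Kc →
      ∀ φ : Pt m → ℝ, (∀ z ∈ ballMinus B ρ z₀, φ z = 1) →
        (eLpNorm (fun z => φ z * u z) (ENNReal.ofReal (2 * (1 + 2 / (homDim m : ℝ))))
            (volume.restrict (ballMinus B ρ z₀)) ≤
          ENNReal.ofReal (C / (r - ρ)) *
              (eLpNorm u 2 (volume.restrict (ballMinus B r z₀)) +
                eLpNorm Du 2 (volume.restrict (ballMinus B r z₀))) +
            ENNReal.ofReal C *
              eLpNorm f (ENNReal.ofReal ((2 * (homDim m : ℝ) + 4) / ((homDim m : ℝ) + 4)))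
                (volume.restrict (ballMinus B r z₀))) ∧
        (q < (homDim m : ℝ) + 2 → ∀ β : ℝ, β = ((homDim m : ℝ) + 2) / q - 1 →
          ∀ p : ℕ, 1 < p →
          ∀ Dw : Pt m → Grad m,
            IsWeakGrad (interior (ballMinus B r z₀)) (fun z => u z ^ p) Dw →
            eLpNorm (fun z => φ z * u z ^ p)
                (ENNReal.ofReal (2 * (1 + 2 / (homDim m : ℝ))))
                (volume.restrict (ballMinus B ρ z₀)) ≤
              ENNReal.ofReal (C / (r - ρ)) *
                  (ENNReal.ofReal ((p : ℝ) ^ (1 / (1 - β))) *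
                      eLpNorm (fun z => u z ^ p) 2 (volume.restrict (ballMinus B r z₀)) +
                    eLpNorm Dw 2 (volume.restrict (ballMinus B r z₀))) +
                ENNReal.ofReal
                    (r ^ ((p : ℝ) * (2 - ((homDim m : ℝ) + 2) / q) + (homDim m : ℝ) / 2)) *
                  eLpNorm f (ENNReal.ofReal q) (volume.restrict (ballMinus B r z₀)) ^ p) := by
  obtain ⟨C₁, hC₁, h₁⟩ := sobolev_estimate_one hB hlam hq Kb Kc
  -- The estimate of powers exists only for `q < Q + 2`; otherwise the second claim is vacuous and
  -- any positive constant serves.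
  obtain ⟨C₂, hC₂, h₂⟩ : ∃ C : ℝ, 0 < C ∧ (q < (homDim m : ℝ) + 2 → _) := by
    by_cases hq2 : q < (homDim m : ℝ) + 2
    · obtain ⟨C, hC, h⟩ := sobolev_estimate_pow hB hlam hq hq2 Kb Kc
      exact ⟨C, hC, fun _ => h⟩
    · exact ⟨1, one_pos, fun h => absurd h hq2⟩
  refine ⟨max C₁ C₂, lt_max_of_lt_left hC₁, ?_⟩
  intro a ha Ω _ b c f _ _ hf u Du Yu hu hu0 z₀ ρ r _ hρ hρr hr hcl hb hc φ hφ
  have hδ : 0 < r - ρ := sub_pos.2 hρr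
  have hle : ∀ {C : ℝ}, C ≤ max C₁ C₂ →
      ENNReal.ofReal (C / (r - ρ)) ≤ ENNReal.ofReal (max C₁ C₂ / (r - ρ)) := fun h =>
    ENNReal.ofReal_le_ofReal (div_le_div_of_nonneg_right h hδ.le)
  refine ⟨?_, fun hq2 β hβ p hp Dw hw => ?_⟩
  · refine (h₁ a ha Ω b c f u Du Yu hu hu0 z₀ ρ r hρ hρr hr hcl hb hc φ hφ).trans ?_
    exact add_le_add (mul_le_mul' (hle (le_max_left _ _)) le_rfl)
      (mul_le_mul' (ENNReal.ofReal_le_ofReal (le_max_left _ _)) le_rfl)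
  · have hq0 : q ≠ 0 := by
      have : (0 : ℝ) ≤ homDim m := Nat.cast_nonneg _
      linarith
    -- With `β = (Q + 2) / q - 1`, one has `1 - β = (2q - Q - 2) / q`.
    have e : q / (2 * q - homDim m - 2) = 1 / (1 - β) := by
      rw [hβ, show 1 - (((homDim m : ℝ) + 2) / q - 1) = (2 * q - homDim m - 2) / q by
        field_simp; ring, one_div_div]
    have h := h₂ hq2 a ha Ω b c f hf u Du Yu hu hu0 z₀ ρ r hρ hρr hr hcl hb hc φ hφ p hp Dw hw
    rw [e] at h
    exact h.trans (add_le_add (mul_le_mul' (hle (le_max_right _ _)) le_rfl) le_rfl)
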